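/- **Theorem.** Let $c\in\mathbb N$. There are a randomized dynamic algorithm and constants $K\in\mathbb N$, $C\in\mathbb R$, depending only on $c$, such that the following holds for all $n\ge 2$, $\varepsilon\in(0,1)$, $\alpha\in(0,1]$ (given to the algorithm as input) and all word sizes $w$ with $2^w\ge n^K$. Let $G_0$ be an undirected graph on $n$ vertices and let $x_1,\dots,x_T$ be any fully dynamic sequence of updates (insertions of absent edges and deletions of present edges, in any order) that is fixed independently of the random choices of the algorithm (oblivious adversary). Let $G_i$ be the graph after the first $i$ updates. Graphs have no parallel edges, may have self-loops (a self-loop at $v$ contributes one to $\deg v$), and every vertex of every $G_i$ has degree at least $1$. The *PageRank* of $G=(V,E)$ is the stationary distribution $\pi$ (with $\pi\ge 0$, $\sum_v\pi_v=1$, $\pi M=\pi$) of the matrix $M_{u,v}=\varepsilon/n+(1-\varepsilon)/\deg(u)$ if $\{u,v\}\in E$, and $M_{u,v}=\varepsilon/n$ otherwise. The algorithm preprocesses $G_0$ and then receives the updates one at a time; it stores a vector $\tilde\pi\in\mathbb R^V$ explicitly in its memory. For $0\le i\le T$ let $A_i$ be the event that, right after the first $i$ updates have been processed, $\tilde\pi$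 is a $(1+\alpha)$-multiplicative approximation of the PageRank $\pi$ of $G_i$, i.e. $(1-\alpha)\pi_v\le\tilde\pi_v\le(1+\alpha)\pi_v$ for all $v$, and that (if $i\ge1$) the $i$-th update took time at most $$C\cdot\frac{\log^5 n}{\varepsilon^2\alpha^2}.$$ Then for every set $I\subseteq\{0,\dots,T\}$ the probability that $A_i$ holds for all $i\in I$ simultaneously is at least $1-|I|\,n^{-c}$. (In particular each $A_i$ has probability at least $1-n^{-c}$, and for sequences of polynomial length all $A_i$ hold simultaneously with high probability.) Time is measured on a randomized real RAM: it has random-access arrays of $w$-bit words and of real numbers; at unit cost it does word arithmetic ($+,-,\times$, integer division and remainder), exact real arithmetic ($+,-,\times,/$), comparisons, conversion of words to reals (but no rounding of reals to words), memory accesses, the sampling of a uniformly random word below a given bound, and the toss of a coin of given bias. -/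

import Mathlib

/-! ## Undirected graphs, edge updates and PageRank -/

/-- An undirected graph on `Fin n`, given by its set of edges.
The elements `s(v, v)` are self-loops. -/
abbrev UGraph (n : ℕ) := Finset (Sym2 (Fin n))

namespace UGraph

/-- The degree of `i`: the number of `j` such that `{i, j}` is an edge.
A self-loop counts once. -/
def deg {n : ℕ} (E : UGraph n) (i : Fin n) : ℕ :=
  (Finset.univ.filter fun j => s(i, j) ∈ E).card

/-- Every vertex has degree at least one, as PageRank requires. -/
def NoIsolated {n : ℕ} (E : UGraph n) : Prop := ∀ i, 1 ≤ E.deg i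

/-- The transition matrix: with probability `ε` jump to a uniformly random vertex,
otherwise move to a uniformly random neighbour. -/
noncomputable def transition {n : ℕ} (ε : ℝ) (E : UGraph n) : Matrix (Fin n) (Fin n) ℝ :=
  fun i j => ε / n + if s(i, j) ∈ E then (1 - ε) * (1 / (E.deg i : ℝ)) else 0

/-- `p` is the PageRank vector of `E` with jump probability `ε`: the stationary distribution
of the transition matrix. -/
structure IsPageRank {n : ℕ} (ε : ℝ) (E : UGraph n) (p : Fin n → ℝ) : Prop where
  nonneg : ∀ v, 0 ≤ p v
  sum_eq_one : ∑ v, p v = 1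
  stationary : Matrix.vecMul p (transition ε E) = p

/-- There is at most one PageRank vector. -/
theorem IsPageRank.unique {n : ℕ} {ε : ℝ} (h0 : 0 < ε) (h1 : ε < 1) {E : UGraph n}
    (hE : E.NoIsolated) {p q : Fin n → ℝ} (hp : IsPageRank ε E p) (hq : IsPageRank ε E q) :
    p = q := by
  have hs : ∑ v, (p v - q v) = 0 := by
    rw [Finset.sum_sub_distrib, hp.sum_eq_one, hq.sum_eq_one, sub_self]
  have hd : ∀ j, p j - q j =
      ∑ i, (p i - q i) * (if s(i, j) ∈ E then (1 - ε) * (1 / (E.deg i : ℝ)) else 0) := by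
    intro j
    have h2 := congrFun hp.stationary j
    have h3 := congrFun hq.stationary j
    simp only [Matrix.vecMul, dotProduct, transition, mul_add, Finset.sum_add_distrib,
      ← Finset.sum_mul] at h2 h3
    rw [hp.sum_eq_one] at h2
    rw [hq.sum_eq_one] at h3
    simp only [sub_mul (p _), Finset.sum_sub_distrib]
    linarith
  have hrow : ∀ i, ∑ j, (if s(i, j) ∈ E then (1 - ε) * (1 / (E.deg i : ℝ)) else 0) = 1 - ε := by
    intro i
    have hpos : (E.deg i : ℝ) ≠ 0 := by
      have := hE i
      positivity
    rw [← Finset.sum_filter, Finset.sum_const, nsmul_eq_mul]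
    change (E.deg i : ℝ) * _ = _
    field_simp
  have hle : ∑ j, |p j - q j| ≤ (1 - ε) * ∑ i, |p i - q i| := by
    calc ∑ j, |p j - q j|
        ≤ ∑ j, ∑ i, |p i - q i| *
            (if s(i, j) ∈ E then (1 - ε) * (1 / (E.deg i : ℝ)) else 0) := by
          refine Finset.sum_le_sum fun j _ => ?_
          rw [hd j]
          refine (Finset.abs_sum_le_sum_abs _ _).trans (Finset.sum_le_sum fun i _ => ?_)
          rw [abs_mul]
          refine le_of_eq (congrArg _ (abs_of_nonneg ?_))
          split_ifs
          · have : 0 ≤ 1 - ε := by linarith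
            positivity
          · exact le_refl _
      _ = (1 - ε) * ∑ i, |p i - q i| := by
          rw [Finset.sum_comm, Finset.mul_sum]
          refine Finset.sum_congr rfl fun i _ => ?_
          rw [← Finset.mul_sum, hrow i, mul_comm]
  have hnn : ∀ j ∈ Finset.univ, 0 ≤ |p j - q j| := fun j _ => abs_nonneg _
  have hz : ∑ j, |p j - q j| = 0 := by
    have h4 := Finset.sum_nonneg hnn
    nlinarith
  funext j
  have h5 := (Finset.sum_eq_zero_iff_of_nonneg hnn).1 hz j (Finset.mem_univ j)
  exact sub_eq_zero.1 (abs_eq_zero.1 h5)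

/-- `q` is a `1 + α` multiplicative approximation of `p`. -/
def MulApprox {n : ℕ} (α : ℝ) (p q : Fin n → ℝ) : Prop :=
  ∀ v, (1 - α) * p v ≤ q v ∧ q v ≤ (1 + α) * p v

end UGraph

/-- An edge update: the insertion (`ins = true`) or the deletion (`ins = false`) of the
edge `{u, v}`. -/
structure EdgeUpdate (n : ℕ) where
  ins : Bool
  u : Fin n
  v : Fin n

namespace EdgeUpdate

/-- The graph after the update. -/
def apply {n : ℕ} (E : UGraph n) (x : EdgeUpdate n) : UGraph n :=
  if x.ins then insert s(x.u, x.v) E else E.erase s(x.u, x.v)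

/-- Only absent edges are inserted and only present edges are deleted. -/
def Legal {n : ℕ} (E : UGraph n) (x : EdgeUpdate n) : Prop :=
  if x.ins then s(x.u, x.v) ∉ E else s(x.u, x.v) ∈ E

/-- The graph after a sequence of updates. -/
def applyAll {n : ℕ} (E : UGraph n) (xs : List (EdgeUpdate n)) : UGraph n := xs.foldl apply E

/-- A fully dynamic sequence of updates: every update is legal when it arrives, and PageRank
is well defined initially and after every update. -/
def ValidSeq {n : ℕ} : UGraph n → List (EdgeUpdate n) → Prop
  | E, [] => E.NoIsolated
  | E, x :: xs => E.NoIsolated ∧ x.Legal E ∧ ValidSeq (x.apply E) xs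

end EdgeUpdate

/-! ## The machine model: a randomized real RAM

The memory consists of arrays of `w`-bit words and of arrays of real numbers. A program uses
finitely many of these arrays. Word arithmetic is modulo `2 ^ w`. Real numbers can be added,
subtracted, multiplied, divided and compared exactly; words can be converted to reals, but there
is no rounding of reals to words, and programs contain no real literals. Randomness comes from
uniformly random words below a given bound and from coins with a given bias. Each operation,
including each memory access and each node of an expression, takes one unit of time. -/

namespace RealRAM

/-- The memory contents: `words a i` and `reals a i` are the `i`-th cells of the `a`-th word array
and of the `a`-th real array. -/
structure State where
  words : ℕ → ℕ → ℕ
  reals : ℕ → ℕ → ℝ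

/-- Word expressions; `get a i` reads the cell with (computed) index `i` of array `a`. -/
inductive WExp where
  | lit (k : ℕ)
  | get (a : ℕ) (i : WExp)
  | add (x y : WExp)
  | sub (x y : WExp)
  | mul (x y : WExp)
  | div (x y : WExp)
  | mod (x y : WExp)

namespace WExp

/-- The value of a word expression, with word size `w`. Subtraction is truncated at `0`. -/
def eval (w : ℕ) (σ : State) : WExp → ℕ
  | lit k => k % 2 ^ w
  | get a i => σ.words a (i.eval w σ)
  | add x y => (x.eval w σ + y.eval w σ) % 2 ^ w
  | sub x y => x.eval w σ - y.eval w σ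
  | mul x y => (x.eval w σ * y.eval w σ) % 2 ^ w
  | div x y => x.eval w σ / y.eval w σ
  | mod x y => x.eval w σ % y.eval w σ

/-- The time to evaluate a word expression. -/
def cost : WExp → ℕ
  | lit _ => 1
  | get _ i => i.cost + 1
  | add x y => x.cost + y.cost + 1
  | sub x y => x.cost + y.cost + 1
  | mul x y => x.cost + y.cost + 1
  | div x y => x.cost + y.cost + 1
  | mod x y => x.cost + y.cost + 1

end WExp

/-- Real expressions. -/
inductive RExp where
  | ofWord (x : WExp)
  | get (a : ℕ) (i : WExp)
  | add (x y : RExp)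
  | sub (x y : RExp)
  | mul (x y : RExp)
  | div (x y : RExp)

namespace RExp

/-- The value of a real expression, with word size `w`. -/
noncomputable def eval (w : ℕ) (σ : State) : RExp → ℝ
  | ofWord x => (x.eval w σ : ℝ)
  | get a i => σ.reals a (i.eval w σ)
  | add x y => x.eval w σ + y.eval w σ
  | sub x y => x.eval w σ - y.eval w σ
  | mul x y => x.eval w σ * y.eval w σ
  | div x y => x.eval w σ / y.eval w σ

/-- The time to evaluate a real expression. -/
def cost : RExp → ℕ
  | ofWord x => x.cost + 1
  | get _ i => i.cost + 1
  | add x y => x.cost + y.cost + 1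
  | sub x y => x.cost + y.cost + 1
  | mul x y => x.cost + y.cost + 1
  | div x y => x.cost + y.cost + 1

end RExp

/-- Conditions: comparisons of words and of reals, and Boolean combinations. -/
inductive BExp where
  | wlt (x y : WExp)
  | rlt (x y : RExp)
  | not (b : BExp)
  | and (b c : BExp)

namespace BExp

/-- The truth value of a condition, with word size `w`. -/
def Holds (w : ℕ) (σ : State) : BExp → Prop
  | wlt x y => x.eval w σ < y.eval w σ
  | rlt x y => x.eval w σ < y.eval w σ
  | not b => ¬ b.Holds w σ
  | and b c => b.Holds w σ ∧ c.Holds w σ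

/-- The time to evaluate a condition. -/
def cost : BExp → ℕ
  | wlt x y => x.cost + y.cost + 1
  | rlt x y => x.cost + y.cost + 1
  | not b => b.cost + 1
  | and b c => b.cost + c.cost + 1

end BExp

/-- Programs.
* `wset a i e`, `rset a i e` store the value of `e` in the cell with index `i` of array `a`;
* `unif a i m` stores in a word cell a uniformly random word that is less than `m`;
* `coin a i p` stores in a word cell the outcome (`1` or `0`) of a coin of bias `p`;
* `loop k b c` executes `c` as long as `b` holds, but at most `k` times, where `k` is evaluated
  on entry. -/
inductive Prog where
  | skip
  | wset (a : ℕ) (i : WExp) (e : WExp)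
  | rset (a : ℕ) (i : WExp) (e : RExp)
  | unif (a : ℕ) (i : WExp) (m : WExp)
  | coin (a : ℕ) (i : WExp) (p : RExp)
  | seq (c d : Prog)
  | ite (b : BExp) (c d : Prog)
  | loop (k : WExp) (b : BExp) (c : Prog)

namespace State

/-- Store the word `x` in cell `i` of word array `a`. -/
def setWord (σ : State) (a i x : ℕ) : State :=
  { σ with words := Function.update σ.words a (Function.update (σ.words a) i x) }

/-- Store the real `x` in cell `i` of real array `a`. -/
def setReal (σ : State) (a i : ℕ) (x : ℝ) : State :=
  { σ with reals := Function.update σ.reals a (Function.update (σ.reals a) i x) }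

end State

/-- A uniformly random number less than `m` (and `0` if `m = 0`). -/
noncomputable def unifPMF : ℕ → PMF ℕ
  | 0 => PMF.pure 0
  | m + 1 => (PMF.uniformOfFintype (Fin (m + 1))).map fun k => (k : ℕ)

/-- A coin that is `1` with probability `p` (clipped to `[0, 1]`) and `0` otherwise. -/
noncomputable def coinPMF (p : ℝ) : PMF ℕ :=
  (PMF.ofFintype (fun b : Bool => if b then min (ENNReal.ofReal p) 1
    else 1 - min (ENNReal.ofReal p) 1) (by simp)).map fun b => if b then 1 else 0

/-- Charge `t` units of time to a computation. -/
noncomputable def charge (t : ℕ) (m : PMF (State × ℕ)) : PMF (State × ℕ) :=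
  m.map fun r => (r.1, r.2 + t)

/-- Run `m`, then `f` on the resulting memory, and add the times. -/
noncomputable def andThen (m : PMF (State × ℕ)) (f : State → PMF (State × ℕ)) :
    PMF (State × ℕ) :=
  m.bind fun r => charge r.2 (f r.1)

open Classical in
/-- At most `k` iterations of `body` while `cond` holds, where each test takes time `t`. -/
noncomputable def iter (t : ℕ) (cond : State → Prop) (body : State → PMF (State × ℕ)) :
    ℕ → State → PMF (State × ℕ)
  | 0, σ => PMF.pure (σ, 1)
  | k + 1, σ =>
    charge t (if cond σ then andThen (body σ) (iter t cond body k) else PMF.pure (σ, 0))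

open Classical in
/-- The joint distribution of the final memory and of the running time of a program that is started
on memory `σ`, with word size `w`. -/
noncomputable def exec (w : ℕ) : Prog → State → PMF (State × ℕ)
  | .skip, σ => PMF.pure (σ, 1)
  | .wset a i e, σ =>
    PMF.pure (σ.setWord a (i.eval w σ) (e.eval w σ), i.cost + e.cost + 1)
  | .rset a i e, σ =>
    PMF.pure (σ.setReal a (i.eval w σ) (e.eval w σ), i.cost + e.cost + 1)
  | .unif a i m, σ =>
    (unifPMF (m.eval w σ)).map fun x => (σ.setWord a (i.eval w σ) x, i.cost + m.cost + 1)
  | .coin a i p, σ =>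
    (coinPMF (p.eval w σ)).map fun x =>
      (σ.setWord a (i.eval w σ) (x % 2 ^ w), i.cost + p.cost + 1)
  | .seq c d, σ => andThen (exec w c σ) (exec w d)
  | .ite b c d, σ => charge (b.cost + 1) (if b.Holds w σ then exec w c σ else exec w d σ)
  | .loop k b c, σ =>
    charge (k.cost + 1) (iter (b.cost + 1) (b.Holds w) (exec w c) (k.eval w σ) σ)

/-! ## Dynamic algorithms on the machine -/

/-- A dynamic algorithm: a program that preprocesses the initial graph, and a program that is run
upon each update. Both are fixed finite programs; the memory persists between the runs. -/
structure DynAlg where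
  init : Prog
  update : Prog

/-- The initial memory. Cell `0` of word array `0` holds `n`; word array `1` holds the adjacency
matrix of the initial graph, row by row; cells `0` and `1` of real array `0` hold `ε` and `α`.
All other cells are `0`. -/
noncomputable def inputState {n : ℕ} (ε α : ℝ) (E : UGraph n) : State where
  words := fun a k =>
    if a = 0 ∧ k = 0 then n
    else if a = 1 ∧ ∃ u v : Fin n, k = u * n + v ∧ s(u, v) ∈ E then 1
    else 0
  reals := fun a k =>
    if a = 0 ∧ k = 0 then ε
    else if a = 0 ∧ k = 1 then α
    else 0

/-- An update is announced in the cells `0`, `1`, `2` of word array `2`: the kind of the update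
(`1` for insertions, `0` for deletions) and the two endpoints of the edge. -/
def announce {n : ℕ} (σ : State) (x : EdgeUpdate n) : State :=
  ((σ.setWord 2 0 (if x.ins then 1 else 0)).setWord 2 1 x.u).setWord 2 2 x.v

/-- The vector that is explicitly stored in the memory: the cells `0, …, n - 1` of real array `1`. -/
def output (n : ℕ) (σ : State) : Fin n → ℝ := fun v => σ.reals 1 v

/-- The random history of the processing of a sequence of updates, from memory `σ` on: for each
update, the memory right after it and the time that was spent on it. -/
noncomputable def processUpdates (A : DynAlg) (w : ℕ) {n : ℕ} :
    State → List (EdgeUpdate n) → PMF (List (State × ℕ))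
  | _, [] => PMF.pure []
  | σ, x :: xs =>
    (exec w A.update (announce σ x)).bind fun r => (processUpdates A w r.1 xs).map (r :: ·)

/-- The random history of a run of the algorithm: entry `0` belongs to the preprocessing, and
entry `i` to the `i`-th update. The update sequence is fixed beforehand (oblivious adversary). -/
noncomputable def history (A : DynAlg) (w : ℕ) {n : ℕ} (ε α : ℝ) (E : UGraph n)
    (xs : List (EdgeUpdate n)) : PMF (List (State × ℕ)) :=
  (exec w A.init (inputState ε α E)).bind fun r => (processUpdates A w r.1 xs).map (r :: ·)

/-- In the history `h`, after the first `i` updates the stored vector is a `1 + α` multiplicative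
approximation of the PageRank of the current graph, and the `i`-th update (if `i ≥ 1`)
took time at most `B`. -/
def GoodAt {n : ℕ} (ε α B : ℝ) (E : UGraph n) (xs : List (EdgeUpdate n)) (i : ℕ)
    (h : List (State × ℕ)) : Prop :=
  ∃ r, h[i]? = some r ∧
    (∃ p, UGraph.IsPageRank ε (EdgeUpdate.applyAll E (xs.take i)) p ∧
      UGraph.MulApprox α p (output n r.1)) ∧
    (1 ≤ i → (r.2 : ℝ) ≤ B)

end RealRAM

/-! PageRank is a sum of discounted visits. With `Q` the transition matrix of the random walk
multiplied by `1 - ε` and `G = (1 - Q)⁻¹`, one has `π v = (ε / n) * ∑ u, G u v`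
(`isPageRank_pageRank`). So `R` independent walks from every vertex estimate `π`. The walks are not
stopped at random: each arrival is counted with the discount accumulated so far (`visits`).

The difficulty is that an edge update changes the degree of a vertex, and hence the law of every
step from it. The remedy is a particular way to draw a uniform neighbour. Each vertex has `n` slots,
of which the first `deg u` hold its neighbours. From `u` one draws a slot below `n`; if slot `s` is
empty, one draws again below `s`, and so on until a filled slot is hit. The neighbour so obtained is
uniform, the expected number of draws per step is at most the harmonic number `H n`, and the draws
never consult the degree. An insertion or deletion alters at most two slots at each end, hence at
most four keys (pairs of vertex and slot). A stored walk that uses none of these keys remains valid,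
and any other is redrawn after its first altered key. This turns the law of a walk for the old table
into its law for the new one (`walkLaw_bind_resample`), independently over the walks
(`prodLaw_bind`, `foldUpdate_eq_prodLaw`). The table and the altered keys depend on the update
sequence only, which is fixed in advance. Therefore at every time the stored family has exactly the
law of fresh independent walks (`LawInvariant`), whatever happened before.

Update time. The chain of states `(u, m)` has an explicit invariant measure, of mass `deg u` at `(u,
n)` and `deg u / (s + 1)` at `(u, s)`; in one step from it each key is drawn with mass at most `1`
(`SlotTable.stationaryMean_step`, `SlotTable.stationaryMean_indicator`). Since degrees are at least
`1`, one walk of `M` draws from every vertex is dominated by this measure, so a fixed key occurs at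
most `R * M` times in expectation, and at most `3 * R * M` times outside an event of probability
`exp (-R)` (`SlotTable.count_le`). Each occurrence costs one redone walk, of time `O(M)`. With `R`
of order `log n / α ^ 2` and `M` of order `(log n) ^ 2 / ε` the total is `O(R * M ^ 2)`, which is
the claimed bound.

Accuracy. Cutting the walks after `M` draws costs little, because the remaining discounted visits
shrink by the factor `1 - ε / (2 * H n)` per draw, up to a constant multiple of `1 / ε`
(`fullVisits_sub_meanVisits`). Convexity of `exp` lets a discount be treated like a killing
probability, which bounds the exponential moments of the visits to `v` by `1 + a * mean` with `a`
governed by `G v v` (`walkMean_exp_visits_le`). A Chernoff bound then gives relative error `α`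
outside an event of probability `2 * exp (-α ^ 2 * R / 16)` (`SlotTable.accurate`). No factor `ε` is
lost in the exponent, because the total mean is at least `R * G v v`: `R` of the walks start at `v`
itself.

If `ε ^ 2 * α ^ 2 * n ^ 3 ≤ 1`, the time bound allows order `n ^ 3` operations, and PageRank is
recomputed exactly by `n` rank-one updates of an inverse (`inv_one_sub_discountedRows_succ`). In the
remaining regime `1 / ε` and `1 / α` are polynomial in `n`, so that all indices fit into words and
the truncation error can be controlled.

The machine is related to these laws by couplings (`Cpl`): a run of a program is coupled with a
sample of an abstract law so that the memory encodes the sample and the time is bounded. A program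
logic (`Runs`, `RunsT`, `Samples`) produces the couplings, `exists_init` and `exists_update` provide
them for the two programs, and `historyFrom_bad_le` together with a union bound concludes. -/

namespace RealRAM

open scoped ENNReal

/-! ## Couplings -/

/-- There is a coupling of `μ` and `m` whose support lies in the relation `Q`. -/
def Cpl {β γ : Type*} (m : PMF γ) (μ : PMF β) (Q : β → γ → Prop) : Prop :=
  ∃ ν : PMF (β × γ), ν.map Prod.fst = μ ∧ ν.map Prod.snd = m ∧ ∀ x ∈ ν.support, Q x.1 x.2

namespace Cpl

variable {β γ δ η : Type*}

theorem pure {b : β} {g : γ} {Q : β → γ → Prop} (h : Q b g) : Cpl (PMF.pure g) (PMF.pure b) Q := by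
  refine ⟨PMF.pure (b, g), by simp [PMF.pure_map], by simp [PMF.pure_map], ?_⟩
  intro x hx
  rw [PMF.mem_support_pure_iff] at hx
  subst hx
  exact h

theorem mono {m : PMF γ} {μ : PMF β} {Q Q' : β → γ → Prop} (h : Cpl m μ Q)
    (hQ : ∀ b g, b ∈ μ.support → g ∈ m.support → Q b g → Q' b g) : Cpl m μ Q' := by
  obtain ⟨ν, rfl, rfl, h3⟩ := h
  refine ⟨ν, rfl, rfl, fun x hx => hQ _ _ ?_ ?_ (h3 x hx)⟩
  · exact (PMF.mem_support_map_iff _ _ _).2 ⟨x, hx, rfl⟩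
  · exact (PMF.mem_support_map_iff _ _ _).2 ⟨x, hx, rfl⟩

/-- Couplings compose along kernels: glue a coupling of the continuations over each related pair.
This is what lets random programs be analysed statement by statement. -/
theorem bind {m : PMF γ} {μ : PMF β} {Q : β → γ → Prop} {f : γ → PMF δ} {κ : β → PMF η}
    {Q' : η → δ → Prop} (h : Cpl m μ Q) (h' : ∀ b g, Q b g → Cpl (f g) (κ b) Q') :
    Cpl (m.bind f) (μ.bind κ) Q' := by
  obtain ⟨ν, rfl, rfl, h3⟩ := h
  have key : ∀ x : β × γ, ∃ ν' : PMF (η × δ), ν'.map Prod.fst = κ x.1 ∧ ν'.map Prod.snd = f x.2 ∧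
      (Q x.1 x.2 → ∀ y ∈ ν'.support, Q' y.1 y.2) := by
    intro x
    by_cases hx : Q x.1 x.2
    · obtain ⟨ν', a, b, c⟩ := h' _ _ hx
      exact ⟨ν', a, b, fun _ => c⟩
    -- Pairs outside `Q` have no mass under `ν`, but `choose` needs some coupling for every pair;
    -- the independent one serves.
    · refine ⟨(κ x.1).bind fun b => (f x.2).map fun g => (b, g), ?_, ?_, fun h => absurd h hx⟩
      · rw [PMF.map_bind]
        simp only [PMF.map_comp]
        have : ∀ b : η, (Prod.fst ∘ fun g : δ => (b, g)) = Function.const δ b := fun b => rfl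
        simp only [this, PMF.map_const, PMF.bind_pure]
      · rw [PMF.map_bind]
        simp only [PMF.map_comp]
        have : ∀ b : η, (Prod.snd ∘ fun g : δ => (b, g)) = id := fun b => rfl
        simp only [this, PMF.map_id, PMF.bind_const]
  choose F hF1 hF2 hF3 using key
  refine ⟨ν.bind F, ?_, ?_, ?_⟩
  · rw [PMF.map_bind, PMF.bind_map]
    exact congrArg _ (funext hF1)
  · rw [PMF.map_bind, PMF.bind_map]
    exact congrArg _ (funext hF2)
  · intro y hy
    obtain ⟨x, hx, hy⟩ := (PMF.mem_support_bind_iff _ _ _).1 hy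
    exact hF3 x (h3 x hx) y hy

theorem map_left {m : PMF γ} {μ : PMF β} {Q : β → γ → Prop} {Q' : η → γ → Prop} (f : β → η)
    (h : Cpl m μ Q) (hQ : ∀ b g, Q b g → Q' (f b) g) : Cpl m (μ.map f) Q' := by
  have := h.bind (f := PMF.pure) (κ := fun b => PMF.pure (f b)) (Q' := Q')
    fun b g hb => pure (hQ b g hb)
  rwa [PMF.bind_pure] at this

theorem map_right {m : PMF γ} {μ : PMF β} {Q : β → γ → Prop} {Q' : β → δ → Prop} (f : γ → δ)
    (h : Cpl m μ Q) (hQ : ∀ b g, Q b g → Q' b (f g)) : Cpl (m.map f) μ Q' := by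
  have := h.bind (f := fun g => PMF.pure (f g)) (κ := PMF.pure) (Q' := Q')
    fun b g hb => pure (hQ b g hb)
  rwa [PMF.bind_pure] at this

theorem self (m : PMF γ) : Cpl m m fun a b => a = b := by
  refine ⟨m.map fun a => (a, a), ?_, ?_, ?_⟩
  · rw [PMF.map_comp]; exact PMF.map_id _
  · rw [PMF.map_comp]; exact PMF.map_id _
  · intro x hx
    obtain ⟨a, _, rfl⟩ := (PMF.mem_support_map_iff _ _ _).1 hx
    rfl

/-- The way back from couplings to probabilities: a bad event of the machine is at most as likely as
the event of the ideal law that it forces. -/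
theorem prob_le {m : PMF γ} {μ : PMF β} {Q : β → γ → Prop} (h : Cpl m μ Q) {S : Set γ} {T : Set β}
    (hST : ∀ b g, Q b g → g ∈ S → b ∈ T) : m.toOuterMeasure S ≤ μ.toOuterMeasure T := by
  obtain ⟨ν, rfl, rfl, h3⟩ := h
  rw [PMF.toOuterMeasure_map_apply, PMF.toOuterMeasure_map_apply]
  exact PMF.toOuterMeasure_mono _ fun x hx => hST _ _ (h3 x hx.2) hx.1

end Cpl

/-! ## The arrays that a program writes -/

namespace Prog

/-- The word arrays that a program may write. -/
def wordTargets : Prog → List ℕ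
  | skip => []
  | wset a _ _ => [a]
  | rset _ _ _ => []
  | unif a _ _ => [a]
  | coin a _ _ => [a]
  | seq c d => c.wordTargets ++ d.wordTargets
  | ite _ c d => c.wordTargets ++ d.wordTargets
  | loop _ _ c => c.wordTargets

/-- The real arrays that a program may write. -/
def realTargets : Prog → List ℕ
  | skip => []
  | wset _ _ _ => []
  | rset a _ _ => [a]
  | unif _ _ _ => []
  | coin _ _ _ => []
  | seq c d => c.realTargets ++ d.realTargets
  | ite _ c d => c.realTargets ++ d.realTargets
  | loop _ _ c => c.realTargets

/-- Programs without loops. -/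
def LoopFree : Prog → Prop
  | seq c d => c.LoopFree ∧ d.LoopFree
  | ite _ c d => c.LoopFree ∧ d.LoopFree
  | loop _ _ _ => False
  | _ => True

/-- A bound for the time of a program without loops. -/
def staticCost : Prog → ℕ
  | skip => 1
  | wset _ i e => i.cost + e.cost + 1
  | rset _ i e => i.cost + e.cost + 1
  | unif _ i m => i.cost + m.cost + 1
  | coin _ i p => i.cost + p.cost + 1
  | seq c d => c.staticCost + d.staticCost
  | ite b c d => c.staticCost + d.staticCost + (b.cost + 1)
  | loop _ _ _ => 0

end Prog

/-- The two memories differ only in the listed arrays. -/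
def AgreeOff (ws rs : List ℕ) (σ σ' : State) : Prop :=
  (∀ a, a ∉ ws → σ'.words a = σ.words a) ∧ ∀ a, a ∉ rs → σ'.reals a = σ.reals a

theorem AgreeOff.refl (ws rs : List ℕ) (σ : State) : AgreeOff ws rs σ σ :=
  ⟨fun _ _ => rfl, fun _ _ => rfl⟩

theorem AgreeOff.trans {ws rs : List ℕ} {σ₁ σ₂ σ₃ : State} (h : AgreeOff ws rs σ₁ σ₂)
    (h' : AgreeOff ws rs σ₂ σ₃) : AgreeOff ws rs σ₁ σ₃ :=
  ⟨fun a ha => (h'.1 a ha).trans (h.1 a ha), fun a ha => (h'.2 a ha).trans (h.2 a ha)⟩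

theorem AgreeOff.mono {ws rs ws' rs' : List ℕ} {σ σ' : State} (h : AgreeOff ws rs σ σ')
    (hw : ws ⊆ ws') (hr : rs ⊆ rs') : AgreeOff ws' rs' σ σ' :=
  ⟨fun a ha => h.1 a fun h' => ha (hw h'), fun a ha => h.2 a fun h' => ha (hr h')⟩

/-- The memories agree up to the arrays that the program may write. -/
def Prog.Agree (P : Prog) (σ σ' : State) : Prop := AgreeOff P.wordTargets P.realTargets σ σ'

theorem State.setWord_words (σ : State) (a i x b : ℕ) :
    (σ.setWord a i x).words b = if b = a then Function.update (σ.words a) i x else σ.words b := by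
  unfold State.setWord
  by_cases h : b = a
  · subst h; simp
  · simp [h]

theorem State.setWord_words_apply (σ : State) (a i x b j : ℕ) :
    (σ.setWord a i x).words b j = if b = a ∧ j = i then x else σ.words b j := by
  rw [State.setWord_words]
  by_cases h : b = a
  · subst h; simp [Function.update_apply]
  · simp [h]

@[simp] theorem State.setWord_reals (σ : State) (a i x : ℕ) :
    (σ.setWord a i x).reals = σ.reals := rfl

@[simp] theorem State.setReal_words (σ : State) (a i : ℕ) (x : ℝ) :
    (σ.setReal a i x).words = σ.words := rfl

theorem State.setReal_reals_apply (σ : State) (a i : ℕ) (x : ℝ) (b j : ℕ) :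
    (σ.setReal a i x).reals b j = if b = a ∧ j = i then x else σ.reals b j := by
  unfold State.setReal
  by_cases h : b = a
  · subst h; simp [Function.update_apply]
  · simp [h]

theorem mem_support_charge {t : ℕ} {m : PMF (State × ℕ)} {r : State × ℕ} :
    r ∈ (charge t m).support ↔ ∃ r' ∈ m.support, (r'.1, r'.2 + t) = r := by
  simp only [charge, PMF.mem_support_map_iff]

theorem mem_support_andThen {m : PMF (State × ℕ)} {f : State → PMF (State × ℕ)} {r : State × ℕ} :
    r ∈ (andThen m f).support ↔
      ∃ r₁ ∈ m.support, ∃ r₂ ∈ (f r₁.1).support, (r₂.1, r₂.2 + r₁.2) = r := by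
  simp only [andThen, PMF.mem_support_bind_iff, mem_support_charge]

/-- The frame rule. The written arrays are read off syntactically, so that later proofs get all
unchanged arrays by `decide`. -/
theorem agree_exec (w : ℕ) (P : Prog) :
    ∀ (σ : State) (r : State × ℕ), r ∈ (exec w P σ).support → P.Agree σ r.1 := by
  induction P with
  | skip =>
    intro σ r hr
    simp only [exec, PMF.mem_support_pure_iff] at hr
    subst hr
    exact AgreeOff.refl _ _ _
  | wset a i e =>
    intro σ r hr
    simp only [exec, PMF.mem_support_pure_iff] at hr
    subst hr
    refine ⟨fun b hb => ?_, fun b _ => rfl⟩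
    have : b ≠ a := by simpa [Prog.wordTargets] using hb
    simp [State.setWord_words, this]
  | rset a i e =>
    intro σ r hr
    simp only [exec, PMF.mem_support_pure_iff] at hr
    subst hr
    refine ⟨fun b hb => rfl, fun b hb => ?_⟩
    have : b ≠ a := by simpa [Prog.realTargets] using hb
    funext j
    simp [State.setReal_reals_apply, this]
  | unif a i e =>
    intro σ r hr
    simp only [exec, PMF.mem_support_map_iff] at hr
    obtain ⟨x, -, rfl⟩ := hr
    refine ⟨fun b hb => ?_, fun b _ => rfl⟩
    have : b ≠ a := by simpa [Prog.wordTargets] using hb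
    simp [State.setWord_words, this]
  | coin a i e =>
    intro σ r hr
    simp only [exec, PMF.mem_support_map_iff] at hr
    obtain ⟨x, -, rfl⟩ := hr
    refine ⟨fun b hb => ?_, fun b _ => rfl⟩
    have : b ≠ a := by simpa [Prog.wordTargets] using hb
    simp [State.setWord_words, this]
  | seq c d hc hd =>
    intro σ r hr
    simp only [exec, mem_support_andThen] at hr
    obtain ⟨r₁, h₁, r₂, h₂, rfl⟩ := hr
    exact ((hc _ _ h₁).mono (by simp [Prog.wordTargets]) (by simp [Prog.realTargets])).trans
      ((hd _ _ h₂).mono (by simp [Prog.wordTargets]) (by simp [Prog.realTargets]))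
  | ite b c d hc hd =>
    intro σ r hr
    simp only [exec, mem_support_charge] at hr
    obtain ⟨r₁, h₁, rfl⟩ := hr
    split_ifs at h₁
    · exact (hc _ _ h₁).mono (by simp [Prog.wordTargets]) (by simp [Prog.realTargets])
    · exact (hd _ _ h₁).mono (by simp [Prog.wordTargets]) (by simp [Prog.realTargets])
  | loop k b c hc =>
    intro σ r hr
    simp only [exec, mem_support_charge] at hr
    obtain ⟨r₁, h₁, rfl⟩ := hr
    generalize k.eval w σ = m at h₁
    show AgreeOff c.wordTargets c.realTargets σ r₁.1
    induction m generalizing σ r₁ with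
    | zero =>
      simp only [iter, PMF.mem_support_pure_iff] at h₁
      subst h₁
      exact AgreeOff.refl _ _ _
    | succ m ih =>
      simp only [iter, mem_support_charge] at h₁
      obtain ⟨r₂, h₂, rfl⟩ := h₁
      split_ifs at h₂
      · obtain ⟨r₃, h₃, r₄, h₄, rfl⟩ := mem_support_andThen.1 h₂
        exact (hc _ _ h₃).trans (ih r₃.1 r₄ h₄)
      · rw [PMF.mem_support_pure_iff] at h₂
        subst h₂
        exact AgreeOff.refl _ _ _

/-- Without loops the time depends only on the branches taken, and `staticCost` adds up both
branches. Numerical time bounds for straight-line pieces thereby become closed computations. -/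
theorem cost_le_staticCost (w : ℕ) (P : Prog) (hP : P.LoopFree) :
    ∀ (σ : State) (r : State × ℕ), r ∈ (exec w P σ).support → r.2 ≤ P.staticCost := by
  induction P with
  | skip =>
    intro σ r hr
    simp only [exec, PMF.mem_support_pure_iff] at hr
    subst hr
    exact le_rfl
  | wset a i e =>
    intro σ r hr
    simp only [exec, PMF.mem_support_pure_iff] at hr
    subst hr
    exact le_rfl
  | rset a i e =>
    intro σ r hr
    simp only [exec, PMF.mem_support_pure_iff] at hr
    subst hr
    exact le_rfl
  | unif a i e =>
    intro σ r hr
    simp only [exec, PMF.mem_support_map_iff] at hr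
    obtain ⟨x, -, rfl⟩ := hr
    exact le_rfl
  | coin a i e =>
    intro σ r hr
    simp only [exec, PMF.mem_support_map_iff] at hr
    obtain ⟨x, -, rfl⟩ := hr
    exact le_rfl
  | seq c d hc hd =>
    intro σ r hr
    simp only [exec, mem_support_andThen] at hr
    obtain ⟨r₁, h₁, r₂, h₂, rfl⟩ := hr
    have := hc hP.1 _ _ h₁
    have := hd hP.2 _ _ h₂
    simp only [Prog.staticCost]
    omega
  | ite b c d hc hd =>
    intro σ r hr
    simp only [exec, mem_support_charge] at hr
    obtain ⟨r₁, h₁, rfl⟩ := hr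
    simp only [Prog.staticCost]
    split_ifs at h₁
    · have := hc hP.1 _ _ h₁
      omega
    · have := hd hP.2 _ _ h₁
      omega
  | loop k b c hc => exact absurd hP (by simp [Prog.LoopFree])

/-! ## Deterministic runs -/

/-- The computation `m` ends surely in one memory, which satisfies `Q`, within time `B`. -/
def Det (m : PMF (State × ℕ)) (B : ℕ) (Q : State → Prop) : Prop :=
  ∃ σ t, m = PMF.pure (σ, t) ∧ t ≤ B ∧ Q σ

/-- The program `P`, started on `σ`, runs deterministically within time `B` and ends in a memory
that satisfies `Q`. -/
def RunsT (w : ℕ) (P : Prog) (σ : State) (B : ℕ) (Q : State → Prop) : Prop := Det (exec w P σ) B Q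

/-- The program `P`, started on `σ`, runs deterministically and ends in a memory that
satisfies `Q`. -/
def Runs (w : ℕ) (P : Prog) (σ : State) (Q : State → Prop) : Prop := ∃ B, RunsT w P σ B Q

theorem Det.mono {m : PMF (State × ℕ)} {B B' : ℕ} {Q Q' : State → Prop} (h : Det m B Q)
    (hB : B ≤ B') (hQ : ∀ σ, Q σ → Q' σ) : Det m B' Q' := by
  obtain ⟨σ, t, h1, h2, h3⟩ := h
  exact ⟨σ, t, h1, h2.trans hB, hQ σ h3⟩

theorem Det.charge {m : PMF (State × ℕ)} {B t : ℕ} {Q : State → Prop} (h : Det m B Q) :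
    Det (charge t m) (B + t) Q := by
  obtain ⟨σ, s, rfl, h2, h3⟩ := h
  exact ⟨σ, s + t, by simp [RealRAM.charge, PMF.pure_map], by omega, h3⟩

theorem Det.andThen {m : PMF (State × ℕ)} {f : State → PMF (State × ℕ)} {B B' : ℕ}
    {Q : State → Prop} (h : Det m B fun σ => Det (f σ) B' Q) : Det (andThen m f) (B + B') Q := by
  obtain ⟨σ, s, rfl, h2, σ', s', h3, h4, h5⟩ := h
  exact ⟨σ', s' + s, by simp [RealRAM.andThen, RealRAM.charge, h3, PMF.pure_map], by omega, h5⟩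

/-! ### Program logic for deterministic runs. -/

section rules

variable {w : ℕ} {P P' : Prog} {σ : State} {B B' : ℕ} {Q Q' : State → Prop}

theorem RunsT.mono (h : RunsT w P σ B Q) (hB : B ≤ B') (hQ : ∀ σ', P.Agree σ σ' → Q σ' → Q' σ') :
    RunsT w P σ B' Q' := by
  obtain ⟨σ', t, h1, h2, h3⟩ := h
  refine ⟨σ', t, h1, h2.trans hB, hQ _ ?_ h3⟩
  exact agree_exec w P σ (σ', t) (by rw [h1, PMF.mem_support_pure_iff])

theorem RunsT.runs (h : RunsT w P σ B Q) : Runs w P σ Q := ⟨B, h⟩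

theorem Runs.mono (h : Runs w P σ Q) (hQ : ∀ σ', P.Agree σ σ' → Q σ' → Q' σ') :
    Runs w P σ Q' := by
  obtain ⟨B, h⟩ := h
  exact ⟨B, h.mono le_rfl hQ⟩

/-- Separates time from correctness: a loop-free piece is first verified with no time bound in mind,
and the bound is added here. -/
theorem Runs.timed (hP : P.LoopFree) (h : Runs w P σ Q) : RunsT w P σ P.staticCost Q := by
  obtain ⟨B, σ', t, h1, h2, h3⟩ := h
  refine ⟨σ', t, h1, ?_, h3⟩
  exact cost_le_staticCost w P hP σ (σ', t) (by rw [h1, PMF.mem_support_pure_iff])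

theorem RunsT.seq (h : RunsT w P σ B fun σ' => RunsT w P' σ' B' Q) :
    RunsT w (.seq P P') σ (B + B') Q := Det.andThen h

theorem Runs.seq (h : Runs w P σ fun σ' => Runs w P' σ' Q) : Runs w (.seq P P') σ Q := by
  obtain ⟨B, σ', t, h1, h2, B', h3⟩ := h
  exact ⟨B + B', RunsT.seq ⟨σ', t, h1, h2, h3⟩⟩

theorem Runs.skip (h : Q σ) : Runs w .skip σ Q := ⟨1, σ, 1, rfl, le_rfl, h⟩

theorem Runs.wset {a : ℕ} {i e : WExp} (iv ev : ℕ) (hi : i.eval w σ = iv) (he : e.eval w σ = ev)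
    (h : Q (σ.setWord a iv ev)) : Runs w (.wset a i e) σ Q :=
  ⟨_, _, _, rfl, le_rfl, by rw [hi, he]; exact h⟩

theorem Runs.rset {a : ℕ} {i : WExp} {e : RExp} (iv : ℕ) (ev : ℝ) (hi : i.eval w σ = iv)
    (he : e.eval w σ = ev) (h : Q (σ.setReal a iv ev)) : Runs w (.rset a i e) σ Q :=
  ⟨_, _, _, rfl, le_rfl, by rw [hi, he]; exact h⟩

theorem RunsT.ite {b : BExp} {d : Prog} (h1 : b.Holds w σ → RunsT w P σ B Q)
    (h2 : ¬ b.Holds w σ → RunsT w d σ B Q) : RunsT w (.ite b P d) σ (B + (b.cost + 1)) Q := by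
  unfold RunsT
  simp only [exec]
  refine Det.charge ?_
  split_ifs with h
  · exact h1 h
  · exact h2 h

theorem Runs.ite_pos {b : BExp} {d : Prog} (hb : b.Holds w σ) (h : Runs w P σ Q) :
    Runs w (.ite b P d) σ Q := by
  obtain ⟨B, h⟩ := h
  exact ⟨_, RunsT.ite (fun _ => h) fun h' => absurd hb h'⟩

theorem Runs.ite_neg {b : BExp} {d : Prog} (hb : ¬ b.Holds w σ) (h : Runs w P σ Q) :
    Runs w (.ite b d P) σ Q := by
  obtain ⟨B, h⟩ := h
  exact ⟨_, RunsT.ite (fun h' => absurd h' hb) fun _ => h⟩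

/-- While loops: the invariant `I` holds when the loop is left, and either the condition fails
or all iterations have been made. -/
theorem Runs.while {k : WExp} {b : BExp} (I : ℕ → State → Prop) (m : ℕ) (hk : k.eval w σ = m)
    (h0 : I 0 σ)
    (hstep : ∀ j < m, ∀ σ', P.Agree σ σ' → b.Holds w σ' → I j σ' → Runs w P σ' (I (j + 1)))
    (hQ : ∀ j ≤ m, ∀ σ', P.Agree σ σ' → I j σ' → (j = m ∨ ¬ b.Holds w σ') → Q σ') :
    Runs w (.loop k b P) σ Q := by
  suffices h : ∀ l j, l + j = m → ∀ σ', P.Agree σ σ' → I j σ' →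
      ∃ B, Det (iter (b.cost + 1) (b.Holds w) (exec w P) l σ') B Q by
    obtain ⟨B, h⟩ := h m 0 rfl σ (AgreeOff.refl _ _ _) h0
    refine ⟨B + (k.cost + 1), ?_⟩
    unfold RunsT
    simp only [exec, hk]
    exact h.charge
  intro l
  induction l with
  | zero =>
    intro j hj σ' hs hI
    exact ⟨1, σ', 1, rfl, le_rfl, hQ j (by omega) σ' hs hI (Or.inl (by omega))⟩
  | succ l ih =>
    intro j hj σ' hs hI
    by_cases hb : b.Holds w σ'
    · obtain ⟨B, h⟩ := (hstep j (by omega) σ' hs hb hI).mono fun σ'' hs'' hI'' =>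
        ih (j + 1) (by omega) σ'' (AgreeOff.trans hs hs'') hI''
      obtain ⟨σ'', t, h1, h2, B', h3⟩ := h
      refine ⟨B + B' + (b.cost + 1), ?_⟩
      simp only [iter, hb, if_true]
      exact (Det.andThen ⟨σ'', t, h1, h2, h3⟩).charge
    · refine ⟨0 + (b.cost + 1), ?_⟩
      simp only [iter, hb, if_false]
      exact Det.charge ⟨σ', 0, rfl, le_rfl, hQ j (by omega) σ' hs hI (Or.inr hb)⟩

/-- A condition that is always true. -/
def BExp.tt : BExp := .not (.wlt (.lit 0) (.lit 0))

theorem BExp.holds_tt (w : ℕ) (σ : State) : BExp.tt.Holds w σ := by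
  simp [BExp.tt, BExp.Holds]

/-- Repeat a program a given number of times. -/
def Prog.rep (k : WExp) (P : Prog) : Prog := .loop k .tt P

/-- The `5` per iteration is the price of one test of `BExp.tt`. -/
theorem RunsT.rep {k : WExp} (I : ℕ → State → Prop) (m : ℕ) (hk : k.eval w σ = m)
    (h0 : I 0 σ)
    (hstep : ∀ j < m, ∀ σ', P.Agree σ σ' → I j σ' → RunsT w P σ' B (I (j + 1)))
    (hQ : ∀ σ', P.Agree σ σ' → I m σ' → Q σ') :
    RunsT w (.rep k P) σ (m * (B + 5) + (k.cost + 2)) Q := by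
  suffices h : ∀ l j, l + j = m → ∀ σ', P.Agree σ σ' → I j σ' →
      Det (iter (BExp.tt.cost + 1) (BExp.tt.Holds w) (exec w P) l σ') (l * (B + 5) + 1) Q by
    have h := h m 0 rfl σ (AgreeOff.refl _ _ _) h0
    unfold RunsT Prog.rep
    simp only [exec, hk]
    exact (h.charge (t := k.cost + 1)).mono (by omega) fun _ h => h
  intro l
  induction l with
  | zero =>
    intro j hj σ' hs hI
    have : j = m := by omega
    subst this
    exact ⟨σ', 1, rfl, by omega, hQ σ' hs hI⟩
  | succ l ih =>
    intro j hj σ' hs hI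
    have h := (hstep j (by omega) σ' hs hI).mono le_rfl fun σ'' hs'' hI'' =>
        ih (j + 1) (by omega) σ'' (AgreeOff.trans hs hs'') hI''
    rw [iter, if_pos (BExp.holds_tt w σ')]
    refine (Det.charge (Det.andThen h)).mono ?_ fun _ h => h
    simp only [BExp.tt, BExp.cost, WExp.cost]
    rw [Nat.succ_mul]
    omega

theorem Runs.rep {k : WExp} (I : ℕ → State → Prop) (m : ℕ) (hk : k.eval w σ = m)
    (h0 : I 0 σ)
    (hstep : ∀ j < m, ∀ σ', P.Agree σ σ' → I j σ' → Runs w P σ' (I (j + 1)))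
    (hQ : ∀ σ', P.Agree σ σ' → I m σ' → Q σ') : Runs w (.rep k P) σ Q := by
  refine Runs.while I m hk h0 (fun j hj σ' hs _ hI => hstep j hj σ' hs hI) ?_
  intro j hj σ' hs hI h
  rcases h with rfl | h
  · exact hQ σ' hs hI
  · exact absurd (BExp.holds_tt w σ') h

end rules

/-! ## Random runs -/

/-- The outcome of the computation `m` is coupled with a sample of `μ` such that `Q` holds,
and the time is at most `B`. -/
def Smp {β : Type*} (m : PMF (State × ℕ)) (B : ℕ) (μ : PMF β) (Q : β → State → Prop) : Prop :=
  Cpl m μ fun b r => r.2 ≤ B ∧ Q b r.1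

/-- The outcome of the program `P`, started on `σ`, is coupled with a sample of `μ` such that `Q`
holds, and the time is at most `B`. -/
def Samples {β : Type*} (w : ℕ) (P : Prog) (σ : State) (B : ℕ) (μ : PMF β)
    (Q : β → State → Prop) : Prop := Smp (exec w P σ) B μ Q

section samples

variable {β γ : Type*} {w : ℕ} {P P' : Prog} {σ : State} {B B' : ℕ} {μ : PMF β}

theorem Det.smp {m : PMF (State × ℕ)} {b : β} {Q : β → State → Prop} (h : Det m B (Q b)) :
    Smp m B (PMF.pure b) Q := by
  obtain ⟨σ', t, rfl, h2, h3⟩ := h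
  exact Cpl.pure ⟨h2, h3⟩

theorem RunsT.samples {b : β} {Q : β → State → Prop} (h : RunsT w P σ B (Q b)) :
    Samples w P σ B (PMF.pure b) Q := Det.smp h

theorem Smp.mono {m : PMF (State × ℕ)} {Q Q' : β → State → Prop} (h : Smp m B μ Q)
    (hB : B ≤ B') (hQ : ∀ b σ', b ∈ μ.support → Q b σ' → Q' b σ') : Smp m B' μ Q' :=
  Cpl.mono h fun b r hb _ hbr => ⟨hbr.1.trans hB, hQ b r.1 hb hbr.2⟩

theorem Samples.mono {Q Q' : β → State → Prop} (h : Samples w P σ B μ Q) (hB : B ≤ B')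
    (hQ : ∀ b σ', b ∈ μ.support → P.Agree σ σ' → Q b σ' → Q' b σ') : Samples w P σ B' μ Q' := by
  unfold Samples Smp at *
  exact Cpl.mono h fun b r hb hr hbr => ⟨hbr.1.trans hB, hQ b r.1 hb (agree_exec w P σ r hr) hbr.2⟩

theorem Smp.charge {m : PMF (State × ℕ)} {Q : β → State → Prop} (h : Smp m B μ Q) (t : ℕ) :
    Smp (charge t m) (B + t) μ Q :=
  Cpl.map_right _ h fun _ _ hb => ⟨Nat.add_le_add_right hb.1 t, hb.2⟩

theorem Smp.andThen {m : PMF (State × ℕ)} {f : State → PMF (State × ℕ)} {κ : β → PMF γ}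
    {Q : β → State → Prop} {Q' : γ → State → Prop} (h : Smp m B μ Q)
    (h' : ∀ b σ', Q b σ' → Smp (f σ') B' (κ b) Q') :
    Smp (andThen m f) (B + B') (μ.bind κ) Q' := by
  refine Cpl.bind h fun b r hb => ?_
  exact ((h' b r.1 hb.2).charge r.2).mono (by have := hb.1; omega) fun _ _ _ h => h

theorem Samples.seq {κ : β → PMF γ} {Q : β → State → Prop} {Q' : γ → State → Prop}
    (h : Samples w P σ B μ Q) (h' : ∀ b σ', Q b σ' → Samples w P' σ' B' (κ b) Q') :
    Samples w (.seq P P') σ (B + B') (μ.bind κ) Q' := Smp.andThen h h'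

/-- A deterministic first part contributes time but leaves the sampled law unchanged. -/
theorem Samples.seq_left {Q : β → State → Prop}
    (h : RunsT w P σ B fun σ' => Samples w P' σ' B' μ Q) :
    Samples w (.seq P P') σ (B + B') μ Q := by
  obtain ⟨σ', t, h1, h2, h3⟩ := h
  unfold Samples
  simp only [exec, andThen, h1, PMF.pure_bind]
  exact (Smp.charge h3 t).mono (by omega) fun _ _ _ h => h

theorem Samples.seq_right {Q Q' : β → State → Prop}
    (h : Samples w P σ B μ Q) (h' : ∀ b σ', Q b σ' → RunsT w P' σ' B' (Q' b)) :
    Samples w (.seq P P') σ (B + B') μ Q' := by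
  have := h.seq (κ := PMF.pure) (Q' := Q') fun b σ' hb => (h' b σ' hb).samples
  rwa [PMF.bind_pure] at this

theorem Smp.map {m : PMF (State × ℕ)} {Q : β → State → Prop} {Q' : γ → State → Prop} (f : β → γ)
    (h : Smp m B μ Q) (hQ : ∀ b σ', Q b σ' → Q' (f b) σ') :
    Smp m B (μ.map f) Q' :=
  Cpl.map_left f h fun _ _ hb => ⟨hb.1, hQ _ _ hb.2⟩

theorem Samples.ite {Q : β → State → Prop} {b : BExp} {d : Prog}
    (h1 : b.Holds w σ → Samples w P σ B μ Q) (h2 : ¬ b.Holds w σ → Samples w d σ B μ Q) :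
    Samples w (.ite b P d) σ (B + (b.cost + 1)) μ Q := by
  unfold Samples
  simp only [exec]
  refine Smp.charge ?_ _
  split_ifs with h
  · exact h1 h
  · exact h2 h

theorem Samples.unif {a : ℕ} {i m : WExp} (iv mv : ℕ) (hi : i.eval w σ = iv)
    (hm : m.eval w σ = mv) :
    Samples w (.unif a i m) σ (i.cost + m.cost + 1) (unifPMF mv)
      (fun x σ' => σ' = σ.setWord a iv x) := by
  subst hi hm
  unfold Samples Smp
  simp only [exec]
  refine Cpl.map_right _ (Cpl.self _) ?_
  rintro x _ rfl
  exact ⟨le_rfl, rfl⟩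

end samples


open scoped ENNReal

/-! ## Expectations of nonnegative functions -/

section expectation

variable {α β : Type*}

/-- The expectation of a nonnegative function. -/
noncomputable def Ex (p : PMF α) (f : α → ℝ≥0∞) : ℝ≥0∞ := ∑' a, p a * f a

theorem Ex_pure (a : α) (f : α → ℝ≥0∞) : Ex (PMF.pure a) f = f a := by
  unfold Ex
  rw [tsum_eq_single a]
  · simp
  · intro b hb
    simp [PMF.pure_apply_of_ne _ _ hb]

theorem Ex_bind (p : PMF α) (q : α → PMF β) (f : β → ℝ≥0∞) :
    Ex (p.bind q) f = Ex p fun a => Ex (q a) f := by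
  unfold Ex
  simp only [PMF.bind_apply, ← ENNReal.tsum_mul_right, ← ENNReal.tsum_mul_left]
  rw [ENNReal.tsum_comm]
  simp only [mul_assoc]

theorem Ex_map (p : PMF α) (g : α → β) (f : β → ℝ≥0∞) : Ex (p.map g) f = Ex p fun a => f (g a) := by
  rw [PMF.map, Ex_bind]
  simp only [Function.comp_apply, Ex_pure]

theorem Ex_const_mul (p : PMF α) (c : ℝ≥0∞) (f : α → ℝ≥0∞) :
    Ex p (fun a => c * f a) = c * Ex p f := by
  unfold Ex
  rw [← ENNReal.tsum_mul_left]
  exact tsum_congr fun a => by ring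

theorem Ex_mul_const (p : PMF α) (c : ℝ≥0∞) (f : α → ℝ≥0∞) :
    Ex p (fun a => f a * c) = Ex p f * c := by
  simp only [mul_comm _ c, Ex_const_mul]

theorem unifPMF_succ (m : ℕ) :
    unifPMF (m + 1) = (PMF.uniformOfFintype (Fin (m + 1))).map Fin.val :=
  PMF.map_id _

theorem Ex_unif {m : ℕ} (hm : 0 < m) (f : ℕ → ℝ≥0∞) :
    Ex (unifPMF m) f = (m : ℝ≥0∞)⁻¹ * ∑ s ∈ Finset.range m, f s := by
  obtain ⟨m, rfl⟩ := Nat.exists_eq_succ_of_ne_zero hm.ne'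
  simp only [unifPMF_succ, Ex_map, Nat.succ_eq_add_one]
  unfold Ex
  rw [tsum_fintype]
  simp only [PMF.uniformOfFintype_apply, Fintype.card_fin, ← Finset.mul_sum]
  rw [Finset.sum_range]

theorem mem_support_unif {m s : ℕ} (hm : 0 < m) (hs : s ∈ (unifPMF m).support) : s < m := by
  obtain ⟨m, rfl⟩ := Nat.exists_eq_succ_of_ne_zero hm.ne'
  simp only [Nat.succ_eq_add_one, unifPMF_succ, PMF.mem_support_map_iff] at hs
  obtain ⟨a, -, rfl⟩ := hs
  exact a.2

theorem markov (p : PMF α) (f : α → ℝ≥0∞) (S : Set α) (h : ∀ a ∈ S, 1 ≤ f a) :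
    p.toOuterMeasure S ≤ Ex p f := by
  rw [PMF.toOuterMeasure_apply]
  unfold Ex
  refine ENNReal.tsum_le_tsum fun a => ?_
  by_cases ha : a ∈ S
  · rw [Set.indicator_of_mem ha]
    calc p a = p a * 1 := (mul_one _).symm
      _ ≤ _ := by gcongr; exact h a ha
  · simp [Set.indicator_of_notMem ha]

end expectation

/-! ## Independent families -/

section product

variable {β : Type*} [Inhabited β]

/-- The law of a family of independent samples from `κ 0, …, κ (N - 1)`. -/
noncomputable def prodLaw (κ : ℕ → PMF β) : ℕ → PMF (ℕ → β)
  | 0 => PMF.pure fun _ => default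
  | N + 1 => (prodLaw κ N).bind fun f => (κ N).map fun b => Function.update f N b

theorem prodLaw_congr {κ κ' : ℕ → PMF β} {N : ℕ} (h : ∀ i < N, κ i = κ' i) :
    prodLaw κ N = prodLaw κ' N := by
  induction N with
  | zero => rfl
  | succ N ih => simp only [prodLaw, ih fun i hi => h i (by omega), h N (by omega)]

theorem eq_default_of_mem_support {κ : ℕ → PMF β} {N : ℕ} {f : ℕ → β}
    (hf : f ∈ (prodLaw κ N).support) : ∀ i, N ≤ i → f i = default := by
  induction N generalizing f with
  | zero =>
    simp only [prodLaw, PMF.mem_support_pure_iff] at hf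
    subst hf
    exact fun _ _ => rfl
  | succ N ih =>
    simp only [prodLaw, PMF.mem_support_bind_iff, PMF.mem_support_map_iff] at hf
    obtain ⟨g, hg, b, -, rfl⟩ := hf
    intro i hi
    rw [Function.update_of_ne (by omega)]
    exact ih hg i (by omega)

theorem mem_support_of_mem_support {κ : ℕ → PMF β} {N : ℕ} {f : ℕ → β}
    (hf : f ∈ (prodLaw κ N).support) : ∀ i < N, f i ∈ (κ i).support := by
  induction N generalizing f with
  | zero => intro i hi; omega
  | succ N ih =>
    simp only [prodLaw, PMF.mem_support_bind_iff, PMF.mem_support_map_iff] at hf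
    obtain ⟨g, hg, b, hb, rfl⟩ := hf
    intro i hi
    by_cases h : i = N
    · subst h
      simpa using hb
    · rw [Function.update_of_ne h]
      exact ih hg i (by omega)

/-- A fixed family is a product of point masses. The entries from `N` on must be `default`, since
`prodLaw` never samples them. -/
theorem prodLaw_pure {ω : ℕ → β} {N : ℕ} (h : ∀ i, N ≤ i → ω i = default) :
    prodLaw (fun i => PMF.pure (ω i)) N = PMF.pure ω := by
  have : ∀ N, prodLaw (fun i => PMF.pure (ω i)) N =
      PMF.pure fun i => if i < N then ω i else default := by
    intro N
    induction N with
    | zero => simp [prodLaw]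
    | succ N ih =>
      simp only [prodLaw, ih, PMF.pure_bind, PMF.pure_map]
      congr 1
      funext i
      by_cases hi : i = N
      · subst hi; simp
      · rw [Function.update_of_ne hi]
        simp only [show i < N + 1 ↔ i < N by omega]
  rw [this]
  congr 1
  funext i
  split_ifs with hi
  · rfl
  · exact (h i (by omega)).symm

/-- Processing a single member leaves the members independent: later samples commute with the update
of entry `i`. -/
theorem prodLaw_bind_update (κ : ℕ → PMF β) (r : β → PMF β) {N i : ℕ} (hi : i < N) :
    ((prodLaw κ N).bind fun f => (r (f i)).map fun b => Function.update f i b) =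
      prodLaw (Function.update κ i ((κ i).bind r)) N := by
  induction N with
  | zero => omega
  | succ N ih =>
    by_cases h : i = N
    · subst h
      have h1 : prodLaw (Function.update κ i ((κ i).bind r)) i = prodLaw κ i :=
        prodLaw_congr fun j hj => Function.update_of_ne (by omega) _ _
      simp only [prodLaw, h1, PMF.bind_bind, PMF.bind_map, Function.comp_def, Function.update_self,
        Function.update_idem, PMF.map_bind]
    · have hiN : i < N := by omega
      simp only [prodLaw, ← ih hiN, PMF.bind_bind, PMF.bind_map, Function.comp_def,
        Function.update_of_ne h, Function.update_of_ne (Ne.symm h)]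
      congr 1
      funext f
      simp only [PMF.map, Function.comp_def]
      rw [PMF.bind_comm]
      simp only [Function.update_comm h]

/-- If every member is processed independently by the same kernel, the result is again an
independent family. With `r` the redrawing of a walk, this keeps the stored walks independent
through an update. -/
theorem prodLaw_bind (κ : ℕ → PMF β) (r : β → PMF β) (N : ℕ) :
    ((prodLaw κ N).bind fun ω => prodLaw (fun i => r (ω i)) N) =
      prodLaw (fun i => (κ i).bind r) N := by
  induction N with
  | zero => simp [prodLaw]
  | succ N ih =>
    have h1 : ∀ (f : ℕ → β) (b : β), prodLaw (fun i => r (Function.update f N b i)) N =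
        prodLaw (fun i => r (f i)) N := fun f b =>
      prodLaw_congr fun j hj => by rw [Function.update_of_ne (by omega)]
    simp only [prodLaw, ← ih, PMF.bind_bind, PMF.bind_map, Function.comp_def, h1,
      Function.update_self, PMF.map_bind]
    congr 1
    funext f
    rw [PMF.bind_comm]

theorem Ex_prodLaw (κ : ℕ → PMF β) (h : ℕ → β → ℝ≥0∞) (N : ℕ) :
    Ex (prodLaw κ N) (fun f => ∏ i ∈ Finset.range N, h i (f i)) =
      ∏ i ∈ Finset.range N, Ex (κ i) (h i) := by
  induction N with
  | zero => simp [prodLaw, Ex_pure]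
  | succ N ih =>
    simp only [prodLaw, Ex_bind, Ex_map, Finset.prod_range_succ, Function.update_self]
    rw [← ih, ← Ex_mul_const]
    congr 1
    funext f
    rw [← Ex_const_mul]
    congr 1
    funext b
    congr 1
    refine Finset.prod_congr rfl fun i hi => ?_
    rw [Finset.mem_range] at hi
    rw [Function.update_of_ne (by omega)]

/-- Replace the listed members of a family, one after the other, by samples of `r`. -/
noncomputable def foldUpdate (r : β → PMF β) : List ℕ → (ℕ → β) → PMF (ℕ → β)
  | [], f => PMF.pure f
  | i :: l, f => (r (f i)).bind fun b => foldUpdate r l (Function.update f i b)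

/-- The list may name a member repeatedly, as a walk is listed once for each touched position on it.
Idempotence of `r` makes the repetitions irrelevant for the law. -/
theorem prodLaw_bind_foldUpdate {r : β → PMF β} (hr : ∀ b, (r b).bind r = r b) {N : ℕ}
    (l : List ℕ) (hl : ∀ i ∈ l, i < N) (κ : ℕ → PMF β) :
    (prodLaw κ N).bind (foldUpdate r l) =
      prodLaw (fun i => if i ∈ l then (κ i).bind r else κ i) N := by
  induction l generalizing κ with
  | nil => simp [foldUpdate]
  | cons i l ih =>
    have h1 : foldUpdate r (i :: l) = fun f =>
        ((r (f i)).map fun b => Function.update f i b).bind (foldUpdate r l) := by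
      funext f
      rw [PMF.bind_map]
      rfl
    rw [h1, ← PMF.bind_bind, prodLaw_bind_update κ r (hl i (by simp)),
      ih fun j hj => hl j (by simp [hj])]
    refine prodLaw_congr fun j _ => ?_
    by_cases hji : j = i
    · subst hji
      simp only [Function.update_self, PMF.bind_bind, hr, ite_self, List.mem_cons, true_or, if_true]
    · simp only [Function.update_of_ne hji, List.mem_cons, hji, false_or]

/-- The sequential refresh of the listed members has the same law as processing all members in
parallel, because `r` does nothing to the unlisted ones. Obtained by applying
`prodLaw_bind_foldUpdate` to point masses. -/
theorem foldUpdate_eq_prodLaw {r : β → PMF β} (hr : ∀ b, (r b).bind r = r b) {N : ℕ}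
    {l : List ℕ} (hl : ∀ i ∈ l, i < N) {ω : ℕ → β} (hω : ∀ i, N ≤ i → ω i = default)
    (h : ∀ i < N, i ∉ l → r (ω i) = PMF.pure (ω i)) :
    foldUpdate r l ω = prodLaw (fun i => r (ω i)) N := by
  have h1 := prodLaw_bind_foldUpdate hr l hl fun i => PMF.pure (ω i)
  rw [prodLaw_pure hω, PMF.pure_bind] at h1
  rw [h1]
  refine prodLaw_congr fun i hi => ?_
  split_ifs with hil
  · rw [PMF.pure_bind]
  · exact (h i hi hil).symm

end product

/-! ## The law of a walk

A walk is recorded as a list of keys. In state `(u, m)` a number `s < m` is drawn, and the key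
`u * n + s` is recorded. If slot `s` of `u` is empty, the next state is `(u, s)`, and if it holds
the neighbour `v`, then the next state is `(v, n)`. The table `τ` stores `v + 1` for a slot that
holds `v` and `0` for an empty slot. -/

/-- The state after a key. -/
def nextState (n : ℕ) (τ : ℕ → ℕ) (k : ℕ) : ℕ × ℕ :=
  if τ k = 0 then (k / n, k % n) else (τ k - 1, n)

/-- The law of a walk with a given number of draws and a given initial state. -/
noncomputable def walkLaw (n : ℕ) (τ : ℕ → ℕ) : ℕ → ℕ × ℕ → PMF (List ℕ)
  | 0, _ => PMF.pure []
  | L + 1, p => (unifPMF p.2).bind fun s =>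
      (walkLaw n τ L (nextState n τ (p.1 * n + s))).map fun l => (p.1 * n + s) :: l

/-- Replace the part of a walk after the first key in `S` by a fresh one. -/
noncomputable def resample (n : ℕ) (τ : ℕ → ℕ) (S : List ℕ) : List ℕ → PMF (List ℕ)
  | [] => PMF.pure []
  | k :: l =>
    if k ∈ S then (walkLaw n τ l.length (nextState n τ k)).map fun l' => k :: l'
    else (resample n τ S l).map fun l' => k :: l'

section walks

variable {n : ℕ} {τ τ' : ℕ → ℕ} {S : List ℕ}

theorem length_of_mem_walkLaw {L : ℕ} {p : ℕ × ℕ} {l : List ℕ}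
    (h : l ∈ (walkLaw n τ L p).support) : l.length = L := by
  induction L generalizing p l with
  | zero =>
    simp only [walkLaw, PMF.mem_support_pure_iff] at h
    simp [h]
  | succ L ih =>
    simp only [walkLaw, PMF.mem_support_bind_iff, PMF.mem_support_map_iff] at h
    obtain ⟨s, -, l', hl', rfl⟩ := h
    simp [ih hl']

theorem length_of_mem_resample {l l' : List ℕ} (h : l' ∈ (resample n τ S l).support) :
    l'.length = l.length := by
  induction l generalizing l' with
  | nil =>
    simp only [resample, PMF.mem_support_pure_iff] at h
    simp [h]
  | cons k l ih =>
    simp only [resample] at h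
    split_ifs at h
    · simp only [PMF.mem_support_map_iff] at h
      obtain ⟨l₂, hl₂, rfl⟩ := h
      simp [length_of_mem_walkLaw hl₂]
    · simp only [PMF.mem_support_map_iff] at h
      obtain ⟨l₂, hl₂, rfl⟩ := h
      simp [ih hl₂]

theorem bind_congr_support {α β : Type*} {p : PMF α} {f g : α → PMF β}
    (h : ∀ a ∈ p.support, f a = g a) : p.bind f = p.bind g := by
  ext b
  simp only [PMF.bind_apply]
  refine tsum_congr fun a => ?_
  by_cases ha : p a = 0
  · simp [ha]
  · rw [h a ha]

/-- The central invariance. Up to and including its first key in `S` a walk is generated identically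
by both tables; afterwards it is redrawn by the new table. Hence a walk for `τ` becomes a walk for
`τ'`, with no trace of the past. -/
theorem walkLaw_bind_resample (h : ∀ k, k ∉ S → τ k = τ' k) (L : ℕ) (p : ℕ × ℕ) :
    (walkLaw n τ L p).bind (resample n τ' S) = walkLaw n τ' L p := by
  induction L generalizing p with
  | zero => simp [walkLaw, resample]
  | succ L ih =>
    simp only [walkLaw, PMF.bind_bind, PMF.bind_map, Function.comp_def, resample]
    congr 1
    funext s
    split_ifs with hk
    -- After a key in `S` the old continuation matters only through its length, which is almost
    -- surely `L`, so it integrates out.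
    · rw [bind_congr_support (g := fun _ =>
        (walkLaw n τ' L (nextState n τ' (p.1 * n + s))).map fun l' => (p.1 * n + s) :: l')]
      · rw [PMF.bind_const]
      · intro l hl
        rw [length_of_mem_walkLaw hl]
    · have : nextState n τ (p.1 * n + s) = nextState n τ' (p.1 * n + s) := by
        unfold nextState
        rw [h _ hk]
      rw [this, ← ih, PMF.map_bind]

/-- The first key in `S` survives a redraw, so a second redraw starts at the same place and replaces
the fresh part by another fresh part of equal length. -/
theorem resample_idem (l : List ℕ) :
    (resample n τ S l).bind (resample n τ S) = resample n τ S l := by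
  induction l with
  | nil => simp [resample]
  | cons k l ih =>
    simp only [resample]
    split_ifs with hk
    · rw [PMF.bind_map]
      rw [bind_congr_support (g := fun _ =>
        (walkLaw n τ l.length (nextState n τ k)).map fun l' => k :: l')]
      · rw [PMF.bind_const]
      · intro l' hl'
        simp [resample, hk, length_of_mem_walkLaw hl']
    · conv_rhs => rw [← ih]
      rw [PMF.bind_map, PMF.map_bind]
      simp [resample, hk, Function.comp_def]

theorem resample_eq_pure {l : List ℕ} (h : ∀ k ∈ l, k ∉ S) :
    resample n τ S l = PMF.pure l := by
  induction l with
  | nil => rfl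
  | cons k l ih =>
    rw [resample, if_neg (h k (by simp)), ih fun k' hk' => h k' (by simp [hk']), PMF.pure_map]

end walks


open scoped ENNReal

/-! ## Slot tables -/

/-- `τ` is a table of slots for the graph with adjacency matrix `A` and degrees `deg`. -/
structure SlotTable (n : ℕ) (τ deg : ℕ → ℕ) (A : ℕ → ℕ → ℝ) : Prop where
  deg_pos : ∀ u < n, 1 ≤ deg u
  deg_le : ∀ u < n, deg u ≤ n
  filled : ∀ u < n, ∀ s < deg u, τ (u * n + s) ≠ 0
  lt : ∀ u < n, ∀ s < deg u, τ (u * n + s) - 1 < n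
  empty : ∀ u < n, ∀ s < n, deg u ≤ s → τ (u * n + s) = 0
  sum : ∀ u < n, ∀ f : ℕ → ℝ, ∑ s ∈ Finset.range (deg u), f (τ (u * n + s) - 1) =
    ∑ v ∈ Finset.range n, A u v * f v
  symm : ∀ u v, A u v = A v u

/-- The states that a walk visits. -/
def WalkState (n : ℕ) (deg : ℕ → ℕ) (p : ℕ × ℕ) : Prop := p.1 < n ∧ deg p.1 ≤ p.2 ∧ p.2 ≤ n

namespace SlotTable

variable {n : ℕ} {τ deg : ℕ → ℕ} {A : ℕ → ℕ → ℝ} (T : SlotTable n τ deg A)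
include T

theorem pos_of_state {p : ℕ × ℕ} (hp : WalkState n deg p) : 0 < p.2 :=
  lt_of_lt_of_le (T.deg_pos _ hp.1) hp.2.1

theorem next_filled {u s : ℕ} (hu : u < n) (hs : s < deg u) :
    nextState n τ (u * n + s) = (τ (u * n + s) - 1, n) := by
  rw [nextState, if_neg (T.filled u hu s hs)]

theorem next_empty {u s : ℕ} (hu : u < n) (hs : deg u ≤ s) (hsn : s < n) :
    nextState n τ (u * n + s) = (u, s) := by
  rw [nextState, if_pos (T.empty u hu s hsn hs)]
  have hn : 0 < n := by omega
  rw [mul_comm u n, Nat.mul_add_div hn, Nat.mul_add_mod, Nat.div_eq_of_lt hsn, Nat.mod_eq_of_lt hsn,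
    add_zero]

theorem walkState_start {u : ℕ} (hu : u < n) : WalkState n deg (u, n) :=
  ⟨hu, T.deg_le u hu, le_rfl⟩

theorem walkState_next {p : ℕ × ℕ} (hp : WalkState n deg p) {s : ℕ} (hs : s < p.2) :
    WalkState n deg (nextState n τ (p.1 * n + s)) := by
  have hsn : s < n := lt_of_lt_of_le hs hp.2.2
  by_cases h : s < deg p.1
  · rw [T.next_filled hp.1 h]
    exact T.walkState_start (T.lt _ hp.1 _ h)
  · rw [T.next_empty hp.1 (by omega) hsn]
    exact ⟨hp.1, by simpa using h, hsn.le⟩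

theorem deg_eq_sum {u : ℕ} (hu : u < n) : (deg u : ℝ) = ∑ v ∈ Finset.range n, A u v := by
  have := T.sum u hu fun _ => 1
  simpa using this

end SlotTable

/-! ## Real expectations over walks -/

/-- The expectation of a real function of a walk. -/
noncomputable def walkMean (n : ℕ) (τ : ℕ → ℕ) : ℕ → ℕ × ℕ → (List ℕ → ℝ) → ℝ
  | 0, _, f => f []
  | L + 1, p, f => (p.2 : ℝ)⁻¹ * ∑ s ∈ Finset.range p.2,
      walkMean n τ L (nextState n τ (p.1 * n + s)) fun l => f ((p.1 * n + s) :: l)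

section walkMean

variable {n : ℕ} {τ deg : ℕ → ℕ} {A : ℕ → ℕ → ℝ}

theorem walkMean_mono {L : ℕ} {p : ℕ × ℕ} {f g : List ℕ → ℝ} (h : ∀ l, l.length = L → f l ≤ g l) :
    walkMean n τ L p f ≤ walkMean n τ L p g := by
  induction L generalizing p f g with
  | zero => exact h _ rfl
  | succ L ih =>
    simp only [walkMean]
    gcongr with s hs
    exact ih fun l hl => h _ (by simp [hl])

theorem walkMean_const_mul (L : ℕ) (p : ℕ × ℕ) (c : ℝ) (f : List ℕ → ℝ) :
    walkMean n τ L p (fun l => c * f l) = c * walkMean n τ L p f := by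
  induction L generalizing p f with
  | zero => rfl
  | succ L ih =>
    have : ∀ s, (walkMean n τ L (nextState n τ (p.1 * n + s)) fun l => c * f ((p.1 * n + s) :: l)) =
        c * walkMean n τ L (nextState n τ (p.1 * n + s)) fun l => f ((p.1 * n + s) :: l) :=
      fun s => ih _ fun l => f ((p.1 * n + s) :: l)
    simp only [walkMean, this, ← Finset.mul_sum]
    ring

theorem walkMean_add (L : ℕ) (p : ℕ × ℕ) (f g : List ℕ → ℝ) :
    walkMean n τ L p (fun l => f l + g l) = walkMean n τ L p f + walkMean n τ L p g := by
  induction L generalizing p f g with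
  | zero => rfl
  | succ L ih =>
    simp only [walkMean, ih, Finset.sum_add_distrib]
    ring

theorem walkMean_nonneg (L : ℕ) (p : ℕ × ℕ) {f : List ℕ → ℝ} (h : ∀ l, 0 ≤ f l) :
    0 ≤ walkMean n τ L p f := by
  induction L generalizing p f with
  | zero => exact h _
  | succ L ih =>
    simp only [walkMean]
    exact mul_nonneg (by positivity) (Finset.sum_nonneg fun s _ => ih _ fun l => h _)

theorem SlotTable.walkMean_const (T : SlotTable n τ deg A) (L : ℕ) {p : ℕ × ℕ}
    (hp : WalkState n deg p) (c : ℝ) : walkMean n τ L p (fun _ => c) = c := by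
  induction L generalizing p with
  | zero => rfl
  | succ L ih =>
    have hpos := T.pos_of_state hp
    simp only [walkMean]
    rw [Finset.sum_congr rfl fun s hs => ih (T.walkState_next hp (Finset.mem_range.1 hs))]
    simp
    field_simp

/-- Moves from `ℝ≥0∞` to real averages, where subtraction and negative coefficients are available.
States satisfying `WalkState` are needed because their second component is positive, so that every
draw is a genuine average. -/
theorem SlotTable.Ex_walkLaw (T : SlotTable n τ deg A) (L : ℕ) {p : ℕ × ℕ}
    (hp : WalkState n deg p) {f : List ℕ → ℝ} (hf : ∀ l, 0 ≤ f l) :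
    Ex (walkLaw n τ L p) (fun l => ENNReal.ofReal (f l)) = ENNReal.ofReal (walkMean n τ L p f) := by
  induction L generalizing p f with
  | zero => simp [walkLaw, Ex_pure, walkMean]
  | succ L ih =>
    have hpos := T.pos_of_state hp
    simp only [walkLaw, walkMean, Ex_bind, Ex_map, Ex_unif hpos]
    rw [ENNReal.ofReal_mul (by positivity), ENNReal.ofReal_inv_of_pos (by exact_mod_cast hpos),
      ENNReal.ofReal_natCast, ENNReal.ofReal_sum_of_nonneg]
    · congr 1
      exact Finset.sum_congr rfl fun s hs =>
        ih (T.walkState_next hp (Finset.mem_range.1 hs)) fun l => hf _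
    · exact fun s _ => walkMean_nonneg _ _ fun l => hf _

end walkMean

/-! ## Discounted visits -/

/-- The discount that a key causes. -/
noncomputable def discount (τ : ℕ → ℕ) (ε : ℝ) (k : ℕ) : ℝ := if τ k = 0 then 1 else 1 - ε

/-- The discounted number of arrivals at `v` of a walk, where `m` is the second component of its
initial state. -/
noncomputable def visits (n : ℕ) (τ : ℕ → ℕ) (ε : ℝ) (v : ℕ) : ℕ → List ℕ → ℝ
  | _, [] => 0
  | m, k :: l => (if m = n ∧ k / n = v then 1 else 0) +
      discount τ ε k * visits n τ ε v (nextState n τ k).2 l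

section visits

variable {n : ℕ} {τ deg : ℕ → ℕ} {A : ℕ → ℕ → ℝ} {ε : ℝ} {v : ℕ}

theorem discount_nonneg (h1 : ε ≤ 1) (k : ℕ) : 0 ≤ discount τ ε k := by
  unfold discount
  split_ifs <;> linarith

theorem discount_le_one (h0 : 0 ≤ ε) (k : ℕ) : discount τ ε k ≤ 1 := by
  unfold discount
  split_ifs <;> linarith

theorem visits_nonneg (h1 : ε ≤ 1) (m : ℕ) (l : List ℕ) : 0 ≤ visits n τ ε v m l := by
  induction l generalizing m with
  | nil => exact le_rfl
  | cons k l ih =>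
    simp only [visits]
    have := mul_nonneg (discount_nonneg (τ := τ) h1 k) (ih (nextState n τ k).2)
    split_ifs <;> linarith

/-- The expected discounted number of arrivals at `v`. -/
noncomputable def meanVisits (n : ℕ) (τ : ℕ → ℕ) (ε : ℝ) (v L : ℕ) (p : ℕ × ℕ) : ℝ :=
  walkMean n τ L p (visits n τ ε v p.2)

/-- Whether a state is an arrival at `v`. -/
noncomputable def arrival (n v : ℕ) (p : ℕ × ℕ) : ℝ := if p.2 = n ∧ p.1 = v then 1 else 0

theorem key_div {u s : ℕ} (hs : s < n) : (u * n + s) / n = u := by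
  rw [mul_comm u n, Nat.mul_add_div (by omega), Nat.div_eq_of_lt hs, add_zero]

theorem key_mod {u s : ℕ} (hs : s < n) : (u * n + s) % n = s := by
  rw [mul_comm u n, Nat.mul_add_mod, Nat.mod_eq_of_lt hs]

theorem visits_cons {p : ℕ × ℕ} {s : ℕ} (hs : s < n) (l : List ℕ) :
    visits n τ ε v p.2 ((p.1 * n + s) :: l) = arrival n v p +
      discount τ ε (p.1 * n + s) * visits n τ ε v (nextState n τ (p.1 * n + s)).2 l := by
  rw [visits, key_div hs, arrival]

/-- Conditioning on the first draw. -/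
theorem SlotTable.meanVisits_succ (T : SlotTable n τ deg A) (L : ℕ) {p : ℕ × ℕ}
    (hp : WalkState n deg p) :
    meanVisits n τ ε v (L + 1) p = arrival n v p + (p.2 : ℝ)⁻¹ * ∑ s ∈ Finset.range p.2,
      discount τ ε (p.1 * n + s) * meanVisits n τ ε v L (nextState n τ (p.1 * n + s)) := by
  have hpos := T.pos_of_state hp
  have h1 : ∀ s ∈ Finset.range p.2, walkMean n τ L (nextState n τ (p.1 * n + s))
      (fun l => visits n τ ε v p.2 ((p.1 * n + s) :: l)) = arrival n v p +
      discount τ ε (p.1 * n + s) * meanVisits n τ ε v L (nextState n τ (p.1 * n + s)) := by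
    intro s hs
    rw [Finset.mem_range] at hs
    have hsn : s < n := lt_of_lt_of_le hs hp.2.2
    simp only [visits_cons hsn]
    rw [walkMean_add, T.walkMean_const L (T.walkState_next hp hs), walkMean_const_mul]
    rfl
  rw [meanVisits, walkMean, Finset.sum_congr rfl h1, Finset.sum_add_distrib, mul_add]
  congr 1
  simp
  field_simp

theorem meanVisits_nonneg (h1 : ε ≤ 1) (L : ℕ) (p : ℕ × ℕ) : 0 ≤ meanVisits n τ ε v L p :=
  walkMean_nonneg _ _ fun l => visits_nonneg h1 _ l

/-- The equation for the total discounted number of visits at `v`. -/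
structure Potential (n : ℕ) (A : ℕ → ℕ → ℝ) (deg : ℕ → ℕ) (ε : ℝ) (v : ℕ) (G : ℕ → ℝ) : Prop where
  eq : ∀ u < n, G u = (if u = v then 1 else 0) +
    (1 - ε) / deg u * ∑ x ∈ Finset.range n, A u x * G x
  nonneg : ∀ u < n, 0 ≤ G u
  le : ∀ u < n, G u ≤ 1 / ε

/-- The total expected discounted number of visits at `v`, from an arbitrary state. -/
noncomputable def fullVisits (n v : ℕ) (G : ℕ → ℝ) (p : ℕ × ℕ) : ℝ :=
  arrival n v p + (G p.1 - if p.1 = v then 1 else 0)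

theorem fullVisits_arrival (G : ℕ → ℝ) (u : ℕ) : fullVisits n v G (u, n) = G u := by
  simp [fullVisits, arrival]

/-- This shows that repeated draws amount to one uniform neighbour. Let `y = G u - [u = v]`. The
`deg u` filled slots contribute `deg u * y` by the equation for `G`, and each of the `m - deg u`
empty slots leads to a non-arrival state at `u`, worth `y`. The average over all `m` slots is
therefore `y`. -/
theorem fullVisits_eq (T : SlotTable n τ deg A) {G : ℕ → ℝ} (hG : Potential n A deg ε v G)
    {p : ℕ × ℕ} (hp : WalkState n deg p) :
    fullVisits n v G p = arrival n v p + (p.2 : ℝ)⁻¹ * ∑ s ∈ Finset.range p.2,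
      discount τ ε (p.1 * n + s) * fullVisits n v G (nextState n τ (p.1 * n + s)) := by
  obtain ⟨u, m⟩ := p
  obtain ⟨hu, hm1, hm2⟩ := hp
  dsimp only at *
  have hdpos := T.deg_pos u hu
  have hd0 : (deg u : ℝ) ≠ 0 := by positivity
  have hm0 : (m : ℝ) ≠ 0 := by
    have : 0 < m := by omega
    positivity
  set y := G u - if u = v then 1 else 0 with hy
  have hy' : (1 - ε) * ∑ x ∈ Finset.range n, A u x * G x = deg u * y := by
    rw [hy, hG.eq u hu]
    field_simp
    ring
  rw [← Finset.sum_range_add_sum_Ico _ hm1]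
  have e1 : ∑ s ∈ Finset.range (deg u), discount τ ε (u * n + s) *
      fullVisits n v G (nextState n τ (u * n + s)) = deg u * y := by
    rw [← hy', ← T.sum u hu, Finset.mul_sum]
    refine Finset.sum_congr rfl fun s hs => ?_
    rw [Finset.mem_range] at hs
    rw [T.next_filled hu hs, fullVisits_arrival, discount, if_neg (T.filled u hu s hs)]
  have e2 : ∑ s ∈ Finset.Ico (deg u) m, discount τ ε (u * n + s) *
      fullVisits n v G (nextState n τ (u * n + s)) = (m - deg u) * y := by
    have : ∀ s ∈ Finset.Ico (deg u) m, discount τ ε (u * n + s) *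
      fullVisits n v G (nextState n τ (u * n + s)) = y := by
      intro s hs
      rw [Finset.mem_Ico] at hs
      have hsn : s < n := by omega
      rw [T.next_empty hu hs.1 hsn, discount, if_pos (T.empty u hu s hsn hs.1), fullVisits,
        arrival, if_neg (by simp; omega)]
      simp [hy]
    rw [Finset.sum_congr rfl this]
    simp [Nat.cast_sub hm1]
  rw [e1, e2, fullVisits]
  simp only [← hy]
  field_simp
  ring

/-! ### Harmonic numbers and the truncation error. -/

/-- The harmonic numbers. -/
noncomputable def harm (m : ℕ) : ℝ := ∑ i ∈ Finset.range m, 1 / ((i : ℝ) + 1)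

theorem harm_mono {m m' : ℕ} (h : m ≤ m') : harm m ≤ harm m' := by
  unfold harm
  refine Finset.sum_le_sum_of_subset_of_nonneg (Finset.range_mono h) fun i _ _ => by positivity

theorem harm_nonneg (m : ℕ) : 0 ≤ harm m := by
  unfold harm
  positivity

theorem one_le_harm {m : ℕ} (h : 1 ≤ m) : 1 ≤ harm m := by
  have := harm_mono h
  simpa [harm] using this

/-- In other words, a uniform draw below `m` lowers the harmonic number by exactly `1` on average.
-/
theorem sum_harm (m : ℕ) : ∑ s ∈ Finset.range m, harm s = m * harm m - m := by
  induction m with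
  | zero => simp
  | succ m ih =>
    rw [Finset.sum_range_succ, ih]
    have : harm (m + 1) = harm m + 1 / ((m : ℝ) + 1) := by
      unfold harm
      rw [Finset.sum_range_succ]
    rw [this]
    push_cast
    field_simp
    ring

/-- Drift argument for the expected visits after the `L`-th draw, with Lyapunov function `1 + δ *
harm m` and `δ = ε / harm n`. A further draw at the same vertex lowers it by `δ` on average
(`sum_harm`). An arrival resets it to `1 + δ * harm n = 1 + ε`, but also brings the discount `1 -
ε`, and the product is at most `1`. As the function stays below `2`, a loss of `δ` is a factor `1 -
δ / 2`. -/
theorem fullVisits_sub_meanVisits (T : SlotTable n τ deg A) (h0 : 0 < ε) (h1 : ε < 1)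
    {G : ℕ → ℝ} (hG : Potential n A deg ε v G) (L : ℕ) {p : ℕ × ℕ} (hp : WalkState n deg p) :
    0 ≤ fullVisits n v G p - meanVisits n τ ε v L p ∧
      fullVisits n v G p - meanVisits n τ ε v L p ≤
        1 / ε * (1 + ε / harm n * harm p.2) * (1 - ε / harm n / 2) ^ L := by
  induction L generalizing p with
  | zero =>
    have hn : 1 ≤ n := lt_of_le_of_lt (Nat.zero_le _) hp.1
    have h2 : meanVisits n τ ε v 0 p = 0 := rfl
    have h3 : fullVisits n v G p ≤ G p.1 := by
      -- In an arrival state this is an equality; at `u = v` without arrival the current visit is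
      -- not counted.
      unfold fullVisits arrival
      by_cases hv : p.1 = v <;> by_cases hm : p.2 = n <;> simp [hv, hm]
    have h4 : 0 ≤ fullVisits n v G p := by
      have hy : 0 ≤ G p.1 - if p.1 = v then 1 else 0 := by
        have hAG : 0 ≤ ∑ x ∈ Finset.range n, A p.1 x * G x := by
          rw [← T.sum p.1 hp.1]
          exact Finset.sum_nonneg fun s hs => hG.nonneg _ (T.lt _ hp.1 _ (Finset.mem_range.1 hs))
        rw [hG.eq p.1 hp.1]
        have : 0 ≤ (1 - ε) / deg p.1 := div_nonneg (by linarith) (by positivity)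
        have := mul_nonneg this hAG
        linarith
      have ha : 0 ≤ arrival n v p := by
        unfold arrival
        split_ifs <;> norm_num
      unfold fullVisits
      linarith
    refine ⟨by linarith, ?_⟩
    rw [h2, pow_zero, mul_one, sub_zero]
    have h5 : 0 ≤ ε / harm n * harm p.2 :=
      mul_nonneg (div_nonneg h0.le (harm_nonneg _)) (harm_nonneg _)
    calc fullVisits n v G p ≤ 1 / ε := h3.trans (hG.le _ hp.1)
      _ = 1 / ε * 1 := (mul_one _).symm
      _ ≤ _ := by
        gcongr
        linarith
  | succ L ih =>
    have hn : 1 ≤ n := lt_of_le_of_lt (Nat.zero_le _) hp.1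
    have hH := one_le_harm hn
    have hpos := T.pos_of_state hp
    have hpos' : (0 : ℝ) < p.2 := by exact_mod_cast hpos
    set δ := ε / harm n with hδ
    have hδ0 : 0 < δ := by positivity
    have hδH : δ * harm n = ε := by rw [hδ]; field_simp
    have hδ1 : δ < 1 := by
      rw [hδ, div_lt_one (by linarith)]
      linarith
    have hrec : fullVisits n v G p - meanVisits n τ ε v (L + 1) p =
        (p.2 : ℝ)⁻¹ * ∑ s ∈ Finset.range p.2, discount τ ε (p.1 * n + s) *
        (fullVisits n v G (nextState n τ (p.1 * n + s)) -
          meanVisits n τ ε v L (nextState n τ (p.1 * n + s))) := by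
      rw [fullVisits_eq T hG hp, T.meanVisits_succ L hp]
      simp only [mul_sub, Finset.sum_sub_distrib]
      ring
    rw [hrec]
    constructor
    · refine mul_nonneg (by positivity) (Finset.sum_nonneg fun s hs => ?_)
      exact mul_nonneg (discount_nonneg h1.le _)
        (ih (T.walkState_next hp (Finset.mem_range.1 hs))).1
    · have hterm : ∀ s ∈ Finset.range p.2, discount τ ε (p.1 * n + s) *
          (fullVisits n v G (nextState n τ (p.1 * n + s)) -
            meanVisits n τ ε v L (nextState n τ (p.1 * n + s))) ≤
          1 / ε * (1 - δ / 2) ^ L * (1 + δ * harm s) := by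
        intro s hs
        rw [Finset.mem_range] at hs
        have hb := (ih (T.walkState_next hp hs)).2
        have hq : 0 ≤ 1 / ε * (1 - δ / 2) ^ L :=
          mul_nonneg (by positivity) (pow_nonneg (by linarith) _)
        have hs0 := mul_nonneg hδ0.le (harm_nonneg s)
        have hsn : s < n := lt_of_lt_of_le hs hp.2.2
        by_cases hd : s < deg p.1
        -- Filled slot: `(1 - ε) * (1 + ε) ≤ 1`, and the term `δ * harm s` is not even needed.
        · rw [T.next_filled hp.1 hd] at hb ⊢
          rw [discount, if_neg (T.filled _ hp.1 _ hd)]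
          dsimp only at hb
          rw [hδH] at hb
          calc _ ≤ (1 - ε) * (1 / ε * (1 + ε) * (1 - δ / 2) ^ L) :=
                mul_le_mul_of_nonneg_left hb (by linarith)
            _ = 1 / ε * (1 - δ / 2) ^ L * ((1 - ε) * (1 + ε)) := by ring
            _ ≤ _ := by
              refine mul_le_mul_of_nonneg_left ?_ hq
              nlinarith
        · rw [T.next_empty hp.1 (by omega) hsn] at hb ⊢
          rw [discount, if_pos (T.empty _ hp.1 _ hsn (by omega)), one_mul]
          refine hb.trans (le_of_eq ?_)
          ring
      calc _ ≤ (p.2 : ℝ)⁻¹ * ∑ s ∈ Finset.range p.2,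
            1 / ε * (1 - δ / 2) ^ L * (1 + δ * harm s) := by
            refine mul_le_mul_of_nonneg_left (Finset.sum_le_sum hterm) (by positivity)
        _ = 1 / ε * (1 - δ / 2) ^ L * (1 + δ * harm p.2 - δ) := by
            rw [← Finset.mul_sum, Finset.sum_add_distrib, ← Finset.mul_sum, sum_harm]
            simp
            field_simp
            ring
        -- Since `δ * harm p.2 ≤ ε < 1`, the Lyapunov function is at most `2`, so `δ / 2` times it
        -- is at most `δ`.
        _ ≤ 1 / ε * (1 - δ / 2) ^ L * ((1 - δ / 2) * (1 + δ * harm p.2)) := by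
            refine mul_le_mul_of_nonneg_left ?_
              (mul_nonneg (by positivity) (pow_nonneg (by linarith) _))
            have := mul_le_mul_of_nonneg_left (harm_mono hp.2.2) hδ0.le
            nlinarith
        _ = _ := by ring

/-- Exponential moments by induction on the number of draws. The bound `1 + a * mean` is affine in
the mean, so it passes through averages over the draws; only an arrival at `v` brings a factor `exp
θ`. There the hypothesis `ha` is what closes the induction, with `y` the mean of the later visits.
The sign of `a` is free, so the same lemma serves for both tails. -/
theorem walkMean_exp_visits_le (T : SlotTable n τ deg A) (h0 : 0 ≤ ε) (h1 : ε ≤ 1)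
    {θ a Y : ℝ} (hY : ∀ L, meanVisits n τ ε v (L + 1) (v, n) - 1 ≤ Y)
    (ha : ∀ y, 0 ≤ y → y ≤ Y → Real.exp θ * (1 + a * y) ≤ 1 + a * (1 + y))
    (L : ℕ) {p : ℕ × ℕ} (hp : WalkState n deg p) :
    walkMean n τ L p (fun l => Real.exp (θ * visits n τ ε v p.2 l)) ≤
      1 + a * meanVisits n τ ε v L p := by
  induction L generalizing p with
  | zero => simp [walkMean, meanVisits, visits]
  | succ L ih =>
    have hpos := T.pos_of_state hp
    have hpos' : (p.2 : ℝ) ≠ 0 := by positivity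
    set y := (p.2 : ℝ)⁻¹ * ∑ s ∈ Finset.range p.2,
      discount τ ε (p.1 * n + s) * meanVisits n τ ε v L (nextState n τ (p.1 * n + s)) with hy
    have hrec : meanVisits n τ ε v (L + 1) p = arrival n v p + y := T.meanVisits_succ L hp
    have hterm : ∀ s ∈ Finset.range p.2, walkMean n τ L (nextState n τ (p.1 * n + s))
        (fun l => Real.exp (θ * visits n τ ε v p.2 ((p.1 * n + s) :: l))) ≤
        Real.exp (θ * arrival n v p) * (1 + a * (discount τ ε (p.1 * n + s) *
          meanVisits n τ ε v L (nextState n τ (p.1 * n + s)))) := by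
      intro s hs
      rw [Finset.mem_range] at hs
      have hsn : s < n := lt_of_lt_of_le hs hp.2.2
      have hst := T.walkState_next hp hs
      set D := discount τ ε (p.1 * n + s)
      have hD0 : 0 ≤ D := discount_nonneg h1 _
      have hD1 : D ≤ 1 := discount_le_one h0 _
      set q := nextState n τ (p.1 * n + s)
      calc _ ≤ walkMean n τ L q (fun l => Real.exp (θ * arrival n v p) *
            ((1 - D) + D * Real.exp (θ * visits n τ ε v q.2 l))) := by
            refine walkMean_mono fun l _ => ?_
            rw [visits_cons hsn, mul_add, Real.exp_add]
            refine mul_le_mul_of_nonneg_left ?_ (Real.exp_pos _).le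
            -- Convexity replaces the discount `D` by survival with probability `D`.
            have := convexOn_exp.2 (Set.mem_univ (0 : ℝ))
              (Set.mem_univ (θ * visits n τ ε v q.2 l)) (by linarith : 0 ≤ 1 - D) hD0 (by ring)
            simp only [smul_eq_mul, mul_zero, Real.exp_zero, mul_one, zero_add] at this
            calc Real.exp (θ * (D * visits n τ ε v q.2 l))
                = Real.exp (D * (θ * visits n τ ε v q.2 l)) := by ring_nf
              _ ≤ _ := this
        _ = Real.exp (θ * arrival n v p) * ((1 - D) + D * walkMean n τ L q
              fun l => Real.exp (θ * visits n τ ε v q.2 l)) := by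
            rw [walkMean_const_mul, walkMean_add, T.walkMean_const L hst, walkMean_const_mul]
        _ ≤ _ := by
            refine mul_le_mul_of_nonneg_left ?_ (Real.exp_pos _).le
            have := mul_le_mul_of_nonneg_left (ih hst) hD0
            linarith
    have hsum : walkMean n τ (L + 1) p (fun l => Real.exp (θ * visits n τ ε v p.2 l)) ≤
        Real.exp (θ * arrival n v p) * (1 + a * y) := by
      rw [walkMean]
      calc _ ≤ (p.2 : ℝ)⁻¹ * ∑ s ∈ Finset.range p.2, Real.exp (θ * arrival n v p) *
            (1 + a * (discount τ ε (p.1 * n + s) *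
              meanVisits n τ ε v L (nextState n τ (p.1 * n + s)))) :=
            mul_le_mul_of_nonneg_left (Finset.sum_le_sum hterm) (by positivity)
        _ = _ := by
            rw [← Finset.mul_sum, Finset.sum_add_distrib, ← Finset.mul_sum, hy]
            simp
            field_simp
    refine hsum.trans ?_
    rw [hrec]
    have hy0 : 0 ≤ y := mul_nonneg (by positivity) (Finset.sum_nonneg fun s _ =>
      mul_nonneg (discount_nonneg h1 _) (meanVisits_nonneg h1 _ _))
    -- At an arrival the range of `y` comes from `hY`; elsewhere the visit contributes nothing and
    -- the two sides already agree.
    by_cases hv : p.2 = n ∧ p.1 = v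
    · have hpv : p = (v, n) := Prod.ext hv.2 hv.1
      have hyY := hY L
      rw [← hpv, hrec] at hyY
      simp only [arrival, hv, and_self, if_true, mul_one] at hyY ⊢
      exact ha y hy0 (by linarith)
    · simp [arrival, hv]

end visits


open scoped ENNReal

/-! ## Concentration -/

/-- The law of the family of walks, `R` from each vertex. -/
noncomputable def familyLaw (n R M : ℕ) (τ : ℕ → ℕ) : PMF (ℕ → List ℕ) :=
  prodLaw (fun i => walkLaw n τ M (i % n, n)) (n * R)

theorem sum_range_mul_mod {n : ℕ} (R : ℕ) (f : ℕ → ℝ) :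
    ∑ i ∈ Finset.range (n * R), f (i % n) = R * ∑ u ∈ Finset.range n, f u := by
  induction R with
  | zero => simp
  | succ R ih =>
    rw [Nat.mul_succ, Finset.sum_range_add, ih]
    have : ∀ x ∈ Finset.range n, f ((n * R + x) % n) = f x := by
      intro x hx
      rw [Nat.mul_add_mod, Nat.mod_eq_of_lt (Finset.mem_range.1 hx)]
    rw [Finset.sum_congr rfl this]
    push_cast
    ring

section concentration

variable {n R M : ℕ} {τ deg : ℕ → ℕ} {A : ℕ → ℕ → ℝ} {ε α : ℝ} {v : ℕ}

/-- Exponential Markov inequality. Independence turns the moment into a product, `1 + a ≤ exp a`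
turns the factors into exponentials, and each starting vertex occurs `R` times among the residues `i
% n`. -/
theorem SlotTable.chernoff (T : SlotTable n τ deg A) (hn : 0 < n) (X : List ℕ → ℝ) (a : ℕ → ℝ)
    (hX : ∀ u < n, walkMean n τ M (u, n) (fun l => Real.exp (X l)) ≤ 1 + a u) (t : ℝ) :
    (familyLaw n R M τ).toOuterMeasure {ω | t ≤ ∑ i ∈ Finset.range (n * R), X (ω i)} ≤
      ENNReal.ofReal (Real.exp (R * ∑ u ∈ Finset.range n, a u - t)) := by
  have hEx : ∀ i, Ex (walkLaw n τ M (i % n, n)) (fun l => ENNReal.ofReal (Real.exp (X l))) ≤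
      ENNReal.ofReal (Real.exp (a (i % n))) := by
    intro i
    have hu : i % n < n := Nat.mod_lt _ hn
    rw [T.Ex_walkLaw M (T.walkState_start hu) fun l => (Real.exp_pos _).le]
    refine ENNReal.ofReal_le_ofReal ((hX _ hu).trans ?_)
    rw [add_comm]
    exact Real.add_one_le_exp _
  calc _ ≤ Ex (familyLaw n R M τ) (fun ω => ENNReal.ofReal (Real.exp (-t)) *
        ∏ i ∈ Finset.range (n * R), ENNReal.ofReal (Real.exp (X (ω i)))) := by
        refine markov _ _ _ fun ω hω => ?_
        rw [Set.mem_ofPred_eq] at hω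
        rw [← ENNReal.ofReal_prod_of_nonneg fun i _ => (Real.exp_pos _).le, ← Real.exp_sum,
          ← ENNReal.ofReal_mul (Real.exp_pos _).le, ← Real.exp_add, ENNReal.one_le_ofReal,
          Real.one_le_exp_iff]
        linarith
    _ = ENNReal.ofReal (Real.exp (-t)) * ∏ i ∈ Finset.range (n * R),
        Ex (walkLaw n τ M (i % n, n)) (fun l => ENNReal.ofReal (Real.exp (X l))) := by
        rw [Ex_const_mul, familyLaw,
          Ex_prodLaw _ fun _ l => ENNReal.ofReal (Real.exp (X l))]
    _ ≤ ENNReal.ofReal (Real.exp (-t)) * ∏ i ∈ Finset.range (n * R),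
        ENNReal.ofReal (Real.exp (a (i % n))) := by
        gcongr with i hi
        exact hEx i
    _ = _ := by
        rw [← ENNReal.ofReal_prod_of_nonneg fun i _ => (Real.exp_pos _).le, ← Real.exp_sum,
          ← ENNReal.ofReal_mul (Real.exp_pos _).le, ← Real.exp_add, sum_range_mul_mod R a]
        congr 2
        ring

/-- The inequality `ha` for the upper tail. With `g = G * θ` small, the slope `a = θ * (1 + 2 * g)`
exceeds `θ` only by a relative error of order `g`, which is the deviation to be tolerated. -/
theorem exp_upper_bound {G θ y : ℝ} (hG : 1 ≤ G) (hθ : 0 ≤ θ) (hθG : G * θ ≤ 1 / 4) (hy : 0 ≤ y)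
    (hyG : y ≤ G - 1) :
    Real.exp θ * (1 + θ * (1 + 2 * (G * θ)) * y) ≤ 1 + θ * (1 + 2 * (G * θ)) * (1 + y) := by
  set g := G * θ with hg
  have hθ1 : θ ≤ g := by nlinarith
  have hexp : Real.exp θ ≤ 1 + θ + θ ^ 2 := by
    have h := Real.abs_exp_sub_one_sub_id_le (x := θ) (by rw [abs_of_nonneg hθ]; linarith)
    have := (abs_le.1 h).2
    linarith
  have hg0 : 0 ≤ g := by nlinarith
  have h1 : 0 ≤ 1 + θ * (1 + 2 * g) * y := by positivity
  refine (mul_le_mul_of_nonneg_right hexp h1).trans ?_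
  have h2 : θ * y ≤ g - θ := by nlinarith
  -- After replacing `exp θ` by `1 + θ + θ ^ 2` and cancelling `1 + a * y`, both sides are multiples
  -- of `θ`. The variable `y` enters only through `θ * y ≤ g - θ`.
  suffices h : (1 + θ) * (1 + θ * (1 + 2 * g) * y) ≤ 1 + 2 * g by nlinarith
  have h3 : θ * (1 + 2 * g) * y ≤ (1 + 2 * g) * (g - θ) := by nlinarith
  have h4 : (1 + θ) * (1 + θ * (1 + 2 * g) * y) ≤ (1 + θ) * (1 + (1 + 2 * g) * (g - θ)) := by
    gcongr
  refine h4.trans ?_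
  nlinarith [mul_nonneg hg0 hθ, mul_nonneg (mul_nonneg hg0 hθ) hg0,
    mul_nonneg hg0 (sub_nonneg.2 hθG), mul_nonneg hθ (sub_nonneg.2 hθG), mul_nonneg hθ hθ,
    mul_nonneg (mul_nonneg hθ hθ) hg0]

/-- The counterpart for the lower tail, with negative parameter `-η` and negative slope `-η * (1 - G
* η)`. -/
theorem exp_lower_bound {G η y : ℝ} (hG : 1 ≤ G) (hη : 0 ≤ η) (hηG : G * η ≤ 1 / 4) (hy : 0 ≤ y)
    (hyG : y ≤ G - 1) :
    Real.exp (-η) * (1 + -(η * (1 - G * η)) * y) ≤ 1 + -(η * (1 - G * η)) * (1 + y) := by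
  set g := G * η with hg
  have hη1 : η ≤ g := by nlinarith
  have hexp : Real.exp (-η) ≤ 1 - η + η ^ 2 := by
    have h := Real.abs_exp_sub_one_sub_id_le (x := -η)
      (by rw [abs_neg, abs_of_nonneg hη]; linarith)
    have := (abs_le.1 h).2
    linarith
  have hg0 : 0 ≤ g := by nlinarith
  have h2 : η * y ≤ g - η := by nlinarith
  have h1 : 0 ≤ 1 + -(η * (1 - g)) * y := by nlinarith
  refine (mul_le_mul_of_nonneg_right hexp h1).trans ?_
  -- What remains after `exp (-η) ≤ 1 - η + η ^ 2`, once `1 + a * y` is cancelled and the factor `η`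
  -- removed.
  have h3 : (1 - g) * (1 + (1 - η) * y * η) ≤ 1 - η := by
    have : (1 - η) * y * η ≤ g - η := by nlinarith [mul_nonneg hη hy]
    have h5 : (1 - g) * (1 + (1 - η) * y * η) ≤ (1 - g) * (1 + (g - η)) := by
      refine mul_le_mul_of_nonneg_left (by linarith) (by linarith)
    nlinarith
  nlinarith

/-- Each coordinate of the estimate is accurate with high probability. -/
theorem SlotTable.accurate (T : SlotTable n τ deg A) (h0 : 0 < ε) (h1 : ε < 1) (hα : 0 < α)
    (hα1 : α ≤ 1) (hv : v < n) {G : ℕ → ℝ} (hG : Potential n A deg ε v G)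
    (hM : n * (2 / ε) * (1 - ε / harm n / 2) ^ M ≤ α / 2) :
    (familyLaw n R M τ).toOuterMeasure {ω |
      ¬ ((1 - α) * (R * ∑ u ∈ Finset.range n, G u) ≤
          ∑ i ∈ Finset.range (n * R), visits n τ ε v n (ω i) ∧
        ∑ i ∈ Finset.range (n * R), visits n τ ε v n (ω i) ≤
          (1 + α) * (R * ∑ u ∈ Finset.range n, G u))} ≤
      2 * ENNReal.ofReal (Real.exp (-(α ^ 2 * R / 16))) := by
  have hn : 0 < n := by omega
  have hdiff := fun L {p : ℕ × ℕ} (hp : WalkState n deg p) =>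
    fullVisits_sub_meanVisits T h0 h1 hG L hp
  have hGnn := hG.nonneg
  set m : ℕ → ℝ := fun u => meanVisits n τ ε v M (u, n) with hm
  set μ := ∑ u ∈ Finset.range n, G u with hμ
  have hG1 : 1 ≤ G v := by
    rw [hG.eq v hv, if_pos rfl]
    have hAG : 0 ≤ ∑ x ∈ Finset.range n, A v x * G x := by
      rw [← T.sum v hv]
      exact Finset.sum_nonneg fun s hs => hG.nonneg _ (T.lt _ hv _ (Finset.mem_range.1 hs))
    have : 0 ≤ (1 - ε) / deg v := div_nonneg (by linarith) (by positivity)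
    have := mul_nonneg this hAG
    linarith
  -- Some of the walks start at `v` itself. This makes the total mean large compared with `G v`, the
  -- scale of the fluctuations, and keeps `ε` out of the exponent.
  have hμG : G v ≤ μ := Finset.single_le_sum (f := G) (fun u hu => hGnn u (Finset.mem_range.1 hu))
    (Finset.mem_range.2 hv)
  have hmle : ∀ u < n, m u ≤ G u := fun u hu => by
    have := (hdiff M (T.walkState_start hu)).1
    rw [fullVisits_arrival] at this
    simp only [hm]
    linarith
  have hmge : ∀ u < n, G u - 2 / ε * (1 - ε / harm n / 2) ^ M ≤ m u := fun u hu => by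
    have := (hdiff M (T.walkState_start hu)).2
    rw [fullVisits_arrival] at this
    dsimp only at this
    rw [div_mul_cancel₀ _ (by linarith [one_le_harm hn] : harm n ≠ 0)] at this
    have h2 : 1 / ε * (1 + ε) * (1 - ε / harm n / 2) ^ M ≤
        2 / ε * (1 - ε / harm n / 2) ^ M := by
      have : 0 ≤ (1 - ε / harm n / 2) ^ M := by
        refine pow_nonneg ?_ _
        have : ε / harm n ≤ 1 := by
          rw [div_le_one (by linarith [one_le_harm hn])]
          linarith [one_le_harm hn]
        linarith
      refine mul_le_mul_of_nonneg_right ?_ this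
      rw [div_mul_eq_mul_div, one_mul]
      gcongr
      linarith
    simp only [hm]
    linarith
  have hsum_le : ∑ u ∈ Finset.range n, m u ≤ μ :=
    Finset.sum_le_sum fun u hu => hmle u (Finset.mem_range.1 hu)
  -- The total truncation error is at most `α / 2`, and `μ ≥ G v ≥ 1` turns it into a relative
  -- error.
  have hsum_ge : (1 - α / 2) * μ ≤ ∑ u ∈ Finset.range n, m u := by
    have h3 : ∑ u ∈ Finset.range n, (G u - 2 / ε * (1 - ε / harm n / 2) ^ M) ≤
        ∑ u ∈ Finset.range n, m u :=
      Finset.sum_le_sum fun u hu => hmge u (Finset.mem_range.1 hu)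
    rw [Finset.sum_sub_distrib] at h3
    simp only [Finset.sum_const, Finset.card_range, nsmul_eq_mul] at h3
    rw [← mul_assoc] at h3
    nlinarith
  have hY : ∀ L, meanVisits n τ ε v (L + 1) (v, n) - 1 ≤ G v - 1 := fun L => by
    have := (hdiff (L + 1) (T.walkState_start hv)).1
    rw [fullVisits_arrival] at this
    linarith
  -- Now `G v * θ = α / 4`, so the relative loss in the slopes is at most `α / 2`, which leaves part
  -- of the allowed deviation `α` for the exponent. As `θ * μ ≥ α / 4`, the exponent is at least `α
  -- ^ 2 * R / 16`.
  set θ := α / (4 * G v) with hθ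
  have hGpos : 0 < G v := by linarith
  have hθ0 : 0 < θ := by positivity
  have hGθ : G v * θ = α / 4 := by rw [hθ]; field_simp
  have hR : (0 : ℝ) ≤ R := Nat.cast_nonneg _
  have hθμ : α / 4 ≤ θ * μ := by
    rw [← hGθ, mul_comm]
    exact mul_le_mul_of_nonneg_left hμG hθ0.le
  have hup := T.chernoff (R := R) (M := M) hn (fun l => θ * visits n τ ε v n l)
    (fun u => θ * (1 + 2 * (G v * θ)) * m u)
    (fun u hu => walkMean_exp_visits_le T h0.le h1.le hY
      (fun y hy hyG => exp_upper_bound hG1 hθ0.le (by linarith) hy hyG) M (T.walkState_start hu))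
    (θ * ((1 + α) * (R * μ)))
  have hlow := T.chernoff (R := R) (M := M) hn (fun l => -θ * visits n τ ε v n l)
    (fun u => -(θ * (1 - G v * θ)) * m u)
    (fun u hu => walkMean_exp_visits_le T h0.le h1.le hY
      (fun y hy hyG => exp_lower_bound hG1 hθ0.le (by linarith) hy hyG) M (T.walkState_start hu))
    (-θ * ((1 - α) * (R * μ)))
  simp only [← Finset.mul_sum] at hup hlow
  have hRμ : R * (α ^ 2 / 16) ≤ R * (θ * μ * (α / 4)) := by
    refine mul_le_mul_of_nonneg_left ?_ hR
    nlinarith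
  have hup' : Real.exp (R * (θ * (1 + 2 * (G v * θ)) * ∑ u ∈ Finset.range n, m u) -
      θ * ((1 + α) * (R * μ))) ≤ Real.exp (-(α ^ 2 * R / 16)) := by
    rw [Real.exp_le_exp, hGθ]
    have : R * (θ * (1 + 2 * (α / 4)) * ∑ u ∈ Finset.range n, m u) ≤
        R * (θ * (1 + 2 * (α / 4)) * μ) := by gcongr
    have h5 : R * (θ * (1 + 2 * (α / 4)) * μ) - θ * ((1 + α) * (R * μ)) =
      -2 * (R * (θ * μ * (α / 4))) := by ring
    have h6 : 0 ≤ R * (α ^ 2 / 16) := by positivity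
    linarith
  have hlow' : Real.exp (R * (-(θ * (1 - G v * θ)) * ∑ u ∈ Finset.range n, m u) -
      -θ * ((1 - α) * (R * μ))) ≤ Real.exp (-(α ^ 2 * R / 16)) := by
    rw [Real.exp_le_exp, hGθ]
    have h7 : 0 ≤ R * (θ * (1 - α / 4)) := mul_nonneg hR (mul_nonneg hθ0.le (by linarith))
    have h8 := mul_le_mul_of_nonneg_left hsum_ge h7
    -- The truncation loss `1 - α / 2` and the slope loss `1 - α / 4` together stay below the
    -- tolerance `α`.
    have h5 : -(R * (θ * (1 - α / 4)) * ((1 - α / 2) * μ)) - -θ * ((1 - α) * (R * μ)) =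
      -(R * (θ * μ * (α / 4))) - R * (θ * μ) * (α ^ 2 / 8) := by ring
    have h9 : 0 ≤ R * (θ * μ) * (α ^ 2 / 8) :=
      mul_nonneg (mul_nonneg hR (by linarith)) (by positivity)
    linarith
  have hunion : {ω : ℕ → List ℕ | ¬ ((1 - α) * (R * μ) ≤
        ∑ i ∈ Finset.range (n * R), visits n τ ε v n (ω i) ∧
      ∑ i ∈ Finset.range (n * R), visits n τ ε v n (ω i) ≤ (1 + α) * (R * μ))} ⊆
      {ω | -θ * ((1 - α) * (R * μ)) ≤
        -θ * ∑ i ∈ Finset.range (n * R), visits n τ ε v n (ω i)} ∪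
      {ω | θ * ((1 + α) * (R * μ)) ≤
        θ * ∑ i ∈ Finset.range (n * R), visits n τ ε v n (ω i)} := by
    intro ω hω
    simp only [Set.mem_ofPred_eq, Set.mem_union, not_and_or, not_le] at hω ⊢
    rcases hω with h | h
    · left
      nlinarith
    · right
      exact mul_le_mul_of_nonneg_left h.le hθ0.le
  refine (MeasureTheory.measure_mono hunion).trans ((MeasureTheory.measure_union_le _ _).trans ?_)
  rw [two_mul]
  exact add_le_add (hlow.trans (ENNReal.ofReal_le_ofReal hlow'))
    (hup.trans (ENNReal.ofReal_le_ofReal hup'))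

/-! ## The number of occurrences of a key -/

/-- The expected number of occurrences of a key. -/
noncomputable def meanCount (n : ℕ) (τ : ℕ → ℕ) (k L : ℕ) (p : ℕ × ℕ) : ℝ :=
  walkMean n τ L p fun l => (l.count k : ℝ)

/-- Balance equation for the slots of one vertex of degree `d`. Start with mass `d` at bound `n` and
mass `d / (m + 1)` at the intermediate bound `m`; then slot `s` is drawn with mass `1` if it is
filled and with mass `d / (s + 1)` if it is empty, which is precisely the mass of the state that an
empty slot leads to. -/
theorem sum_record_weights {n d : ℕ} (hd : 1 ≤ d) (hdn : d ≤ n) (F : ℕ → ℝ) :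
    (d : ℝ) * ((n : ℝ)⁻¹ * ∑ s ∈ Finset.range n, F s) + ∑ m ∈ Finset.Ico d n,
      (d : ℝ) / ((m : ℝ) + 1) * ((m : ℝ)⁻¹ * ∑ s ∈ Finset.range m, F s) =
    ∑ s ∈ Finset.range d, F s + ∑ s ∈ Finset.Ico d n, (d : ℝ) / ((s : ℝ) + 1) * F s := by
  induction n, hdn using Nat.le_induction with
  | base =>
    have : (d : ℝ) ≠ 0 := by positivity
    simp
    field_simp
  | succ n hn ih =>
    have h1 : (n : ℝ) ≠ 0 := by
      have : 0 < n := by omega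
      positivity
    have h2 : (n : ℝ) + 1 ≠ 0 := by positivity
    rw [Finset.sum_Ico_succ_top hn, Finset.sum_Ico_succ_top hn, Finset.sum_range_succ]
    have key : (d : ℝ) * (((n : ℝ) + 1)⁻¹ * ∑ s ∈ Finset.range n, F s) +
        (d : ℝ) / ((n : ℝ) + 1) * ((n : ℝ)⁻¹ * ∑ s ∈ Finset.range n, F s) =
        (d : ℝ) * ((n : ℝ)⁻¹ * ∑ s ∈ Finset.range n, F s) := by
      field_simp
    push_cast
    linear_combination ih + key

/-- The integral of a function of the state with respect to the stationary measure. -/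
noncomputable def stationaryMean (n : ℕ) (deg : ℕ → ℕ) (f : ℕ × ℕ → ℝ) : ℝ :=
  ∑ u ∈ Finset.range n, ((deg u : ℝ) * f (u, n) +
    ∑ s ∈ Finset.Ico (deg u) n, (deg u : ℝ) / ((s : ℝ) + 1) * f (u, s))

/-- The measure is invariant. Within a vertex this is `sum_record_weights`; between vertices every
neighbour receives mass `1` along each edge, and symmetry of the adjacency matrix makes the total
inflow of `x` equal to `deg x`. -/
theorem SlotTable.stationaryMean_step (T : SlotTable n τ deg A) (f : ℕ × ℕ → ℝ) :
    stationaryMean n deg (fun p => (p.2 : ℝ)⁻¹ * ∑ s ∈ Finset.range p.2,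
      f (nextState n τ (p.1 * n + s))) = stationaryMean n deg f := by
  unfold stationaryMean
  have h1 : ∀ u ∈ Finset.range n, ((deg u : ℝ) * ((n : ℝ)⁻¹ * ∑ s ∈ Finset.range n,
      f (nextState n τ (u * n + s))) + ∑ m ∈ Finset.Ico (deg u) n, (deg u : ℝ) / ((m : ℝ) + 1) *
      ((m : ℝ)⁻¹ * ∑ s ∈ Finset.range m, f (nextState n τ (u * n + s)))) =
      ∑ x ∈ Finset.range n, A u x * f (x, n) +
        ∑ s ∈ Finset.Ico (deg u) n, (deg u : ℝ) / ((s : ℝ) + 1) * f (u, s) := by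
    intro u hu
    rw [Finset.mem_range] at hu
    rw [sum_record_weights (T.deg_pos u hu) (T.deg_le u hu), ← T.sum u hu fun x => f (x, n)]
    congr 1
    · refine Finset.sum_congr rfl fun s hs => ?_
      rw [T.next_filled hu (Finset.mem_range.1 hs)]
    · refine Finset.sum_congr rfl fun s hs => ?_
      rw [Finset.mem_Ico] at hs
      rw [T.next_empty hu hs.1 hs.2]
  rw [Finset.sum_congr rfl h1, Finset.sum_add_distrib, Finset.sum_add_distrib, Finset.sum_comm]
  congr 1
  refine Finset.sum_congr rfl fun x hx => ?_
  rw [← Finset.sum_mul, T.deg_eq_sum (Finset.mem_range.1 hx)]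
  simp only [T.symm x]

/-- In one step from the invariant measure a key is drawn with mass `1` if it is filled and `d / (s
+ 1) ≤ 1` otherwise. So no key is used often, which is what makes updates cheap. -/
theorem SlotTable.stationaryMean_indicator (T : SlotTable n τ deg A) (k : ℕ) :
    stationaryMean n deg (fun p => (p.2 : ℝ)⁻¹ * ∑ s ∈ Finset.range p.2,
      if p.1 * n + s = k then 1 else 0) ≤ 1 := by
  unfold stationaryMean
  have h1 : ∀ u ∈ Finset.range n, ((deg u : ℝ) * ((n : ℝ)⁻¹ * ∑ s ∈ Finset.range n,
      if u * n + s = k then (1 : ℝ) else 0) + ∑ m ∈ Finset.Ico (deg u) n,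
      (deg u : ℝ) / ((m : ℝ) + 1) * ((m : ℝ)⁻¹ * ∑ s ∈ Finset.range m,
      if u * n + s = k then (1 : ℝ) else 0)) ≤ if u = k / n then 1 else 0 := by
    intro u hu
    rw [Finset.mem_range] at hu
    have hd := T.deg_le u hu
    rw [sum_record_weights (T.deg_pos u hu) (T.deg_le u hu)]
    have h2 : ∑ s ∈ Finset.Ico (deg u) n, (deg u : ℝ) / ((s : ℝ) + 1) *
        (if u * n + s = k then 1 else 0) ≤
        ∑ s ∈ Finset.Ico (deg u) n, if u * n + s = k then (1 : ℝ) else 0 := by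
      refine Finset.sum_le_sum fun s hs => ?_
      rw [Finset.mem_Ico] at hs
      refine mul_le_of_le_one_left (by split_ifs <;> norm_num) ?_
      rw [div_le_one (by positivity)]
      have : (deg u : ℝ) ≤ s := by exact_mod_cast hs.1
      linarith
    refine (add_le_add le_rfl h2).trans ?_
    rw [Finset.sum_range_add_sum_Ico _ hd]
    have h3 : ∀ s ∈ Finset.range n, (if u * n + s = k then (1 : ℝ) else 0) =
        if s = k % n then (if u = k / n then 1 else 0) else 0 := by
      intro s hs
      rw [Finset.mem_range] at hs
      by_cases h : u * n + s = k
      · subst h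
        simp [key_div hs, key_mod hs]
      · rw [if_neg h]
        by_cases h4 : s = k % n
        · by_cases h5 : u = k / n
          · exfalso
            apply h
            rw [h4, h5, Nat.div_add_mod']
          · simp [h5]
        · simp [h4]
    rw [Finset.sum_congr rfl h3, Finset.sum_ite_eq']
    split_ifs <;> norm_num
  refine (Finset.sum_le_sum h1).trans ?_
  rw [Finset.sum_ite_eq']
  split_ifs <;> norm_num

theorem SlotTable.stationaryMean_add (f g : ℕ × ℕ → ℝ) :
    stationaryMean n deg (fun p => f p + g p) = stationaryMean n deg f + stationaryMean n deg g := by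
  unfold stationaryMean
  rw [← Finset.sum_add_distrib]
  refine Finset.sum_congr rfl fun u _ => ?_
  simp only [mul_add, Finset.sum_add_distrib]
  ring

theorem stationaryMean_congr {f g : ℕ × ℕ → ℝ} (T : SlotTable n τ deg A)
    (h : ∀ p, WalkState n deg p → f p = g p) : stationaryMean n deg f = stationaryMean n deg g := by
  unfold stationaryMean
  refine Finset.sum_congr rfl fun u hu => ?_
  rw [Finset.mem_range] at hu
  rw [h _ (T.walkState_start hu)]
  congr 1
  refine Finset.sum_congr rfl fun s hs => ?_
  rw [Finset.mem_Ico] at hs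
  rw [h (u, s) ⟨hu, hs.1, hs.2.le⟩]

/-- Each of the `L` draws contributes at most `1`, by invariance. -/
theorem SlotTable.stationaryMean_count (T : SlotTable n τ deg A) (k L : ℕ) :
    stationaryMean n deg (meanCount n τ k L) ≤ L := by
  induction L with
  | zero =>
    refine le_of_eq ?_
    simp [stationaryMean, meanCount, walkMean]
  | succ L ih =>
    have hrec : ∀ p, WalkState n deg p → meanCount n τ k (L + 1) p =
        (p.2 : ℝ)⁻¹ * ∑ s ∈ Finset.range p.2, meanCount n τ k L (nextState n τ (p.1 * n + s)) +
        (p.2 : ℝ)⁻¹ * ∑ s ∈ Finset.range p.2, if p.1 * n + s = k then 1 else 0 := by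
      intro p hp
      rw [← mul_add, ← Finset.sum_add_distrib, meanCount, walkMean]
      congr 1
      refine Finset.sum_congr rfl fun s hs => ?_
      have : ∀ l : List ℕ, (((p.1 * n + s) :: l).count k : ℝ) =
          (l.count k : ℝ) + if p.1 * n + s = k then 1 else 0 := by
        intro l
        rw [List.count_cons]
        push_cast
        congr 1
        simp [beq_iff_eq]
      simp only [this]
      rw [walkMean_add, T.walkMean_const L (T.walkState_next hp (Finset.mem_range.1 hs))]
      rfl
    rw [stationaryMean_congr T hrec, stationaryMean_add]
    have h1 := T.stationaryMean_step (meanCount n τ k L)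
    rw [h1]
    have h2 := T.stationaryMean_indicator k
    push_cast
    linarith

/-- One walk from each vertex is dominated by the invariant measure, because degrees are at least
`1`. -/
theorem SlotTable.sum_meanCount_le (T : SlotTable n τ deg A) (k L : ℕ) :
    ∑ u ∈ Finset.range n, meanCount n τ k L (u, n) ≤ L := by
  refine le_trans ?_ (T.stationaryMean_count k L)
  unfold stationaryMean
  have hnn : ∀ p, 0 ≤ meanCount n τ k L p := fun p => walkMean_nonneg _ _ fun l => Nat.cast_nonneg _
  refine Finset.sum_le_sum fun u hu => ?_
  rw [Finset.mem_range] at hu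
  have h1 : (1 : ℝ) ≤ deg u := by exact_mod_cast T.deg_pos u hu
  have h2 : 0 ≤ ∑ s ∈ Finset.Ico (deg u) n, (deg u : ℝ) / ((s : ℝ) + 1) *
      meanCount n τ k L (u, s) :=
    Finset.sum_nonneg fun s _ => mul_nonneg (by positivity) (hnn _)
  nlinarith [hnn (u, n)]

/-- With high probability a key occurs at most `3 * R * M` times. -/
theorem SlotTable.count_le (T : SlotTable n τ deg A) (hn : 0 < n) (k : ℕ) :
    (familyLaw n R M τ).toOuterMeasure {ω |
      3 * R * M < ∑ i ∈ Finset.range (n * R), (ω i).count k} ≤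
      ENNReal.ofReal (Real.exp (-R)) := by
  -- The counts will be divided by `M`; for `M = 0` the walks are empty.
  rcases Nat.eq_zero_or_pos M with hM | hM
  · subst hM
    have : (familyLaw n R 0 τ).toOuterMeasure {ω |
      3 * R * 0 < ∑ i ∈ Finset.range (n * R), (ω i).count k} = 0 := by
      rw [PMF.toOuterMeasure_apply_eq_zero_iff, Set.disjoint_left]
      intro ω hω h
      have : ∑ i ∈ Finset.range (n * R), (ω i).count k = 0 := by
        refine Finset.sum_eq_zero fun i hi => ?_
        have := mem_support_of_mem_support hω i (Finset.mem_range.1 hi)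
        have := length_of_mem_walkLaw this
        rw [List.length_eq_zero_iff.1 this]
        rfl
      rw [Set.mem_ofPred_eq, this] at h
      omega
    rw [this]
    exact zero_le
  have hM' : (0 : ℝ) < M := by exact_mod_cast hM
  -- Counts of a single walk are scaled into `[0, 1]`. The mean exponent is at most `2 * R` and the
  -- threshold is `3 * R`, which leaves `exp (-R)`.
  have h := T.chernoff (R := R) (M := M) hn
    (fun l => if l.length = M then (l.count k : ℝ) / M else 0)
    (fun u => 2 / M * meanCount n τ k M (u, n)) ?_ (3 * R)
  · refine le_trans ?_ (h.trans (ENNReal.ofReal_le_ofReal ?_))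
    · refine PMF.toOuterMeasure_mono _ ?_
      rintro ω ⟨hω, hs⟩
      rw [Set.mem_ofPred_eq] at hω ⊢
      have h2 : ∑ i ∈ Finset.range (n * R),
          (if (ω i).length = M then ((ω i).count k : ℝ) / M else 0) =
          (∑ i ∈ Finset.range (n * R), ((ω i).count k : ℝ)) / M := by
        rw [Finset.sum_div]
        refine Finset.sum_congr rfl fun i hi => ?_
        rw [if_pos (length_of_mem_walkLaw (mem_support_of_mem_support hs i (Finset.mem_range.1 hi)))]
      rw [h2, le_div_iff₀ hM']
      have : ((3 * R * M : ℕ) : ℝ) ≤ ((∑ i ∈ Finset.range (n * R), (ω i).count k : ℕ) : ℝ) :=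
        Nat.cast_le.2 hω.le
      push_cast at this
      exact this
    · rw [Real.exp_le_exp, ← Finset.mul_sum]
      have := T.sum_meanCount_le k M
      have h3 : 2 / (M : ℝ) * ∑ u ∈ Finset.range n, meanCount n τ k M (u, n) ≤ 2 := by
        calc _ ≤ 2 / (M : ℝ) * M := by gcongr
          _ = 2 := by field_simp
      have hR : (0 : ℝ) ≤ R := Nat.cast_nonneg _
      nlinarith
  · intro u hu
    have hst := T.walkState_start hu
    calc _ ≤ walkMean n τ M (u, n) (fun l => 1 + 2 / M * (l.count k : ℝ)) := by
          refine walkMean_mono fun l hl => ?_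
          rw [if_pos hl]
          have hc : (l.count k : ℝ) ≤ M := by
            rw [← hl]
            exact_mod_cast List.count_le_length
          set x := (l.count k : ℝ) / M with hx
          have hx0 : 0 ≤ x := by positivity
          have hx1 : x ≤ 1 := by rw [hx, div_le_one hM']; exact hc
          -- Yields `exp x ≤ 1 + x + x ^ 2 ≤ 1 + 2 * x` on `[0, 1]`.
          have h4 := Real.abs_exp_sub_one_sub_id_le (x := x) (by rw [abs_of_nonneg hx0]; exact hx1)
          have h5 := (abs_le.1 h4).2
          have h6 : 2 / (M : ℝ) * (l.count k : ℝ) = 2 * x := by rw [hx]; ring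
          rw [h6]
          nlinarith
      _ = _ := by
          rw [walkMean_add, T.walkMean_const M hst, walkMean_const_mul]
          rfl

end concentration


open Matrix

/-! ## PageRank as a sum over discounted visits -/

section potential

variable {n : ℕ} {ε : ℝ} {E : UGraph n}

/-- The discounted transition matrix of the walk on the graph. -/
noncomputable def discounted (ε : ℝ) (E : UGraph n) : Matrix (Fin n) (Fin n) ℝ :=
  fun i j => if s(i, j) ∈ E then (1 - ε) * (1 / (E.deg i : ℝ)) else 0

/-- The first `k` rows of the discounted transition matrix. -/
noncomputable def discountedRows (ε : ℝ) (E : UGraph n) (k : ℕ) : Matrix (Fin n) (Fin n) ℝ :=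
  fun i j => if (i : ℕ) < k then discounted ε E i j else 0

theorem discounted_nonneg (h1 : ε < 1) (i j : Fin n) : 0 ≤ discounted ε E i j := by
  unfold discounted
  split_ifs
  · have : 0 ≤ 1 - ε := by linarith
    positivity
  · exact le_rfl

theorem sum_discounted (hE : E.NoIsolated) (i : Fin n) : ∑ j, discounted ε E i j = 1 - ε := by
  have hpos : (E.deg i : ℝ) ≠ 0 := by
    have := hE i
    positivity
  unfold discounted
  rw [← Finset.sum_filter, Finset.sum_const, nsmul_eq_mul]
  change (E.deg i : ℝ) * _ = _
  field_simp

/-- Strict diagonal dominance: the rows of `Q` sum to `1 - ε < 1`. It holds for every `k`, so the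
elimination below never meets a singular matrix. -/
theorem det_one_sub_discountedRows (h0 : 0 < ε) (h1 : ε < 1) (hE : E.NoIsolated) (k : ℕ) :
    IsUnit (1 - discountedRows ε E k).det := by
  rw [isUnit_iff_ne_zero]
  refine det_ne_zero_of_sum_row_lt_diag fun i => ?_
  have hq := fun j => discounted_nonneg (E := E) h1 i j
  have hs := sum_discounted (ε := ε) hE i
  rw [← Finset.add_sum_erase _ _ (Finset.mem_univ i)] at hs
  have hoff : ∀ j ∈ Finset.univ.erase i, ‖(1 - discountedRows ε E k) i j‖ ≤ discounted ε E i j := by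
    intro j hj
    rw [Matrix.sub_apply, Matrix.one_apply_ne (Finset.ne_of_mem_erase hj).symm, zero_sub, norm_neg,
      discountedRows]
    split_ifs
    · rw [Real.norm_of_nonneg (hq j)]
    · rw [norm_zero]; exact hq j
  refine lt_of_le_of_lt (Finset.sum_le_sum hoff) ?_
  have hnn : 0 ≤ ∑ j ∈ Finset.univ.erase i, discounted ε E i j :=
    Finset.sum_nonneg fun j _ => hq j
  rw [Matrix.sub_apply, Matrix.one_apply_eq, discountedRows, Real.norm_eq_abs]
  refine lt_of_lt_of_le ?_ (le_abs_self _)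
  split_ifs <;> linarith [hq i]

theorem discountedRows_self : discountedRows ε E n = discounted ε E := by
  funext i j
  simp [discountedRows]

theorem discountedRows_zero : discountedRows ε E 0 = 0 := by
  funext i j
  simp [discountedRows]

/-- The matrix of the discounted numbers of visits. -/
noncomputable def visitMatrix (ε : ℝ) (E : UGraph n) : Matrix (Fin n) (Fin n) ℝ :=
  (1 - discounted ε E)⁻¹

theorem isUnit_det_one_sub_discounted (h0 : 0 < ε) (h1 : ε < 1) (hE : E.NoIsolated) :
    IsUnit (1 - discounted ε E).det := by
  rw [← discountedRows_self]
  exact det_one_sub_discountedRows h0 h1 hE n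

theorem visitMatrix_eq_left (h0 : 0 < ε) (h1 : ε < 1) (hE : E.NoIsolated) :
    visitMatrix ε E = 1 + discounted ε E * visitMatrix ε E := by
  have h := mul_nonsing_inv _ (isUnit_det_one_sub_discounted h0 h1 hE)
  rw [sub_mul, one_mul] at h
  exact eq_add_of_sub_eq h

theorem visitMatrix_eq_right (h0 : 0 < ε) (h1 : ε < 1) (hE : E.NoIsolated) :
    visitMatrix ε E = 1 + visitMatrix ε E * discounted ε E := by
  have h := nonsing_inv_mul _ (isUnit_det_one_sub_discounted h0 h1 hE)
  rw [mul_sub, mul_one] at h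
  exact eq_add_of_sub_eq h

/-- The minimum principle. -/
theorem nonneg_of_eq_add_discounted (h0 : 0 < ε) (h1 : ε < 1) (hE : E.NoIsolated) {x b : Fin n → ℝ}
    (hb : ∀ i, 0 ≤ b i) (hx : ∀ i, x i = b i + ∑ j, discounted ε E i j * x j) (i : Fin n) :
    0 ≤ x i := by
  have : Nonempty (Fin n) := ⟨i⟩
  obtain ⟨i₀, hi₀⟩ := Finite.exists_min x
  refine le_trans ?_ (hi₀ i)
  have h2 : (1 - ε) * x i₀ ≤ ∑ j, discounted ε E i₀ j * x j := by
    rw [← sum_discounted (ε := ε) hE i₀, Finset.sum_mul]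
    exact Finset.sum_le_sum fun j _ => mul_le_mul_of_nonneg_left (hi₀ j) (discounted_nonneg h1 _ _)
  have h3 := hx i₀
  have h4 := hb i₀
  nlinarith

theorem visitMatrix_nonneg (h0 : 0 < ε) (h1 : ε < 1) (hE : E.NoIsolated) (u v : Fin n) :
    0 ≤ visitMatrix ε E u v := by
  refine nonneg_of_eq_add_discounted (E := E) (x := fun u => visitMatrix ε E u v)
    (b := fun u => (1 : Matrix (Fin n) (Fin n) ℝ) u v) h0 h1 hE ?_ ?_ u
  · intro i
    rw [Matrix.one_apply]
    split_ifs <;> norm_num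
  · intro i
    conv_lhs => rw [visitMatrix_eq_left h0 h1 hE]
    rw [Matrix.add_apply, Matrix.mul_apply]

/-- Minimum principle for the difference to `1 / ε`, the solution of the same equation with
right-hand side constantly `1`. -/
theorem visitMatrix_le (h0 : 0 < ε) (h1 : ε < 1) (hE : E.NoIsolated) (u v : Fin n) :
    visitMatrix ε E u v ≤ 1 / ε := by
  rw [← sub_nonneg]
  refine nonneg_of_eq_add_discounted (E := E) (x := fun u => 1 / ε - visitMatrix ε E u v)
    (b := fun u => 1 - (1 : Matrix (Fin n) (Fin n) ℝ) u v) h0 h1 hE ?_ ?_ u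
  · intro i
    rw [Matrix.one_apply]
    split_ifs <;> norm_num
  · intro i
    conv_lhs => rw [visitMatrix_eq_left h0 h1 hE]
    rw [Matrix.add_apply, Matrix.mul_apply]
    simp only [mul_sub, Finset.sum_sub_distrib]
    rw [← Finset.sum_mul, sum_discounted hE]
    field_simp
    ring

/-- The PageRank vector. -/
noncomputable def pageRank (ε : ℝ) (E : UGraph n) (v : Fin n) : ℝ :=
  ε / n * ∑ u, visitMatrix ε E u v

/-- The rows of `(1 - Q)⁻¹` sum to `1 / ε`, which gives the normalization; stationarity is `G = 1 +
G * Q` multiplied by the constant row vector `ε / n`. -/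
theorem isPageRank_pageRank (hn : 0 < n) (h0 : 0 < ε) (h1 : ε < 1) (hE : E.NoIsolated) :
    UGraph.IsPageRank ε E (pageRank ε E) := by
  have hn' : (n : ℝ) ≠ 0 := by positivity
  have hsum : ∑ v, pageRank ε E v = 1 := by
    have h2 : ∀ u, ∑ v, visitMatrix ε E u v = 1 / ε := by
      intro u
      have h3 : ∑ v, visitMatrix ε E u v = 1 + (1 - ε) * ∑ v, visitMatrix ε E u v := by
        conv_lhs => rw [visitMatrix_eq_right h0 h1 hE]
        simp only [Matrix.add_apply, Matrix.mul_apply, Finset.sum_add_distrib]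
        rw [Finset.sum_comm]
        simp only [← Finset.mul_sum, sum_discounted hE, ← Finset.sum_mul]
        rw [mul_comm (1 - ε)]
        congr 1
        simp [Matrix.one_apply]
      field_simp
      linarith
    unfold pageRank
    rw [← Finset.mul_sum, Finset.sum_comm]
    simp only [h2]
    simp
    field_simp
  refine ⟨fun v => ?_, hsum, ?_⟩
  · unfold pageRank
    exact mul_nonneg (by positivity) (Finset.sum_nonneg fun u _ => visitMatrix_nonneg h0 h1 hE u v)
  · funext j
    have h2 : ∀ i, UGraph.transition ε E i j = ε / n + discounted ε E i j := fun i => rfl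
    simp only [Matrix.vecMul, dotProduct, h2, mul_add, Finset.sum_add_distrib]
    rw [← Finset.sum_mul, hsum, one_mul]
    conv_rhs => rw [pageRank, visitMatrix_eq_right h0 h1 hE]
    simp only [pageRank, Matrix.add_apply, Matrix.mul_apply, Finset.sum_add_distrib]
    rw [Finset.sum_comm (f := fun x x_1 => visitMatrix ε E x x_1 * discounted ε E x_1 j)]
    simp only [mul_assoc, ← Finset.mul_sum, ← Finset.sum_mul]
    rw [mul_add]
    congr 1
    simp [Matrix.one_apply]

/-- The adjacency matrix, indexed by natural numbers. -/
noncomputable def adj (E : UGraph n) (u v : ℕ) : ℝ :=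
  if ∃ (hu : u < n) (hv : v < n), s((⟨u, hu⟩ : Fin n), (⟨v, hv⟩ : Fin n)) ∈ E then 1 else 0

theorem adj_fin (E : UGraph n) (u v : Fin n) : adj E u v = if s(u, v) ∈ E then 1 else 0 := by
  unfold adj
  congr 1
  simp

theorem adj_symm (E : UGraph n) (u v : ℕ) : adj E u v = adj E v u := by
  unfold adj
  congr 1
  refine propext ⟨?_, ?_⟩ <;>
  · rintro ⟨h1, h2, h⟩
    exact ⟨h2, h1, by rwa [Sym2.eq_swap]⟩

theorem discounted_eq_adj (E : UGraph n) (u v : Fin n) :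
    discounted ε E u v = (1 - ε) / E.deg u * adj E u v := by
  rw [adj_fin, discounted]
  split_ifs <;> ring

/-- Connects matrices over `Fin n` with the walks, whose vertices are natural numbers; the extension
by `0` is never evaluated. -/
theorem potential_visitMatrix (h0 : 0 < ε) (h1 : ε < 1) (hE : E.NoIsolated) {deg : ℕ → ℕ}
    (hdeg : ∀ u : Fin n, deg u = E.deg u) (v : Fin n) :
    Potential n (adj E) deg ε v
      (fun u => if h : u < n then visitMatrix ε E ⟨u, h⟩ v else 0) where
  eq u hu := by
    rw [Finset.sum_range]
    simp only [hu, dif_pos, Fin.is_lt, Fin.eta]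
    conv_lhs => rw [visitMatrix_eq_left h0 h1 hE]
    rw [Matrix.add_apply, Matrix.mul_apply, Matrix.one_apply, Finset.mul_sum]
    congr 1
    · simp [Fin.ext_iff]
    · refine Finset.sum_congr rfl fun j _ => ?_
      rw [discounted_eq_adj, ← hdeg]
      ring
  nonneg u hu := by
    simp only [hu, dif_pos]
    exact visitMatrix_nonneg h0 h1 hE _ _
  le u hu := by
    simp only [hu, dif_pos]
    exact visitMatrix_le h0 h1 hE _ _

/-- The Sherman–Morrison formula. Admitting row `k` of `Q` subtracts the rank-one matrix formed by
the `k`-th unit vector and that row, so the inverse changes by a rank-one term built from column `k`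
of `B` and the row `q * B`. -/
theorem inv_one_sub_discountedRows_succ (h0 : 0 < ε) (h1 : ε < 1) (hE : E.NoIsolated) (k : Fin n)
    (B : Matrix (Fin n) (Fin n) ℝ) (hB : B = (1 - discountedRows ε E k)⁻¹) (r : Fin n → ℝ)
    (hr : ∀ j, r j = ∑ b, discounted ε E k b * B b j) (i j : Fin n) :
    (1 - discountedRows ε E (k + 1))⁻¹ i j = B i j + B i k / (1 - r k) * r j := by
  set q : Fin n → ℝ := fun b => discounted ε E k b with hq
  have hr' : r = q ᵥ* B := by
    funext j
    rw [hr]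
    rfl
  have hA' : 1 - discountedRows ε E (k + 1) =
      (1 - discountedRows ε E k) - vecMulVec (Pi.single k 1) q := by
    funext a b
    simp only [Matrix.sub_apply, discountedRows, vecMulVec_apply, Pi.single_apply, hq]
    by_cases ha : a = k
    · subst ha
      simp
    · have : (a : ℕ) ≠ k := fun h => ha (Fin.ext h)
      have h2 : (a : ℕ) < k + 1 ↔ (a : ℕ) < k := by omega
      simp [ha, h2]
  have hu := det_one_sub_discountedRows h0 h1 hE (k : ℕ)
  have hAB : (1 - discountedRows ε E k) * B = 1 := by rw [hB]; exact mul_nonsing_inv _ hu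
  set x : Fin n → ℝ := fun i => B i k with hx
  have hAx : (1 - discountedRows ε E k) *ᵥ x = Pi.single k 1 := by
    funext a
    have := congrFun (congrFun hAB a) k
    rw [Matrix.mul_apply] at this
    rw [Pi.single_apply, Matrix.mulVec, dotProduct, this, Matrix.one_apply]
  have hqx : q ⬝ᵥ x = r k := by rw [hr']; rfl
  -- If the pivot vanished, column `k` of `B` would be a kernel vector of the next matrix, which is
  -- invertible; so it would be zero, contradicting `hAx`.
  have hd : 1 - r k ≠ 0 := by
    intro hd
    have h3 : (1 - discountedRows ε E (k + 1)) *ᵥ x = 0 := by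
      rw [hA', Matrix.sub_mulVec, hAx, Matrix.vecMulVec_mulVec, hqx]
      have : r k = 1 := by linarith
      simp [this]
    have h4 := Matrix.eq_zero_of_mulVec_eq_zero
      (isUnit_iff_ne_zero.1 (det_one_sub_discountedRows h0 h1 hE ((k : ℕ) + 1))) h3
    rw [h4, Matrix.mulVec_zero] at hAx
    have := congrFun hAx k
    simp at this
  have hmul : (1 - discountedRows ε E (k + 1)) * (B + (1 - r k)⁻¹ • vecMulVec x r) = 1 := by
    rw [hA', Matrix.sub_mul, Matrix.mul_add, hAB, Matrix.mul_add, Matrix.mul_smul, Matrix.mul_smul,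
      Matrix.mul_vecMulVec, hAx, Matrix.vecMulVec_mul, ← hr', Matrix.vecMulVec_mul_vecMulVec, hqx]
    ext a b
    simp only [Matrix.sub_apply, Matrix.add_apply, Matrix.smul_apply, vecMulVec_apply, smul_eq_mul,
      Pi.smul_apply]
    field_simp
    simp
  rw [Matrix.inv_eq_right_inv hmul]
  simp only [Matrix.add_apply, Matrix.smul_apply, vecMulVec_apply, smul_eq_mul, hx]
  ring

end potential


/-! ## The algorithm

Word arrays: `0` holds `n`, `3` the degrees, `4` the slot table, `5` the slots of the neighbours,
`6` the keys of the walks, `7` the positions of every key, `8` the places of the positions in these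
lists, `9` the lengths of these lists, `10` the marks of the touched keys, `11` the positions of the
touched keys, `12` the touched keys, `13` the number of walks per vertex, `14` their length, `15` the
number of all positions, `16` whether PageRank is to be computed exactly. The other arrays are
registers. Real arrays: `1` holds the output, `2` the contributions of the positions, `3` and `4`
the matrix and the row of the exact computation. The other arrays are registers. -/

/-- The register `a`. -/
abbrev V (a : ℕ) : WExp := .get a (.lit 0)

/-- The real register `a`. -/
abbrev RV (a : ℕ) : RExp := .get a (.lit 0)

/-- Assign a register. -/
abbrev setV (a : ℕ) (e : WExp) : Prog := .wset a (.lit 0) e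

/-- Assign a real register. -/
abbrev setR (a : ℕ) (e : RExp) : Prog := .rset a (.lit 0) e

/-- Increment a register. -/
abbrev incV (a : ℕ) : Prog := setV a (.add (V a) (.lit 1))

infixr:60 " ;; " => Prog.seq

/-- The key with vertex register `a` and slot `e`. -/
abbrev keyAt (a : ℕ) (e : WExp) : WExp := .add (.mul (V a) (V 0)) e

/-- Address `e` in the list of the key in register `a`. -/
abbrev listAt (a : ℕ) (e : WExp) : WExp := .add (.mul (V a) (V 15)) e

/-- Copy one position of the key in register `20`. -/
def touchStep : Prog :=
  .wset 11 (V 22) (.get 7 (listAt 20 (V 23))) ;; incV 22 ;; incV 23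

/-- The beginning of `touch`. -/
def touchStart : Prog :=
  .wset 10 (V 20) (.lit 1) ;; .wset 12 (V 21) (V 20) ;; incV 21 ;; setV 23 (.lit 0)

/-- Mark the key in register `20` and copy its positions. -/
def touch : Prog := touchStart ;; .rep (.get 9 (V 20)) touchStep

/-- The end of `attach`. -/
def attachEnd : Prog :=
  .wset 4 (V 20) (.add (V 25) (.lit 1)) ;; .wset 5 (keyAt 24 (V 25)) (V 20) ;;
  .wset 3 (V 24) (.add (.get 3 (V 24)) (.lit 1))

/-- Put the vertex in register `25` into the first empty slot of the vertex in register `24`. -/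
def attach : Prog := setV 20 (keyAt 24 (.get 3 (V 24))) ;; touch ;; attachEnd

/-- The end of `detach`. -/
def detachEnd : Prog :=
  setV 27 (.sub (.get 4 (V 20)) (.lit 1)) ;; .wset 4 (V 26) (.add (V 27) (.lit 1)) ;;
  .wset 5 (keyAt 24 (V 27)) (V 26) ;; .wset 4 (V 20) (.lit 0) ;;
  .wset 3 (V 24) (.sub (.get 3 (V 24)) (.lit 1))

/-- The middle part of `detach`. -/
def detachMiddle : Prog :=
  setV 26 (V 20) ;; setV 20 (keyAt 24 (.sub (.get 3 (V 24)) (.lit 1)))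

/-- Remove the vertex in register `25` from its slot at the vertex in register `24`, and move the
vertex in the last slot there. -/
def detach : Prog :=
  setV 20 (.get 5 (keyAt 24 (V 25))) ;; touch ;; detachMiddle ;; touch ;; detachEnd

/-- Apply a program to the two directions of the announced edge. -/
def bothEnds (P : Prog) : Prog :=
  (setV 24 (.get 2 (.lit 1)) ;; setV 25 (.get 2 (.lit 2))) ;; P ;;
  .ite (.and (.not (.wlt (.get 2 (.lit 1)) (.get 2 (.lit 2))))
      (.not (.wlt (.get 2 (.lit 2)) (.get 2 (.lit 1))))) .skip
    ((setV 24 (.get 2 (.lit 2)) ;; setV 25 (.get 2 (.lit 1))) ;; P)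

/-- Move the position in register `31` to the list of the key in register `34`. -/
def rekeyIndex : Prog :=
  setV 36 (.get 6 (V 31)) ;;
  .wset 9 (V 36) (.sub (.get 9 (V 36)) (.lit 1)) ;;
  setV 37 (.get 7 (listAt 36 (.get 9 (V 36)))) ;;
  .wset 7 (listAt 36 (.get 8 (V 31))) (V 37) ;;
  .wset 8 (V 37) (.get 8 (V 31)) ;;
  .wset 7 (listAt 34 (.get 9 (V 34))) (V 31) ;;
  .wset 8 (V 31) (.get 9 (V 34)) ;;
  .wset 9 (V 34) (.add (.get 9 (V 34)) (.lit 1)) ;;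
  .wset 6 (V 31) (V 34)

/-- Replace the contribution of the position in register `31`. -/
def rekeyValue : Prog :=
  .rset 1 (.div (V 36) (V 0)) (.sub (.get 1 (.div (V 36) (V 0))) (.get 2 (V 31))) ;;
  .ite (.wlt (V 33) (V 0)) (.rset 2 (V 31) (.ofWord (.lit 0))) (.rset 2 (V 31) (RV 5)) ;;
  .rset 1 (.div (V 34) (V 0)) (.add (.get 1 (.div (V 34) (V 0))) (.get 2 (V 31)))

/-- Pass to the next state of the walk. -/
def follow : Prog :=
  .ite (.wlt (.lit 0) (.get 10 (V 34))) (setV 30 (.lit 1)) .skip ;;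
  .ite (.wlt (.lit 0) (.get 4 (V 34)))
    (setV 32 (.sub (.get 4 (V 34)) (.lit 1)) ;; setV 33 (V 0) ;;
      setR 5 (.mul (RV 5) (.sub (.ofWord (.lit 1)) (RV 0))))
    (setV 32 (.div (V 34) (V 0)) ;; setV 33 (.mod (V 34) (V 0))) ;;
  incV 31

/-- The deterministic part of a fresh draw. -/
def useDraw : Prog := setV 34 (keyAt 32 (V 35)) ;; rekeyIndex ;; rekeyValue ;; follow

/-- A fresh draw. -/
def draw : Prog := .unif 35 (.lit 0) (V 33) ;; useDraw

/-- Keep the draw of the stored walk. -/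
def keep : Prog := setV 34 (.get 6 (V 31)) ;; follow

/-- One step of the walk. -/
def walkStep : Prog := .ite (.wlt (.lit 0) (V 30)) draw keep

/-- The beginning of a walk. -/
def walkStart : Prog :=
  setV 31 (.mul (V 29) (V 14)) ;; setV 32 (.mod (V 29) (V 0)) ;; setV 33 (V 0) ;; setR 5 (RV 6)

/-- Redo the walk in register `29`, all of it if register `30` is `1`, and otherwise the part after
the first marked key. -/
def walk : Prog := walkStart ;; .rep (V 14) walkStep

/-- Redo the walk of the next touched position. -/
def refreshStep : Prog :=
  (setV 29 (.div (.get 11 (V 28)) (V 14)) ;; setV 30 (.lit 0)) ;; walk ;; incV 28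

/-- Redo the walks of all touched positions. -/
def refresh : Prog := setV 28 (.lit 0) ;; .rep (V 22) refreshStep

/-- Remove one mark. -/
def clearStep : Prog := .wset 10 (.get 12 (V 28)) (.lit 0) ;; incV 28

/-- Remove all marks. -/
def clear : Prog := setV 28 (.lit 0) ;; .rep (V 21) clearStep

/-- One term of an entry of the row. -/
def rowTerm : Prog :=
  setR 7 (.add (RV 7) (.get 3 (.add (.mul (.sub (.get 4 (keyAt 42 (V 44))) (.lit 1)) (V 0)) (V 43)))) ;;
  incV 44

/-- One entry of the row. -/
def rowEntry : Prog :=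
  (setR 7 (.ofWord (.lit 0)) ;; setV 44 (.lit 0)) ;; .rep (.get 3 (V 42)) rowTerm ;;
  .rset 4 (V 43) (.mul (.div (.sub (.ofWord (.lit 1)) (RV 0)) (.ofWord (.get 3 (V 42)))) (RV 7)) ;;
  incV 43

/-- Update one entry of the matrix. -/
def entryUpdate : Prog :=
  .rset 3 (keyAt 44 (V 43)) (.add (.get 3 (keyAt 44 (V 43))) (.mul (RV 8) (.get 4 (V 43)))) ;; incV 43

/-- Update one row of the matrix. -/
def rowUpdate : Prog :=
  (setR 8 (.div (.get 3 (keyAt 44 (V 42))) (.sub (.ofWord (.lit 1)) (.get 4 (V 42)))) ;;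
    setV 43 (.lit 0)) ;; .rep (V 0) entryUpdate ;; incV 44

/-- Take one more row of the transition matrix into account. -/
def pivot : Prog :=
  setV 43 (.lit 0) ;; .rep (V 0) rowEntry ;; setV 44 (.lit 0) ;; .rep (V 0) rowUpdate ;; incV 42

/-- Add one entry of a column. -/
def columnTerm : Prog := setR 7 (.add (RV 7) (.get 3 (keyAt 44 (V 43)))) ;; incV 44

/-- Output one entry of PageRank. -/
def outputEntry : Prog :=
  (setR 7 (.ofWord (.lit 0)) ;; setV 44 (.lit 0)) ;; .rep (V 0) columnTerm ;;
  .rset 1 (V 43) (.mul (.div (RV 0) (.ofWord (V 0))) (RV 7)) ;; incV 43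

/-- Erase one entry of the matrix. -/
def zeroStep : Prog := .rset 3 (V 42) (.ofWord (.lit 0)) ;; incV 42

/-- Set one diagonal entry of the matrix. -/
def diagStep : Prog := .rset 3 (keyAt 42 (V 42)) (.ofWord (.lit 1)) ;; incV 42

/-- Compute PageRank exactly. -/
def solve : Prog :=
  (setV 42 (.lit 0) ;; .rep (.mul (V 0) (V 0)) zeroStep) ;;
  (setV 42 (.lit 0) ;; .rep (V 0) diagStep) ;;
  (setV 42 (.lit 0) ;; .rep (V 0) pivot) ;;
  (setV 43 (.lit 0) ;; .rep (V 0) outputEntry)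

/-- Compute PageRank exactly, if this is required. -/
def solveIf : Prog := .ite (.wlt (.lit 0) (V 16)) solve .skip

/-- The change of the graph. -/
def changeGraph : Prog :=
  (setV 21 (.lit 0) ;; setV 22 (.lit 0)) ;;
  .ite (.wlt (.lit 0) (.get 2 (.lit 0))) (bothEnds attach) (bothEnds detach)

/-- The update program. -/
def updateProg : Prog := changeGraph ;; refresh ;; clear ;; solveIf

/-- Add one term of the harmonic number. -/
def harmonicStep : Prog :=
  setR 9 (.add (RV 9) (.div (.ofWord (.lit 1)) (.add (.ofWord (V 40)) (.ofWord (.lit 1))))) ;; incV 40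

/-- Compute the harmonic number. -/
def harmonicProg : Prog := setV 40 (.lit 0) ;; .rep (V 0) harmonicStep

/-- The product of six copies of `n` and of `c`. -/
def capExp (c : ℕ) : WExp :=
  .mul (.lit c) (.mul (.mul (.mul (V 0) (V 0)) (.mul (V 0) (V 0))) (.mul (V 0) (V 0)))

/-- Compute the number of walks, their length, and the weight of a walk. -/
def paramsProg (c : ℕ) : Prog :=
  .loop (capExp c) (.rlt (.mul (.ofWord (V 13)) (.mul (.get 0 (.lit 1)) (.get 0 (.lit 1))))
    (.mul (.ofWord (.lit c)) (RV 9))) (incV 13) ;;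
  .loop (capExp c) (.rlt (.mul (.ofWord (V 14)) (RV 0))
    (.mul (.ofWord (.lit 10)) (.mul (RV 9) (RV 9)))) (incV 14) ;;
  setV 15 (.mul (.mul (V 0) (V 13)) (V 14)) ;;
  setR 6 (.div (RV 0) (.mul (.ofWord (V 0)) (.ofWord (V 13))))

/-- Decide whether PageRank is computed exactly. -/
def regimeProg (c : ℕ) : Prog :=
  .ite (.rlt (.ofWord (.lit 1))
    (.mul (.mul (.mul (RV 0) (RV 0)) (.mul (.get 0 (.lit 1)) (.get 0 (.lit 1))))
      (.mul (.ofWord (V 0)) (.mul (.ofWord (V 0)) (.ofWord (V 0))))))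
    (paramsProg c) (setV 16 (.lit 1))

/-- Treat one entry of the adjacency matrix. -/
def buildStep : Prog :=
  .ite (.wlt (.lit 0) (.get 1 (keyAt 24 (V 25)))) attach .skip ;; incV 25

/-- Treat one row of the adjacency matrix. -/
def buildRow : Prog := setV 25 (.lit 0) ;; .rep (V 0) buildStep ;; incV 24

/-- Build the slot table. -/
def buildProg : Prog := setV 24 (.lit 0) ;; .rep (V 0) buildRow

/-- Put one position into the list of key `0`. -/
def indexStep : Prog := .wset 7 (V 28) (V 28) ;; .wset 8 (V 28) (V 28) ;; incV 28

/-- Put all positions into the list of key `0`. -/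
def indexProg : Prog := setV 28 (.lit 0) ;; .rep (V 15) indexStep ;; .wset 9 (.lit 0) (V 15)

/-- Make one walk. -/
def startStep : Prog := setV 30 (.lit 1) ;; walk ;; incV 29

/-- Make all walks. -/
def startProg : Prog := setV 29 (.lit 0) ;; .rep (.mul (V 0) (V 13)) startStep

/-- The preprocessing program. -/
def initProg (c : ℕ) : Prog :=
  harmonicProg ;; regimeProg c ;; buildProg ;; clear ;; indexProg ;; startProg ;; solveIf

/-! ## Touching keys -/

/-- The keys in `S` are marked and their positions have been copied. -/
structure Touched (N : ℕ) (σ : State) (S : List ℕ) : Prop where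
  num : σ.words 21 0 = S.length
  mark : ∀ k, σ.words 10 k = if k ∈ S then 1 else 0
  keys : ∀ k ∈ S, ∃ i < S.length, σ.words 12 i = k
  count : σ.words 22 0 = (S.map (σ.words 9)).sum
  lt : ∀ q < (S.map (σ.words 9)).sum, σ.words 11 q < N
  mem : ∀ k ∈ S, ∀ t < σ.words 9 k, ∃ q < (S.map (σ.words 9)).sum,
    σ.words 11 q = σ.words 7 (k * N + t)

theorem runs_incV {w a v : ℕ} {σ : State} {Q : State → Prop} (h : σ.words a 0 = v)
    (hv : v + 1 < 2 ^ w) (hQ : Q (σ.setWord a 0 (v + 1))) : Runs w (incV a) σ Q := by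
  have h1 : 1 % 2 ^ w = 1 := Nat.mod_eq_of_lt (by omega)
  refine Runs.wset 0 (v + 1) (by simp [WExp.eval]) ?_ hQ
  simp [WExp.eval, h, h1, Nat.mod_eq_of_lt hv]

theorem key_lt {n k N t : ℕ} (hk : k < n) (ht : t < N) : k * N + t < n * N := by
  have := Nat.mul_le_mul_right N (Nat.succ_le_of_lt hk)
  rw [Nat.succ_mul] at this
  omega

theorem key_eq_iff {N k k' t t' : ℕ} (ht : t < N) (ht' : t' < N) :
    k * N + t = k' * N + t' ↔ k = k' ∧ t = t' := by
  constructor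
  · intro h
    have h1 := congrArg (· / N) h
    have h2 := congrArg (· % N) h
    simp only [key_div ht, key_div ht', key_mod ht, key_mod ht'] at h1 h2
    exact ⟨h1, h2⟩
  · rintro ⟨rfl, rfl⟩
    rfl

/-- The positions are copied because the redoing of walks alters the very lists they are taken from.
-/
theorem runs_touch {w n N k : ℕ} {σ : State} {S : List ℕ} (hT : Touched N σ S)
    (hN : σ.words 15 0 = N) (hk : σ.words 20 0 = k) (hkn : k < n * n)
    (hb : n * n * (N + 1) + 1 < 2 ^ w) (hS : S.length + 1 < 2 ^ w)
    (hsum : ((k :: S).map (σ.words 9)).sum + 1 < 2 ^ w) (hc : σ.words 9 k ≤ N)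
    (hlt : ∀ t < σ.words 9 k, σ.words 7 (k * N + t) < N) :
    RunsT w touch σ (100 + 100 * σ.words 9 k) fun σ' => Touched N σ' (k :: S) := by
  have h1 : 1 % 2 ^ w = 1 := Nat.mod_eq_of_lt (by omega)
  set c := σ.words 9 with hcdef
  have hstart : Runs w touchStart σ fun σ' =>
      σ'.words 10 = Function.update (σ.words 10) k 1 ∧
      σ'.words 12 = Function.update (σ.words 12) S.length k ∧
      σ'.words 21 0 = S.length + 1 ∧ σ'.words 23 0 = 0 := by
    refine Runs.seq (Runs.wset k 1 (by simp [WExp.eval, hk]) (by simp [WExp.eval, h1]) ?_)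
    refine Runs.seq (Runs.wset S.length k (by simp [WExp.eval, State.setWord_words_apply, hT.num])
      (by simp [WExp.eval, State.setWord_words_apply, hk]) ?_)
    refine Runs.seq (runs_incV (v := S.length) (by simp [State.setWord_words_apply, hT.num]) hS ?_)
    refine Runs.wset 0 0 (by simp [WExp.eval]) (by simp [WExp.eval]) ?_
    simp [State.setWord_words]
  have hstart' := hstart.timed (by simp [touchStart, Prog.LoopFree])
  have hsum' : ((k :: S).map c).sum = (S.map c).sum + c k := by
    rw [List.map_cons, List.sum_cons, add_comm]
  rw [hsum'] at hsum
  have hloop : ∀ σ₁, touchStart.Agree σ σ₁ → σ₁.words 10 = Function.update (σ.words 10) k 1 ∧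
      σ₁.words 12 = Function.update (σ.words 12) S.length k ∧
      σ₁.words 21 0 = S.length + 1 ∧ σ₁.words 23 0 = 0 →
      RunsT w (.rep (.get 9 (V 20)) touchStep) σ₁
        (c k * (touchStep.staticCost + 5) + ((WExp.get 9 (V 20)).cost + 2))
        fun σ' => Touched N σ' (k :: S) := by
    rintro σ₁ hA ⟨e10, e12, e21, e23⟩
    have f9 : σ₁.words 9 = c := hA.1 9 (by decide)
    have f7 : σ₁.words 7 = σ.words 7 := hA.1 7 (by decide)
    have f20 : σ₁.words 20 = σ.words 20 := hA.1 20 (by decide)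
    have f15 : σ₁.words 15 = σ.words 15 := hA.1 15 (by decide)
    have f11 : σ₁.words 11 = σ.words 11 := hA.1 11 (by decide)
    have f22 : σ₁.words 22 = σ.words 22 := hA.1 22 (by decide)
    refine RunsT.rep (fun j σ' => σ'.words 22 0 = (S.map c).sum + j ∧ σ'.words 23 0 = j ∧
      (∀ q < (S.map c).sum, σ'.words 11 q = σ.words 11 q) ∧
      ∀ t < j, σ'.words 11 ((S.map c).sum + t) = σ.words 7 (k * N + t)) (c k) ?_ ?_ ?_ ?_
    · simp [WExp.eval, f20, hk, f9]
    · exact ⟨by rw [f22, hT.count]; rfl, e23, fun q _ => by rw [f11], fun t ht => by omega⟩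
    · rintro j hj σ₂ hA₂ ⟨i22, i23, i11, i11'⟩
      have g7 : σ₂.words 7 = σ.words 7 := (hA₂.1 7 (by decide)).trans f7
      have g20 : σ₂.words 20 = σ.words 20 := (hA₂.1 20 (by decide)).trans f20
      have g15 : σ₂.words 15 = σ.words 15 := (hA₂.1 15 (by decide)).trans f15
      refine Runs.timed (by simp [touchStep, Prog.LoopFree]) ?_
      have hjN : j < N := by omega
      have hk1 : k * N + j < n * n * N := key_lt hkn hjN
      have hk2 : k * N + j < 2 ^ w := by
        rw [Nat.mul_succ] at hb
        omega
      refine Runs.seq (Runs.wset ((S.map c).sum + j) (σ.words 7 (k * N + j))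
        (by simp [WExp.eval, i22]) ?_ ?_)
      · simp [WExp.eval, g20, hk, g15, hN, i23, g7, Nat.mod_eq_of_lt hk2]
      refine Runs.seq (runs_incV (v := (S.map c).sum + j) (by simp [State.setWord_words_apply, i22])
        (by omega) ?_)
      refine runs_incV (v := j) (by simp [State.setWord_words_apply, i23]) (by omega) ?_
      refine ⟨by simp [State.setWord_words_apply]; omega, by simp [State.setWord_words_apply], ?_, ?_⟩
      · intro q hq
        have : q ≠ (S.map c).sum + j := by omega
        simp [State.setWord_words_apply, this, i11 q hq]
      · intro t ht
        by_cases htj : t = j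
        · simp [State.setWord_words_apply, htj]
        · simp [State.setWord_words_apply, htj, i11' t (by omega)]
    · rintro σ₂ hA₂ ⟨i22, i23, i11, i11'⟩
      have g9 : σ₂.words 9 = c := (hA₂.1 9 (by decide)).trans f9
      have g7 : σ₂.words 7 = σ.words 7 := (hA₂.1 7 (by decide)).trans f7
      have g10 : σ₂.words 10 = σ₁.words 10 := hA₂.1 10 (by decide)
      have g12 : σ₂.words 12 = σ₁.words 12 := hA₂.1 12 (by decide)
      have g21 : σ₂.words 21 = σ₁.words 21 := hA₂.1 21 (by decide)
      constructor
      · rw [g21, e21]; simp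
      · intro k'
        rw [g10, e10, Function.update_apply, hT.mark]
        by_cases h : k' = k <;> simp [h]
      · intro k' hk'
        rw [g12, e12]
        by_cases h : k' = k
        · exact ⟨S.length, by simp, by simp [h]⟩
        · obtain ⟨i, hi, hik⟩ := hT.keys k' (by simpa [h] using hk')
          exact ⟨i, by simp; omega, by rw [Function.update_of_ne (by omega), hik]⟩
      · rw [g9, hsum', i22]
      · rw [g9, hsum']
        intro q hq
        by_cases h : q < (S.map c).sum
        · rw [i11 q h]
          exact hT.lt q h
        · obtain ⟨t, rfl⟩ := Nat.exists_eq_add_of_le (not_lt.1 h)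
          rw [i11' t (by omega)]
          exact hlt t (by omega)
      · rw [g9, hsum', g7]
        intro k' hk' t ht
        by_cases h : k' = k
        · subst h
          exact ⟨(S.map c).sum + t, by omega, i11' t ht⟩
        · obtain ⟨q, hq, hqt⟩ := hT.mem k' (by simpa [h] using hk') t ht
          exact ⟨q, lt_of_lt_of_le hq (Nat.le_add_right _ _), by rw [i11 q hq, hqt]⟩
  have hB : touchStart.staticCost ≤ 50 := by decide
  have hB' : touchStep.staticCost + 5 ≤ 100 := by decide
  have hB'' : (WExp.get 9 (V 20)).cost + 2 ≤ 50 := by decide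
  refine RunsT.mono (RunsT.seq (hstart'.mono le_rfl hloop)) ?_ fun _ _ h => h
  have := Nat.mul_le_mul_left (c k) hB'
  omega


/-! ## Changing the slot table -/

/-- The contents of the arrays `3`, `4` and `5`. -/
structure Table where
  deg : ℕ → ℕ
  slot : ℕ → ℕ
  place : ℕ → ℕ

namespace Table

/-- Put `b` into the first empty slot of `a`. -/
def attach (n a b : ℕ) (t : Table) : Table where
  deg := Function.update t.deg a (t.deg a + 1)
  slot := Function.update t.slot (a * n + t.deg a) (b + 1)
  place := Function.update t.place (a * n + b) (a * n + t.deg a)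

/-- The last used slot of `a`. -/
def lastKey (n a : ℕ) (t : Table) : ℕ := a * n + (t.deg a - 1)

/-- Remove `b` from the slots of `a`. -/
def detach (n a b : ℕ) (t : Table) : Table where
  deg := Function.update t.deg a (t.deg a - 1)
  slot := Function.update (Function.update t.slot (t.place (a * n + b))
    (t.slot (t.lastKey n a) - 1 + 1)) (t.lastKey n a) 0
  place := Function.update t.place (a * n + (t.slot (t.lastKey n a) - 1)) (t.place (a * n + b))

/-- The table describes the graph with the neighbourhoods `nb`. -/
structure Ok (n : ℕ) (t : Table) (nb : ℕ → Finset ℕ) : Prop where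
  sub : ∀ a < n, ∀ b ∈ nb a, b < n
  card : ∀ a < n, t.deg a = (nb a).card
  fill : ∀ a < n, ∀ s < t.deg a, ∃ b ∈ nb a, t.slot (a * n + s) = b + 1 ∧
    t.place (a * n + b) = a * n + s
  empty : ∀ a < n, ∀ s < n, t.deg a ≤ s → t.slot (a * n + s) = 0
  place : ∀ a < n, ∀ b ∈ nb a, ∃ s < t.deg a, t.place (a * n + b) = a * n + s ∧
    t.slot (a * n + s) = b + 1

variable {n a b : ℕ} {t : Table} {nb : ℕ → Finset ℕ}

theorem Ok.deg_le (h : t.Ok n nb) (ha : a < n) : t.deg a ≤ n := by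
  rw [h.card a ha]
  calc (nb a).card ≤ (Finset.range n).card :=
        Finset.card_le_card fun b hb => Finset.mem_range.2 (h.sub a ha b hb)
    _ = n := Finset.card_range n

theorem Ok.deg_lt (h : t.Ok n nb) (ha : a < n) (hb : b < n) (hab : b ∉ nb a) : t.deg a < n := by
  rw [h.card a ha]
  calc (nb a).card < (Finset.range n).card :=
        Finset.card_lt_card ⟨fun b hb => Finset.mem_range.2 (h.sub a ha b hb),
          fun h' => hab (h' (Finset.mem_range.2 hb))⟩
    _ = n := Finset.card_range n

theorem Ok.deg_pos (h : t.Ok n nb) (ha : a < n) (hab : b ∈ nb a) : 0 < t.deg a := by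
  rw [h.card a ha]
  exact Finset.card_pos.2 ⟨b, hab⟩

/-- The filled slots of a vertex always form an initial segment, so the new neighbour goes to slot
`deg a` and only this one key changes. -/
theorem Ok.attach (h : t.Ok n nb) (ha : a < n) (hb : b < n) (hab : b ∉ nb a) :
    (t.attach n a b).Ok n (Function.update nb a (insert b (nb a))) := by
  have hd := h.deg_lt ha hb hab
  refine ⟨?_, ?_, ?_, ?_, ?_⟩
  · intro x hx y hy
    by_cases hxa : x = a
    · subst hxa
      rw [Function.update_self, Finset.mem_insert] at hy
      rcases hy with rfl | hy
      · exact hb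
      · exact h.sub x hx y hy
    · rw [Function.update_of_ne hxa] at hy
      exact h.sub x hx y hy
  · intro x hx
    by_cases hxa : x = a
    · subst hxa
      simp [Table.attach, Finset.card_insert_of_notMem hab, h.card x hx]
    · simp [Table.attach, hxa, h.card x hx]
  · intro x hx s hs
    by_cases hxa : x = a
    · subst hxa
      simp only [Table.attach, Function.update_self] at hs
      by_cases hsd : s = t.deg x
      · subst hsd
        exact ⟨b, by simp, by simp [Table.attach], by simp [Table.attach]⟩
      · obtain ⟨y, hy, h1, h2⟩ := h.fill x hx s (by omega)
        have hyb : y ≠ b := by rintro rfl; exact hab hy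
        refine ⟨y, by simp [hy], ?_, ?_⟩
        · simp only [Table.attach]
          rw [Function.update_of_ne (by omega), h1]
        · simp only [Table.attach]
          rw [Function.update_of_ne (by omega), h2]
    · simp only [Table.attach, Function.update_of_ne hxa] at hs
      obtain ⟨y, hy, h1, h2⟩ := h.fill x hx s hs
      have hsn : s < n := lt_of_lt_of_le hs (h.deg_le hx)
      have hyn := h.sub x hx y hy
      refine ⟨y, by simp [hxa, hy], ?_, ?_⟩
      · simp only [Table.attach]
        rw [Function.update_of_ne, h1]
        rw [Ne, key_eq_iff hsn hd]
        exact fun h => hxa h.1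
      · simp only [Table.attach]
        rw [Function.update_of_ne, h2]
        rw [Ne, key_eq_iff hyn hb]
        exact fun h => hxa h.1
  · intro x hx s hs hds
    by_cases hxa : x = a
    · subst hxa
      simp only [Table.attach, Function.update_self] at hds
      simp only [Table.attach]
      rw [Function.update_of_ne (by omega)]
      exact h.empty x hx s hs (by omega)
    · simp only [Table.attach, Function.update_of_ne hxa] at hds
      simp only [Table.attach]
      rw [Function.update_of_ne, h.empty x hx s hs hds]
      rw [Ne, key_eq_iff hs hd]
      exact fun h => hxa h.1
  · intro x hx y hy
    by_cases hxa : x = a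
    · subst hxa
      rw [Function.update_self, Finset.mem_insert] at hy
      by_cases hyb : y = b
      · subst hyb
        exact ⟨t.deg x, by simp [Table.attach], by simp [Table.attach], by simp [Table.attach]⟩
      · obtain ⟨s, hs, h1, h2⟩ := h.place x hx y (hy.resolve_left hyb)
        refine ⟨s, by simp [Table.attach]; omega, ?_, ?_⟩
        · simp only [Table.attach]
          rw [Function.update_of_ne (by omega), h1]
        · simp only [Table.attach]
          rw [Function.update_of_ne (by omega), h2]
    · rw [Function.update_of_ne hxa] at hy
      obtain ⟨s, hs, h1, h2⟩ := h.place x hx y hy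
      have hsn : s < n := lt_of_lt_of_le hs (h.deg_le hx)
      have hyn := h.sub x hx y hy
      refine ⟨s, by simp [Table.attach, hxa, hs], ?_, ?_⟩
      · simp only [Table.attach]
        rw [Function.update_of_ne, h1]
        rw [Ne, key_eq_iff hyn hb]
        exact fun h => hxa h.1
      · simp only [Table.attach]
        rw [Function.update_of_ne, h2]
        rw [Ne, key_eq_iff hsn hd]
        exact fun h => hxa h.1

/-- To keep the filled slots an initial segment, the neighbour in the last slot moves to the freed
one; at most two keys change. The last slot is emptied after the move, which is also right if the
two slots coincide. -/
theorem Ok.detach (h : t.Ok n nb) (ha : a < n) (hab : b ∈ nb a) :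
    (t.detach n a b).Ok n (Function.update nb a ((nb a).erase b)) := by
  have hb := h.sub a ha b hab
  have hdpos := h.deg_pos ha hab
  have hdn := h.deg_le ha
  obtain ⟨s₀, hs₀, hp₀, ht₀⟩ := h.place a ha b hab
  -- `c` is the neighbour to be moved. If `c = b`, its new place is meaningless but is no longer
  -- consulted.
  obtain ⟨c, hc, hc1, hc2⟩ := h.fill a ha (t.deg a - 1) (by omega)
  have hcn := h.sub a ha c hc
  set d := t.deg a - 1 with hd
  have hdet : t.detach n a b = ⟨Function.update t.deg a d,
      Function.update (Function.update t.slot (a * n + s₀) (c + 1)) (a * n + d) 0,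
      Function.update t.place (a * n + c) (a * n + s₀)⟩ := by
    have : t.lastKey n a = a * n + d := rfl
    unfold Table.detach
    rw [this, hp₀, hc1, Nat.add_sub_cancel]
  have hs₀n : s₀ < n := by omega
  have hdn' : d < n := by omega
  have hne : ∀ x y s : ℕ, x ≠ a → y < n → s < n → x * n + y ≠ a * n + s := by
    intro x y s hxa hy hs
    rw [Ne, key_eq_iff hy hs]
    exact fun h => hxa h.1
  rw [hdet]
  refine ⟨?_, ?_, ?_, ?_, ?_⟩
  · intro x hx y hy
    by_cases hxa : x = a
    · subst hxa
      rw [Function.update_self] at hy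
      exact h.sub x hx y (Finset.mem_of_mem_erase hy)
    · rw [Function.update_of_ne hxa] at hy
      exact h.sub x hx y hy
  · intro x hx
    by_cases hxa : x = a
    · subst hxa
      simp [Finset.card_erase_of_mem hab, hd, h.card x hx]
    · simp [hxa, h.card x hx]
  · intro x hx s hs
    by_cases hxa : x = a
    · subst hxa
      simp only [Function.update_self] at hs ⊢
      by_cases hss : s = s₀
      · subst hss
        have hcb : c ≠ b := by
          rintro rfl
          omega
        refine ⟨c, Finset.mem_erase.2 ⟨hcb, hc⟩, ?_, ?_⟩
        · rw [Function.update_of_ne (by omega)]; simp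
        · simp
      · obtain ⟨y, hy, h1, h2⟩ := h.fill x hx s (by omega)
        have hyb : y ≠ b := by
          rintro rfl
          omega
        have hyc : y ≠ c := by
          rintro rfl
          omega
        refine ⟨y, Finset.mem_erase.2 ⟨hyb, hy⟩, ?_, ?_⟩
        · rw [Function.update_of_ne (by omega), Function.update_of_ne (by omega), h1]
        · rw [Function.update_of_ne (by omega), h2]
    · simp only [Function.update_of_ne hxa] at hs ⊢
      obtain ⟨y, hy, h1, h2⟩ := h.fill x hx s hs
      have hsn : s < n := lt_of_lt_of_le hs (h.deg_le hx)
      have hyn := h.sub x hx y hy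
      refine ⟨y, hy, ?_, ?_⟩
      · rw [Function.update_of_ne (hne _ _ _ hxa hsn hdn'),
          Function.update_of_ne (hne _ _ _ hxa hsn hs₀n), h1]
      · rw [Function.update_of_ne (hne _ _ _ hxa hyn hcn), h2]
  · intro x hx s hs hds
    by_cases hxa : x = a
    · subst hxa
      simp only [Function.update_self] at hds ⊢
      by_cases hsd : s = d
      · simp [hsd]
      · rw [Function.update_of_ne (by omega), Function.update_of_ne (by omega)]
        exact h.empty x hx s hs (by omega)
    · simp only [Function.update_of_ne hxa] at hds ⊢
      rw [Function.update_of_ne (hne _ _ _ hxa hs hdn'),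
        Function.update_of_ne (hne _ _ _ hxa hs hs₀n)]
      exact h.empty x hx s hs hds
  · intro x hx y hy
    by_cases hxa : x = a
    · subst hxa
      rw [Function.update_self, Finset.mem_erase] at hy
      simp only [Function.update_self]
      by_cases hyc : y = c
      · subst hyc
        have : s₀ ≠ d := by
          rintro rfl
          have : y = b := by omega
          exact hy.1 this
        refine ⟨s₀, by omega, by simp, ?_⟩
        rw [Function.update_of_ne (by omega)]; simp
      · obtain ⟨s, hs, h1, h2⟩ := h.place x hx y hy.2
        have hsd : s ≠ d := by
          rintro rfl
          omega
        have hss : s ≠ s₀ := by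
          rintro rfl
          have := hy.1
          omega
        refine ⟨s, by omega, ?_, ?_⟩
        · rw [Function.update_of_ne (by omega), h1]
        · rw [Function.update_of_ne (by omega), Function.update_of_ne (by omega), h2]
    · rw [Function.update_of_ne hxa] at hy
      simp only [Function.update_of_ne hxa]
      obtain ⟨s, hs, h1, h2⟩ := h.place x hx y hy
      have hsn : s < n := lt_of_lt_of_le hs (h.deg_le hx)
      have hyn := h.sub x hx y hy
      refine ⟨s, hs, ?_, ?_⟩
      · rw [Function.update_of_ne (hne _ _ _ hxa hyn hcn), h1]
      · rw [Function.update_of_ne (hne _ _ _ hxa hsn hdn'),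
          Function.update_of_ne (hne _ _ _ hxa hsn hs₀n), h2]

/-- `slot` and `place` are mutually inverse bijections between the filled slots and the neighbours.
-/
theorem Ok.sum (h : t.Ok n nb) (ha : a < n) (f : ℕ → ℝ) :
    ∑ s ∈ Finset.range (t.deg a), f (t.slot (a * n + s) - 1) = ∑ b ∈ nb a, f b := by
  refine Finset.sum_nbij' (fun s => t.slot (a * n + s) - 1) (fun b => t.place (a * n + b) - a * n)
    ?_ ?_ ?_ ?_ ?_
  · intro s hs
    obtain ⟨b, hb, h1, h2⟩ := h.fill a ha s (Finset.mem_range.1 hs)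
    simpa [h1] using hb
  · intro b hb
    obtain ⟨s, hs, h1, h2⟩ := h.place a ha b hb
    simpa [h1] using hs
  · intro s hs
    obtain ⟨b, hb, h1, h2⟩ := h.fill a ha s (Finset.mem_range.1 hs)
    simp [h1, h2]
  · intro b hb
    obtain ⟨s, hs, h1, h2⟩ := h.place a ha b hb
    simp [h1, h2]
  · intro s hs
    rfl

end Table

/-- The table is stored in the memory. -/
structure HasTable (σ : State) (t : Table) : Prop where
  deg : σ.words 3 = t.deg
  slot : σ.words 4 = t.slot
  place : σ.words 5 = t.place

theorem HasTable.of_eq {σ σ' : State} {t : Table} (h : HasTable σ t) (h3 : σ'.words 3 = σ.words 3)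
    (h4 : σ'.words 4 = σ.words 4) (h5 : σ'.words 5 = σ.words 5) : HasTable σ' t :=
  ⟨h3.trans h.deg, h4.trans h.slot, h5.trans h.place⟩

theorem Touched.of_eq {N : ℕ} {σ σ' : State} {S : List ℕ} (h : Touched N σ S)
    (h7 : σ'.words 7 = σ.words 7) (h9 : σ'.words 9 = σ.words 9) (h10 : σ'.words 10 = σ.words 10)
    (h11 : σ'.words 11 = σ.words 11) (h12 : σ'.words 12 = σ.words 12)
    (h21 : σ'.words 21 = σ.words 21) (h22 : σ'.words 22 = σ.words 22) : Touched N σ' S := by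
  obtain ⟨a, b, c, d, e, f⟩ := h
  constructor
  · rw [h21, a]
  · rw [h10]; exact b
  · rw [h12]; exact c
  · rw [h22, h9, d]
  · rw [h9, h11]; exact e
  · rw [h9, h11, h7]; exact f

theorem sum_map_le {c : ℕ → ℕ} {B : ℕ} (S : List ℕ) (h : ∀ k ∈ S, c k ≤ B) :
    (S.map c).sum ≤ S.length * B := by
  have := List.sum_le_card_nsmul (S.map c) B (by
    intro x hx
    obtain ⟨k, hk, rfl⟩ := List.mem_map.1 hx
    exact h k hk)
  simpa using this

/-- What `touch` needs to know about the lists of positions. -/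
structure Lists (n N B : ℕ) (σ : State) : Prop where
  num : σ.words 15 0 = N
  le : ∀ k, σ.words 9 k ≤ B
  lt : ∀ k < n * n, ∀ t < σ.words 9 k, σ.words 7 (k * N + t) < N

section attach

variable {w n N B : ℕ} {σ : State} {S : List ℕ} {t : Table}

theorem runs_touch' (hT : Touched N σ S) (hL : Lists n N B σ) (hBN : B ≤ N) {k : ℕ}
    (hk : σ.words 20 0 = k) (hkn : k < n * n)
    (hb : n * n * (N + 1) + 1 < 2 ^ w) (hS : (S.length + 2) * (B + 1) < 2 ^ w) :
    RunsT w touch σ (100 + 100 * σ.words 9 k) fun σ' => Touched N σ' (k :: S) := by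
  refine runs_touch hT hL.num hk hkn hb ?_ ?_ ((hL.le k).trans hBN) (hL.lt k hkn)
  · have : S.length + 2 ≤ (S.length + 2) * (B + 1) := Nat.le_mul_of_pos_right _ (by omega)
    omega
  · have h1 := sum_map_le (c := σ.words 9) (B := B) (k :: S) fun k _ => hL.le k
    rw [List.length_cons] at h1
    have h2 : (S.length + 2) * (B + 1) = (S.length + 1) * B + B + S.length + 2 := by ring
    omega

theorem Lists.of_eq {σ' : State} (h : Lists n N B σ) (h7 : σ'.words 7 = σ.words 7)
    (h9 : σ'.words 9 = σ.words 9) (h15 : σ'.words 15 = σ.words 15) : Lists n N B σ' := by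
  obtain ⟨a, b, c⟩ := h
  constructor
  · rw [h15, a]
  · rw [h9]; exact b
  · rw [h9, h7]; exact c

theorem runs_attach {a b : ℕ} {nb : ℕ → Finset ℕ} (hn : σ.words 0 0 = n) (h24 : σ.words 24 0 = a)
    (h25 : σ.words 25 0 = b) (ha : a < n) (hb : b < n) (ht : HasTable σ t) (hok : t.Ok n nb)
    (hab : b ∉ nb a) (hT : Touched N σ S) (hL : Lists n N B σ) (hBN : B ≤ N)
    (hw : n * n * (N + 1) + 1 < 2 ^ w) (hS : (S.length + 2) * (B + 1) < 2 ^ w) :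
    RunsT w attach σ (300 + 100 * σ.words 9 (a * n + t.deg a)) fun σ' =>
      HasTable σ' (t.attach n a b) ∧ Touched N σ' ((a * n + t.deg a) :: S) := by
  have hd := hok.deg_lt ha hb hab
  have hnn : n * n < 2 ^ w := by
    rw [Nat.mul_succ] at hw
    omega
  have hkey : a * n + t.deg a < n * n := key_lt ha hd
  have hkey' : a * n + b < n * n := key_lt ha hb
  have h1 : 1 % 2 ^ w = 1 := Nat.mod_eq_of_lt (by omega)
  have m1 : a * n % 2 ^ w = a * n := Nat.mod_eq_of_lt (by omega)
  have m2 : (a * n + t.deg a) % 2 ^ w = a * n + t.deg a := Nat.mod_eq_of_lt (by omega)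
  have m3 : (a * n + b) % 2 ^ w = a * n + b := Nat.mod_eq_of_lt (by omega)
  have hn2 : n ≤ n * n := Nat.le_mul_of_pos_left _ (by omega)
  have m4 : (b + 1) % 2 ^ w = b + 1 := Nat.mod_eq_of_lt (by omega)
  have m5 : (t.deg a + 1) % 2 ^ w = t.deg a + 1 := Nat.mod_eq_of_lt (by omega)
  have hfirst : Runs w (setV 20 (keyAt 24 (.get 3 (V 24)))) σ fun σ₁ =>
      σ₁.words 20 0 = a * n + t.deg a := by
    refine Runs.wset 0 (a * n + t.deg a) (by simp [WExp.eval]) ?_ (by simp [State.setWord_words])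
    simp [WExp.eval, h24, hn, ht.deg, m1, m2]
  have hlast : ∀ σ₂, σ₂.words 20 0 = a * n + t.deg a → σ₂.words 24 = σ.words 24 →
      σ₂.words 25 = σ.words 25 → σ₂.words 0 = σ.words 0 → HasTable σ₂ t →
      Runs w attachEnd σ₂ fun σ' => HasTable σ' (t.attach n a b) := by
    intro σ₂ g20 g24 g25 g0 gt
    refine Runs.seq (Runs.wset (a * n + t.deg a) (b + 1) (by simp [WExp.eval, g20])
      (by simp [WExp.eval, g25, h25, h1, m4]) ?_)
    refine Runs.seq (Runs.wset (a * n + b) (a * n + t.deg a)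
      (by simp [WExp.eval, State.setWord_words, g24, h24, g0, hn, g25, h25, m1, m3])
      (by simp [WExp.eval, State.setWord_words, g20]) ?_)
    refine Runs.wset a (t.deg a + 1)
      (by simp [WExp.eval, State.setWord_words, g24, h24])
      (by simp [WExp.eval, State.setWord_words, g24, h24, gt.deg, h1, m5]) ?_
    constructor <;> simp [State.setWord_words, gt.deg, gt.slot, gt.place, Table.attach]
  refine RunsT.mono (B := 50 + ((100 + 100 * σ.words 9 (a * n + t.deg a)) + 50)) ?_ (by omega)
    fun _ _ h => h
  refine RunsT.seq ((hfirst.timed (by simp [Prog.LoopFree])).mono (by decide) fun σ₁ hA h20 => ?_)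
  have f9 : σ₁.words 9 = σ.words 9 := hA.1 9 (by decide)
  refine RunsT.seq ((runs_touch' (σ := σ₁) (hT.of_eq (hA.1 7 (by decide)) f9
      (hA.1 10 (by decide)) (hA.1 11 (by decide)) (hA.1 12 (by decide)) (hA.1 21 (by decide))
      (hA.1 22 (by decide))) (hL.of_eq (hA.1 7 (by decide)) f9 (hA.1 15 (by decide)))
      hBN h20 hkey hw hS).mono (by rw [f9]) fun σ₂ hA₂ hT₂ => ?_)
  have e₂ : ∀ x, x ∉ (setV 20 (keyAt 24 (.get 3 (V 24)))).wordTargets → x ∉ touch.wordTargets →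
    σ₂.words x = σ.words x := fun x hx hx' => (hA₂.1 x hx').trans (hA.1 x hx)
  refine ((hlast σ₂ ((congrFun (hA₂.1 20 (by decide)) 0).trans h20)
    (e₂ 24 (by decide) (by decide)) (e₂ 25 (by decide) (by decide)) (e₂ 0 (by decide) (by decide))
    (ht.of_eq (e₂ 3 (by decide) (by decide)) (e₂ 4 (by decide) (by decide))
      (e₂ 5 (by decide) (by decide)))).timed
    (by simp [attachEnd, Prog.LoopFree])).mono (by decide) fun σ₃ hA₃ h₃ => ⟨h₃, ?_⟩
  exact hT₂.of_eq (hA₃.1 7 (by decide)) (hA₃.1 9 (by decide)) (hA₃.1 10 (by decide))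
    (hA₃.1 11 (by decide)) (hA₃.1 12 (by decide)) (hA₃.1 21 (by decide)) (hA₃.1 22 (by decide))

theorem runs_detach {a b : ℕ} {nb : ℕ → Finset ℕ} (hn : σ.words 0 0 = n) (h24 : σ.words 24 0 = a)
    (h25 : σ.words 25 0 = b) (ha : a < n) (ht : HasTable σ t) (hok : t.Ok n nb)
    (hab : b ∈ nb a) (hT : Touched N σ S) (hL : Lists n N B σ) (hBN : B ≤ N)
    (hw : n * n * (N + 1) + 1 < 2 ^ w) (hS : (S.length + 3) * (B + 1) < 2 ^ w) :
    RunsT w detach σ (500 + 100 * (σ.words 9 (t.place (a * n + b)) + σ.words 9 (t.lastKey n a)))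
      fun σ' => HasTable σ' (t.detach n a b) ∧
        Touched N σ' (t.lastKey n a :: t.place (a * n + b) :: S) := by
  have hb := hok.sub a ha b hab
  have hdpos := hok.deg_pos ha hab
  have hdn := hok.deg_le ha
  have hnn : n * n < 2 ^ w := by
    rw [Nat.mul_succ] at hw
    omega
  obtain ⟨s₀, hs₀, hp₀, ht₀⟩ := hok.place a ha b hab
  obtain ⟨c, hc, hc1, hc2⟩ := hok.fill a ha (t.deg a - 1) (by omega)
  have hcn := hok.sub a ha c hc
  have hlk : t.lastKey n a = a * n + (t.deg a - 1) := rfl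
  have hkey : t.lastKey n a < n * n := by rw [hlk]; exact key_lt ha (by omega)
  have hkey₀ : t.place (a * n + b) < n * n := by rw [hp₀]; exact key_lt ha (by omega)
  have hkeyb : a * n + b < n * n := key_lt ha hb
  have hkeyc : a * n + c < n * n := key_lt ha hcn
  have hn2 : n ≤ n * n := Nat.le_mul_of_pos_left _ (by omega)
  have h1 : 1 % 2 ^ w = 1 := Nat.mod_eq_of_lt (by omega)
  have m1 : a * n % 2 ^ w = a * n := Nat.mod_eq_of_lt (by omega)
  have m2 : (a * n + (t.deg a - 1)) % 2 ^ w = a * n + (t.deg a - 1) :=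
    Nat.mod_eq_of_lt (by omega)
  have m3 : (a * n + b) % 2 ^ w = a * n + b := Nat.mod_eq_of_lt (by omega)
  have m4 : (c + 1) % 2 ^ w = c + 1 := Nat.mod_eq_of_lt (by omega)
  have m5 : (a * n + c) % 2 ^ w = a * n + c := Nat.mod_eq_of_lt (by omega)
  have hfirst : Runs w (setV 20 (.get 5 (keyAt 24 (V 25)))) σ fun σ₁ =>
      σ₁.words 20 0 = t.place (a * n + b) := by
    refine Runs.wset 0 (t.place (a * n + b)) (by simp [WExp.eval]) ?_
      (by simp [State.setWord_words])
    simp [WExp.eval, h24, hn, h25, ht.place, m1, m3]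
  have hmid : ∀ σ₂, σ₂.words 20 0 = t.place (a * n + b) → σ₂.words 24 = σ.words 24 →
      σ₂.words 0 = σ.words 0 → σ₂.words 3 = σ.words 3 →
      Runs w detachMiddle σ₂ fun σ' => σ'.words 20 0 = t.lastKey n a ∧
        σ'.words 26 0 = t.place (a * n + b) := by
    intro σ₂ g20 g24 g0 g3
    refine Runs.seq (Runs.wset 0 (t.place (a * n + b)) (by simp [WExp.eval])
      (by simp [WExp.eval, g20]) ?_)
    refine Runs.wset 0 (t.lastKey n a) (by simp [WExp.eval]) ?_ (by simp [State.setWord_words])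
    simp [WExp.eval, State.setWord_words, g24, h24, g0, hn, g3, ht.deg, h1, m1, m2, hlk]
  have hlast : ∀ σ₂, σ₂.words 20 0 = t.lastKey n a → σ₂.words 26 0 = t.place (a * n + b) →
      σ₂.words 24 = σ.words 24 → σ₂.words 0 = σ.words 0 → HasTable σ₂ t →
      Runs w detachEnd σ₂ fun σ' => HasTable σ' (t.detach n a b) := by
    intro σ₂ g20 g26 g24 g0 gt
    refine Runs.seq (Runs.wset 0 c (by simp [WExp.eval])
      (by simp [WExp.eval, g20, gt.slot, hlk, hc1, h1]) ?_)
    refine Runs.seq (Runs.wset (t.place (a * n + b)) (c + 1)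
      (by simp [WExp.eval, State.setWord_words, g26])
      (by simp [WExp.eval, State.setWord_words, h1, m4]) ?_)
    refine Runs.seq (Runs.wset (a * n + c) (t.place (a * n + b))
      (by simp [WExp.eval, State.setWord_words, g24, h24, g0, hn, m1, m5])
      (by simp [WExp.eval, State.setWord_words, g26]) ?_)
    refine Runs.seq (Runs.wset (t.lastKey n a) 0
      (by simp [WExp.eval, State.setWord_words, g20])
      (by simp [WExp.eval]) ?_)
    refine Runs.wset a (t.deg a - 1)
      (by simp [WExp.eval, State.setWord_words, g24, h24])
      (by simp [WExp.eval, State.setWord_words, g24, h24, gt.deg, h1]) ?_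
    have hc3 : t.slot (t.lastKey n a) - 1 = c := by rw [hlk, hc1]; omega
    constructor <;> simp [State.setWord_words, gt.deg, gt.slot, gt.place, Table.detach, hc3]
  have hlen : (S.length + 2) * (B + 1) < 2 ^ w :=
    lt_of_le_of_lt (Nat.mul_le_mul_right _ (by omega)) hS
  refine RunsT.mono (B := 50 + ((100 + 100 * σ.words 9 (t.place (a * n + b))) + (50 +
    ((100 + 100 * σ.words 9 (t.lastKey n a)) + 50)))) ?_ (by omega) fun _ _ h => h
  refine RunsT.seq ((hfirst.timed (by simp [Prog.LoopFree])).mono (by decide) fun σ₁ hA h20 => ?_)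
  have f9 : σ₁.words 9 = σ.words 9 := hA.1 9 (by decide)
  refine RunsT.seq ((runs_touch' (σ := σ₁) (hT.of_eq (hA.1 7 (by decide)) f9
      (hA.1 10 (by decide)) (hA.1 11 (by decide)) (hA.1 12 (by decide)) (hA.1 21 (by decide))
      (hA.1 22 (by decide))) (hL.of_eq (hA.1 7 (by decide)) (hA.1 9 (by decide))
      (hA.1 15 (by decide))) hBN h20 hkey₀ hw hlen).mono (by rw [f9])
      fun σ₂ hA₂ hT₂ => ?_)
  have e₂ : ∀ a, a ∉ (setV 20 (.get 5 (keyAt 24 (V 25)))).wordTargets → a ∉ touch.wordTargets →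
    σ₂.words a = σ.words a := fun a ha ha' => (hA₂.1 a ha').trans (hA.1 a ha)
  have h20₂ : σ₂.words 20 0 = t.place (a * n + b) :=
    (congrFun (hA₂.1 20 (by decide)) 0).trans h20
  refine RunsT.seq (((hmid σ₂ h20₂ (e₂ 24 (by decide) (by decide)) (e₂ 0 (by decide) (by decide))
    (e₂ 3 (by decide) (by decide))).timed (by simp [detachMiddle, Prog.LoopFree])).mono
    (by decide) ?_)
  rintro σ₃ hA₃ ⟨h20₃, h26₃⟩
  have e₃ : ∀ a, a ∉ (setV 20 (.get 5 (keyAt 24 (V 25)))).wordTargets → a ∉ touch.wordTargets →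
    a ∉ detachMiddle.wordTargets → σ₃.words a = σ.words a :=
    fun a ha ha' ha'' => (hA₃.1 a ha'').trans (e₂ a ha ha')
  have f9₃ : σ₃.words 9 = σ.words 9 := e₃ 9 (by decide) (by decide) (by decide)
  refine RunsT.seq ((runs_touch' (σ := σ₃) (S := t.place (a * n + b) :: S)
      (hT₂.of_eq (hA₃.1 7 (by decide)) (hA₃.1 9 (by decide))
      (hA₃.1 10 (by decide)) (hA₃.1 11 (by decide)) (hA₃.1 12 (by decide)) (hA₃.1 21 (by decide))
      (hA₃.1 22 (by decide))) (hL.of_eq (e₃ 7 (by decide) (by decide) (by decide)) f9₃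
      (e₃ 15 (by decide) (by decide) (by decide))) hBN h20₃ hkey hw (by simpa using hS)).mono
      (by rw [f9₃]) fun σ₄ hA₄ hT₄ => ?_)
  refine ((hlast σ₄ ((congrFun (hA₄.1 20 (by decide)) 0).trans h20₃)
    ((congrFun (hA₄.1 26 (by decide)) 0).trans h26₃)
    ((hA₄.1 24 (by decide)).trans (e₃ 24 (by decide) (by decide) (by decide)))
    ((hA₄.1 0 (by decide)).trans (e₃ 0 (by decide) (by decide) (by decide)))
    (ht.of_eq ((hA₄.1 3 (by decide)).trans (e₃ 3 (by decide) (by decide) (by decide)))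
      ((hA₄.1 4 (by decide)).trans (e₃ 4 (by decide) (by decide) (by decide)))
      ((hA₄.1 5 (by decide)).trans (e₃ 5 (by decide) (by decide) (by decide))))).timed
    (by simp [detachEnd, Prog.LoopFree])).mono (by decide) fun σ₅ hA₅ h₅ => ⟨h₅, ?_⟩
  exact hT₄.of_eq (hA₅.1 7 (by decide)) (hA₅.1 9 (by decide)) (hA₅.1 10 (by decide))
    (hA₅.1 11 (by decide)) (hA₅.1 12 (by decide)) (hA₅.1 21 (by decide)) (hA₅.1 22 (by decide))

end attach


/-! ## The index of the positions of every key -/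

/-- For each key `k`, the cells `k * N, …, k * N + cnt k - 1` list the positions in `P` with key `k`,
and `pos` is the inverse of this enumeration. -/
structure Index (N : ℕ) (P : Finset ℕ) (key list pos cnt : ℕ → ℕ) : Prop where
  pos_lt : ∀ p ∈ P, pos p < cnt (key p)
  list_pos : ∀ p ∈ P, list (key p * N + pos p) = p
  list_mem : ∀ k t, t < cnt k → list (k * N + t) ∈ P
  key_list : ∀ k t, t < cnt k → key (list (k * N + t)) = k
  pos_list : ∀ k t, t < cnt k → pos (list (k * N + t)) = t

namespace Index

variable {N : ℕ} {P : Finset ℕ} {key list pos cnt : ℕ → ℕ}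

/-- The stored length of a list is therefore the number of occurrences of its key in the walks, the
random variable that governs the update time. -/
theorem card_eq (h : Index N P key list pos cnt) (k : ℕ) :
    (P.filter fun p => key p = k).card = cnt k := by
  rw [← Finset.card_range (cnt k)]
  refine (Finset.card_bij' (fun t _ => list (k * N + t)) (fun p _ => pos p) ?_ ?_ ?_ ?_).symm
  · intro t ht
    rw [Finset.mem_range] at ht
    exact Finset.mem_filter.2 ⟨h.list_mem k t ht, h.key_list k t ht⟩
  · intro p hp
    obtain ⟨hp', rfl⟩ := Finset.mem_filter.1 hp
    exact Finset.mem_range.2 (h.pos_lt p hp')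
  · intro t ht
    exact h.pos_list k t (Finset.mem_range.1 ht)
  · intro p hp
    obtain ⟨hp', rfl⟩ := Finset.mem_filter.1 hp
    exact h.list_pos p hp'

theorem cnt_le (h : Index N P key list pos cnt) (k : ℕ) : cnt k ≤ P.card := by
  rw [← h.card_eq k]
  exact Finset.card_filter_le _ _

/-- Deletion in constant time: the last entry of the list takes the place of the removed one. Lists
of different keys do not overlap because each has at most `N` entries. -/
theorem remove (h : Index N P key list pos cnt) (hP : P.card ≤ N) {p : ℕ} (hp : p ∈ P) :
    Index N (P.erase p) key
      (Function.update list (key p * N + pos p) (list (key p * N + (cnt (key p) - 1))))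
      (Function.update pos (list (key p * N + (cnt (key p) - 1))) (pos p))
      (Function.update cnt (key p) (cnt (key p) - 1)) := by
  have hi := h.pos_lt p hp
  have hlp := h.list_pos p hp
  obtain ⟨c, hc⟩ : ∃ c, cnt (key p) = c + 1 := ⟨cnt (key p) - 1, by omega⟩
  have hcN := fun k => (h.cnt_le k).trans hP
  have hkl := h.key_list (key p) c (by omega)
  have hml := h.list_mem (key p) c (by omega)
  have hpl := h.pos_list (key p) c (by omega)
  rw [hc, Nat.add_sub_cancel]
  set o := key p with ho
  set i := pos p with hidef
  set last := list (o * N + c) with hlast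
  have hcN' := hcN o
  constructor
  · intro q hq
    obtain ⟨hqp, hq⟩ := Finset.mem_erase.1 hq
    have h1 := h.pos_lt q hq
    have h2 := h.list_pos q hq
    by_cases hql : q = last
    · rw [hql, hkl, Function.update_self, Function.update_self]
      have : i ≠ c := by
        intro hic
        apply hqp
        rw [hql, hlast, ← hic, hlp]
      omega
    · rw [Function.update_of_ne hql]
      by_cases hqo : key q = o
      · rw [hqo, Function.update_self]
        have : pos q ≠ c := by
          intro hqc
          rw [hqo, hqc] at h2
          exact hql h2.symm
        rw [hqo] at h1
        omega
      · rwa [Function.update_of_ne hqo]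
  · intro q hq
    obtain ⟨hqp, hq⟩ := Finset.mem_erase.1 hq
    have h1 := h.pos_lt q hq
    have h2 := h.list_pos q hq
    by_cases hql : q = last
    · rw [hql, hkl, Function.update_self, Function.update_self]
    · rw [Function.update_of_ne hql, Function.update_of_ne, h2]
      rw [Ne, key_eq_iff (lt_of_lt_of_le h1 (hcN _)) (by omega)]
      rintro ⟨h3, h4⟩
      apply hqp
      rw [← h2, h3, h4, hlp]
  · intro k t ht
    rw [Finset.mem_erase]
    by_cases hk : k = o
    · subst hk
      rw [Function.update_self] at ht
      by_cases hti : t = i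
      · subst hti
        rw [Function.update_self]
        refine ⟨fun h3 => ?_, hml⟩
        rw [h3] at hpl
        omega
      · rw [Function.update_of_ne (by omega)]
        refine ⟨fun h3 => ?_, h.list_mem o t (by omega)⟩
        have := h.pos_list o t (by omega)
        rw [h3] at this
        omega
    · rw [Function.update_of_ne hk] at ht
      rw [Function.update_of_ne]
      · refine ⟨fun h3 => ?_, h.list_mem k t ht⟩
        have := h.key_list k t ht
        rw [h3] at this
        exact hk this.symm
      · rw [Ne, key_eq_iff (lt_of_lt_of_le ht (hcN _)) (by omega)]
        exact fun h3 => hk h3.1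
  · intro k t ht
    by_cases hk : k = o
    · subst hk
      rw [Function.update_self] at ht
      by_cases hti : t = i
      · subst hti
        rw [Function.update_self, hkl]
      · rw [Function.update_of_ne (by omega)]
        exact h.key_list o t (by omega)
    · rw [Function.update_of_ne hk] at ht
      rw [Function.update_of_ne, h.key_list k t ht]
      rw [Ne, key_eq_iff (lt_of_lt_of_le ht (hcN _)) (by omega)]
      exact fun h3 => hk h3.1
  · intro k t ht
    by_cases hk : k = o
    · subst hk
      rw [Function.update_self] at ht
      by_cases hti : t = i
      · subst hti
        rw [Function.update_self, Function.update_self]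
      · have h6 : o * N + t ≠ o * N + i := by omega
        have h5 : list (o * N + t) ≠ last := by
          intro h3
          have h4 := h.pos_list o t (by omega)
          rw [h3, hpl] at h4
          omega
        rw [Function.update_of_ne h6, Function.update_of_ne h5, h.pos_list o t (by omega)]
    · rw [Function.update_of_ne hk] at ht
      have h5 : list (k * N + t) ≠ last := by
        intro h3
        have := h.key_list k t ht
        rw [h3, hkl] at this
        exact hk this.symm
      have h6 : k * N + t ≠ o * N + i := by
        rw [Ne, key_eq_iff (lt_of_lt_of_le ht (hcN _)) (by omega)]
        exact fun h3 => hk h3.1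
      rw [Function.update_of_ne h6, Function.update_of_ne h5, h.pos_list k t ht]

/-- Appending needs room in the block of `N` cells reserved for the key, hence the strict bound on
the number of positions. -/
theorem insert (h : Index N P key list pos cnt) (hP : P.card < N) {p : ℕ} (hp : p ∉ P) (k : ℕ) :
    Index N (insert p P) (Function.update key p k) (Function.update list (k * N + cnt k) p)
      (Function.update pos p (cnt k)) (Function.update cnt k (cnt k + 1)) := by
  have hcN := fun k => lt_of_le_of_lt (h.cnt_le k) hP
  have hne : ∀ q ∈ P, q ≠ p := fun q hq h => hp (h ▸ hq)
  have hup : ∀ k', cnt k' ≤ Function.update cnt k (cnt k + 1) k' := by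
    intro k'
    by_cases hk : k' = k
    · subst hk; simp
    · rw [Function.update_of_ne hk]
  have hold : ∀ k' t, t < Function.update cnt k (cnt k + 1) k' → ¬ (k' = k ∧ t = cnt k) →
      t < cnt k' ∧ k' * N + t ≠ k * N + cnt k := by
    intro k' t ht hn
    have h1 : t < cnt k' := by
      by_cases hk : k' = k
      · subst hk
        rw [Function.update_self] at ht
        have : t ≠ cnt k' := fun h => hn ⟨rfl, h⟩
        omega
      · rwa [Function.update_of_ne hk] at ht
    refine ⟨h1, ?_⟩
    rwa [Ne, key_eq_iff (h1.trans (hcN _)) (hcN _)]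
  constructor
  · intro q hq
    by_cases hqp : q = p
    · subst hqp; simp
    · have hq : q ∈ P := (Finset.mem_insert.1 hq).resolve_left hqp
      rw [Function.update_of_ne hqp, Function.update_of_ne hqp]
      exact lt_of_lt_of_le (h.pos_lt q hq) (hup _)
  · intro q hq
    by_cases hqp : q = p
    · subst hqp; simp
    · have hq : q ∈ P := (Finset.mem_insert.1 hq).resolve_left hqp
      have h1 := h.pos_lt q hq
      rw [Function.update_of_ne hqp, Function.update_of_ne hqp, Function.update_of_ne,
        h.list_pos q hq]
      rw [Ne, key_eq_iff (h1.trans (hcN _)) (hcN _)]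
      rintro ⟨h3, h4⟩
      rw [h3, h4] at h1
      omega
  · intro k' t ht
    by_cases hn : k' = k ∧ t = cnt k
    · rw [hn.1, hn.2]; simp
    · obtain ⟨h1, h2⟩ := hold k' t ht hn
      rw [Function.update_of_ne h2]
      exact Finset.mem_insert_of_mem (h.list_mem k' t h1)
  · intro k' t ht
    by_cases hn : k' = k ∧ t = cnt k
    · rw [hn.1, hn.2]; simp
    · obtain ⟨h1, h2⟩ := hold k' t ht hn
      rw [Function.update_of_ne h2, Function.update_of_ne (hne _ (h.list_mem k' t h1)),
        h.key_list k' t h1]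
  · intro k' t ht
    by_cases hn : k' = k ∧ t = cnt k
    · rw [hn.1, hn.2]; simp
    · obtain ⟨h1, h2⟩ := hold k' t ht hn
      rw [Function.update_of_ne h2, Function.update_of_ne (hne _ (h.list_mem k' t h1)),
        h.pos_list k' t h1]

end Index

/-! ## The memory of the walks -/

/-- The consistency of the stored walks, their index, and the output. -/
structure Mem (n N : ℕ) (σ : State) : Prop where
  index : Index N (Finset.range N) (σ.words 6) (σ.words 7) (σ.words 8) (σ.words 9)
  key_lt : ∀ p < N, σ.words 6 p < n * n
  out : ∀ v, σ.reals 1 v = ∑ p ∈ Finset.range N, if σ.words 6 p / n = v then σ.reals 2 p else 0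

/-- Only the summand of the changed position moves. This is the bookkeeping that keeps the output
correct while single draws are replaced. -/
theorem sum_update {n N : ℕ} {key : ℕ → ℕ} {wt : ℕ → ℝ} {p k : ℕ} (hp : p < N) (x : ℝ) (v : ℕ) :
    (∑ q ∈ Finset.range N, if Function.update key p k q / n = v then Function.update wt p x q else 0) =
      (∑ q ∈ Finset.range N, if key q / n = v then wt q else 0) -
        (if key p / n = v then wt p else 0) + if k / n = v then x else 0 := by
  have hp' := Finset.mem_range.2 hp
  rw [← Finset.add_sum_erase _ _ hp', ← Finset.add_sum_erase _ (fun q => if key q / n = v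
    then wt q else 0) hp', Function.update_self, Function.update_self]
  have : ∀ q ∈ (Finset.range N).erase p,
      (if Function.update key p k q / n = v then Function.update wt p x q else 0) =
      if key q / n = v then wt q else 0 := by
    intro q hq
    have := Finset.ne_of_mem_erase hq
    rw [Function.update_of_ne this, Function.update_of_ne this]
  rw [Finset.sum_congr rfl this]
  ring

/-- The parameters that are stored in the memory. -/
structure Params (n R M N : ℕ) (ε W₀ : ℝ) (σ : State) : Prop where
  n : σ.words 0 0 = n
  R : σ.words 13 0 = R
  M : σ.words 14 0 = M
  N : σ.words 15 0 = N
  ε : σ.reals 0 0 = ε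
  W₀ : σ.reals 6 0 = W₀

theorem Params.of_eq {n R M N : ℕ} {ε W₀ : ℝ} {σ σ' : State} (h : Params n R M N ε W₀ σ)
    (h0 : σ'.words 0 = σ.words 0) (h13 : σ'.words 13 = σ.words 13)
    (h14 : σ'.words 14 = σ.words 14) (h15 : σ'.words 15 = σ.words 15)
    (hr0 : σ'.reals 0 = σ.reals 0) (hr6 : σ'.reals 6 = σ.reals 6) : Params n R M N ε W₀ σ' := by
  obtain ⟨a, b, c, d, e, f⟩ := h
  exact ⟨by rw [h0, a], by rw [h13, b], by rw [h14, c], by rw [h15, d], by rw [hr0, e],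
    by rw [hr6, f]⟩

/-- The registers of a walk. -/
structure Regs (p u m : ℕ) (W : ℝ) (fr : ℕ) (σ : State) : Prop where
  p : σ.words 31 0 = p
  u : σ.words 32 0 = u
  m : σ.words 33 0 = m
  W : σ.reals 5 0 = W
  fr : σ.words 30 0 = fr

/-! ### One draw of a walk, in memory. -/

section step

variable {w n R M N : ℕ} {ε W₀ : ℝ} {σ : State}

/-- `Index.remove` followed by `Index.insert`. The assignments are in an order that also works when
the old and the new key are equal. -/
theorem runs_rekeyIndex (hw : n * n * (N + 1) + 1 < 2 ^ w) (hP : Params n R M N ε W₀ σ)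
    (hI : Index N (Finset.range N) (σ.words 6) (σ.words 7) (σ.words 8) (σ.words 9))
    (hkl : ∀ p < N, σ.words 6 p < n * n) {p k : ℕ} (hp : p < N) (h31 : σ.words 31 0 = p)
    (h34 : σ.words 34 0 = k) (hk : k < n * n) :
    Runs w rekeyIndex σ fun σ' =>
      Index N (Finset.range N) (σ'.words 6) (σ'.words 7) (σ'.words 8) (σ'.words 9) ∧
      σ'.words 6 = Function.update (σ.words 6) p k ∧ σ'.words 36 0 = σ.words 6 p := by
  set key := σ.words 6 with hkey
  set list := σ.words 7 with hlist
  set pos := σ.words 8 with hpos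
  set cnt := σ.words 9 with hcnt
  have hw' : n * n * N + n * n + 1 < 2 ^ w := by rw [Nat.mul_succ] at hw; exact hw
  have hbound : ∀ k < n * n, ∀ t ≤ N, k * N + t < 2 ^ w := by
    intro k hk t ht
    have := Nat.mul_le_mul_right N (Nat.succ_le_of_lt hk)
    rw [Nat.succ_mul] at this
    omega
  have hNw : N + 1 < 2 ^ w := by
    have := Nat.mul_le_mul_right N (show 1 ≤ n * n by omega)
    omega
  have hrem := hI.remove (by simp) (Finset.mem_range.2 hp)
  have hcard : ((Finset.range N).erase p).card < N := by
    rw [Finset.card_erase_of_mem (Finset.mem_range.2 hp), Finset.card_range]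
    omega
  have hins := hrem.insert hcard (Finset.notMem_erase p _) k
  rw [Finset.insert_erase (Finset.mem_range.2 hp)] at hins
  set o := key p with ho
  have hok : o < n * n := hkl p hp
  have hco : cnt o ≤ N := by simpa using hI.cnt_le o
  have hpp : pos p < N := lt_of_lt_of_le (hI.pos_lt p (Finset.mem_range.2 hp)) hco
  set c := cnt o - 1 with hc
  set last := list (o * N + c) with hlast
  set cnt₁ := Function.update cnt o c with hcnt₁
  -- The position has just been removed, so even a full list has a free cell.
  have hc₁ : cnt₁ k < N := lt_of_le_of_lt (hrem.cnt_le k) hcard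
  have h1 : 1 % 2 ^ w = 1 := Nat.mod_eq_of_lt (by omega)
  have a1 : o * N % 2 ^ w = o * N := Nat.mod_eq_of_lt (by simpa using hbound o hok 0 (by omega))
  have a2 : (o * N + c) % 2 ^ w = o * N + c := Nat.mod_eq_of_lt (hbound o hok c (by omega))
  have a3 : (o * N + pos p) % 2 ^ w = o * N + pos p :=
    Nat.mod_eq_of_lt (hbound o hok _ (by omega))
  have a4 : k * N % 2 ^ w = k * N := Nat.mod_eq_of_lt (by simpa using hbound k hk 0 (by omega))
  have a5 : (k * N + cnt₁ k) % 2 ^ w = k * N + cnt₁ k :=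
    Nat.mod_eq_of_lt (hbound k hk _ (by omega))
  have a6 : (cnt₁ k + 1) % 2 ^ w = cnt₁ k + 1 := Nat.mod_eq_of_lt (by omega)
  have hN := hP.N
  unfold rekeyIndex
  refine Runs.seq (Runs.wset 0 o (by simp [WExp.eval]) (by simp [WExp.eval, h31, ← hkey, ho]) ?_)
  refine Runs.seq (Runs.wset o c (by simp [WExp.eval, State.setWord_words])
    (by simp [WExp.eval, State.setWord_words, ← hcnt, h1, hc]) ?_)
  refine Runs.seq (Runs.wset 0 last (by simp [WExp.eval])
    (by simp [WExp.eval, State.setWord_words, ← hcnt, ← hlist, hN, a1, a2, hlast]) ?_)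
  refine Runs.seq (Runs.wset (o * N + pos p) last
    (by simp [WExp.eval, State.setWord_words, ← hpos, hN, a1, a3, h31])
    (by simp [WExp.eval, State.setWord_words]) ?_)
  refine Runs.seq (Runs.wset last (pos p)
    (by simp [WExp.eval, State.setWord_words])
    (by simp [WExp.eval, State.setWord_words, ← hpos, h31]) ?_)
  refine Runs.seq (Runs.wset (k * N + cnt₁ k) p
    (by simp [WExp.eval, State.setWord_words, ← hcnt, ← hcnt₁, hN, a4, a5, h34])
    (by simp [WExp.eval, State.setWord_words, h31]) ?_)
  refine Runs.seq (Runs.wset p (cnt₁ k)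
    (by simp [WExp.eval, State.setWord_words, h31])
    (by simp [WExp.eval, State.setWord_words, ← hcnt, ← hcnt₁, h34]) ?_)
  refine Runs.seq (Runs.wset k (cnt₁ k + 1)
    (by simp [WExp.eval, State.setWord_words, h34])
    (by simp [WExp.eval, State.setWord_words, ← hcnt, ← hcnt₁, h34, h1, a6]) ?_)
  refine Runs.wset p k
    (by simp [WExp.eval, State.setWord_words, h31])
    (by simp [WExp.eval, State.setWord_words, h34]) ?_
  refine ⟨?_, ?_, ?_⟩
  · simp only [State.setWord_words, ← hcnt, ← hlist, ← hpos, ← hkey]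
    simpa using hins
  · simp [State.setWord_words, ← hkey]
  · simp [State.setWord_words]

/-- The old contribution leaves the output at the old vertex `o / n` and the new one enters at `k /
n`. Only draws from an arrival state, those with `m = n`, carry weight, since intermediate draws
stay at a vertex already counted. -/
theorem runs_rekeyValue (hP : Params n R M N ε W₀ σ) {p u m k fr o : ℕ} {W : ℝ}
    (hR : Regs p u m W fr σ) (hm : m ≤ n) (h34 : σ.words 34 0 = k) (h36 : σ.words 36 0 = o) :
    Runs w rekeyValue σ fun σ' =>
      σ'.reals 2 = Function.update (σ.reals 2) p (if m = n then W else 0) ∧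
      ∀ v, σ'.reals 1 v = σ.reals 1 v - (if o / n = v then σ.reals 2 p else 0) +
        if k / n = v then (if m = n then W else 0) else 0 := by
  have h0 := hP.n
  have h31 := hR.p
  have h33 := hR.m
  have h5 := hR.W
  unfold rekeyValue
  refine Runs.seq (Runs.rset (o / n) (σ.reals 1 (o / n) - σ.reals 2 p)
    (by simp [WExp.eval, h36, h0]) (by simp [RExp.eval, WExp.eval, h36, h0, h31]) ?_)
  refine Runs.seq (Runs.mono (Q := fun σ₁ => σ₁ = (σ.setReal 1 (o / n) (σ.reals 1 (o / n) - σ.reals 2 p)).setReal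
      2 p (if m = n then W else 0)) ?_ ?_)
  · by_cases hmn : m = n
    · refine Runs.ite_neg (by simp [BExp.Holds, WExp.eval, h33, h0, hmn]) ?_
      exact Runs.rset p W (by simp [WExp.eval, h31])
        (by simp [RExp.eval, WExp.eval, State.setReal_reals_apply, h5]) (by simp [hmn])
    · refine Runs.ite_pos (by simp [BExp.Holds, WExp.eval, h33, h0]; omega) ?_
      exact Runs.rset p 0 (by simp [WExp.eval, h31])
        (by simp [RExp.eval, WExp.eval]) (by simp [hmn])
  · rintro σ₁ - rfl
    generalize (if m = n then W else 0) = x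
    refine Runs.rset (k / n) ((if k / n = o / n then σ.reals 1 (o / n) - σ.reals 2 p else
      σ.reals 1 (k / n)) + x)
      (by simp [WExp.eval, h34, h0])
      (by simp [RExp.eval, WExp.eval, State.setReal_reals_apply, h34, h0, h31]) ?_
    refine ⟨?_, ?_⟩
    · funext q
      simp [State.setReal_reals_apply, Function.update_apply]
    · intro v
      simp only [State.setReal_reals_apply, true_and]
      by_cases hv : v = k / n
      · subst hv
        by_cases hko : k / n = o / n
        · simp [hko]
        · simp [hko, Ne.symm hko]
      · by_cases hvo : v = o / n
        · subst hvo
          simp [Ne.symm hv, hv]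
        · simp [Ne.symm hv, hv, hvo, Ne.symm hvo]

/-- The flag is raised only after the key has been used, so a marked key is itself retained and
redrawing begins with the next draw, in accordance with `resample`. -/
theorem runs_follow {τ : ℕ → ℕ} {S : List ℕ} (hw : n * n * (N + 1) + 1 < 2 ^ w)
    (hP : Params n R M N ε W₀ σ) {p u m k fr : ℕ} {W : ℝ} (hR : Regs p u m W fr σ)
    (hp : p < N) (hn : 0 < n) (h34 : σ.words 34 0 = k) (hτ : σ.words 4 = τ)
    (hmark : ∀ k, σ.words 10 k = if k ∈ S then 1 else 0) :
    Runs w follow σ fun σ' =>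
      Regs (p + 1) (nextState n τ k).1 (nextState n τ k).2 (discount τ ε k * W)
        (if k ∈ S then 1 else fr) σ' := by
  have h0 := hP.n
  have h31 := hR.p
  have hpw : p + 1 < 2 ^ w := by
    have := Nat.mul_le_mul_right (N + 1) (Nat.mul_pos hn hn)
    omega
  have h1 : 1 % 2 ^ w = 1 := Nat.mod_eq_of_lt (by omega)
  have he := hP.ε
  have hW := hR.W
  unfold follow
  refine Runs.seq (Runs.mono (Q := fun σ₁ => σ₁ = σ.setWord 30 0 (if k ∈ S then 1 else fr)) ?_ ?_)
  · by_cases hk : k ∈ S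
    · refine Runs.ite_pos (by simp [BExp.Holds, WExp.eval, h34, hmark, hk]) ?_
      exact Runs.wset 0 1 (by simp [WExp.eval]) (by simp [WExp.eval, h1]) (by simp [hk])
    · refine Runs.ite_neg (by simp [BExp.Holds, WExp.eval, h34, hmark, hk]) (Runs.skip ?_)
      rw [if_neg hk, ← hR.fr]
      unfold State.setWord
      simp
  · rintro σ₁ - rfl
    refine Runs.seq (Runs.mono (Q := fun σ₂ => Regs p (nextState n τ k).1 (nextState n τ k).2
        (discount τ ε k * W) (if k ∈ S then 1 else fr) σ₂) ?_ ?_)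
    · by_cases hk : τ k = 0
      · refine Runs.ite_neg
          (by simp [BExp.Holds, WExp.eval, State.setWord_words, h34, hτ, hk]) ?_
        refine Runs.seq (Runs.wset 0 (k / n) (by simp [WExp.eval])
          (by simp [WExp.eval, State.setWord_words, h34, h0]) ?_)
        refine Runs.wset 0 (k % n) (by simp [WExp.eval])
          (by simp [WExp.eval, State.setWord_words, h34, h0]) ?_
        constructor <;> simp [State.setWord_words, h31, nextState, hk, discount, hW]
      · refine Runs.ite_pos
          (by simp [BExp.Holds, WExp.eval, State.setWord_words, h34, hτ]; omega) ?_
        refine Runs.seq (Runs.wset 0 (τ k - 1) (by simp [WExp.eval])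
          (by simp [WExp.eval, State.setWord_words, h34, hτ, h1]) ?_)
        refine Runs.seq (Runs.wset 0 n (by simp [WExp.eval])
          (by simp [WExp.eval, State.setWord_words, h0]) ?_)
        refine Runs.rset 0 (W * (1 - ε)) (by simp [WExp.eval])
          (by simp [RExp.eval, WExp.eval, hW, he, h1]) ?_
        constructor <;> simp [State.setWord_words, State.setReal_reals_apply, h31, nextState, hk,
          discount, mul_comm]
    · rintro σ₂ - hR₂
      refine runs_incV hR₂.p hpw ?_
      constructor <;> simp [State.setWord_words, hR₂.u, hR₂.m, hR₂.W, hR₂.fr]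

end step


/-! ## Walks -/

/-- The state of the memory while a walk is being made. -/
structure Walking (n R M N : ℕ) (ε W₀ : ℝ) (τ : ℕ → ℕ) (S : List ℕ) (σ : State) : Prop where
  params : Params n R M N ε W₀ σ
  mem : Mem n N σ
  table : σ.words 4 = τ
  mark : ∀ k, σ.words 10 k = if k ∈ S then 1 else 0

/-- The cells of an array from `p` on contain the entries of the list. -/
def Seg {β : Type*} (f : ℕ → β) : ℕ → List β → Prop
  | _, [] => True
  | p, x :: l => f p = x ∧ Seg f (p + 1) l

theorem Seg.congr {β : Type*} {f g : ℕ → β} {p : ℕ} {l : List β} (h : Seg f p l)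
    (hfg : ∀ q, p ≤ q → q < p + l.length → g q = f q) : Seg g p l := by
  induction l generalizing p with
  | nil => trivial
  | cons x l ih =>
    rw [List.length_cons] at hfg
    exact ⟨(hfg p le_rfl (by omega)).trans h.1, ih h.2 fun q h1 h2 => hfg q (by omega) (by omega)⟩

/-- The contributions of the draws of a walk, where `m` is the second component of its initial
state, and `W` is its initial weight. -/
noncomputable def weights (n : ℕ) (τ : ℕ → ℕ) (ε : ℝ) : ℕ → ℝ → List ℕ → List ℝ
  | _, _, [] => []
  | m, W, k :: l => (if m = n then W else 0) ::
      weights n τ ε (nextState n τ k).2 (discount τ ε k * W) l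

theorem length_weights (n : ℕ) (τ : ℕ → ℕ) (ε : ℝ) (m : ℕ) (W : ℝ) (l : List ℕ) :
    (weights n τ ε m W l).length = l.length := by
  induction l generalizing m W with
  | nil => rfl
  | cons k l ih => simp [weights, ih]

/-- A rough bound on states that needs only `τ k ≤ n`; it keeps indices in range without reference
to the graph. -/
theorem nextState_lt {n : ℕ} {τ : ℕ → ℕ} (hτ : ∀ k, τ k ≤ n) {k : ℕ} (hk : k < n * n) :
    (nextState n τ k).1 < n ∧ (nextState n τ k).2 ≤ n := by
  have hn : 0 < n := Nat.pos_of_ne_zero (by rintro rfl; simp at hk)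
  unfold nextState
  split_ifs with h
  · exact ⟨Nat.div_lt_of_lt_mul hk, (Nat.mod_lt _ hn).le⟩
  · have := hτ k
    exact ⟨by dsimp only; omega, le_rfl⟩

section walks

variable {w n R M N : ℕ} {ε W₀ : ℝ} {τ : ℕ → ℕ} {S : List ℕ} {σ : State}

theorem Samples.timed {β : Type*} {P : Prog} {B : ℕ} {μ : PMF β} {Q : β → State → Prop}
    (hP : P.LoopFree) (h : Samples w P σ B μ Q) : Samples w P σ P.staticCost μ Q := by
  unfold Samples Smp at *
  exact Cpl.mono h fun b r _ hr hbr => ⟨cost_le_staticCost w P hP σ r hr, hbr.2⟩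

theorem runs_useDraw (hw : n * n * (N + 1) + 1 < 2 ^ w) (hI : Walking n R M N ε W₀ τ S σ)
    {p u m s fr : ℕ} {W : ℝ} (hR : Regs p u m W fr σ) (hp : p < N) (hu : u < n) (hm : m ≤ n)
    (h35 : σ.words 35 0 = s) (hs : s < n) :
    Runs w useDraw σ fun σ' => Walking n R M N ε W₀ τ S σ' ∧
      Regs (p + 1) (nextState n τ (u * n + s)).1 (nextState n τ (u * n + s)).2
        (discount τ ε (u * n + s) * W) (if u * n + s ∈ S then 1 else fr) σ' ∧
      σ'.words 6 = Function.update (σ.words 6) p (u * n + s) ∧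
      σ'.reals 2 = Function.update (σ.reals 2) p (if m = n then W else 0) := by
  have hk : u * n + s < n * n := key_lt hu hs
  set k := u * n + s with hkdef
  have hnn : n * n < 2 ^ w := by
    rw [Nat.mul_succ] at hw
    omega
  have m1 : u * n % 2 ^ w = u * n := Nat.mod_eq_of_lt (by omega)
  have m2 : (u * n + s) % 2 ^ w = u * n + s := Nat.mod_eq_of_lt (by omega)
  unfold useDraw
  refine Runs.seq (Runs.mono (Q := fun σ₁ => σ₁.words 34 0 = k) ?_ fun σ₁ hA₁ h34 => ?_)
  · refine Runs.wset 0 k (by simp [WExp.eval]) ?_ (by simp [State.setWord_words])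
    simp [WExp.eval, hR.u, hI.params.n, h35, m1, m2, hkdef]
  have hP₁ : Params n R M N ε W₀ σ₁ := hI.params.of_eq (hA₁.1 _ (by decide)) (hA₁.1 _ (by decide))
    (hA₁.1 _ (by decide)) (hA₁.1 _ (by decide)) (hA₁.2 _ (by decide)) (hA₁.2 _ (by decide))
  have e6 : σ₁.words 6 = σ.words 6 := hA₁.1 6 (by decide)
  have hI₁ : Index N (Finset.range N) (σ₁.words 6) (σ₁.words 7) (σ₁.words 8) (σ₁.words 9) := by
    rw [e6, hA₁.1 7 (by decide), hA₁.1 8 (by decide), hA₁.1 9 (by decide)]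
    exact hI.mem.index
  have h31 : σ₁.words 31 0 = p := by rw [hA₁.1 31 (by decide)]; exact hR.p
  refine Runs.seq (Runs.mono (runs_rekeyIndex hw hP₁ hI₁ (by rw [e6]; exact hI.mem.key_lt) hp h31
    h34 hk) ?_)
  rintro σ₂ hA₂ ⟨hI₂, e6₂, h36⟩
  have hP₂ : Params n R M N ε W₀ σ₂ := hP₁.of_eq (hA₂.1 _ (by decide)) (hA₂.1 _ (by decide))
    (hA₂.1 _ (by decide)) (hA₂.1 _ (by decide)) (hA₂.2 _ (by decide)) (hA₂.2 _ (by decide))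
  have hR₂ : Regs p u m W fr σ₂ := by
    constructor
    · rw [hA₂.1 31 (by decide), h31]
    · rw [hA₂.1 32 (by decide), hA₁.1 32 (by decide), hR.u]
    · rw [hA₂.1 33 (by decide), hA₁.1 33 (by decide), hR.m]
    · rw [hA₂.2 5 (by decide), hA₁.2 5 (by decide), hR.W]
    · rw [hA₂.1 30 (by decide), hA₁.1 30 (by decide), hR.fr]
  have h34₂ : σ₂.words 34 0 = k := by rw [hA₂.1 34 (by decide), h34]
  rw [e6] at e6₂ h36
  refine Runs.seq (Runs.mono (runs_rekeyValue hP₂ hR₂ hm h34₂ h36) ?_)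
  rintro σ₃ hA₃ ⟨e2, e1⟩
  have r2 : σ₂.reals 2 = σ.reals 2 := (hA₂.2 2 (by decide)).trans (hA₁.2 2 (by decide))
  have r1 : σ₂.reals 1 = σ.reals 1 := (hA₂.2 1 (by decide)).trans (hA₁.2 1 (by decide))
  rw [r2] at e2
  rw [r1, r2] at e1
  have hP₃ : Params n R M N ε W₀ σ₃ := hP₂.of_eq (hA₃.1 _ (by decide)) (hA₃.1 _ (by decide))
    (hA₃.1 _ (by decide)) (hA₃.1 _ (by decide)) (hA₃.2 _ (by decide)) (hA₃.2 _ (by decide))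
  have hR₃ : Regs p u m W fr σ₃ := by
    constructor
    · rw [hA₃.1 31 (by decide), hR₂.p]
    · rw [hA₃.1 32 (by decide), hR₂.u]
    · rw [hA₃.1 33 (by decide), hR₂.m]
    · rw [hA₃.2 5 (by decide), hR₂.W]
    · rw [hA₃.1 30 (by decide), hR₂.fr]
  have e6₃ : σ₃.words 6 = Function.update (σ.words 6) p k := (hA₃.1 6 (by decide)).trans e6₂
  have hτ₃ : σ₃.words 4 = τ := (hA₃.1 4 (by decide)).trans
    ((hA₂.1 4 (by decide)).trans ((hA₁.1 4 (by decide)).trans hI.table))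
  have hmark₃ : ∀ k, σ₃.words 10 k = if k ∈ S then 1 else 0 := by
    rw [hA₃.1 10 (by decide), hA₂.1 10 (by decide), hA₁.1 10 (by decide)]
    exact hI.mark
  have hmem₃ : Mem n N σ₃ := by
    constructor
    · rw [hA₃.1 6 (by decide), hA₃.1 7 (by decide), hA₃.1 8 (by decide), hA₃.1 9 (by decide)]
      exact hI₂
    · intro q hq
      rw [e6₃, Function.update_apply]
      split_ifs
      · exact hk
      · exact hI.mem.key_lt q hq
    · intro v
      rw [e1, e6₃, e2, sum_update hp, hI.mem.out]
  refine Runs.mono (runs_follow hw hP₃ hR₃ hp (by omega)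
    ((congrFun (hA₃.1 34 (by decide)) 0).trans h34₂) hτ₃ hmark₃) fun σ₄ hA₄ hR₄ => ?_
  refine ⟨⟨?_, ?_, ?_, ?_⟩, hR₄, ?_, ?_⟩
  · exact hP₃.of_eq (hA₄.1 _ (by decide)) (hA₄.1 _ (by decide))
      (hA₄.1 _ (by decide)) (hA₄.1 _ (by decide)) (hA₄.2 _ (by decide)) (hA₄.2 _ (by decide))
  · constructor
    · rw [hA₄.1 6 (by decide), hA₄.1 7 (by decide), hA₄.1 8 (by decide), hA₄.1 9 (by decide)]
      exact hmem₃.index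
    · rw [hA₄.1 6 (by decide)]
      exact hmem₃.key_lt
    · rw [hA₄.1 6 (by decide), hA₄.2 1 (by decide), hA₄.2 2 (by decide)]
      exact hmem₃.out
  · rw [hA₄.1 4 (by decide), hτ₃]
  · rw [hA₄.1 10 (by decide)]
    exact hmark₃
  · rw [hA₄.1 6 (by decide), e6₃]
  · rw [hA₄.2 2 (by decide), e2]

theorem samples_draw (hw : n * n * (N + 1) + 1 < 2 ^ w) (hI : Walking n R M N ε W₀ τ S σ)
    {p u m fr : ℕ} {W : ℝ} (hR : Regs p u m W fr σ) (hp : p < N) (hu : u < n) (hm : m ≤ n) :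
    Samples w draw σ draw.staticCost (unifPMF m) fun s σ' => s < n ∧
      Walking n R M N ε W₀ τ S σ' ∧
      Regs (p + 1) (nextState n τ (u * n + s)).1 (nextState n τ (u * n + s)).2
        (discount τ ε (u * n + s) * W) (if u * n + s ∈ S then 1 else fr) σ' ∧
      σ'.words 6 = Function.update (σ.words 6) p (u * n + s) ∧
      σ'.reals 2 = Function.update (σ.reals 2) p (if m = n then W else 0) := by
  have hfree : useDraw.LoopFree := by
    simp [useDraw, rekeyIndex, rekeyValue, follow, Prog.LoopFree]
  refine Samples.timed (B := ((WExp.lit 0).cost + (V 33).cost + 1) + useDraw.staticCost)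
    ⟨trivial, hfree⟩ ?_
  refine Samples.seq_right (Samples.mono (Samples.unif 0 m (by simp [WExp.eval])
    (by simp [WExp.eval, hR.m])) le_rfl (Q' := fun s σ' => s < n ∧ σ' = σ.setWord 35 0 s)
    fun s σ' hs _ h => ⟨?_, h⟩) ?_
  -- For `m = 0` the machine returns `0`. This state does not occur for a slot table, but the range
  -- bounds used here do not exclude it.
  · rcases Nat.eq_zero_or_pos m with h0 | h0
    · subst h0
      simp only [unifPMF, PMF.mem_support_pure_iff] at hs
      omega
    · exact lt_of_lt_of_le (mem_support_unif h0 hs) hm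
  · rintro s _ ⟨hs, rfl⟩
    have hI' : Walking n R M N ε W₀ τ S (σ.setWord 35 0 s) :=
      ⟨hI.params.of_eq rfl rfl rfl rfl rfl rfl, ⟨hI.mem.index, hI.mem.key_lt, hI.mem.out⟩,
        hI.table, hI.mark⟩
    have hR' : Regs p u m W fr (σ.setWord 35 0 s) := ⟨hR.p, hR.u, hR.m, hR.W, hR.fr⟩
    refine ((runs_useDraw hw hI' hR' hp hu hm (by simp [State.setWord_words]) hs).timed
      hfree).mono le_rfl fun σ' _ h => ⟨hs, h⟩

theorem runs_keep (hw : n * n * (N + 1) + 1 < 2 ^ w) (hI : Walking n R M N ε W₀ τ S σ)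
    {p u m fr k : ℕ} {W : ℝ} (hR : Regs p u m W fr σ) (hp : p < N) (hn : 0 < n)
    (hk : σ.words 6 p = k) :
    RunsT w keep σ keep.staticCost fun σ' => Walking n R M N ε W₀ τ S σ' ∧
      Regs (p + 1) (nextState n τ k).1 (nextState n τ k).2
        (discount τ ε k * W) (if k ∈ S then 1 else fr) σ' ∧
      σ'.words 6 = σ.words 6 ∧ σ'.reals 2 = σ.reals 2 := by
  refine Runs.timed (by simp [keep, follow, Prog.LoopFree]) ?_
  unfold keep
  refine Runs.seq (Runs.mono (Q := fun σ₁ => σ₁.words 34 0 = k) ?_ fun σ₁ hA₁ h34 => ?_)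
  · exact Runs.wset 0 k (by simp [WExp.eval]) (by simp [WExp.eval, hR.p, hk])
      (by simp [State.setWord_words])
  have hP₁ : Params n R M N ε W₀ σ₁ := hI.params.of_eq (hA₁.1 _ (by decide)) (hA₁.1 _ (by decide))
    (hA₁.1 _ (by decide)) (hA₁.1 _ (by decide)) (hA₁.2 _ (by decide)) (hA₁.2 _ (by decide))
  have hR₁ : Regs p u m W fr σ₁ := by
    constructor
    · rw [hA₁.1 31 (by decide), hR.p]
    · rw [hA₁.1 32 (by decide), hR.u]
    · rw [hA₁.1 33 (by decide), hR.m]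
    · rw [hA₁.2 5 (by decide), hR.W]
    · rw [hA₁.1 30 (by decide), hR.fr]
  refine Runs.mono (runs_follow hw hP₁ hR₁ hp hn h34 ((hA₁.1 4 (by decide)).trans hI.table)
    (by rw [hA₁.1 10 (by decide)]; exact hI.mark)) fun σ₂ hA₂ hR₂ => ?_
  have e : ∀ a, a ∉ (setV 34 (.get 6 (V 31))).wordTargets → a ∉ follow.wordTargets →
    σ₂.words a = σ.words a := fun a ha ha' => (hA₂.1 a ha').trans (hA₁.1 a ha)
  have er : ∀ a, a ∉ follow.realTargets → σ₂.reals a = σ.reals a :=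
    fun a ha' => (hA₂.2 a ha').trans (hA₁.2 a (by simp [Prog.realTargets]))
  have e6 := e 6 (by decide) (by decide)
  have e7 := e 7 (by decide) (by decide)
  have e8 := e 8 (by decide) (by decide)
  have e9 := e 9 (by decide) (by decide)
  refine ⟨⟨?_, ⟨?_, ?_, ?_⟩, ?_, ?_⟩, hR₂, e6, er 2 (by decide)⟩
  · exact hP₁.of_eq (hA₂.1 _ (by decide)) (hA₂.1 _ (by decide))
      (hA₂.1 _ (by decide)) (hA₂.1 _ (by decide)) (hA₂.2 _ (by decide)) (hA₂.2 _ (by decide))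
  · rw [e6, e7, e8, e9]
    exact hI.mem.index
  · rw [e6]
    exact hI.mem.key_lt
  · rw [e6, er 1 (by decide), er 2 (by decide)]
    exact hI.mem.out
  · rw [e 4 (by decide) (by decide), hI.table]
  · rw [e 10 (by decide) (by decide)]
    exact hI.mark

/-- The iterations of a loop that repeats the program `P`. -/
noncomputable def repLaw (w : ℕ) (P : Prog) (L : ℕ) (σ : State) : PMF (State × ℕ) :=
  iter (BExp.tt.cost + 1) (BExp.tt.Holds w) (exec w P) L σ

theorem Smp.repLaw_zero {β : Type*} {P : Prog} {b : β} {Q : β → State → Prop} (h : Q b σ) :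
    Smp (repLaw w P 0 σ) 1 (PMF.pure b) Q := Det.smp ⟨σ, 1, rfl, le_rfl, h⟩

theorem Smp.repLaw_succ {β γ : Type*} {P : Prog} {L B B' : ℕ} {μ : PMF β} {κ : β → PMF γ}
    {Q : β → State → Prop} {Q' : γ → State → Prop} (h : Samples w P σ B μ Q)
    (h' : ∀ b σ', Q b σ' → Smp (repLaw w P L σ') B' (κ b) Q') :
    Smp (repLaw w P (L + 1) σ) (B + B' + 5) (μ.bind κ) Q' := by
  have := (Smp.andThen h h').charge (BExp.tt.cost + 1)
  unfold repLaw
  rw [iter, if_pos (BExp.holds_tt w σ)]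
  exact this

theorem Samples.rep {β : Type*} {P : Prog} {k : WExp} {m B : ℕ} {μ : PMF β}
    {Q : β → State → Prop} (hk : k.eval w σ = m) (h : Smp (repLaw w P m σ) B μ Q) :
    Samples w (.rep k P) σ (B + (k.cost + 1)) μ Q := by
  unfold Samples Prog.rep
  simp only [exec, hk]
  exact h.charge _

/-- The array cells outside of a segment are the same. -/
def SameOff {β : Type*} (f g : ℕ → β) (p L : ℕ) : Prop := ∀ q, q < p ∨ p + L ≤ q → g q = f q

theorem SameOff.cons {β : Type*} {f g h : ℕ → β} {p L : ℕ} (h1 : ∀ q, q ≠ p → g q = f q)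
    (h2 : SameOff g h (p + 1) L) : SameOff f h p (L + 1) := fun q hq => by
  rw [h2 q (by omega), h1 q (by omega)]

/-- With the flag raised the loop follows the recursion of `walkLaw` literally. -/
theorem samples_fresh (hw : n * n * (N + 1) + 1 < 2 ^ w) (hτ : ∀ k, τ k ≤ n) (L : ℕ)
    (hI : Walking n R M N ε W₀ τ S σ) {p u m : ℕ} {W : ℝ} (hR : Regs p u m W 1 σ)
    (hp : p + L ≤ N) (hu : u < n) (hm : m ≤ n) :
    Smp (repLaw w walkStep L σ) (L * 400 + 1) (walkLaw n τ L (u, m)) fun l σ' =>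
      Walking n R M N ε W₀ τ S σ' ∧ Seg (σ'.words 6) p l ∧
      Seg (σ'.reals 2) p (weights n τ ε m W l) ∧
      SameOff (σ.words 6) (σ'.words 6) p L ∧ SameOff (σ.reals 2) (σ'.reals 2) p L := by
  induction L generalizing σ p u m W with
  | zero => exact Smp.repLaw_zero ⟨hI, trivial, trivial, fun _ _ => rfl, fun _ _ => rfl⟩
  | succ L ih =>
    have hstep : Samples w walkStep σ 395 (unifPMF m) fun s σ' => s < n ∧
        Walking n R M N ε W₀ τ S σ' ∧
        Regs (p + 1) (nextState n τ (u * n + s)).1 (nextState n τ (u * n + s)).2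
          (discount τ ε (u * n + s) * W) 1 σ' ∧
        σ'.words 6 = Function.update (σ.words 6) p (u * n + s) ∧
        σ'.reals 2 = Function.update (σ.reals 2) p (if m = n then W else 0) := by
      unfold walkStep
      refine Samples.mono (Samples.ite (fun _ => samples_draw hw hI hR (by omega) hu hm) ?_)
        (by decide) ?_
      · intro h
        simp [BExp.Holds, WExp.eval, hR.fr] at h
      · rintro s σ' - - ⟨h1, h2, h3, h4, h5⟩
        exact ⟨h1, h2, by simpa using h3, h4, h5⟩
    refine (Smp.repLaw_succ (B' := L * 400 + 1) (κ := fun s =>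
      (walkLaw n τ L (nextState n τ (u * n + s))).map fun l => (u * n + s) :: l) hstep ?_).mono
      (by omega) fun l σ' _ h => h
    rintro s σ₁ ⟨hs, hI₁, hR₁, e6, e2⟩
    have hlt := nextState_lt hτ (key_lt hu hs)
    refine Smp.map _ (ih hI₁ hR₁ (by omega) hlt.1 hlt.2) ?_
    rintro l σ₂ ⟨hI₂, hk, hwt, s6, s2⟩
    refine ⟨hI₂, ⟨?_, hk⟩, ⟨?_, hwt⟩, SameOff.cons (fun q hq => ?_) s6,
      SameOff.cons (fun q hq => ?_) s2⟩
    · rw [s6 p (Or.inl (by omega)), e6, Function.update_self]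
    · rw [s2 p (Or.inl (by omega)), e2, Function.update_self]
    · rw [e6, Function.update_of_ne hq]
    · rw [e2, Function.update_of_ne hq]

/-- Before the first marked key the old and new tables agree along the walk, so the stored keys and
contributions are already those for `τ`. At that key itself the contribution depends only on the
state before it, so it too may be kept. From there on `samples_fresh` takes over. -/
theorem samples_redo (hw : n * n * (N + 1) + 1 < 2 ^ w) (hτ : ∀ k, τ k ≤ n) {τ₀ : ℕ → ℕ}
    (hS : ∀ k, k ∉ S → τ₀ k = τ k) (l₀ : List ℕ)
    (hI : Walking n R M N ε W₀ τ S σ) {p u m : ℕ} {W : ℝ} (hR : Regs p u m W 0 σ)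
    (hp : p + l₀.length ≤ N) (hn : 0 < n) (hk : Seg (σ.words 6) p l₀)
    (hwt : Seg (σ.reals 2) p (weights n τ₀ ε m W l₀)) :
    Smp (repLaw w walkStep l₀.length σ) (l₀.length * 400 + 1) (resample n τ S l₀) fun l σ' =>
      Walking n R M N ε W₀ τ S σ' ∧ Seg (σ'.words 6) p l ∧
      Seg (σ'.reals 2) p (weights n τ ε m W l) ∧
      SameOff (σ.words 6) (σ'.words 6) p l₀.length ∧
      SameOff (σ.reals 2) (σ'.reals 2) p l₀.length := by
  induction l₀ generalizing σ p u m W with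
  | nil => exact Smp.repLaw_zero ⟨hI, trivial, trivial, fun _ _ => rfl, fun _ _ => rfl⟩
  | cons k l₀ ih =>
    obtain ⟨hk1, hk2⟩ := hk
    obtain ⟨hw1, hw2⟩ := hwt
    rw [List.length_cons] at hp ⊢
    have hstep : Samples w walkStep σ 395 (PMF.pure k) fun _ σ' => Walking n R M N ε W₀ τ S σ' ∧
        Regs (p + 1) (nextState n τ k).1 (nextState n τ k).2
          (discount τ ε k * W) (if k ∈ S then 1 else 0) σ' ∧
        σ'.words 6 = σ.words 6 ∧ σ'.reals 2 = σ.reals 2 := by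
      unfold walkStep
      refine Samples.mono (Samples.ite (B := keep.staticCost) ?_ fun _ =>
        (runs_keep hw hI hR (by omega) hn hk1).samples) (by decide) fun _ _ _ _ h => h
      intro h
      simp [BExp.Holds, WExp.eval, hR.fr] at h
    have hlt := nextState_lt hτ (hk1 ▸ hI.mem.key_lt p (by omega))
    rw [resample]
    by_cases hkS : k ∈ S
    · rw [if_pos hkS]
      rw [← PMF.pure_bind k fun _ => PMF.map _ _]
      refine (Smp.repLaw_succ (B' := l₀.length * 400 + 1) hstep ?_).mono (by omega)
        fun l σ' _ h => h
      rintro _ σ₁ ⟨hI₁, hR₁, e6, e2⟩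
      rw [if_pos hkS] at hR₁
      refine Smp.map _ (samples_fresh hw hτ l₀.length hI₁ hR₁ (by omega) hlt.1 hlt.2) ?_
      rintro l σ₂ ⟨hI₂, hk, hwt, s6, s2⟩
      refine ⟨hI₂, ⟨?_, hk⟩, ⟨?_, hwt⟩, SameOff.cons (fun q hq => ?_) s6,
        SameOff.cons (fun q hq => ?_) s2⟩
      · rw [s6 p (Or.inl (by omega)), e6, hk1]
      · rw [s2 p (Or.inl (by omega)), e2, hw1]
      · rw [e6]
      · rw [e2]
    · rw [if_neg hkS]
      rw [← PMF.pure_bind k fun _ => PMF.map _ _]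
      refine (Smp.repLaw_succ (B' := l₀.length * 400 + 1) hstep ?_).mono (by omega)
        fun l σ' _ h => h
      rintro _ σ₁ ⟨hI₁, hR₁, e6, e2⟩
      rw [if_neg hkS] at hR₁
      have hd : discount τ₀ ε k = discount τ ε k := by unfold discount; rw [hS k hkS]
      have hnx : nextState n τ₀ k = nextState n τ k := by unfold nextState; rw [hS k hkS]
      rw [hd, hnx] at hw2
      refine Smp.map _ (ih hI₁ hR₁ (by omega) (by rw [e6]; exact hk2) (by rw [e2]; exact hw2)) ?_
      rintro l σ₂ ⟨hI₂, hk, hwt, s6, s2⟩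
      refine ⟨hI₂, ⟨?_, hk⟩, ⟨?_, hwt⟩, SameOff.cons (fun q hq => ?_) s6,
        SameOff.cons (fun q hq => ?_) s2⟩
      · rw [s6 p (Or.inl (by omega)), e6, hk1]
      · rw [s2 p (Or.inl (by omega)), e2, hw1]
      · rw [e6]
      · rw [e2]

end walks


/-! ## Families of walks -/

/-- The stored walk `i`. -/
structure HasWalk (n M : ℕ) (ε W₀ : ℝ) (τ : ℕ → ℕ) (i : ℕ) (l : List ℕ) (σ : State) : Prop where
  length : l.length = M
  keys : Seg (σ.words 6) (i * M) l
  weights : Seg (σ.reals 2) (i * M) (weights n τ ε n W₀ l)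

/-- Contributions depend on the table only through the keys of the walk, so walks without altered
keys need no work. -/
theorem weights_congr {n : ℕ} {τ τ' : ℕ → ℕ} {ε : ℝ} (l : List ℕ) (h : ∀ k ∈ l, τ k = τ' k) (m : ℕ)
    (W : ℝ) : weights n τ ε m W l = weights n τ' ε m W l := by
  induction l generalizing m W with
  | nil => rfl
  | cons k l ih =>
    have hk := h k (by simp)
    have hd : discount τ ε k = discount τ' ε k := by unfold discount; rw [hk]
    have hnx : nextState n τ k = nextState n τ' k := by unfold nextState; rw [hk]
    rw [weights, weights, hd, hnx, ih fun k hk => h k (by simp [hk])]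

theorem HasWalk.of_sameOff {n M : ℕ} {ε W₀ : ℝ} {τ : ℕ → ℕ} {i j : ℕ} {l : List ℕ} {σ σ' : State}
    (h : HasWalk n M ε W₀ τ j l σ) (hij : j ≠ i)
    (h6 : SameOff (σ.words 6) (σ'.words 6) (i * M) M)
    (h2 : SameOff (σ.reals 2) (σ'.reals 2) (i * M) M) : HasWalk n M ε W₀ τ j l σ' := by
  have key : ∀ q, j * M ≤ q → q < j * M + M → q < i * M ∨ i * M + M ≤ q := by
    intro q h1 h2
    rcases Nat.lt_or_gt_of_ne hij with h | h
    · have := Nat.mul_le_mul_right M h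
      rw [Nat.succ_mul] at this
      omega
    · have := Nat.mul_le_mul_right M h
      rw [Nat.succ_mul] at this
      omega
  refine ⟨h.length, h.keys.congr fun q h1 h3 => h6 q ?_, h.weights.congr fun q h1 h3 => h2 q ?_⟩
  · rw [h.length] at h3
    exact key q h1 h3
  · rw [length_weights, h.length] at h3
    exact key q h1 h3

theorem HasWalk.of_eq {n M : ℕ} {ε W₀ : ℝ} {τ : ℕ → ℕ} {i : ℕ} {l : List ℕ} {σ σ' : State}
    (h : HasWalk n M ε W₀ τ i l σ) (h6 : σ'.words 6 = σ.words 6) (h2 : σ'.reals 2 = σ.reals 2) :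
    HasWalk n M ε W₀ τ i l σ' := by
  obtain ⟨a, b, c⟩ := h
  exact ⟨a, by rw [h6]; exact b, by rw [h2]; exact c⟩

theorem Walking.of_eq {n R M N : ℕ} {ε W₀ : ℝ} {τ : ℕ → ℕ} {S : List ℕ} {σ σ' : State}
    (h : Walking n R M N ε W₀ τ S σ)
    (hw : ∀ a ∈ [0, 4, 6, 7, 8, 9, 10, 13, 14, 15], σ'.words a = σ.words a)
    (hr : ∀ a ∈ [0, 1, 2, 6], σ'.reals a = σ.reals a) : Walking n R M N ε W₀ τ S σ' := by
  refine ⟨h.params.of_eq (hw _ (by simp)) (hw _ (by simp)) (hw _ (by simp)) (hw _ (by simp))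
    (hr _ (by simp)) (hr _ (by simp)), ⟨?_, ?_, ?_⟩, ?_, ?_⟩
  · rw [hw 6 (by simp), hw 7 (by simp), hw 8 (by simp), hw 9 (by simp)]
    exact h.mem.index
  · rw [hw 6 (by simp)]
    exact h.mem.key_lt
  · rw [hw 6 (by simp), hr 1 (by simp), hr 2 (by simp)]
    exact h.mem.out
  · rw [hw 4 (by simp)]
    exact h.table
  · rw [hw 10 (by simp)]
    exact h.mark

section family

variable {w n R M N : ℕ} {ε W₀ : ℝ} {τ : ℕ → ℕ} {S : List ℕ} {σ : State}

theorem runs_walkStart (hw : N < 2 ^ w) (hI : Walking n R M N ε W₀ τ S σ)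
    {i fr : ℕ} (hi : i * M ≤ N) (h29 : σ.words 29 0 = i) (h30 : σ.words 30 0 = fr) :
    RunsT w walkStart σ walkStart.staticCost fun σ' => Walking n R M N ε W₀ τ S σ' ∧
      Regs (i * M) (i % n) n W₀ fr σ' ∧ σ'.words 6 = σ.words 6 ∧ σ'.reals 2 = σ.reals 2 := by
  refine Runs.timed (by simp [walkStart, Prog.LoopFree]) ?_
  have hP := hI.params
  have m1 : i * M % 2 ^ w = i * M := Nat.mod_eq_of_lt (by omega)
  refine Runs.mono (Q := Regs (i * M) (i % n) n W₀ fr) ?_ fun σ' hA hR =>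
    ⟨hI.of_eq (fun a ha => hA.1 a ?_) (fun a ha => hA.2 a ?_), hR, hA.1 6 (by decide),
      hA.2 2 (by decide)⟩
  · unfold walkStart
    refine Runs.seq (Runs.wset 0 (i * M) (by simp [WExp.eval])
      (by simp [WExp.eval, h29, hP.M, m1]) ?_)
    refine Runs.seq (Runs.wset 0 (i % n) (by simp [WExp.eval])
      (by simp [WExp.eval, State.setWord_words, h29, hP.n]) ?_)
    refine Runs.seq (Runs.wset 0 n (by simp [WExp.eval])
      (by simp [WExp.eval, State.setWord_words, hP.n]) ?_)
    refine Runs.rset 0 W₀ (by simp [WExp.eval]) (by simp [RExp.eval, WExp.eval, hP.W₀]) ?_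
    constructor <;> simp [State.setWord_words, State.setReal_reals_apply, h30]
  · revert a; decide
  · revert a; decide

theorem samples_walk_fresh (hw : n * n * (N + 1) + 1 < 2 ^ w) (hn : 0 < n) (hτ : ∀ k, τ k ≤ n)
    (hI : Walking n R M N ε W₀ τ S σ)
    {i : ℕ} (hi : i * M + M ≤ N) (h29 : σ.words 29 0 = i) (h30 : σ.words 30 0 = 1) :
    Samples w walk σ (M * 400 + 100) (walkLaw n τ M (i % n, n)) fun l σ' =>
      Walking n R M N ε W₀ τ S σ' ∧ HasWalk n M ε W₀ τ i l σ' ∧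
      SameOff (σ.words 6) (σ'.words 6) (i * M) M ∧
      SameOff (σ.reals 2) (σ'.reals 2) (i * M) M := by
  have hNw : N < 2 ^ w := by
    have := Nat.mul_le_mul_right (N + 1) (Nat.mul_pos hn hn)
    omega
  have hB : walkStart.staticCost + (M * 400 + 1 + ((V 14).cost + 1)) ≤ M * 400 + 100 := by
    have : walkStart.staticCost + ((V 14).cost + 2) ≤ 100 := by decide
    omega
  refine Samples.mono (Samples.seq_left (RunsT.mono (runs_walkStart hNw hI (by omega) h29 h30)
    le_rfl ?_)) hB (Q := fun l σ' => Walking n R M N ε W₀ τ S σ' ∧ Seg (σ'.words 6) (i * M) l ∧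
      Seg (σ'.reals 2) (i * M) (weights n τ ε n W₀ l) ∧
      SameOff (σ.words 6) (σ'.words 6) (i * M) M ∧
      SameOff (σ.reals 2) (σ'.reals 2) (i * M) M)
    fun l σ' hl _ h => ⟨h.1, ⟨length_of_mem_walkLaw hl, h.2.1, h.2.2.1⟩, h.2.2.2⟩
  rintro σ₁ - ⟨hI₁, hR₁, e6, e2⟩
  refine Samples.rep (m := M) (by simp [WExp.eval, hI₁.params.M]) ?_
  rw [← e6, ← e2]
  exact samples_fresh hw hτ M hI₁ hR₁ hi (Nat.mod_lt _ hn) le_rfl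

theorem samples_walk_redo (hw : n * n * (N + 1) + 1 < 2 ^ w) (hn : 0 < n) (hτ : ∀ k, τ k ≤ n)
    {τ₀ : ℕ → ℕ} (hS : ∀ k, k ∉ S → τ₀ k = τ k) {l₀ : List ℕ}
    (hI : Walking n R M N ε W₀ τ S σ)
    {i : ℕ} (hi : i * M + M ≤ N) (hl : HasWalk n M ε W₀ τ₀ i l₀ σ)
    (h29 : σ.words 29 0 = i) (h30 : σ.words 30 0 = 0) :
    Samples w walk σ (M * 400 + 100) (resample n τ S l₀) fun l σ' =>
      Walking n R M N ε W₀ τ S σ' ∧ HasWalk n M ε W₀ τ i l σ' ∧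
      SameOff (σ.words 6) (σ'.words 6) (i * M) M ∧
      SameOff (σ.reals 2) (σ'.reals 2) (i * M) M := by
  have hNw : N < 2 ^ w := by
    have := Nat.mul_le_mul_right (N + 1) (Nat.mul_pos hn hn)
    omega
  have hB : walkStart.staticCost + (M * 400 + 1 + ((V 14).cost + 1)) ≤ M * 400 + 100 := by
    have : walkStart.staticCost + ((V 14).cost + 2) ≤ 100 := by decide
    omega
  refine Samples.mono (Samples.seq_left (RunsT.mono (runs_walkStart hNw hI (by omega) h29 h30)
    le_rfl ?_)) hB (Q := fun l σ' => Walking n R M N ε W₀ τ S σ' ∧ Seg (σ'.words 6) (i * M) l ∧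
      Seg (σ'.reals 2) (i * M) (weights n τ ε n W₀ l) ∧
      SameOff (σ.words 6) (σ'.words 6) (i * M) M ∧
      SameOff (σ.reals 2) (σ'.reals 2) (i * M) M)
    fun l σ' hl' _ h => ⟨h.1, ⟨(length_of_mem_resample hl').trans hl.length, h.2.1, h.2.2.1⟩, h.2.2.2⟩
  rintro σ₁ - ⟨hI₁, hR₁, e6, e2⟩
  refine Samples.rep (m := M) (by simp [WExp.eval, hI₁.params.M]) ?_
  have := samples_redo hw hτ hS l₀ hI₁ hR₁ (by rw [hl.length]; exact hi) hn
    (by rw [e6]; exact hl.keys) (by rw [e2]; exact hl.weights)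
  rw [hl.length, e6, e2] at this
  exact this

/-- The walks of the family `ω` are stored; those whose index is in `l` may have contributions with
respect to an old slot table. -/
def Pending (n R M : ℕ) (ε W₀ : ℝ) (τ : ℕ → ℕ) (S : List ℕ) (l : List ℕ) (ω : ℕ → List ℕ)
    (σ : State) : Prop :=
  ∀ i < n * R, ∃ τ₀ : ℕ → ℕ, (∀ k, k ∉ S → τ₀ k = τ k) ∧ (i ∉ l → τ₀ = τ) ∧
    HasWalk n M ε W₀ τ₀ i (ω i) σ

/-- A listed walk may still carry contributions for the old table; once redone it carries those for
`τ`, and redoing it again is covered by `τ₀ = τ`. The law follows the recursion of `foldUpdate`. -/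
theorem samples_refreshLoop (hw : n * n * (N + 1) + 1 < 2 ^ w) (hn : 0 < n) (hτ : ∀ k, τ k ≤ n)
    (hN : N = n * R * M) (l : List ℕ) (hl : ∀ i ∈ l, i < n * R) {q Q : ℕ} (hQ : q + l.length ≤ Q)
    (hQw : Q < 2 ^ w) {ω : ℕ → List ℕ}
    (hI : Walking n R M N ε W₀ τ S σ) (hω : Pending n R M ε W₀ τ S l ω σ)
    (h28 : σ.words 28 0 = q) (h11 : Seg (fun q => σ.words 11 q / M) q l) :
    Smp (repLaw w refreshStep l.length σ) (l.length * (M * 400 + 200) + 1)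
      (foldUpdate (resample n τ S) l ω) fun ω' σ' =>
        Walking n R M N ε W₀ τ S σ' ∧ Pending n R M ε W₀ τ S [] ω' σ' := by
  induction l generalizing σ q ω with
  | nil =>
    exact Smp.mono (Smp.repLaw_zero (b := ω) (Q := fun ω' σ' => Walking n R M N ε W₀ τ S σ' ∧
      Pending n R M ε W₀ τ S [] ω' σ') ⟨hI, hω⟩) (by omega) fun _ _ _ h => h
  | cons i l ih =>
    have hi := hl i (by simp)
    rw [List.length_cons] at hQ ⊢
    have hstep : Samples w refreshStep σ (M * 400 + 195) (resample n τ S (ω i)) fun b σ' =>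
        Walking n R M N ε W₀ τ S σ' ∧ Pending n R M ε W₀ τ S l (Function.update ω i b) σ' ∧
        σ'.words 28 0 = q + 1 ∧ σ'.words 11 = σ.words 11 := by
      have hB : (setV 29 (.div (.get 11 (V 28)) (V 14)) ;; setV 30 (.lit 0)).staticCost +
        ((M * 400 + 100) + (incV 28).staticCost) ≤ M * 400 + 195 := by
        have : (setV 29 (.div (.get 11 (V 28)) (V 14)) ;; setV 30 (.lit 0)).staticCost +
          (incV 28).staticCost ≤ 95 := by decide
        omega
      unfold refreshStep
      refine Samples.mono (Samples.seq_left (RunsT.mono (Q := fun σ₁ => σ₁.words 29 0 = i ∧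
        σ₁.words 30 0 = 0) (Runs.timed (by simp [Prog.LoopFree]) ?_) le_rfl ?_)) hB
        fun _ _ _ _ h => h
      · refine Runs.seq (Runs.wset 0 i (by simp [WExp.eval]) ?_ ?_)
        · simp [WExp.eval, h28, hI.params.M, h11.1]
        · exact Runs.wset 0 0 (by simp [WExp.eval]) (by simp [WExp.eval])
            (by simp [State.setWord_words])
      · rintro σ₁ hA₁ ⟨h29, h30⟩
        have hI₁ : Walking n R M N ε W₀ τ S σ₁ := hI.of_eq
          (fun a ha => hA₁.1 a (by revert a; decide)) (fun a _ => hA₁.2 a (by simp [Prog.realTargets]))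
        have e6 : σ₁.words 6 = σ.words 6 := hA₁.1 6 (by decide)
        have e2 : σ₁.reals 2 = σ.reals 2 := hA₁.2 2 (by decide)
        -- `τ₀` is the table for which walk `i` was last made; it agrees with `τ` off `S`, which is
        -- all that redoing needs.
        obtain ⟨τ₀, hτ₀, -, hwalk⟩ := hω i hi
        have hiN : i * M + M ≤ N := by
          have := Nat.mul_le_mul_right M (Nat.succ_le_of_lt hi)
          rw [Nat.succ_mul] at this
          omega
        refine Samples.seq_right (Samples.mono (samples_walk_redo hw hn hτ hτ₀ hI₁ hiN
          (hwalk.of_eq e6 e2) h29 h30) le_rfl (Q' := fun b σ₂ =>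
            Walking n R M N ε W₀ τ S σ₂ ∧ Pending n R M ε W₀ τ S l (Function.update ω i b) σ₂ ∧
            σ₂.words 28 0 = q ∧ σ₂.words 11 = σ.words 11) ?_) ?_
        · rintro b σ₂ - hA₂ ⟨hI₂, hb, s6, s2⟩
          refine ⟨hI₂, fun j hj => ?_, ?_, ?_⟩
          · by_cases hji : j = i
            · subst hji
              rw [Function.update_self]
              exact ⟨τ, fun _ _ => rfl, fun _ => rfl, hb⟩
            · rw [Function.update_of_ne hji]
              obtain ⟨τ₁, h1, h2, h3⟩ := hω j hj
              exact ⟨τ₁, h1, fun h => h2 (by simp [hji, h]), (h3.of_eq e6 e2).of_sameOff hji s6 s2⟩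
          · rw [hA₂.1 28 (by decide), hA₁.1 28 (by decide), h28]
          · rw [hA₂.1 11 (by decide), hA₁.1 11 (by decide)]
        · rintro b σ₂ ⟨hI₂, hω₂, h28₂, h11₂⟩
          refine RunsT.mono (Runs.timed (by simp [Prog.LoopFree]) (runs_incV (Q := fun σ₃ =>
            σ₃.words 28 0 = q + 1) h28₂ (by omega) (by simp [State.setWord_words]))) le_rfl ?_
          intro σ₃ hA₃ h28₃
          refine ⟨hI₂.of_eq (fun a ha => hA₃.1 a (by revert a; decide))
            (fun a _ => hA₃.2 a (by simp [Prog.realTargets])), fun j hj => ?_, h28₃,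
            (hA₃.1 11 (by decide)).trans h11₂⟩
          obtain ⟨τ₁, h1, h2, h3⟩ := hω₂ j hj
          exact ⟨τ₁, h1, h2, h3.of_eq (hA₃.1 6 (by decide)) (hA₃.2 2 (by decide))⟩
    rw [foldUpdate]
    refine (Smp.repLaw_succ (B' := l.length * (M * 400 + 200) + 1) hstep ?_).mono
      (by rw [Nat.succ_mul]; omega) fun _ _ _ h => h
    rintro b σ₁ ⟨hI₁, hω₁, h28₁, h11₁⟩
    exact ih (fun j hj => hl j (by simp [hj])) (by omega) hI₁ hω₁ h28₁
      (h11.2.congr fun q _ _ => by rw [h11₁])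

theorem samples_refresh (hw : n * n * (N + 1) + 1 < 2 ^ w) (hn : 0 < n) (hτ : ∀ k, τ k ≤ n)
    (hN : N = n * R * M) (l : List ℕ) (hl : ∀ i ∈ l, i < n * R)
    (hQw : l.length < 2 ^ w) {ω : ℕ → List ℕ}
    (hI : Walking n R M N ε W₀ τ S σ) (hω : Pending n R M ε W₀ τ S l ω σ)
    (h22 : σ.words 22 0 = l.length) (h11 : Seg (fun q => σ.words 11 q / M) 0 l) :
    Samples w refresh σ (l.length * (M * 400 + 200) + 100)
      (foldUpdate (resample n τ S) l ω) fun ω' σ' =>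
        Walking n R M N ε W₀ τ S σ' ∧ Pending n R M ε W₀ τ S [] ω' σ' := by
  have hB : (setV 28 (.lit 0)).staticCost + (l.length * (M * 400 + 200) + 1 + ((V 22).cost + 1)) ≤
      l.length * (M * 400 + 200) + 100 := by
    have : (setV 28 (.lit 0)).staticCost + ((V 22).cost + 2) ≤ 100 := by decide
    omega
  unfold refresh
  refine Samples.mono (Samples.seq_left (RunsT.mono (Q := fun σ₁ => σ₁.words 28 0 = 0)
    (Runs.timed (by simp [Prog.LoopFree]) ?_) le_rfl ?_)) hB fun _ _ _ _ h => h
  · exact Runs.wset 0 0 (by simp [WExp.eval]) (by simp [WExp.eval]) (by simp [State.setWord_words])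
  · intro σ₁ hA₁ h28
    have h22₁ : σ₁.words 22 0 = l.length := by rw [hA₁.1 22 (by decide), h22]
    refine Samples.rep (m := l.length) (by simp [WExp.eval, h22₁]) ?_
    refine samples_refreshLoop hw hn hτ hN l hl (by omega : 0 + l.length ≤ l.length) hQw
      (hI.of_eq (fun a ha => hA₁.1 a (by revert a; decide))
        (fun a _ => hA₁.2 a (by simp [Prog.realTargets]))) ?_ h28
      (h11.congr fun q _ _ => by rw [hA₁.1 11 (by decide)])
    intro j hj
    obtain ⟨τ₁, h1, h2, h3⟩ := hω j hj
    exact ⟨τ₁, h1, h2, h3.of_eq (hA₁.1 6 (by decide)) (hA₁.2 2 (by decide))⟩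

theorem runs_clear {L : ℕ} (hL : L < 2 ^ w) (h21 : σ.words 21 0 = L)
    (hkeys : ∀ k, σ.words 10 k ≠ 0 → ∃ i < L, σ.words 12 i = k) :
    RunsT w clear σ (L * 100 + 100) fun σ' => ∀ k, σ'.words 10 k = 0 := by
  have hB : (setV 28 (.lit 0)).staticCost + (L * (clearStep.staticCost + 5) + ((V 21).cost + 2)) ≤
      L * 100 + 100 := by
    have h1 : (setV 28 (.lit 0)).staticCost + ((V 21).cost + 2) ≤ 100 := by decide
    have h2 : clearStep.staticCost + 5 ≤ 100 := by decide
    have := Nat.mul_le_mul_left L h2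
    omega
  unfold clear
  refine RunsT.mono (RunsT.seq (RunsT.mono (Q := fun σ₁ => σ₁.words 28 0 = 0)
    (Runs.timed (by simp [Prog.LoopFree]) ?_) le_rfl ?_)) hB fun _ _ h => h
  · exact Runs.wset 0 0 (by simp [WExp.eval]) (by simp [WExp.eval]) (by simp [State.setWord_words])
  · intro σ₁ hA₁ h28
    have e12 : σ₁.words 12 = σ.words 12 := hA₁.1 12 (by decide)
    refine RunsT.rep (fun j σ' => σ'.words 28 0 = j ∧
      ∀ k, σ'.words 10 k ≠ 0 → ∃ i < L, j ≤ i ∧ σ.words 12 i = k) L ?_ ⟨h28, ?_⟩ ?_ ?_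
    · simp [WExp.eval, hA₁.1 21 (by decide), h21]
    · rw [hA₁.1 10 (by decide)]
      intro k hk
      obtain ⟨i, h1, h2⟩ := hkeys k hk
      exact ⟨i, h1, Nat.zero_le _, h2⟩
    · rintro j hj σ₂ hA₂ ⟨g28, g10⟩
      refine Runs.timed (by simp [clearStep, Prog.LoopFree]) ?_
      have e12₂ : σ₂.words 12 = σ.words 12 := (hA₂.1 12 (by decide)).trans e12
      refine Runs.seq (Runs.wset (σ.words 12 j) 0 (by simp [WExp.eval, g28, e12₂])
        (by simp [WExp.eval]) ?_)
      refine runs_incV (v := j) (by simp [State.setWord_words, g28]) (by omega) ?_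
      refine ⟨by simp [State.setWord_words], ?_⟩
      intro k hk
      by_cases hkj : k = σ.words 12 j
      · simp [State.setWord_words_apply, hkj] at hk
      · have hk' : σ₂.words 10 k ≠ 0 := by
          simpa [State.setWord_words_apply, hkj] using hk
        obtain ⟨i, h1, h2, h3⟩ := g10 k hk'
        have : i ≠ j := by
          rintro rfl
          exact hkj h3.symm
        exact ⟨i, h1, by omega, h3⟩
    · rintro σ₂ - ⟨-, g10⟩ k
      by_contra hk
      obtain ⟨i, h1, h2, -⟩ := g10 k hk
      omega

end family


/-! ## Changing the graph -/

section neighbours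

variable {n : ℕ}

open Classical in
/-- The neighbours of a vertex. -/
noncomputable def nbr (E : UGraph n) (a : ℕ) : Finset ℕ :=
  (Finset.range n).filter fun b =>
    ∃ (ha : a < n) (hb : b < n), s((⟨a, ha⟩ : Fin n), (⟨b, hb⟩ : Fin n)) ∈ E

theorem mem_nbr {E : UGraph n} {a b : ℕ} :
    b ∈ nbr E a ↔ ∃ (ha : a < n) (hb : b < n), s((⟨a, ha⟩ : Fin n), (⟨b, hb⟩ : Fin n)) ∈ E := by
  unfold nbr
  rw [Finset.mem_filter, Finset.mem_range]
  exact ⟨fun h => h.2, fun h => ⟨h.2.1, h⟩⟩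

theorem mem_nbr_fin {E : UGraph n} {a b : Fin n} : (b : ℕ) ∈ nbr E a ↔ s(a, b) ∈ E := by
  rw [mem_nbr]
  simp

theorem nbr_insert_ne (E : UGraph n) {u v : Fin n} (huv : u ≠ v) :
    nbr (insert s(u, v) E) = Function.update (Function.update (nbr E) u (insert (v : ℕ) (nbr E u))) v
      (insert (u : ℕ) (Function.update (nbr E) u (insert (v : ℕ) (nbr E u)) v)) := by
  have huv' : (v : ℕ) ≠ u := fun h => huv (Fin.ext h.symm)
  funext a
  ext b
  rw [Function.update_of_ne huv']
  by_cases hav : a = v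
  · subst hav
    rw [Function.update_self, Finset.mem_insert, mem_nbr, mem_nbr]
    simp only [Finset.mem_insert, Sym2.eq_iff, Fin.ext_iff]
    constructor
    · rintro ⟨ha, hb, (⟨h1, -⟩ | ⟨-, h2⟩) | h⟩
      · exact absurd h1 huv'
      · exact Or.inl h2
      · exact Or.inr ⟨ha, hb, h⟩
    · rintro (rfl | ⟨ha, hb, h⟩)
      · exact ⟨v.2, u.2, Or.inl (Or.inr ⟨trivial, rfl⟩)⟩
      · exact ⟨ha, hb, Or.inr h⟩
  · rw [Function.update_of_ne hav]
    by_cases hau : a = u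
    · subst hau
      rw [Function.update_self, Finset.mem_insert, mem_nbr, mem_nbr]
      simp only [Finset.mem_insert, Sym2.eq_iff, Fin.ext_iff]
      constructor
      · rintro ⟨ha, hb, (⟨-, h1⟩ | ⟨h2, -⟩) | h⟩
        · exact Or.inl h1
        · exact absurd h2 hav
        · exact Or.inr ⟨ha, hb, h⟩
      · rintro (rfl | ⟨ha, hb, h⟩)
        · exact ⟨u.2, v.2, Or.inl (Or.inl ⟨trivial, rfl⟩)⟩
        · exact ⟨ha, hb, Or.inr h⟩
    · rw [Function.update_of_ne hau, mem_nbr, mem_nbr]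
      simp only [Finset.mem_insert, Sym2.eq_iff, Fin.ext_iff, hav, hau, false_and, or_self, false_or]

theorem nbr_insert_self (E : UGraph n) (u : Fin n) :
    nbr (insert s(u, u) E) = Function.update (nbr E) u (insert (u : ℕ) (nbr E u)) := by
  funext a
  ext b
  by_cases hau : a = u
  · subst hau
    rw [Function.update_self, Finset.mem_insert, mem_nbr, mem_nbr]
    simp only [Finset.mem_insert, Sym2.eq_iff, Fin.ext_iff]
    constructor
    · rintro ⟨ha, hb, (⟨-, h1⟩ | ⟨-, h2⟩) | h⟩
      · exact Or.inl h1
      · exact Or.inl h2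
      · exact Or.inr ⟨ha, hb, h⟩
    · rintro (rfl | ⟨ha, hb, h⟩)
      · exact ⟨u.2, u.2, Or.inl (Or.inl ⟨trivial, rfl⟩)⟩
      · exact ⟨ha, hb, Or.inr h⟩
  · rw [Function.update_of_ne hau, mem_nbr, mem_nbr]
    simp only [Finset.mem_insert, Sym2.eq_iff, Fin.ext_iff, hau, false_and, or_self, false_or]

theorem nbr_erase_ne (E : UGraph n) {u v : Fin n} (huv : u ≠ v) :
    nbr (E.erase s(u, v)) = Function.update (Function.update (nbr E) u ((nbr E u).erase v)) v
      ((Function.update (nbr E) u ((nbr E u).erase v) v).erase u) := by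
  have huv' : (v : ℕ) ≠ u := fun h => huv (Fin.ext h.symm)
  funext a
  ext b
  rw [Function.update_of_ne huv']
  by_cases hav : a = v
  · subst hav
    rw [Function.update_self, Finset.mem_erase, mem_nbr, mem_nbr]
    simp only [Finset.mem_erase, Ne, Sym2.eq_iff, Fin.ext_iff]
    constructor
    · rintro ⟨ha, hb, h1, h⟩
      exact ⟨fun h2 => h1 (Or.inr ⟨trivial, h2⟩), ha, hb, h⟩
    · rintro ⟨h1, ha, hb, h⟩
      refine ⟨ha, hb, ?_, h⟩
      rintro (⟨h2, -⟩ | ⟨-, h2⟩)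
      · exact huv' h2
      · exact h1 h2
  · rw [Function.update_of_ne hav]
    by_cases hau : a = u
    · subst hau
      rw [Function.update_self, Finset.mem_erase, mem_nbr, mem_nbr]
      simp only [Finset.mem_erase, Ne, Sym2.eq_iff, Fin.ext_iff]
      constructor
      · rintro ⟨ha, hb, h1, h⟩
        exact ⟨fun h2 => h1 (Or.inl ⟨trivial, h2⟩), ha, hb, h⟩
      · rintro ⟨h1, ha, hb, h⟩
        refine ⟨ha, hb, ?_, h⟩
        rintro (⟨-, h2⟩ | ⟨h2, -⟩)
        · exact h1 h2
        · exact hav h2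
    · rw [Function.update_of_ne hau, mem_nbr, mem_nbr]
      simp only [Finset.mem_erase, Ne, Sym2.eq_iff, Fin.ext_iff, hav, hau, false_and, or_self,
        not_false_eq_true, true_and]

theorem nbr_erase_self (E : UGraph n) (u : Fin n) :
    nbr (E.erase s(u, u)) = Function.update (nbr E) u ((nbr E u).erase u) := by
  funext a
  ext b
  by_cases hau : a = u
  · subst hau
    rw [Function.update_self, Finset.mem_erase, mem_nbr, mem_nbr]
    simp only [Finset.mem_erase, Ne, Sym2.eq_iff, Fin.ext_iff]
    constructor
    · rintro ⟨ha, hb, h1, h⟩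
      exact ⟨fun h2 => h1 (Or.inl ⟨trivial, h2⟩), ha, hb, h⟩
    · rintro ⟨h1, ha, hb, h⟩
      refine ⟨ha, hb, ?_, h⟩
      rintro (⟨-, h2⟩ | ⟨-, h2⟩)
      · exact h1 h2
      · exact h1 h2
  · rw [Function.update_of_ne hau, mem_nbr, mem_nbr]
    simp only [Finset.mem_erase, Ne, Sym2.eq_iff, Fin.ext_iff, hau, false_and, or_self,
      not_false_eq_true, true_and]

end neighbours

/-- The table describes the graph. -/
structure Table.Describes {n : ℕ} (t : Table) (E : UGraph n) : Prop where
  ok : t.Ok n (nbr E)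
  slot_le : ∀ k, t.slot k ≤ n

theorem Table.attach_slot_le {n a b : ℕ} {t : Table} (h : ∀ k, t.slot k ≤ n) (hb : b < n) (k : ℕ) :
    (t.attach n a b).slot k ≤ n := by
  simp only [Table.attach, Function.update_apply]
  split_ifs
  · exact hb
  · exact h k

theorem Table.Ok.detach_slot_le {n a b : ℕ} {t : Table} {nb : ℕ → Finset ℕ} (hok : t.Ok n nb)
    (h : ∀ k, t.slot k ≤ n) (ha : a < n) (hab : b ∈ nb a) (k : ℕ) :
    (t.detach n a b).slot k ≤ n := by
  have hdpos := hok.deg_pos ha hab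
  obtain ⟨c, hc, hc1, -⟩ := hok.fill a ha (t.deg a - 1) (by omega)
  have hcn := hok.sub a ha c hc
  have h1 : t.slot (t.lastKey n a) = c + 1 := hc1
  simp only [Table.detach, Function.update_apply]
  split_ifs
  · exact Nat.zero_le _
  · omega
  · exact h k

/-- What the programs that change one end of an edge need. -/
structure Ready (n N : ℕ) (t : Table) (S : List ℕ) (σ : State) : Prop where
  size : σ.words 0 0 = n
  table : HasTable σ t
  touched : Touched N σ S
  lists : Lists n N N σ

theorem Ready.of_eq {n N : ℕ} {t : Table} {S : List ℕ} {σ σ' : State} (h : Ready n N t S σ)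
    (hw : ∀ a ∈ [0, 3, 4, 5, 7, 9, 10, 11, 12, 15, 21, 22], σ'.words a = σ.words a) :
    Ready n N t S σ' := by
  refine ⟨?_, ?_, ?_, ?_⟩
  · rw [hw 0 (by simp)]
    exact h.size
  · exact h.table.of_eq (hw _ (by simp)) (hw _ (by simp)) (hw _ (by simp))
  · exact h.touched.of_eq (hw _ (by simp)) (hw _ (by simp)) (hw _ (by simp)) (hw _ (by simp))
      (hw _ (by simp)) (hw _ (by simp)) (hw _ (by simp))
  · exact h.lists.of_eq (hw _ (by simp)) (hw _ (by simp)) (hw _ (by simp))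

/-- The program `P` turns the table `t` into `t'` and touches the keys in `S'`, if it is applied
to the edge from `a` to `b`. -/
def Changes (w n N : ℕ) (P : Prog) (a b : ℕ) (t t' : Table) (S' : List ℕ) : Prop :=
  ∀ (S : List ℕ) (σ : State), S.length ≤ 2 → Ready n N t S σ → σ.words 24 0 = a → σ.words 25 0 = b →
    RunsT w P σ (500 + 100 * (S'.map (σ.words 9)).sum) (Ready n N t' (S' ++ S))

section bothEnds

variable {w n N : ℕ} {σ : State} {t t₁ t₂ : Table}

theorem changes_attach (hw : 8 * (n * n * (N + 1)) < 2 ^ w) {a b : ℕ} {nb : ℕ → Finset ℕ}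
    (ha : a < n) (hb : b < n) (hok : t.Ok n nb) (hab : b ∉ nb a) :
    Changes w n N attach a b t (t.attach n a b) [a * n + t.deg a] := by
  intro S σ hS hR h24 h25
  have hnn : 1 ≤ n * n := Nat.mul_pos (by omega) (by omega)
  have h1 := Nat.mul_le_mul_right (N + 1) hnn
  refine RunsT.mono (runs_attach hR.size h24 h25 ha hb hR.table hok hab hR.touched hR.lists le_rfl
    (by omega) ?_) (by simp) ?_
  · have := Nat.mul_le_mul_right (N + 1) (show S.length + 2 ≤ 4 by omega)
    omega
  · rintro σ' hA ⟨h2, h3⟩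
    exact ⟨by rw [hA.1 0 (by decide)]; exact hR.size, h2, h3,
      hR.lists.of_eq (hA.1 7 (by decide)) (hA.1 9 (by decide)) (hA.1 15 (by decide))⟩

theorem changes_detach (hw : 8 * (n * n * (N + 1)) < 2 ^ w) {a b : ℕ} {nb : ℕ → Finset ℕ}
    (ha : a < n) (hok : t.Ok n nb) (hab : b ∈ nb a) :
    Changes w n N detach a b t (t.detach n a b) [t.lastKey n a, t.place (a * n + b)] := by
  intro S σ hS hR h24 h25
  have hnn : 1 ≤ n * n := Nat.mul_pos (by omega) (by omega)
  have h1 := Nat.mul_le_mul_right (N + 1) hnn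
  refine RunsT.mono (runs_detach hR.size h24 h25 ha hR.table hok hab hR.touched hR.lists le_rfl
    (by omega) ?_) (by simp [add_comm]) ?_
  · have := Nat.mul_le_mul_right (N + 1) (show S.length + 3 ≤ 5 by omega)
    omega
  · rintro σ' hA ⟨h2, h3⟩
    exact ⟨by rw [hA.1 0 (by decide)]; exact hR.size, h2, h3,
      hR.lists.of_eq (hA.1 7 (by decide)) (hA.1 9 (by decide)) (hA.1 15 (by decide))⟩

theorem runs_setEnds {S : List ℕ} {a b i j : ℕ} (hR : Ready n N t S σ)
    (hi : i < 2 ^ w) (hj : j < 2 ^ w)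
    (h1 : σ.words 2 i = a) (h2 : σ.words 2 j = b) :
    RunsT w (setV 24 (.get 2 (.lit i)) ;; setV 25 (.get 2 (.lit j))) σ 20 fun σ' =>
      Ready n N t S σ' ∧ σ'.words 24 0 = a ∧ σ'.words 25 0 = b := by
  refine RunsT.mono (B := 10) (Q := fun σ' => σ'.words 24 0 = a ∧ σ'.words 25 0 = b)
    (RunsT.mono (Runs.timed (by simp [Prog.LoopFree]) ?_) (by
      simp [Prog.staticCost, WExp.cost]) fun _ _ h => h) (by omega) fun σ' hA h =>
        ⟨hR.of_eq fun a ha => hA.1 a (by revert a; simp [Prog.wordTargets]), h⟩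
  refine Runs.seq (Runs.wset 0 a (by simp [WExp.eval]) (by simp [WExp.eval, Nat.mod_eq_of_lt hi, h1])
    ?_)
  exact Runs.wset 0 b (by simp [WExp.eval])
    (by simp [WExp.eval, State.setWord_words, Nat.mod_eq_of_lt hj, h2])
    (by simp [State.setWord_words])

/-- The second direction starts from the table left by the first. A self-loop occupies one slot
only, so for equal ends the second direction is skipped. Lengths of lists refer to the initial
memory, since `P` does not write array `9`. -/
theorem runs_bothEnds (hw : 8 * (n * n * (N + 1)) < 2 ^ w) {P : Prog}
    (hP : ∀ a ∈ [2, 9], a ∉ P.wordTargets) {u v : ℕ} (hu : u < n) {S₁ S₂ : List ℕ}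
    (hS₁ : S₁.length ≤ 2)
    (h1 : Changes w n N P u v t t₁ S₁)
    (h2 : u ≠ v → Changes w n N P v u t₁ t₂ S₂) (h3 : u = v → t₂ = t₁ ∧ S₂ = [])
    (hR : Ready n N t [] σ) (hσu : σ.words 2 1 = u) (hσv : σ.words 2 2 = v) :
    RunsT w (bothEnds P) σ (1300 + 100 * ((S₂ ++ S₁).map (σ.words 9)).sum)
      (Ready n N t₂ (S₂ ++ S₁)) := by
  have hnn : 1 ≤ n * n := Nat.mul_pos (by omega) (by omega)
  have h4 := Nat.mul_le_mul_right (N + 1) hnn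
  have m1 : 1 % 2 ^ w = 1 := Nat.mod_eq_of_lt (by omega)
  have m2 : 2 % 2 ^ w = 2 := Nat.mod_eq_of_lt (by omega)
  unfold bothEnds
  set b : BExp := .and (.not (.wlt (.get 2 (.lit 1)) (.get 2 (.lit 2))))
      (.not (.wlt (.get 2 (.lit 2)) (.get 2 (.lit 1)))) with hbdef
  have hb : b.cost + 1 ≤ 50 := by decide
  refine RunsT.mono (B := 20 + ((500 + 100 * (S₁.map (σ.words 9)).sum) +
    ((20 + (500 + 100 * (S₂.map (σ.words 9)).sum)) + (b.cost + 1)))) ?_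
    (by rw [List.map_append, List.sum_append]; omega) fun _ _ h => h
  refine RunsT.seq (RunsT.mono (runs_setEnds hR (by omega) (by omega) hσu hσv) le_rfl ?_)
  rintro σ₁ hA₁ ⟨hR₁, h24, h25⟩
  have e9 : σ₁.words 9 = σ.words 9 := hA₁.1 9 (by decide)
  have e2 : σ₁.words 2 = σ.words 2 := hA₁.1 2 (by decide)
  refine RunsT.seq (RunsT.mono (h1 [] σ₁ (by simp) hR₁ h24 h25) (by rw [e9]) ?_)
  intro σ₂ hA₂ hR₂
  rw [List.append_nil] at hR₂
  have e9₂ : σ₂.words 9 = σ.words 9 := (hA₂.1 9 (hP 9 (by simp))).trans e9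
  have e2₂ : σ₂.words 2 = σ.words 2 := (hA₂.1 2 (hP 2 (by simp))).trans e2
  have hcond : b.Holds w σ₂ ↔ u = v := by
    simp only [hbdef, BExp.Holds, WExp.eval, e2₂, m1, m2, hσu, hσv]
    omega
  refine RunsT.ite ?_ ?_
  · intro h
    obtain ⟨rfl, rfl⟩ := h3 (hcond.1 h)
    exact RunsT.mono (Runs.timed trivial (Runs.skip hR₂)) (by simp [Prog.staticCost])
      fun _ _ h => h
  · intro h
    refine RunsT.seq (RunsT.mono (runs_setEnds hR₂ (by omega) (by omega) (a := v) (b := u)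
      (by rw [e2₂, hσv]) (by rw [e2₂, hσu])) le_rfl ?_)
    rintro σ₃ hA₃ ⟨hR₃, h24₃, h25₃⟩
    refine RunsT.mono (h2 (fun huv => h (hcond.2 huv)) S₁ σ₃ hS₁ hR₃ h24₃ h25₃) ?_ fun _ _ h => h
    rw [hA₃.1 9 (by decide), e9₂]

end bothEnds

/-- The change of the graph: the new table and the touched keys. -/
theorem exists_change {n : ℕ} {E : UGraph n} {x : EdgeUpdate n} {t : Table} (ht : t.Describes E)
    (hx : x.Legal E) :
    ∃ (t' : Table) (S : List ℕ), t'.Describes (x.apply E) ∧ S.length ≤ 4 ∧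
      (∀ k, k ∉ S → t.slot k = t'.slot k) ∧
      ∀ (w N : ℕ) (σ : State), 8 * (n * n * (N + 1)) < 2 ^ w →
        σ.words 2 0 = (if x.ins then 1 else 0) → σ.words 2 1 = x.u → σ.words 2 2 = x.v →
        σ.words 0 0 = n → HasTable σ t → Lists n N N σ → (∀ k, σ.words 10 k = 0) →
        RunsT w changeGraph σ (1500 + 100 * (S.map (σ.words 9)).sum) fun σ' =>
          HasTable σ' t' ∧ Touched N σ' S := by
  obtain ⟨hok, hle⟩ := ht
  obtain ⟨ins, u, v⟩ := x
  have hu := u.2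
  have hv := v.2
  have hattach : ∀ (t : Table) (a b : ℕ), ∀ k ∉ [a * n + t.deg a],
      t.slot k = (t.attach n a b).slot k := by
    intro t a b k hk
    rw [List.mem_singleton] at hk
    simp [Table.attach, hk]
  have hdetach : ∀ (t : Table) (a b : ℕ), ∀ k ∉ [t.lastKey n a, t.place (a * n + b)],
      t.slot k = (t.detach n a b).slot k := by
    intro t a b k hk
    simp only [List.mem_cons, List.not_mem_nil, or_false, not_or] at hk
    simp [Table.detach, hk.1, hk.2]
  -- the common part of all cases
  have hrun : ∀ (t₂ : Table) (S : List ℕ), (∀ (w N : ℕ) (σ : State), 8 * (n * n * (N + 1)) < 2 ^ w →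
      Ready n N t [] σ → σ.words 2 1 = u → σ.words 2 2 = v →
      RunsT w (if ins then bothEnds attach else bothEnds detach) σ
        (1300 + 100 * (S.map (σ.words 9)).sum) (Ready n N t₂ S)) →
      ∀ (w N : ℕ) (σ : State), 8 * (n * n * (N + 1)) < 2 ^ w →
        σ.words 2 0 = (if ins then 1 else 0) → σ.words 2 1 = u → σ.words 2 2 = v →
        σ.words 0 0 = n → HasTable σ t → Lists n N N σ → (∀ k, σ.words 10 k = 0) →
        RunsT w changeGraph σ (1500 + 100 * (S.map (σ.words 9)).sum) fun σ' =>
          HasTable σ' t₂ ∧ Touched N σ' S := by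
    intro t₂ S h w N σ hw h20 h21 h22 h0 hT hL hm
    set b : BExp := .wlt (.lit 0) (.get 2 (.lit 0)) with hbdef
    have hB : (setV 21 (.lit 0) ;; setV 22 (.lit 0)).staticCost + (b.cost + 1) ≤ 200 := by decide
    unfold changeGraph
    refine RunsT.mono (B := (setV 21 (.lit 0) ;; setV 22 (.lit 0)).staticCost +
      ((1300 + 100 * (S.map (σ.words 9)).sum) + (b.cost + 1))) (Q := Ready n N t₂ S) ?_ (by omega)
      fun σ' _ h => ⟨h.table, h.touched⟩
    refine RunsT.seq (RunsT.mono (Q := fun σ₁ => σ₁.words 21 0 = 0 ∧ σ₁.words 22 0 = 0)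
      (Runs.timed (by simp [Prog.LoopFree]) ?_) le_rfl ?_)
    · refine Runs.seq (Runs.wset 0 0 (by simp [WExp.eval]) (by simp [WExp.eval]) ?_)
      exact Runs.wset 0 0 (by simp [WExp.eval]) (by simp [WExp.eval])
        (by simp [State.setWord_words])
    · rintro σ₁ hA₁ ⟨g21, g22⟩
      have e2 : σ₁.words 2 = σ.words 2 := hA₁.1 2 (by decide)
      have hR₁ : Ready n N t [] σ₁ := by
        refine ⟨by rw [hA₁.1 0 (by decide), h0], hT.of_eq (hA₁.1 3 (by decide)) (hA₁.1 4 (by decide))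
          (hA₁.1 5 (by decide)), ⟨by simp [g21], ?_, by simp, by simp [g22], by simp, by simp⟩,
          hL.of_eq (hA₁.1 7 (by decide)) (hA₁.1 9 (by decide)) (hA₁.1 15 (by decide))⟩
        rw [hA₁.1 10 (by decide)]
        simpa using hm
      have := h w N σ₁ hw hR₁ (by rw [e2, h21]) (by rw [e2, h22])
      rw [hA₁.1 9 (by decide)] at this
      cases ins with
      | true =>
        refine RunsT.ite (fun _ => by simpa using this) fun hb => absurd ?_ hb
        simp [BExp.Holds, WExp.eval, e2, h20]
      | false =>
        refine RunsT.ite (fun hb => absurd hb ?_) fun _ => by simpa using this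
        simp [BExp.Holds, WExp.eval, e2, h20]
  cases ins with
  | true =>
    have huv : (v : ℕ) ∉ nbr E u := by
      rw [mem_nbr_fin]
      simpa [EdgeUpdate.Legal] using hx
    have hvu : (u : ℕ) ∉ nbr E v := by
      rw [mem_nbr_fin, Sym2.eq_swap, ← mem_nbr_fin]
      exact huv
    have hP : ∀ a ∈ [2, 9], a ∉ attach.wordTargets := by decide
    have hok₁ := hok.attach hu hv huv
    have hle₁ := Table.attach_slot_le (a := u) hle hv
    by_cases hne : u = v
    · refine ⟨t.attach n u v, [u * n + t.deg u], ⟨?_, hle₁⟩, by simp, hattach t u v,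
        hrun _ _ fun w N σ hw hR h1 h2 => ?_⟩
      · simpa [EdgeUpdate.apply, hne, nbr_insert_self] using hok₁
      · exact runs_bothEnds (S₂ := []) hw hP hu (by simp) (changes_attach hw hu hv hok huv)
          (fun h => absurd (congrArg Fin.val hne) h) (fun _ => ⟨rfl, rfl⟩) hR h1 h2
    · have hne' : (v : ℕ) ≠ u := fun h => hne (Fin.ext h.symm)
      have hvu₁ : (u : ℕ) ∉ Function.update (nbr E) u (insert (v : ℕ) (nbr E u)) v := by
        rwa [Function.update_of_ne hne']
      set t₁ := t.attach n u v with ht₁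
      refine ⟨t₁.attach n v u, [v * n + t₁.deg v] ++ [u * n + t.deg u],
        ⟨?_, Table.attach_slot_le hle₁ hu⟩, by simp, ?_, hrun _ _ fun w N σ hw hR h1 h2 => ?_⟩
      · simpa [EdgeUpdate.apply, nbr_insert_ne E hne] using hok₁.attach hv hu hvu₁
      · intro k hk
        rw [List.mem_append, not_or] at hk
        exact (hattach t u v k hk.2).trans (hattach t₁ v u k hk.1)
      · exact runs_bothEnds hw hP hu (by simp) (changes_attach hw hu hv hok huv)
          (fun _ => changes_attach hw hv hu hok₁ hvu₁) (fun h => absurd h.symm hne') hR h1 h2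
  | false =>
    have huv : (v : ℕ) ∈ nbr E u := by
      rw [mem_nbr_fin]
      simpa [EdgeUpdate.Legal] using hx
    have hvu : (u : ℕ) ∈ nbr E v := by
      rw [mem_nbr_fin, Sym2.eq_swap, ← mem_nbr_fin]
      exact huv
    have hP : ∀ a ∈ [2, 9], a ∉ detach.wordTargets := by decide
    have hok₁ := hok.detach hu huv
    have hle₁ := hok.detach_slot_le hle hu huv
    by_cases hne : u = v
    · refine ⟨t.detach n u v, [t.lastKey n u, t.place (u * n + v)], ⟨?_, hle₁⟩, by simp,
        hdetach t u v, hrun _ _ fun w N σ hw hR h1 h2 => ?_⟩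
      · simpa [EdgeUpdate.apply, hne, nbr_erase_self] using hok₁
      · exact runs_bothEnds (S₂ := []) hw hP hu (by simp) (changes_detach hw hu hok huv)
          (fun h => absurd (congrArg Fin.val hne) h) (fun _ => ⟨rfl, rfl⟩) hR h1 h2
    · have hne' : (v : ℕ) ≠ u := fun h => hne (Fin.ext h.symm)
      have hvu₁ : (u : ℕ) ∈ Function.update (nbr E) u ((nbr E u).erase v) v := by
        rwa [Function.update_of_ne hne']
      set t₁ := t.detach n u v with ht₁
      -- Two keys at each end, the freed slot and the last slot; this accounts for the bound `4`.
      refine ⟨t₁.detach n v u,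
        [t₁.lastKey n v, t₁.place (v * n + u)] ++ [t.lastKey n u, t.place (u * n + v)],
        ⟨?_, hok₁.detach_slot_le hle₁ hv hvu₁⟩, by simp, ?_, hrun _ _ fun w N σ hw hR h1 h2 => ?_⟩
      · simpa [EdgeUpdate.apply, nbr_erase_ne E hne] using hok₁.detach hv hvu₁
      · intro k hk
        rw [List.mem_append, not_or] at hk
        exact (hdetach t u v k hk.2).trans (hdetach t₁ v u k hk.1)
      · exact runs_bothEnds hw hP hu (by simp) (changes_detach hw hu hok huv)
          (fun _ => changes_detach hw hv hok₁ hvu₁) (fun h => absurd h.symm hne') hR h1 h2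


/-! ## The exact computation of PageRank -/

/-- The memory contains the graph and `ε`. -/
structure Solving (n : ℕ) (t : Table) (ε : ℝ) (σ : State) : Prop where
  size : σ.words 0 0 = n
  table : HasTable σ t
  eps : σ.reals 0 0 = ε

theorem Solving.of_agree {n : ℕ} {t : Table} {ε : ℝ} {σ σ' : State} {P : Prog}
    (h : Solving n t ε σ) (hA : P.Agree σ σ') (hw : ∀ a ∈ [0, 3, 4, 5], a ∉ P.wordTargets)
    (hr : 0 ∉ P.realTargets) : Solving n t ε σ' := by
  refine ⟨?_, ?_, ?_⟩
  · rw [hA.1 0 (hw 0 (by simp))]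
    exact h.size
  · exact h.table.of_eq (hA.1 3 (hw 3 (by simp))) (hA.1 4 (hw 4 (by simp))) (hA.1 5 (hw 5 (by simp)))
  · rw [hA.2 0 hr]
    exact h.eps

section solve

variable {w n : ℕ} {t : Table} {ε : ℝ} {σ : State}

/-- An entry of the row that `pivot` computes. -/
noncomputable def pivotRow (n : ℕ) (t : Table) (ε : ℝ) (f : ℕ → ℝ) (k j : ℕ) : ℝ :=
  (1 - ε) / t.deg k * ∑ s ∈ Finset.range (t.deg k), f ((t.slot (k * n + s) - 1) * n + j)

theorem runs_rowEntry (hw : n * n + 1 < 2 ^ w) (hσ : Solving n t ε σ) (hle : ∀ k, t.slot k ≤ n)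
    {k j : ℕ} (hk : k < n) (hj : j < n) (hd : t.deg k ≤ n) (h42 : σ.words 42 0 = k)
    (h43 : σ.words 43 0 = j) :
    RunsT w rowEntry σ (50 * n + 100) fun σ' => σ'.words 43 0 = j + 1 ∧
      σ'.reals 4 = Function.update (σ.reals 4) j (pivotRow n t ε (σ.reals 3) k j) := by
  have hn2 : n ≤ n * n := Nat.le_mul_of_pos_left _ (by omega)
  have h1 : 1 % 2 ^ w = 1 := Nat.mod_eq_of_lt (by omega)
  set f := σ.reals 3 with hf
  have hB : (setR 7 (.ofWord (.lit 0)) ;; setV 44 (.lit 0)).staticCost +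
      ((t.deg k * (rowTerm.staticCost + 5) + ((WExp.get 3 (V 42)).cost + 2)) +
      (Prog.seq (.rset 4 (V 43) (.mul (.div (.sub (.ofWord (.lit 1)) (RV 0))
        (.ofWord (.get 3 (V 42)))) (RV 7))) (incV 43)).staticCost) ≤ 50 * n + 100 := by
    have h1 : rowTerm.staticCost + 5 ≤ 50 := by decide
    have h2 : (setR 7 (.ofWord (.lit 0)) ;; setV 44 (.lit 0)).staticCost +
      ((WExp.get 3 (V 42)).cost + 2) + (Prog.seq (.rset 4 (V 43) (.mul (.div (.sub (.ofWord (.lit 1))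
        (RV 0)) (.ofWord (.get 3 (V 42)))) (RV 7))) (incV 43)).staticCost ≤ 100 := by decide
    have := Nat.mul_le_mul hd h1
    omega
  unfold rowEntry
  refine RunsT.mono (RunsT.seq (RunsT.mono (Q := fun σ₁ => σ₁.reals 7 0 = 0 ∧ σ₁.words 44 0 = 0)
    (Runs.timed (by simp [Prog.LoopFree]) ?_) le_rfl ?_)) hB fun _ _ h => h
  · refine Runs.seq (Runs.rset 0 0 (by simp [WExp.eval]) (by simp [RExp.eval, WExp.eval]) ?_)
    exact Runs.wset 0 0 (by simp [WExp.eval]) (by simp [WExp.eval])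
      (by simp [State.setWord_words, State.setReal_reals_apply])
  rintro σ₁ hA₁ ⟨h7, h44⟩
  have hσ₁ := hσ.of_agree hA₁ (by decide) (by decide)
  have g42 : σ₁.words 42 0 = k := by rw [hA₁.1 42 (by decide), h42]
  have g43 : σ₁.words 43 0 = j := by rw [hA₁.1 43 (by decide), h43]
  have g3 : σ₁.reals 3 = f := hA₁.2 3 (by decide)
  have g4 : σ₁.reals 4 = σ.reals 4 := hA₁.2 4 (by decide)
  refine RunsT.seq (RunsT.rep (fun i σ' => σ'.words 44 0 = i ∧ σ'.reals 7 0 =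
    ∑ s ∈ Finset.range i, f ((t.slot (k * n + s) - 1) * n + j)) (t.deg k) ?_ ⟨h44, by simp [h7]⟩
    ?_ ?_)
  · simp [WExp.eval, g42, hσ₁.table.deg]
  · rintro i hi σ₂ hA₂ ⟨i44, i7⟩
    have hσ₂ := hσ₁.of_agree hA₂ (by decide) (by decide)
    have e42 : σ₂.words 42 0 = k := by rw [hA₂.1 42 (by decide), g42]
    have e43 : σ₂.words 43 0 = j := by rw [hA₂.1 43 (by decide), g43]
    have e3 : σ₂.reals 3 = f := (hA₂.2 3 (by decide)).trans g3
    have hin : i < n := by omega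
    have m1 : k * n + i < n * n := key_lt hk hin
    have hx : t.slot (k * n + i) - 1 < n := by have := hle (k * n + i); omega
    have m2 := key_lt hx hj
    have m3 : k * n % 2 ^ w = k * n := Nat.mod_eq_of_lt (by omega)
    have m4 : (k * n + i) % 2 ^ w = k * n + i := Nat.mod_eq_of_lt (by omega)
    have m5 : (t.slot (k * n + i) - 1) * n % 2 ^ w = (t.slot (k * n + i) - 1) * n :=
      Nat.mod_eq_of_lt (by omega)
    have m6 : ((t.slot (k * n + i) - 1) * n + j) % 2 ^ w = (t.slot (k * n + i) - 1) * n + j :=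
      Nat.mod_eq_of_lt (by omega)
    refine Runs.timed (by simp [rowTerm, Prog.LoopFree]) ?_
    refine Runs.seq (Runs.rset 0 (∑ s ∈ Finset.range (i + 1), f ((t.slot (k * n + s) - 1) * n + j))
      (by simp [WExp.eval]) ?_ ?_)
    · simp [RExp.eval, WExp.eval, e42, e43, hσ₂.size, i44, hσ₂.table.slot, e3, i7, h1, m3, m4, m5, m6,
        Finset.sum_range_succ]
    · refine runs_incV (v := i) (by simp [i44]) (by omega) ?_
      simp [State.setWord_words, State.setReal_reals_apply]
  · rintro σ₂ hA₂ ⟨-, i7⟩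
    have hσ₂ := hσ₁.of_agree hA₂ (by decide) (by decide)
    have e42 : σ₂.words 42 0 = k := by rw [hA₂.1 42 (by decide), g42]
    have e43 : σ₂.words 43 0 = j := by rw [hA₂.1 43 (by decide), g43]
    have e4 : σ₂.reals 4 = σ.reals 4 := (hA₂.2 4 (by decide)).trans g4
    refine Runs.timed (by simp [Prog.LoopFree]) ?_
    refine Runs.seq (Runs.rset j (pivotRow n t ε f k j) (by simp [WExp.eval, e43]) ?_ ?_)
    · simp [RExp.eval, WExp.eval, e42, hσ₂.table.deg, hσ₂.eps, i7, h1, pivotRow]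
    · refine runs_incV (v := j) (by simp [e43]) (by omega) ⟨by simp [State.setWord_words], ?_⟩
      funext x
      simp [State.setReal_reals_apply, Function.update_apply, e4]

theorem runs_rows (hw : n * n + 1 < 2 ^ w) (hσ : Solving n t ε σ) (hle : ∀ k, t.slot k ≤ n)
    {k : ℕ} (hk : k < n) (hd : t.deg k ≤ n) (h42 : σ.words 42 0 = k) (h43 : σ.words 43 0 = 0) :
    RunsT w (.rep (V 0) rowEntry) σ (n * (50 * n + 100 + 5) + ((V 0).cost + 2)) fun σ' =>
      ∀ j < n, σ'.reals 4 j = pivotRow n t ε (σ.reals 3) k j := by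
  refine RunsT.rep (fun j σ' => σ'.words 43 0 = j ∧ ∀ j' < j,
    σ'.reals 4 j' = pivotRow n t ε (σ.reals 3) k j') n (by simp [WExp.eval, hσ.size])
    ⟨h43, fun _ h => absurd h (by omega)⟩ ?_ fun σ' _ h => h.2
  rintro j hj σ₁ hA₁ ⟨g43, g4⟩
  have hσ₁ := hσ.of_agree hA₁ (by decide) (by decide)
  have g42 : σ₁.words 42 0 = k := by rw [hA₁.1 42 (by decide), h42]
  have g3 : σ₁.reals 3 = σ.reals 3 := hA₁.2 3 (by decide)
  refine RunsT.mono (runs_rowEntry hw hσ₁ hle hk hj hd g42 g43) le_rfl ?_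
  rintro σ₂ - ⟨h1, h2⟩
  refine ⟨h1, fun j' hj' => ?_⟩
  rw [h2, g3]
  by_cases h : j' = j
  · rw [h, Function.update_self]
  · rw [Function.update_of_ne h, g4 j' (by omega)]

theorem runs_rowUpdate (hw : n * n + 1 < 2 ^ w) (hσ : Solving n t ε σ)
    {k i : ℕ} (hk : k < n) (hi : i < n) (h42 : σ.words 42 0 = k) (h44 : σ.words 44 0 = i) :
    RunsT w rowUpdate σ (50 * n + 100) fun σ' => σ'.words 44 0 = i + 1 ∧
      (∀ j < n, σ'.reals 3 (i * n + j) = σ.reals 3 (i * n + j) +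
        σ.reals 3 (i * n + k) / (1 - σ.reals 4 k) * σ.reals 4 j) ∧
      ∀ i' < n, i' ≠ i → ∀ j < n, σ'.reals 3 (i' * n + j) = σ.reals 3 (i' * n + j) := by
  have hn2 : n ≤ n * n := Nat.le_mul_of_pos_left _ (by omega)
  have h1 : 1 % 2 ^ w = 1 := Nat.mod_eq_of_lt (by omega)
  have hik := key_lt hi hk
  have m1 : i * n % 2 ^ w = i * n := Nat.mod_eq_of_lt (by omega)
  have m2 : (i * n + k) % 2 ^ w = i * n + k := Nat.mod_eq_of_lt (by omega)
  set f := σ.reals 3 with hf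
  set r := σ.reals 4 with hr
  set first : Prog := setR 8 (.div (.get 3 (keyAt 44 (V 42))) (.sub (.ofWord (.lit 1)) (.get 4 (V 42)))) ;;
    setV 43 (.lit 0) with hfirst
  -- The loop overwrites entry `k` of the row too, so the factor is computed before it.
  set F := f (i * n + k) / (1 - r k) with hF
  have hB : first.staticCost + ((n * (entryUpdate.staticCost + 5) + ((V 0).cost + 2)) +
      (incV 44).staticCost) ≤ 50 * n + 100 := by
    have h1 : entryUpdate.staticCost + 5 ≤ 50 := by decide
    have h2 : first.staticCost + ((V 0).cost + 2) + (incV 44).staticCost ≤ 100 := by decide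
    have := Nat.mul_le_mul_left n h1
    omega
  unfold rowUpdate
  refine RunsT.mono (RunsT.seq (RunsT.mono (Q := fun σ₁ => σ₁.reals 8 0 = F ∧ σ₁.words 43 0 = 0)
    (Runs.timed (by simp [Prog.LoopFree]) ?_) le_rfl ?_)) hB fun _ _ h => h
  · refine Runs.seq (Runs.rset 0 F (by simp [WExp.eval]) ?_ ?_)
    · simp [RExp.eval, WExp.eval, h44, h42, hσ.size, h1, m1, m2, hF, ← hf, ← hr]
    · exact Runs.wset 0 0 (by simp [WExp.eval]) (by simp [WExp.eval])
        (by simp [State.setWord_words, State.setReal_reals_apply])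
  rintro σ₁ hA₁ ⟨h8, h43⟩
  have hσ₁ := hσ.of_agree hA₁ (by decide) (by decide)
  have g44 : σ₁.words 44 0 = i := by rw [hA₁.1 44 (by decide), h44]
  have g3 : σ₁.reals 3 = f := hA₁.2 3 (by decide)
  have g4 : σ₁.reals 4 = r := hA₁.2 4 (by decide)
  refine RunsT.seq (RunsT.rep (fun j σ' => σ'.words 43 0 = j ∧
    (∀ j' < n, σ'.reals 3 (i * n + j') = if j' < j then f (i * n + j') + F * r j'
      else f (i * n + j')) ∧
    ∀ i' < n, i' ≠ i → ∀ j < n, σ'.reals 3 (i' * n + j) = f (i' * n + j)) n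
    (by simp [WExp.eval, hσ₁.size]) ⟨h43, fun _ _ => by simp [g3], fun _ _ _ _ _ => by rw [g3]⟩
    ?_ ?_)
  · rintro j hj σ₂ hA₂ ⟨i43, i3, i3'⟩
    have hσ₂ := hσ₁.of_agree hA₂ (by decide) (by decide)
    have e44 : σ₂.words 44 0 = i := by rw [hA₂.1 44 (by decide), g44]
    have e4 : σ₂.reals 4 = r := (hA₂.2 4 (by decide)).trans g4
    have e8 : σ₂.reals 8 0 = F := by rw [hA₂.2 8 (by decide), h8]
    have hij := key_lt hi hj
    have m3 : (i * n + j) % 2 ^ w = i * n + j := Nat.mod_eq_of_lt (by omega)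
    have i3j := i3 j hj
    rw [if_neg (lt_irrefl _)] at i3j
    refine Runs.timed (by simp [entryUpdate, Prog.LoopFree]) ?_
    refine Runs.seq (Runs.rset (i * n + j) (f (i * n + j) + F * r j) ?_ ?_ ?_)
    · simp [WExp.eval, e44, hσ₂.size, i43, m1, m3]
    · simp [RExp.eval, WExp.eval, e44, hσ₂.size, i43, m1, m3, e4, e8, i3j]
    · refine runs_incV (v := j) (by simp [i43]) (by omega) ⟨by simp [State.setWord_words], ?_, ?_⟩
      · intro j' hj'
        by_cases hjj : j' = j
        · subst hjj
          simp [State.setReal_reals_apply]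
        · have : (j' < j + 1) ↔ j' < j := by omega
          simp only [State.setWord_reals, State.setReal_reals_apply, true_and, add_right_inj, hjj,
            if_false, i3 j' hj', this]
      · intro i' hi' hne j' hj'
        have : i' * n + j' ≠ i * n + j := by
          rw [Ne, key_eq_iff hj' hj]
          exact fun h => hne h.1
        simp only [State.setWord_reals, State.setReal_reals_apply, true_and, this, if_false,
          i3' i' hi' hne j' hj']
  · rintro σ₂ hA₂ ⟨-, i3, i3'⟩
    have e44 : σ₂.words 44 0 = i := by rw [hA₂.1 44 (by decide), g44]
    refine Runs.timed (by simp [Prog.LoopFree]) (runs_incV (v := i) e44 (by omega)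
      ⟨by simp [State.setWord_words], fun j hj => ?_, fun i' hi' hne j hj => ?_⟩)
    · rw [State.setWord_reals, i3 j hj, if_pos hj]
    · rw [State.setWord_reals, i3' i' hi' hne j hj]

/-- One rank-one update in order `n ^ 2` operations. The whole pivot row is computed before the
matrix is touched, so all quantities refer to the old matrix. -/
theorem runs_pivot (hw : n * n + 1 < 2 ^ w) (hσ : Solving n t ε σ) (hle : ∀ k, t.slot k ≤ n)
    {k : ℕ} (hk : k < n) (hd : t.deg k ≤ n) (h42 : σ.words 42 0 = k) :
    RunsT w pivot σ (400 * (n * n) + 200) fun σ' => σ'.words 42 0 = k + 1 ∧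
      ∀ i < n, ∀ j < n, σ'.reals 3 (i * n + j) = σ.reals 3 (i * n + j) +
        σ.reals 3 (i * n + k) / (1 - pivotRow n t ε (σ.reals 3) k k) *
          pivotRow n t ε (σ.reals 3) k j := by
  have hn2 : n ≤ n * n := Nat.le_mul_of_pos_left _ (by omega)
  have hB : (setV 43 (.lit 0)).staticCost + ((n * (50 * n + 100 + 5) + ((V 0).cost + 2)) +
      ((setV 44 (.lit 0)).staticCost + ((n * (50 * n + 100 + 5) + ((V 0).cost + 2)) +
      (incV 42).staticCost))) ≤ 400 * (n * n) + 200 := by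
    have h2 : (setV 43 (.lit 0)).staticCost + ((V 0).cost + 2) + (setV 44 (.lit 0)).staticCost +
      ((V 0).cost + 2) + (incV 42).staticCost ≤ 200 := by decide
    have : n * (50 * n + 100 + 5) = 50 * (n * n) + 105 * n := by ring
    omega
  set f := σ.reals 3 with hf
  unfold pivot
  refine RunsT.mono (RunsT.seq (RunsT.mono (Q := fun σ₁ => σ₁.words 43 0 = 0)
    (Runs.timed (by simp [Prog.LoopFree]) (Runs.wset 0 0 (by simp [WExp.eval]) (by simp [WExp.eval])
      (by simp [State.setWord_words]))) le_rfl ?_)) hB fun _ _ h => h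
  intro σ₁ hA₁ h43
  have hσ₁ := hσ.of_agree hA₁ (by decide) (by decide)
  have g42 : σ₁.words 42 0 = k := by rw [hA₁.1 42 (by decide), h42]
  have g3 : σ₁.reals 3 = f := hA₁.2 3 (by decide)
  refine RunsT.seq (RunsT.mono (runs_rows hw hσ₁ hle hk hd g42 h43) le_rfl ?_)
  intro σ₂ hA₂ h4
  rw [g3] at h4
  have hσ₂ := hσ₁.of_agree hA₂ (by decide) (by decide)
  have e42 : σ₂.words 42 0 = k := by rw [hA₂.1 42 (by decide), g42]
  have e3 : σ₂.reals 3 = f := (hA₂.2 3 (by decide)).trans g3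
  refine RunsT.seq (RunsT.mono (Q := fun σ₃ => σ₃.words 44 0 = 0)
    (Runs.timed (by simp [Prog.LoopFree]) (Runs.wset 0 0 (by simp [WExp.eval]) (by simp [WExp.eval])
      (by simp [State.setWord_words]))) le_rfl ?_)
  intro σ₃ hA₃ h44
  have hσ₃ := hσ₂.of_agree hA₃ (by decide) (by decide)
  have a42 : σ₃.words 42 0 = k := by rw [hA₃.1 42 (by decide), e42]
  have a3 : σ₃.reals 3 = f := (hA₃.2 3 (by decide)).trans e3
  have a4 : ∀ j < n, σ₃.reals 4 j = pivotRow n t ε f k j := by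
    rw [hA₃.2 4 (by decide)]
    exact h4
  refine RunsT.seq (RunsT.rep (fun i₀ σ' => σ'.words 44 0 = i₀ ∧
    ∀ i < n, ∀ j < n, σ'.reals 3 (i * n + j) = if i < i₀ then f (i * n + j) +
      f (i * n + k) / (1 - pivotRow n t ε f k k) * pivotRow n t ε f k j else f (i * n + j)) n
    (by simp [WExp.eval, hσ₃.size]) ⟨h44, fun _ _ _ _ => by simp [a3]⟩ ?_ ?_)
  · rintro i hi σ₄ hA₄ ⟨i44, i3⟩
    have hσ₄ := hσ₃.of_agree hA₄ (by decide) (by decide)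
    have b42 : σ₄.words 42 0 = k := by rw [hA₄.1 42 (by decide), a42]
    have b4 : ∀ j < n, σ₄.reals 4 j = pivotRow n t ε f k j := by
      rw [hA₄.2 4 (by decide)]
      exact a4
    refine RunsT.mono (runs_rowUpdate hw hσ₄ hk hi b42 i44) le_rfl ?_
    rintro σ₅ - ⟨c44, c1, c2⟩
    refine ⟨c44, fun i' hi' j hj => ?_⟩
    by_cases h : i' = i
    · subst h
      rw [c1 j hj, if_pos (by omega), i3 i' hi' j hj, i3 i' hi' k hk, if_neg (by omega),
        if_neg (by omega), b4 j hj, b4 k hk]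
    · have : i' < i + 1 ↔ i' < i := by omega
      rw [c2 i' hi' h j hj, i3 i' hi' j hj]
      simp only [this]
  · rintro σ₄ hA₄ ⟨-, i3⟩
    have b42 : σ₄.words 42 0 = k := by rw [hA₄.1 42 (by decide), a42]
    refine Runs.timed (by simp [Prog.LoopFree]) (runs_incV (v := k) b42 (by omega)
      ⟨by simp [State.setWord_words], fun i hi j hj => ?_⟩)
    rw [State.setWord_reals, i3 i hi j hj, if_pos hi]

theorem runs_identity (hw : n * n + 1 < 2 ^ w) (hσ : Solving n t ε σ) :
    RunsT w (.seq (setV 42 (.lit 0)) (.rep (.mul (V 0) (V 0)) zeroStep)) σ (50 * (n * n) + 50)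
      fun σ' => ∀ q < n * n, σ'.reals 3 q = 0 := by
  have hB : (setV 42 (.lit 0)).staticCost + ((n * n) * (zeroStep.staticCost + 5) +
      ((WExp.mul (V 0) (V 0)).cost + 2)) ≤ 50 * (n * n) + 50 := by
    have h1 : zeroStep.staticCost + 5 ≤ 50 := by decide
    have h2 : (setV 42 (.lit 0)).staticCost + ((WExp.mul (V 0) (V 0)).cost + 2) ≤ 50 := by decide
    have := Nat.mul_le_mul_left (n * n) h1
    omega
  refine RunsT.mono (RunsT.seq (RunsT.mono (Q := fun σ₁ => σ₁.words 42 0 = 0)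
    (Runs.timed (by simp [Prog.LoopFree]) (Runs.wset 0 0 (by simp [WExp.eval]) (by simp [WExp.eval])
      (by simp [State.setWord_words]))) le_rfl ?_)) hB fun _ _ h => h
  intro σ₁ hA₁ h42
  have hσ₁ := hσ.of_agree hA₁ (by decide) (by decide)
  refine RunsT.rep (fun i σ' => σ'.words 42 0 = i ∧ ∀ q < i, σ'.reals 3 q = 0) (n * n)
    (by simp [WExp.eval, hσ₁.size, Nat.mod_eq_of_lt (show n * n < 2 ^ w by omega)])
    ⟨h42, fun _ h => absurd h (by omega)⟩ ?_ fun σ' _ h => h.2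
  rintro i hi σ₂ hA₂ ⟨g42, g3⟩
  refine Runs.timed (by simp [zeroStep, Prog.LoopFree]) ?_
  refine Runs.seq (Runs.rset i 0 (by simp [WExp.eval, g42]) (by simp [RExp.eval, WExp.eval]) ?_)
  refine runs_incV (v := i) (by simp [g42]) (by omega) ⟨by simp [State.setWord_words], ?_⟩
  intro q hq
  by_cases h : q = i
  · simp [State.setReal_reals_apply, h]
  · simp only [State.setWord_reals, State.setReal_reals_apply, h, and_false, if_false]
    exact g3 q (by omega)

theorem runs_diagonal (hw : n * n + 1 < 2 ^ w) (hσ : Solving n t ε σ)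
    (h0 : ∀ q < n * n, σ.reals 3 q = 0) :
    RunsT w (.seq (setV 42 (.lit 0)) (.rep (V 0) diagStep)) σ (50 * n + 50)
      fun σ' => ∀ i < n, ∀ j < n, σ'.reals 3 (i * n + j) = if i = j then 1 else 0 := by
  have hB : (setV 42 (.lit 0)).staticCost + (n * (diagStep.staticCost + 5) +
      ((V 0).cost + 2)) ≤ 50 * n + 50 := by
    have h1 : diagStep.staticCost + 5 ≤ 50 := by decide
    have h2 : (setV 42 (.lit 0)).staticCost + ((V 0).cost + 2) ≤ 50 := by decide
    have := Nat.mul_le_mul_left n h1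
    omega
  refine RunsT.mono (RunsT.seq (RunsT.mono (Q := fun σ₁ => σ₁.words 42 0 = 0)
    (Runs.timed (by simp [Prog.LoopFree]) (Runs.wset 0 0 (by simp [WExp.eval]) (by simp [WExp.eval])
      (by simp [State.setWord_words]))) le_rfl ?_)) hB fun _ _ h => h
  intro σ₁ hA₁ h42
  have hσ₁ := hσ.of_agree hA₁ (by decide) (by decide)
  have g3 : σ₁.reals 3 = σ.reals 3 := hA₁.2 3 (by decide)
  refine RunsT.rep (fun k σ' => σ'.words 42 0 = k ∧
    ∀ i < n, ∀ j < n, σ'.reals 3 (i * n + j) = if i = j ∧ i < k then 1 else 0) n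
    (by simp [WExp.eval, hσ₁.size]) ⟨h42, fun i hi j hj => ?_⟩ ?_ ?_
  · rw [g3, h0 _ (key_lt hi hj)]
    simp
  · rintro k hk σ₂ hA₂ ⟨g42, i3⟩
    have hσ₂ := hσ₁.of_agree hA₂ (by decide) (by decide)
    have hn2 : n ≤ n * n := Nat.le_mul_of_pos_left _ (by omega)
    have hkk := key_lt hk hk
    have h1 : 1 % 2 ^ w = 1 := Nat.mod_eq_of_lt (by omega)
    have m1 : k * n % 2 ^ w = k * n := Nat.mod_eq_of_lt (by omega)
    have m2 : (k * n + k) % 2 ^ w = k * n + k := Nat.mod_eq_of_lt (by omega)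
    refine Runs.timed (by simp [diagStep, Prog.LoopFree]) ?_
    refine Runs.seq (Runs.rset (k * n + k) 1 (by simp [WExp.eval, g42, hσ₂.size, m1, m2])
      (by simp [RExp.eval, WExp.eval, h1]) ?_)
    refine runs_incV (v := k) (by simp [g42]) (by omega) ⟨by simp [State.setWord_words], ?_⟩
    intro i hi j hj
    simp only [State.setWord_reals, State.setReal_reals_apply, true_and, key_eq_iff hj hk, i3 i hi j hj]
    by_cases h : i = k ∧ j = k
    · rw [if_pos h, if_pos ⟨h.1.trans h.2.symm, by omega⟩]
    · rw [if_neg h]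
      have : (i = j ∧ i < k + 1) ↔ i = j ∧ i < k := by omega
      simp only [this]
  · rintro σ₂ - ⟨-, i3⟩ i hi j hj
    rw [i3 i hi j hj]
    simp [hi]

theorem runs_outputEntry (hw : n * n + 1 < 2 ^ w) (hσ : Solving n t ε σ) {j : ℕ} (hj : j < n)
    (h43 : σ.words 43 0 = j) :
    RunsT w outputEntry σ (50 * n + 100) fun σ' => σ'.words 43 0 = j + 1 ∧
      σ'.reals 1 = Function.update (σ.reals 1) j
        (ε / n * ∑ i ∈ Finset.range n, σ.reals 3 (i * n + j)) := by
  have hn2 : n ≤ n * n := Nat.le_mul_of_pos_left _ (by omega)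
  set f := σ.reals 3 with hf
  have hB : (setR 7 (.ofWord (.lit 0)) ;; setV 44 (.lit 0)).staticCost +
      ((n * (columnTerm.staticCost + 5) + ((V 0).cost + 2)) +
      (Prog.seq (.rset 1 (V 43) (.mul (.div (RV 0) (.ofWord (V 0))) (RV 7)))
        (incV 43)).staticCost) ≤ 50 * n + 100 := by
    have h1 : columnTerm.staticCost + 5 ≤ 50 := by decide
    have h2 : (setR 7 (.ofWord (.lit 0)) ;; setV 44 (.lit 0)).staticCost +
      ((V 0).cost + 2) + (Prog.seq (.rset 1 (V 43) (.mul (.div (RV 0) (.ofWord (V 0))) (RV 7)))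
        (incV 43)).staticCost ≤ 100 := by decide
    have := Nat.mul_le_mul_left n h1
    omega
  unfold outputEntry
  refine RunsT.mono (RunsT.seq (RunsT.mono (Q := fun σ₁ => σ₁.reals 7 0 = 0 ∧ σ₁.words 44 0 = 0)
    (Runs.timed (by simp [Prog.LoopFree]) ?_) le_rfl ?_)) hB fun _ _ h => h
  · refine Runs.seq (Runs.rset 0 0 (by simp [WExp.eval]) (by simp [RExp.eval, WExp.eval]) ?_)
    exact Runs.wset 0 0 (by simp [WExp.eval]) (by simp [WExp.eval])
      (by simp [State.setWord_words, State.setReal_reals_apply])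
  rintro σ₁ hA₁ ⟨h7, h44⟩
  have hσ₁ := hσ.of_agree hA₁ (by decide) (by decide)
  have g43 : σ₁.words 43 0 = j := by rw [hA₁.1 43 (by decide), h43]
  have g3 : σ₁.reals 3 = f := hA₁.2 3 (by decide)
  have g1 : σ₁.reals 1 = σ.reals 1 := hA₁.2 1 (by decide)
  refine RunsT.seq (RunsT.rep (fun i σ' => σ'.words 44 0 = i ∧ σ'.reals 7 0 =
    ∑ i ∈ Finset.range i, f (i * n + j)) n (by simp [WExp.eval, hσ₁.size]) ⟨h44, by simp [h7]⟩
    ?_ ?_)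
  · rintro i hi σ₂ hA₂ ⟨i44, i7⟩
    have hσ₂ := hσ₁.of_agree hA₂ (by decide) (by decide)
    have e43 : σ₂.words 43 0 = j := by rw [hA₂.1 43 (by decide), g43]
    have e3 : σ₂.reals 3 = f := (hA₂.2 3 (by decide)).trans g3
    have hij := key_lt hi hj
    have m1 : i * n % 2 ^ w = i * n := Nat.mod_eq_of_lt (by omega)
    have m2 : (i * n + j) % 2 ^ w = i * n + j := Nat.mod_eq_of_lt (by omega)
    refine Runs.timed (by simp [columnTerm, Prog.LoopFree]) ?_
    refine Runs.seq (Runs.rset 0 (∑ i ∈ Finset.range (i + 1), f (i * n + j))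
      (by simp [WExp.eval]) ?_ ?_)
    · simp [RExp.eval, WExp.eval, e43, hσ₂.size, i44, e3, i7, m1, m2, Finset.sum_range_succ]
    · refine runs_incV (v := i) (by simp [i44]) (by omega) ?_
      simp [State.setWord_words, State.setReal_reals_apply]
  · rintro σ₂ hA₂ ⟨-, i7⟩
    have hσ₂ := hσ₁.of_agree hA₂ (by decide) (by decide)
    have e43 : σ₂.words 43 0 = j := by rw [hA₂.1 43 (by decide), g43]
    have e1 : σ₂.reals 1 = σ.reals 1 := (hA₂.2 1 (by decide)).trans g1
    refine Runs.timed (by simp [Prog.LoopFree]) ?_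
    refine Runs.seq (Runs.rset j (ε / n * ∑ i ∈ Finset.range n, f (i * n + j))
      (by simp [WExp.eval, e43]) ?_ ?_)
    · simp [RExp.eval, WExp.eval, hσ₂.eps, hσ₂.size, i7]
    · refine runs_incV (v := j) (by simp [e43]) (by omega) ⟨by simp [State.setWord_words], ?_⟩
      funext x
      simp [State.setReal_reals_apply, Function.update_apply, e1]

theorem card_nbr (E : UGraph n) (u : Fin n) : (nbr E u).card = E.deg u := by
  unfold UGraph.deg
  symm
  refine Finset.card_bij (fun v _ => (v : ℕ)) ?_ ?_ ?_
  · intro v hv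
    rw [mem_nbr_fin]
    exact (Finset.mem_filter.1 hv).2
  · intro v _ v' _ h
    exact Fin.ext h
  · intro b hb
    obtain ⟨_, hb', h⟩ := mem_nbr.1 hb
    exact ⟨⟨b, hb'⟩, Finset.mem_filter.2 ⟨Finset.mem_univ _, h⟩, rfl⟩

theorem sum_nbr (E : UGraph n) (u : ℕ) (f : ℕ → ℝ) :
    ∑ b ∈ nbr E u, f b = ∑ b ∈ Finset.range n, adj E u b * f b := by
  unfold nbr adj
  rw [Finset.sum_filter]
  exact Finset.sum_congr rfl fun b _ => by split_ifs <;> simp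

theorem Table.Describes.deg_eq {E : UGraph n} (ht : t.Describes E) (u : Fin n) :
    t.deg u = E.deg u := by
  rw [ht.ok.card u u.2, card_nbr]

/-- Summing over the filled slots of `k` is multiplication by row `k` of the discounted transition
matrix. -/
theorem pivotRow_eq {E : UGraph n} (ht : t.Describes E) (f : ℕ → ℝ) (k j : Fin n) :
    pivotRow n t ε f k j = ∑ b : Fin n, discounted ε E k b * f (b * n + j) := by
  unfold pivotRow
  rw [ht.ok.sum k.2 fun b => f (b * n + j), sum_nbr E k, Finset.mul_sum, Finset.sum_range]
  refine Finset.sum_congr rfl fun b _ => ?_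
  rw [discounted_eq_adj, ht.deg_eq]
  ring

/-- Starting from the identity, which inverts `1 - 0`, the rows of `Q` are admitted one by one;
after `n` of them the matrix is `(1 - Q)⁻¹`, and its column sums give PageRank. -/
theorem runs_solve (hw : n * n + 1 < 2 ^ w) (hn : 0 < n) (h0 : 0 < ε) (h1 : ε < 1) {E : UGraph n}
    (hE : E.NoIsolated) (ht : t.Describes E) (hσ : Solving n t ε σ) :
    RunsT w solve σ (2000 * n ^ 3) fun σ' => ∀ v : Fin n, σ'.reals 1 v = pageRank ε E v := by
  have hB : (50 * (n * n) + 50) + ((50 * n + 50) +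
      (((setV 42 (.lit 0)).staticCost + (n * (400 * (n * n) + 200 + 5) + ((V 0).cost + 2))) +
      ((setV 43 (.lit 0)).staticCost + (n * (50 * n + 100 + 5) + ((V 0).cost + 2))))) ≤
      2000 * n ^ 3 := by
    have h2 : (setV 42 (.lit 0)).staticCost + ((V 0).cost + 2) +
      (setV 43 (.lit 0)).staticCost + ((V 0).cost + 2) ≤ 50 := by decide
    have h3 : n * (400 * (n * n) + 200 + 5) = 400 * n ^ 3 + 205 * n := by ring
    have h4 : n * (50 * n + 100 + 5) = 50 * (n * n) + 105 * n := by ring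
    have h5 : n ≤ n ^ 3 := Nat.le_self_pow (by norm_num) n
    have h6 : n * n ≤ n ^ 3 := by
      calc n * n = n ^ 2 := by ring
        _ ≤ n ^ 3 := Nat.pow_le_pow_right hn (by norm_num)
    omega
  unfold solve
  refine RunsT.mono (RunsT.seq (RunsT.mono (runs_identity hw hσ) le_rfl ?_)) hB fun _ _ h => h
  intro σ₁ hA₁ hz
  have hσ₁ := hσ.of_agree hA₁ (by decide) (by decide)
  refine RunsT.seq (RunsT.mono (runs_diagonal hw hσ₁ hz) le_rfl ?_)
  intro σ₂ hA₂ hdiag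
  have hσ₂ := hσ₁.of_agree hA₂ (by decide) (by decide)
  refine RunsT.seq (RunsT.mono (Q := fun σ₄ => ∀ i j : Fin n, σ₄.reals 3 (i * n + j) =
    (1 - discounted ε E)⁻¹ i j) (RunsT.seq (RunsT.mono (Q := fun σ₃ => σ₃.words 42 0 = 0)
    (Runs.timed (by simp [Prog.LoopFree]) (Runs.wset 0 0 (by simp [WExp.eval]) (by simp [WExp.eval])
      (by simp [State.setWord_words]))) le_rfl ?_)) le_rfl ?_)
  · intro σ₃ hA₃ h42
    have hσ₃ := hσ₂.of_agree hA₃ (by decide) (by decide)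
    have g3 : σ₃.reals 3 = σ₂.reals 3 := hA₃.2 3 (by decide)
    refine RunsT.rep (fun k σ' => σ'.words 42 0 = k ∧ ∀ i j : Fin n, σ'.reals 3 (i * n + j) =
      (1 - discountedRows ε E k)⁻¹ i j) n (by simp [WExp.eval, hσ₃.size]) ⟨h42, fun i j => ?_⟩ ?_ ?_
    · rw [g3, hdiag i i.2 j j.2, discountedRows_zero, sub_zero, inv_one, Matrix.one_apply]
      simp [Fin.ext_iff]
    · rintro k hk σ₄ hA₄ ⟨g42, i3⟩
      have hσ₄ := hσ₃.of_agree hA₄ (by decide) (by decide)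
      refine RunsT.mono (runs_pivot hw hσ₄ ht.slot_le hk (ht.ok.deg_le hk) g42) le_rfl ?_
      rintro σ₅ - ⟨h42', h3⟩
      refine ⟨h42', fun i j => ?_⟩
      rw [h3 i i.2 j j.2]
      have hrow := fun j : Fin n => pivotRow_eq (ε := ε) ht (σ₄.reals 3) ⟨k, hk⟩ j
      simp only [i3] at hrow
      have hinv := inv_one_sub_discountedRows_succ h0 h1 hE ⟨k, hk⟩ _ rfl
        (fun j => pivotRow n t ε (σ₄.reals 3) k j) hrow i j
      rw [hinv, i3 i j]
      have := i3 i ⟨k, hk⟩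
      dsimp only at this
      rw [this]
    · rintro σ₄ - ⟨-, i3⟩
      rwa [discountedRows_self] at i3
  · intro σ₃ hA₃ hinv
    have hσ₃ := hσ₂.of_agree hA₃ (by decide) (by decide)
    refine RunsT.seq (RunsT.mono (Q := fun σ₃ => σ₃.words 43 0 = 0)
      (Runs.timed (by simp [Prog.LoopFree]) (Runs.wset 0 0 (by simp [WExp.eval])
        (by simp [WExp.eval]) (by simp [State.setWord_words]))) le_rfl ?_)
    intro σ₄ hA₄ h43
    have hσ₄ := hσ₃.of_agree hA₄ (by decide) (by decide)
    have g3 : σ₄.reals 3 = σ₃.reals 3 := hA₄.2 3 (by decide)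
    refine RunsT.rep (fun j σ' => σ'.words 43 0 = j ∧ ∀ v : Fin n, (v : ℕ) < j →
      σ'.reals 1 v = pageRank ε E v) n (by simp [WExp.eval, hσ₄.size])
      ⟨h43, fun _ h => absurd h (by omega)⟩ ?_ fun σ' _ h v => h.2 v v.2
    rintro j hj σ₅ hA₅ ⟨g43, i1⟩
    have hσ₅ := hσ₄.of_agree hA₅ (by decide) (by decide)
    have e3 : σ₅.reals 3 = σ₃.reals 3 := (hA₅.2 3 (by decide)).trans g3
    refine RunsT.mono (runs_outputEntry hw hσ₅ hj g43) le_rfl ?_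
    rintro σ₆ - ⟨h43', h1'⟩
    refine ⟨h43', fun v hv => ?_⟩
    rw [h1', e3]
    by_cases hvj : (v : ℕ) = j
    · subst hvj
      rw [Function.update_self, pageRank, Finset.sum_range]
      simp only [hinv, visitMatrix]
    · rw [Function.update_of_ne hvj, i1 v (by omega)]

end solve


/-! ## Preprocessing -/

/-- Peels a deterministic part off the preprocessing, so that the parameters and the slot table
become definite objects before anything random happens. -/
theorem Runs.exec_seq {w : ℕ} {P : Prog} {σ : State} {Q : State → Prop} (h : Runs w P σ Q) :
    ∃ σ' t, P.Agree σ σ' ∧ Q σ' ∧ ∀ P', exec w (.seq P P') σ = charge t (exec w P' σ') := by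
  obtain ⟨B, σ', t, h1, -, h3⟩ := h
  refine ⟨σ', t, agree_exec w P σ (σ', t) (by rw [h1, PMF.mem_support_pure_iff]), h3, fun P' => ?_⟩
  simp only [exec, andThen, h1, PMF.pure_bind]

section preprocessing

variable {w n R M N : ℕ} {ε α W₀ : ℝ} {σ : State}

theorem runs_harmonic (hn : n + 1 < 2 ^ w) (h0 : σ.words 0 0 = n) (h9 : σ.reals 9 0 = 0) :
    Runs w harmonicProg σ fun σ' => σ'.reals 9 0 = harm n := by
  have h1 : 1 % 2 ^ w = 1 := Nat.mod_eq_of_lt (by omega)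
  unfold harmonicProg
  refine Runs.seq (Runs.mono (Q := fun σ₁ => σ₁.words 40 0 = 0)
    (Runs.wset 0 0 (by simp [WExp.eval]) (by simp [WExp.eval]) (by simp [State.setWord_words])) ?_)
  intro σ₁ hA₁ h40
  refine Runs.rep (fun j σ' => σ'.words 40 0 = j ∧ σ'.reals 9 0 = harm j) n
    (by simp [WExp.eval, hA₁.1 0 (by decide), h0])
    ⟨h40, by rw [hA₁.2 9 (by decide), h9]; simp [harm]⟩ ?_ fun _ _ h => h.2
  rintro j hj σ₂ - ⟨g40, g9⟩
  refine Runs.seq (Runs.rset 0 (harm (j + 1)) (by simp [WExp.eval]) ?_ ?_)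
  · simp [RExp.eval, WExp.eval, g40, g9, h1, harm, Finset.sum_range_succ]
  · refine runs_incV (v := j) (by simp [g40]) (by omega) ?_
    simp [State.setWord_words, State.setReal_reals_apply]

/-- The number of walks per vertex and the length of the walks are adequate. -/
structure Adequate (c n R M : ℕ) (ε α : ℝ) : Prop where
  le_R : c * harm n ≤ R * (α * α)
  R_lt : ((R : ℝ) - 1) * (α * α) < c * harm n
  le_M : 10 * (harm n * harm n) ≤ M * ε
  M_lt : ((M : ℝ) - 1) * ε < 10 * (harm n * harm n)

theorem harm_le (m : ℕ) : harm m ≤ m := by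
  unfold harm
  calc ∑ i ∈ Finset.range m, 1 / ((i : ℝ) + 1) ≤ ∑ _i ∈ Finset.range m, (1 : ℝ) := by
        refine Finset.sum_le_sum fun i _ => ?_
        rw [div_le_one (by positivity)]
        have : (0 : ℝ) ≤ i := Nat.cast_nonneg i
        linarith
    _ = m := by simp

theorem eval_capExp {c : ℕ} (hc : c * n ^ 6 < 2 ^ w) (hc0 : 0 < c) (hn : 0 < n)
    (h0 : σ.words 0 0 = n) : (capExp c).eval w σ = c * n ^ 6 := by
  have h6 : n ^ 6 < 2 ^ w := lt_of_le_of_lt (Nat.le_mul_of_pos_left _ hc0) hc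
  have h4 : n * n * (n * n) < 2 ^ w := lt_of_le_of_lt
    (by calc n * n * (n * n) = n ^ 4 := by ring
          _ ≤ n ^ 6 := Nat.pow_le_pow_right hn (by norm_num)) h6
  have h2 : n * n < 2 ^ w := lt_of_le_of_lt
    (by calc n * n = n ^ 2 := by ring
          _ ≤ n ^ 6 := Nat.pow_le_pow_right hn (by norm_num)) h6
  have h6' : n * n * (n * n) * (n * n) = n ^ 6 := by ring
  have hcw : c < 2 ^ w := lt_of_le_of_lt (Nat.le_mul_of_pos_right _ (by positivity)) hc
  simp only [capExp, WExp.eval, Nat.zero_mod, h0, Nat.mod_eq_of_lt h2, Nat.mod_eq_of_lt h4, h6',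
    Nat.mod_eq_of_lt h6, Nat.mod_eq_of_lt hcw, Nat.mod_eq_of_lt hc]

/-- Reals cannot be rounded to words on this machine, so the least integer `j` with `y ≤ j * x` is
found by counting. The hypothesis `hxm` ensures that the cap on the number of iterations is not the
reason for stopping. -/
theorem runs_search {k : WExp} {b : BExp} {a m : ℕ} {x y : ℝ} (hk : k.eval w σ = m)
    (hm : m + 1 < 2 ^ w) (ha : σ.words a 0 = 0) (hy : 0 < y)
    (hxm : y ≤ m * x)
    (hb : ∀ σ' j, (incV a).Agree σ σ' → σ'.words a 0 = j → (b.Holds w σ' ↔ j * x < y)) (hx : 0 < x) :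
    Runs w (.loop k b (incV a)) σ fun σ' => ∃ j : ℕ, σ'.words a 0 = j ∧ y ≤ j * x ∧
      ((j : ℝ) - 1) * x < y := by
  refine Runs.while (fun j σ' => σ'.words a 0 = j ∧ ((j : ℝ) - 1) * x < y) m hk
    ⟨ha, by push_cast; linarith⟩ ?_ ?_
  · rintro j hj σ' hA hbj ⟨h1, h2⟩
    refine runs_incV h1 (by omega) ⟨by simp [State.setWord_words], ?_⟩
    have := (hb σ' j hA h1).1 hbj
    push_cast
    simpa using this
  · rintro j hj σ' hA ⟨h1, h2⟩ h
    refine ⟨j, h1, ?_, h2⟩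
    rcases h with rfl | h
    · exact hxm
    · rw [hb σ' j hA h1] at h
      exact not_lt.1 h

theorem runs_params {c : ℕ} (hc : 10 ≤ c) (hn : 2 ≤ n) (hε : 0 < ε) (hε1 : ε < 1) (hα : 0 < α)
    (hα1 : α ≤ 1)
    (hreg : 1 < ε * ε * (α * α) * (n * (n * n))) (hw : ∀ R M, Adequate c n R M ε α →
      n * R * M < 2 ^ w) (hcap : c * n ^ 6 + 1 < 2 ^ w) (h0 : σ.words 0 0 = n) (h00 : σ.reals 0 0 = ε)
    (h01 : σ.reals 0 1 = α) (h9 : σ.reals 9 0 = harm n) (h13 : σ.words 13 0 = 0)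
    (h14 : σ.words 14 0 = 0) :
    Runs w (paramsProg c) σ fun σ' => ∃ R M, Adequate c n R M ε α ∧
      Params n R M (n * R * M) ε (ε / (n * R)) σ' := by
  have hn0 : 0 < n := by omega
  have hcw : c < 2 ^ w := by
    have : c ≤ c * n ^ 6 := Nat.le_mul_of_pos_right _ (by positivity)
    omega
  have h1 : 1 % 2 ^ w = 1 := Nat.mod_eq_of_lt (by omega)
  have h10 : 10 % 2 ^ w = 10 := Nat.mod_eq_of_lt (by omega)
  have hc' : c % 2 ^ w = c := Nat.mod_eq_of_lt hcw
  have hH1 : 1 ≤ harm n := one_le_harm (by omega)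
  have hHn := harm_le n
  have hnr : (2 : ℝ) ≤ n := by exact_mod_cast hn
  have hcr : (10 : ℝ) ≤ c := by exact_mod_cast hc
  have hn3 : (0 : ℝ) < n * (n * n) := by positivity
  have hαα : α * α ≤ 1 := by nlinarith
  have hεε : ε * ε ≤ ε := by nlinarith
  have hαα0 : 0 < α * α := by positivity
  have hεε0 : 0 < ε * ε := by positivity
  -- The regime condition bounds `1 / α ^ 2`, and likewise `1 / ε`, by `n ^ 3`; with the harmonic
  -- number at most `n` this makes `c * n ^ 6` iterations sufficient.
  have ha3 : 1 < α * α * (n * (n * n)) := by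
    refine hreg.trans_le (mul_le_mul_of_nonneg_right ?_ hn3.le)
    nlinarith
  have he3 : 1 < ε * (n * (n * n)) := by
    refine hreg.trans_le (mul_le_mul_of_nonneg_right ?_ hn3.le)
    nlinarith
  unfold paramsProg
  refine Runs.seq (Runs.mono (runs_search (x := α * α) (y := c * harm n)
    (eval_capExp (by omega) (by omega) hn0 h0) hcap h13 (by positivity) ?_ ?_ hαα0) ?_)
  · push_cast
    have h3 : (n : ℝ) ≤ n ^ 3 * (n ^ 3 * (α * α)) := by
      have e : (n : ℝ) ^ 3 * (α * α) = α * α * (n * (n * n)) := by ring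
      have h4 : (n : ℝ) ≤ n ^ 3 := by
        calc (n : ℝ) = n ^ 1 := (pow_one _).symm
          _ ≤ n ^ 3 := pow_le_pow_right₀ (by linarith) (by norm_num)
      rw [e]
      nlinarith
    calc (c : ℝ) * harm n ≤ c * n := by gcongr
      _ ≤ c * (n ^ 3 * (n ^ 3 * (α * α))) := by gcongr
      _ = c * n ^ 6 * (α * α) := by ring
  · rintro σ' j hA hj
    simp only [BExp.Holds, RExp.eval, WExp.eval, Nat.zero_mod, hj, h1, hc',
      hA.2 0 (by simp [Prog.realTargets]), hA.2 9 (by simp [Prog.realTargets]), h01, h9]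
  rintro σ₁ hA₁ ⟨R, h13₁, hR1, hR2⟩
  have e0 : σ₁.words 0 = σ.words 0 := hA₁.1 0 (by simp [Prog.wordTargets])
  have er : σ₁.reals = σ.reals := funext fun a => hA₁.2 a (by simp [Prog.realTargets])
  refine Runs.seq (Runs.mono (runs_search (x := ε) (y := 10 * (harm n * harm n))
    (eval_capExp (by omega) (by omega) hn0 (by rw [e0, h0])) hcap
      (by rw [hA₁.1 14 (by simp [Prog.wordTargets]), h14]) (by positivity) ?_ ?_ hε) ?_)
  · push_cast
    have h3 : (n : ℝ) * n ≤ n ^ 3 * (ε * (n * (n * n))) := by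
      have h4 : (n : ℝ) * n ≤ n ^ 3 := by
        calc (n : ℝ) * n = n ^ 2 := by ring
          _ ≤ n ^ 3 := pow_le_pow_right₀ (by linarith) (by norm_num)
      nlinarith
    have hHH : harm n * harm n ≤ n * n := by gcongr
    calc 10 * (harm n * harm n) ≤ c * (n * n) := by gcongr
      _ ≤ c * (n ^ 3 * (ε * (n * (n * n)))) := by gcongr
      _ = c * n ^ 6 * ε := by ring
  · rintro σ' j hA hj
    simp only [BExp.Holds, RExp.eval, WExp.eval, Nat.zero_mod, hj, h10,
      hA.2 0 (by simp [Prog.realTargets]), hA.2 9 (by simp [Prog.realTargets]), er, h00, h9,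
      Nat.cast_ofNat]
  rintro σ₂ hA₂ ⟨M, h14₂, hM1, hM2⟩
  have had : Adequate c n R M ε α := ⟨hR1, hR2, hM1, hM2⟩
  have hN := hw R M had
  have hRM : 0 < M := by
    rcases Nat.eq_zero_or_pos M with h | h
    · subst h
      simp only [Nat.cast_zero, zero_mul] at hM1
      nlinarith
    · exact h
  have hnR : n * R < 2 ^ w := lt_of_le_of_lt (Nat.le_mul_of_pos_right _ hRM) hN
  have g0 : σ₂.words 0 0 = n := by rw [hA₂.1 0 (by simp [Prog.wordTargets]), e0, h0]
  have g13 : σ₂.words 13 0 = R := by rw [hA₂.1 13 (by simp [Prog.wordTargets]), h13₁]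
  have g00 : σ₂.reals 0 0 = ε := by rw [hA₂.2 0 (by simp [Prog.realTargets]), er, h00]
  refine Runs.seq (Runs.wset 0 (n * R * M) (by simp [WExp.eval])
    (by simp [WExp.eval, g0, g13, h14₂, Nat.mod_eq_of_lt hnR, Nat.mod_eq_of_lt hN]) ?_)
  refine Runs.rset 0 (ε / (n * R)) (by simp [WExp.eval])
    (by simp [RExp.eval, WExp.eval, State.setWord_words, g0, g13, g00]) ?_
  refine ⟨R, M, had, ?_⟩
  constructor <;> simp [State.setWord_words, State.setReal_reals_apply, g0, g13, h14₂, g00]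

/-- The outcome of the choice of the parameters: `e` tells whether PageRank is computed exactly. -/
def Chosen (c n R M : ℕ) (ε α : ℝ) (e : Bool) : Prop :=
  if e then ¬ 1 < ε * ε * (α * α) * (n * (n * n)) ∧ R = 0 ∧ M = 0
  else 1 < ε * ε * (α * α) * (n * (n * n)) ∧ Adequate c n R M ε α

theorem runs_regime {c : ℕ} (hc : 10 ≤ c) (hn : 2 ≤ n) (hε : 0 < ε) (hε1 : ε < 1) (hα : 0 < α)
    (hα1 : α ≤ 1) (hw : ∀ R M, 1 < ε * ε * (α * α) * (n * (n * n)) → Adequate c n R M ε α →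
      n * R * M < 2 ^ w) (hcap : c * n ^ 6 + 1 < 2 ^ w) (h0 : σ.words 0 0 = n) (h00 : σ.reals 0 0 = ε)
    (h01 : σ.reals 0 1 = α) (h9 : σ.reals 9 0 = harm n) (h13 : σ.words 13 0 = 0)
    (h14 : σ.words 14 0 = 0) (h15 : σ.words 15 0 = 0) (h16 : σ.words 16 0 = 0)
    (h6 : σ.reals 6 0 = 0) :
    Runs w (regimeProg c) σ fun σ' => ∃ R M e, Chosen c n R M ε α e ∧
      Params n R M (n * R * M) ε (ε / (n * R)) σ' ∧ σ'.words 16 0 = if e then 1 else 0 := by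
  have h1 : 1 % 2 ^ w = 1 := Nat.mod_eq_of_lt (by omega)
  set b : BExp := .rlt (.ofWord (.lit 1))
    (.mul (.mul (.mul (RV 0) (RV 0)) (.mul (.get 0 (.lit 1)) (.get 0 (.lit 1))))
      (.mul (.ofWord (V 0)) (.mul (.ofWord (V 0)) (.ofWord (V 0))))) with hbdef
  have hb : b.Holds w σ ↔ 1 < ε * ε * (α * α) * (n * (n * n)) := by
    simp only [hbdef, BExp.Holds, RExp.eval, WExp.eval, Nat.zero_mod, h1, h0, h00, h01, Nat.cast_one]
  unfold regimeProg
  by_cases hreg : 1 < ε * ε * (α * α) * (n * (n * n))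
  · refine Runs.ite_pos (hb.2 hreg) (Runs.mono (runs_params hc hn hε hε1 hα hα1 hreg
      (fun R M => hw R M hreg) hcap h0 h00 h01 h9 h13 h14) ?_)
    rintro σ' hA ⟨R, M, had, hP⟩
    have : (paramsProg c).wordTargets = [13, 14, 15] := rfl
    exact ⟨R, M, false, by simp [Chosen, had, hreg], hP, by
      rw [hA.1 16 (by rw [this]; decide), h16]; simp⟩
  · refine Runs.ite_neg (fun h => hreg (hb.1 h)) (Runs.wset 0 1 (by simp [WExp.eval])
      (by simp [WExp.eval, h1]) ⟨0, 0, true, by simp [Chosen, hreg, -not_lt],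
        ?_, by simp [State.setWord_words]⟩)
    constructor <;> simp [State.setWord_words, h0, h00, h13, h14, h15, h6]

/-! ### Building the slot table and the first walks. -/

/-- The neighbours that have been found when the first `p` entries of the adjacency matrix have
been read. -/
noncomputable def nbrUpTo {n : ℕ} (E : UGraph n) (p a : ℕ) : Finset ℕ :=
  (nbr E a).filter fun b => a * n + b < p

/-- The state while the slot table is being built. -/
structure Building {n : ℕ} (N : ℕ) (E : UGraph n) (p : ℕ) (σ : State) : Prop where
  size : σ.words 0 0 = n
  adj : ∀ a < n, ∀ b < n, σ.words 1 (a * n + b) = if b ∈ nbr E a then 1 else 0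
  table : ∃ t : Table, HasTable σ t ∧ t.Ok n (nbrUpTo E p) ∧ ∀ k, t.slot k ≤ n
  touched : ∃ S : List ℕ, Touched N σ S ∧ S.length ≤ p
  lists : Lists n N 0 σ

theorem Building.of_eq {n N : ℕ} {E : UGraph n} {p : ℕ} {σ σ' : State} (h : Building N E p σ)
    (hw : ∀ a ∈ [0, 1, 3, 4, 5, 7, 9, 10, 11, 12, 15, 21, 22], σ'.words a = σ.words a) :
    Building N E p σ' := by
  obtain ⟨t, h1, h2⟩ := h.table
  obtain ⟨S, h3, h4⟩ := h.touched
  refine ⟨?_, ?_, ⟨t, h1.of_eq (hw _ (by simp)) (hw _ (by simp)) (hw _ (by simp)), h2⟩, ⟨S, ?_, h4⟩, ?_⟩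
  · rw [hw 0 (by simp)]
    exact h.size
  · rw [hw 1 (by simp)]
    exact h.adj
  · exact h3.of_eq (hw _ (by simp)) (hw _ (by simp)) (hw _ (by simp)) (hw _ (by simp))
      (hw _ (by simp)) (hw _ (by simp)) (hw _ (by simp))
  · exact h.lists.of_eq (hw _ (by simp)) (hw _ (by simp)) (hw _ (by simp))

theorem mem_nbr_lt {E : UGraph n} {a b : ℕ} (h : b ∈ nbr E a) : a < n ∧ b < n := by
  obtain ⟨ha, hb, -⟩ := mem_nbr.1 h
  exact ⟨ha, hb⟩

theorem nbrUpTo_succ_of_mem {E : UGraph n} {a b : ℕ} (h : b ∈ nbr E a) :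
    nbrUpTo E (a * n + b + 1) = Function.update (nbrUpTo E (a * n + b)) a
      (insert b (nbrUpTo E (a * n + b) a)) := by
  obtain ⟨ha, hb⟩ := mem_nbr_lt h
  funext x
  ext y
  by_cases hxa : x = a
  · subst hxa
    rw [Function.update_self, Finset.mem_insert, nbrUpTo, nbrUpTo, Finset.mem_filter,
      Finset.mem_filter]
    constructor
    · rintro ⟨h1, h2⟩
      by_cases hy : y = b
      · exact Or.inl hy
      · exact Or.inr ⟨h1, by omega⟩
    · rintro (rfl | ⟨h1, h2⟩)
      · exact ⟨h, by omega⟩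
      · exact ⟨h1, by omega⟩
  · rw [Function.update_of_ne hxa, nbrUpTo, nbrUpTo, Finset.mem_filter, Finset.mem_filter]
    refine and_congr_right fun hy => ?_
    have := mem_nbr_lt hy
    have hne : x * n + y ≠ a * n + b := by
      rw [Ne, key_eq_iff this.2 hb]
      exact fun h => hxa h.1
    omega

theorem nbrUpTo_succ_of_notMem {E : UGraph n} {a b : ℕ} (hb : b < n) (h : b ∉ nbr E a) :
    nbrUpTo E (a * n + b + 1) = nbrUpTo E (a * n + b) := by
  funext x
  ext y
  rw [nbrUpTo, nbrUpTo, Finset.mem_filter, Finset.mem_filter]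
  refine and_congr_right fun hy => ?_
  have := mem_nbr_lt hy
  have hne : x * n + y ≠ a * n + b := by
    rw [Ne, key_eq_iff this.2 hb]
    rintro ⟨rfl, rfl⟩
    exact h hy
  omega

/-- `attach` is reused here while all position lists are still empty, so its `touch` copies nothing.
It does leave marks, which are recorded in `touched` and removed afterwards. -/
theorem runs_buildStep {E : UGraph n} (hw : 8 * (n * n * (N + 1)) < 2 ^ w) {a b : ℕ} (ha : a < n)
    (hb : b < n) (hB : Building N E (a * n + b) σ) (h24 : σ.words 24 0 = a)
    (h25 : σ.words 25 0 = b) :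
    Runs w buildStep σ fun σ' => Building N E (a * n + b + 1) σ' ∧ σ'.words 25 0 = b + 1 := by
  have hab := key_lt ha hb
  have hnn : n * n ≤ n * n * (N + 1) := Nat.le_mul_of_pos_right _ (by omega)
  have hn2 : n ≤ n * n := Nat.le_mul_of_pos_left _ (by omega)
  have h4 : 1 * (N + 1) ≤ n * n * (N + 1) := Nat.mul_le_mul_right _ (by omega)
  have m1 : a * n % 2 ^ w = a * n := Nat.mod_eq_of_lt (by omega)
  have m2 : (a * n + b) % 2 ^ w = a * n + b := Nat.mod_eq_of_lt (by omega)
  obtain ⟨t, ht, hok, hle⟩ := hB.table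
  obtain ⟨S, hS, hSl⟩ := hB.touched
  unfold buildStep
  refine Runs.seq (Runs.mono (Q := fun σ₁ => Building N E (a * n + b + 1) σ₁ ∧
    σ₁.words 25 0 = b) ?_ ?_)
  · by_cases hmem : b ∈ nbr E a
    · refine Runs.ite_pos
        (by simp [BExp.Holds, WExp.eval, h24, h25, hB.size, m1, m2, hB.adj a ha b hb, hmem])
        (Runs.mono (runs_attach hB.size h24 h25 ha hb ht hok (by simp [nbrUpTo]) hS hB.lists
          (Nat.zero_le _) (by omega) (by omega)).runs ?_)
      rintro σ₁ hA₁ ⟨ht₁, hT₁⟩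
      refine ⟨⟨?_, ?_, ⟨_, ht₁, ?_, Table.attach_slot_le hle hb⟩, ⟨_, hT₁, ?_⟩, ?_⟩, ?_⟩
      · rw [hA₁.1 0 (by decide)]
        exact hB.size
      · rw [hA₁.1 1 (by decide)]
        exact hB.adj
      · rw [nbrUpTo_succ_of_mem hmem]
        exact hok.attach ha hb (by simp [nbrUpTo])
      · rw [List.length_cons]
        omega
      · exact hB.lists.of_eq (hA₁.1 7 (by decide)) (hA₁.1 9 (by decide)) (hA₁.1 15 (by decide))
      · rw [hA₁.1 25 (by decide), h25]
    · refine Runs.ite_neg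
        (by simp [BExp.Holds, WExp.eval, h24, h25, hB.size, m1, m2, hB.adj a ha b hb, hmem])
        (Runs.skip ⟨⟨hB.size, hB.adj, ⟨t, ht, ?_, hle⟩, ⟨S, hS, by omega⟩, hB.lists⟩, h25⟩)
      rw [nbrUpTo_succ_of_notMem hb hmem]
      exact hok
  · rintro σ₁ - ⟨h1, h2⟩
    refine Runs.mono (runs_incV (Q := fun σ₂ => σ₂.words 25 0 = b + 1) h2 (by omega)
      (by simp [State.setWord_words])) fun σ₂ hA₂ h3 => ⟨h1.of_eq fun a ha => hA₂.1 a ?_, h3⟩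
    revert a
    decide

theorem runs_build {E : UGraph n} (hw : 8 * (n * n * (N + 1)) < 2 ^ w) (hn : 0 < n)
    (hB : Building N E 0 σ) : Runs w buildProg σ (Building N E (n * n)) := by
  have hnn : n * n ≤ n * n * (N + 1) := Nat.le_mul_of_pos_right _ (by omega)
  have hn2 : n ≤ n * n := Nat.le_mul_of_pos_left _ (by omega)
  unfold buildProg
  refine Runs.seq (Runs.mono (Q := fun σ₁ => σ₁.words 24 0 = 0)
    (Runs.wset 0 0 (by simp [WExp.eval]) (by simp [WExp.eval]) (by simp [State.setWord_words])) ?_)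
  intro σ₁ hA₁ h24
  have hB₁ : Building N E 0 σ₁ := hB.of_eq fun a ha => hA₁.1 a (by revert a; decide)
  refine Runs.rep (fun a σ' => Building N E (a * n) σ' ∧ σ'.words 24 0 = a) n
    (by simp [WExp.eval, hB₁.size]) ⟨by rw [zero_mul]; exact hB₁, h24⟩ ?_ fun _ _ h => h.1
  rintro a ha σ₂ - ⟨hB₂, h24₂⟩
  unfold buildRow
  refine Runs.seq (Runs.mono (Q := fun σ₁ => σ₁.words 25 0 = 0)
    (Runs.wset 0 0 (by simp [WExp.eval]) (by simp [WExp.eval]) (by simp [State.setWord_words])) ?_)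
  intro σ₃ hA₃ h25
  have hB₃ : Building N E (a * n) σ₃ := hB₂.of_eq fun a ha => hA₃.1 a (by revert a; decide)
  have h24₃ : σ₃.words 24 0 = a := by rw [hA₃.1 24 (by decide), h24₂]
  refine Runs.seq (Runs.rep (fun b σ' => Building N E (a * n + b) σ' ∧ σ'.words 25 0 = b) n
    (by simp [WExp.eval, hB₃.size]) ⟨hB₃, h25⟩ ?_ ?_)
  · rintro b hb σ₄ hA₄ ⟨hB₄, h25₄⟩
    exact runs_buildStep hw ha hb hB₄ (by rw [hA₄.1 24 (by decide), h24₃]) h25₄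
  · rintro σ₄ hA₄ ⟨hB₄, -⟩
    have h24₄ : σ₄.words 24 0 = a := by rw [hA₄.1 24 (by decide), h24₃]
    refine Runs.mono (runs_incV (Q := fun σ₂ => σ₂.words 24 0 = a + 1) h24₄ (by omega)
      (by simp [State.setWord_words])) fun σ₂ hA₂ h3 => ⟨?_, h3⟩
    rw [Nat.succ_mul]
    refine hB₄.of_eq fun x hx => hA₂.1 x ?_
    revert x
    decide

/-- A consistent starting point for the index: initially every position has key `0` and contribution
`0`. The first walks can then be made with the same replacement step as all later ones. -/
theorem runs_index (hw : N + 1 < 2 ^ w) (hn : 0 < n) (h15 : σ.words 15 0 = N)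
    (h6 : ∀ p, σ.words 6 p = 0) (h9 : ∀ k, σ.words 9 k = 0) (hr1 : ∀ v, σ.reals 1 v = 0)
    (hr2 : ∀ p, σ.reals 2 p = 0) :
    Runs w indexProg σ (Mem n N) := by
  unfold indexProg
  refine Runs.seq (Runs.mono (Q := fun σ₁ => σ₁.words 28 0 = 0)
    (Runs.wset 0 0 (by simp [WExp.eval]) (by simp [WExp.eval]) (by simp [State.setWord_words])) ?_)
  intro σ₁ hA₁ h28
  have g15 : σ₁.words 15 0 = N := by rw [hA₁.1 15 (by decide), h15]
  refine Runs.seq (Runs.mono (Runs.rep (fun i σ' => σ'.words 28 0 = i ∧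
    ∀ p < i, σ'.words 7 p = p ∧ σ'.words 8 p = p) N
    (by simp [WExp.eval, g15]) ⟨h28, fun _ h => absurd h (by omega)⟩ ?_ (fun _ _ h => h.2)) ?_)
  · rintro i hi σ₂ - ⟨g28, g⟩
    unfold indexStep
    refine Runs.seq (Runs.wset i i (by simp [WExp.eval, g28]) (by simp [WExp.eval, g28]) ?_)
    refine Runs.seq (Runs.wset i i (by simp [WExp.eval, State.setWord_words, g28])
      (by simp [WExp.eval, State.setWord_words, g28]) ?_)
    refine runs_incV (v := i) (by simp [State.setWord_words, g28]) (by omega)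
      ⟨by simp [State.setWord_words], fun p hp => ?_⟩
    by_cases hpi : p = i
    · simp [State.setWord_words_apply, hpi]
    · simpa [State.setWord_words_apply, hpi] using g p (by omega)
  · intro σ₂ hA₂ g
    have e15 : σ₂.words 15 0 = N := by rw [hA₂.1 15 (by decide), g15]
    refine Runs.wset 0 N (by simp [WExp.eval]) (by simp [WExp.eval, e15]) ?_
    have e6 : ∀ p, σ₂.words 6 p = 0 := by
      rw [hA₂.1 6 (by decide), hA₁.1 6 (by decide)]
      exact h6
    have e9 : σ₂.words 9 = fun _ => 0 := by
      rw [hA₂.1 9 (by decide), hA₁.1 9 (by decide)]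
      exact funext h9
    have er1 : ∀ v, σ₂.reals 1 v = 0 := by
      rw [hA₂.2 1 (by decide), hA₁.2 1 (by decide)]
      exact hr1
    have er2 : ∀ v, σ₂.reals 2 v = 0 := by
      rw [hA₂.2 2 (by decide), hA₁.2 2 (by decide)]
      exact hr2
    have hc : ∀ k t, t < Function.update (fun _ => 0) 0 N k → k = 0 ∧ t < N := by
      intro k t h
      rw [Function.update_apply] at h
      split_ifs at h with hk
      · exact ⟨hk, h⟩
      · exact absurd h (Nat.not_lt_zero _)
    refine ⟨?_, fun p _ => by simp [State.setWord_words, e6, hn], fun v => by simp [er1, er2]⟩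
    simp only [State.setWord_words, e9]
    constructor
    · intro p hp
      have hp := Finset.mem_range.1 hp
      simpa [e6, g p hp] using hp
    · intro p hp
      have hp := Finset.mem_range.1 hp
      simp [e6, (g p hp).2, (g p hp).1]
    · intro k t ht
      obtain ⟨rfl, ht'⟩ := hc k t (by simpa using ht)
      simpa [(g t ht').1] using ht'
    · intro k t ht
      obtain ⟨rfl, ht'⟩ := hc k t (by simpa using ht)
      simp [e6]
    · intro k t ht
      obtain ⟨rfl, ht'⟩ := hc k t (by simpa using ht)
      simp [(g t ht').1, (g t ht').2]

end preprocessing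

/-- Sample the entries `j, …, j + L - 1` of a family. -/
noncomputable def extendLaw {β : Type*} (κ : ℕ → PMF β) : ℕ → ℕ → (ℕ → β) → PMF (ℕ → β)
  | _, 0, f => PMF.pure f
  | j, L + 1, f => (κ j).bind fun b => extendLaw κ (j + 1) L (Function.update f j b)

/-- Making the walks in increasing order of index yields the product law; this form of the recursion
matches the loop. -/
theorem prodLaw_bind_extendLaw {β : Type*} [Inhabited β] (κ : ℕ → PMF β) (j L : ℕ) :
    (prodLaw κ j).bind (extendLaw κ j L) = prodLaw κ (j + L) := by
  induction L generalizing j with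
  | zero => simp only [extendLaw, PMF.bind_pure, add_zero]
  | succ L ih =>
    have h := ih (j + 1)
    rw [show j + 1 + L = j + (L + 1) by omega, prodLaw, PMF.bind_bind] at h
    rw [← h]
    congr 1
    funext f
    rw [extendLaw, PMF.bind_map]
    rfl

section start

variable {w n R M N : ℕ} {ε W₀ : ℝ} {τ : ℕ → ℕ} {S : List ℕ} {σ : State}

theorem samples_startLoop (hw : n * n * (N + 1) + 1 < 2 ^ w) (hn : 0 < n) (hτ : ∀ k, τ k ≤ n)
    (hN : N = n * R * M) (hRw : n * R < 2 ^ w) (L : ℕ) {j : ℕ} (hj : j + L = n * R) {ω : ℕ → List ℕ}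
    (hI : Walking n R M N ε W₀ τ S σ) (hω : ∀ i < j, HasWalk n M ε W₀ τ i (ω i) σ)
    (h29 : σ.words 29 0 = j) :
    Smp (repLaw w startStep L σ) (L * (M * 400 + 200) + 1)
      (extendLaw (fun i => walkLaw n τ M (i % n, n)) j L ω) fun ω' σ' =>
        Walking n R M N ε W₀ τ S σ' ∧ ∀ i < n * R, HasWalk n M ε W₀ τ i (ω' i) σ' := by
  induction L generalizing σ j ω with
  | zero =>
    rw [add_zero] at hj
    subst hj
    exact Smp.mono (Smp.repLaw_zero (b := ω) (Q := fun ω' σ' => Walking n R M N ε W₀ τ S σ' ∧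
      ∀ i < n * R, HasWalk n M ε W₀ τ i (ω' i) σ') ⟨hI, hω⟩) (by omega) fun _ _ _ h => h
  | succ L ih =>
    have hjlt : j < n * R := by omega
    have hpow : 0 < 2 ^ w := by omega
    have hstep : Samples w startStep σ (M * 400 + 195) (walkLaw n τ M (j % n, n)) fun b σ' =>
        Walking n R M N ε W₀ τ S σ' ∧
        (∀ i < j + 1, HasWalk n M ε W₀ τ i (Function.update ω j b i) σ') ∧
        (j + 1 < 2 ^ w → σ'.words 29 0 = j + 1) := by
      have hB : (setV 30 (.lit 1)).staticCost +
        ((M * 400 + 100) + (incV 29).staticCost) ≤ M * 400 + 195 := by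
        have : (setV 30 (.lit 1)).staticCost + (incV 29).staticCost ≤ 95 := by decide
        omega
      have h1 : 1 % 2 ^ w = 1 := by
        have := Nat.mul_le_mul_right (N + 1) (Nat.mul_pos hn hn)
        exact Nat.mod_eq_of_lt (by omega)
      unfold startStep
      refine Samples.mono (Samples.seq_left (RunsT.mono (Q := fun σ₁ =>
        σ₁.words 30 0 = 1) (Runs.timed (by simp [Prog.LoopFree]) ?_) le_rfl ?_)) hB
        fun _ _ _ _ h => h
      · exact Runs.wset 0 1 (by simp [WExp.eval]) (by simp [WExp.eval, h1])
            (by simp [State.setWord_words])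
      · intro σ₁ hA₁ h30
        have hI₁ : Walking n R M N ε W₀ τ S σ₁ := hI.of_eq
          (fun a ha => hA₁.1 a (by revert a; decide)) (fun a _ => hA₁.2 a (by simp [Prog.realTargets]))
        have e6 : σ₁.words 6 = σ.words 6 := hA₁.1 6 (by decide)
        have e2 : σ₁.reals 2 = σ.reals 2 := hA₁.2 2 (by decide)
        have hiN : j * M + M ≤ N := by
          have := Nat.mul_le_mul_right M (Nat.succ_le_of_lt hjlt)
          rw [Nat.succ_mul] at this
          omega
        refine Samples.seq_right (Samples.mono (samples_walk_fresh hw hn hτ hI₁ hiN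
          (by rw [hA₁.1 29 (by decide), h29]) h30) le_rfl (Q' := fun b σ₂ =>
            Walking n R M N ε W₀ τ S σ₂ ∧
            (∀ i < j + 1, HasWalk n M ε W₀ τ i (Function.update ω j b i) σ₂) ∧
            σ₂.words 29 0 = j) ?_) ?_
        · rintro b σ₂ - hA₂ ⟨hI₂, hb, s6, s2⟩
          refine ⟨hI₂, fun i hi => ?_, ?_⟩
          · by_cases hij : i = j
            · subst hij
              rwa [Function.update_self]
            · rw [Function.update_of_ne hij]
              exact ((hω i (by omega)).of_eq e6 e2).of_sameOff hij s6 s2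
          · rw [hA₂.1 29 (by decide), hA₁.1 29 (by decide), h29]
        · rintro b σ₂ ⟨hI₂, hω₂, h29₂⟩
          refine RunsT.mono (Q := fun σ₃ => j + 1 < 2 ^ w → σ₃.words 29 0 = j + 1)
            (Runs.timed (by simp [Prog.LoopFree]) ?_) le_rfl ?_
          · refine Runs.wset 0 ((j + 1) % 2 ^ w) (by simp [WExp.eval]) (by simp [WExp.eval, h29₂]) ?_
            intro hlt
            simp [State.setWord_words, Nat.mod_eq_of_lt hlt]
          · intro σ₃ hA₃ h29₃
            refine ⟨hI₂.of_eq (fun a ha => hA₃.1 a (by revert a; decide))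
              (fun a _ => hA₃.2 a (by simp [Prog.realTargets])), fun i hi => ?_, h29₃⟩
            exact (hω₂ i hi).of_eq (hA₃.1 6 (by decide)) (hA₃.2 2 (by decide))
    rw [extendLaw]
    refine (Smp.repLaw_succ (B' := L * (M * 400 + 200) + 1) hstep ?_).mono
      (by rw [Nat.succ_mul]; omega) fun _ _ _ h => h
    rintro b σ₁ ⟨hI₁, hω₁, h29₁⟩
    exact ih (by omega) hI₁ hω₁ (h29₁ (by omega))

theorem samples_start (hw : n * n * (N + 1) + 1 < 2 ^ w) (hn : 0 < n) (hτ : ∀ k, τ k ≤ n)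
    (hN : N = n * R * M) (hRw : n * R < 2 ^ w) (hI : Walking n R M N ε W₀ τ S σ) :
    ∃ B, Samples w startProg σ B (familyLaw n R M τ) fun ω' σ' =>
        Walking n R M N ε W₀ τ S σ' ∧ ∀ i < n * R, HasWalk n M ε W₀ τ i (ω' i) σ' := by
  have hlaw := prodLaw_bind_extendLaw (fun i => walkLaw n τ M (i % n, n)) 0 (n * R)
  rw [prodLaw, PMF.pure_bind, zero_add] at hlaw
  unfold startProg familyLaw
  rw [← hlaw]
  refine ⟨_, Samples.seq_left (B' := n * R * (M * 400 + 200) + 1 + ((WExp.mul (V 0) (V 13)).cost + 1))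
    (RunsT.mono (Q := fun σ₁ => σ₁.words 29 0 = 0)
    (Runs.timed (by simp [Prog.LoopFree]) (Runs.wset 0 0 (by simp [WExp.eval]) (by simp [WExp.eval])
      (by simp [State.setWord_words]))) le_rfl ?_)⟩
  intro σ₁ hA₁ h29
  have hI₁ : Walking n R M N ε W₀ τ S σ₁ := hI.of_eq
    (fun a ha => hA₁.1 a (by revert a; decide)) (fun a _ => hA₁.2 a (by simp [Prog.realTargets]))
  exact Samples.rep (m := n * R)
    (by simp [WExp.eval, hI₁.params.n, hI₁.params.R, Nat.mod_eq_of_lt hRw])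
    (samples_startLoop hw hn hτ hN hRw (n * R) (zero_add _) hI₁ (fun _ h => absurd h (by omega)) h29)

end start


/-! ## The stored family of walks -/

theorem Seg.exists_of_mem {β : Type*} {f : ℕ → β} {p : ℕ} {l : List β} (h : Seg f p l) {x : β}
    (hx : x ∈ l) : ∃ j < l.length, f (p + j) = x := by
  induction l generalizing p with
  | nil => simp at hx
  | cons y l ih =>
    rcases List.mem_cons.1 hx with rfl | hx
    · exact ⟨0, by simp, h.1⟩
    · obtain ⟨j, hj, hjx⟩ := ih h.2 hx
      exact ⟨j + 1, by simpa using hj, by rw [← hjx]; congr 1; omega⟩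

theorem seg_map_range' {β : Type*} (f : ℕ → β) (p L : ℕ) : Seg f p ((List.range' p L).map f) := by
  induction L generalizing p with
  | zero => trivial
  | succ L ih =>
    rw [List.range'_succ, List.map_cons]
    exact ⟨rfl, ih (p + 1)⟩

theorem Seg.sum_count {f : ℕ → ℕ} {p : ℕ} {l : List ℕ} (h : Seg f p l) (k : ℕ) :
    (∑ j ∈ Finset.range l.length, if f (p + j) = k then 1 else 0) = l.count k := by
  induction l generalizing p with
  | nil => simp
  | cons x l ih =>
    have := ih h.2
    rw [List.length_cons, Finset.sum_range_succ', List.count_cons, ← this, add_zero, h.1]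
    congr 1
    · refine Finset.sum_congr rfl fun j _ => ?_
      rw [show p + (j + 1) = p + 1 + j by omega]
    · simp

/-- The contributions of a walk at `v` add up to its discounted visits, scaled by the initial
weight. -/
theorem Seg.sum_weights {key : ℕ → ℕ} {wt : ℕ → ℝ} {n : ℕ} {τ : ℕ → ℕ} {ε : ℝ} (v : ℕ) {p m : ℕ}
    {W : ℝ} {l : List ℕ} (h : Seg key p l) (h' : Seg wt p (weights n τ ε m W l)) :
    (∑ j ∈ Finset.range l.length, if key (p + j) / n = v then wt (p + j) else 0) =
      W * visits n τ ε v m l := by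
  induction l generalizing p m W with
  | nil => simp [visits]
  | cons x l ih =>
    have hih := ih h.2 h'.2
    have : ∀ j ∈ Finset.range l.length, (if key (p + (j + 1)) / n = v then wt (p + (j + 1)) else 0) =
        if key (p + 1 + j) / n = v then wt (p + 1 + j) else 0 := by
      intro j _
      rw [show p + (j + 1) = p + 1 + j by omega]
    rw [List.length_cons, Finset.sum_range_succ', Finset.sum_congr rfl this, hih, add_zero, h.1, h'.1,
      visits]
    by_cases h1 : m = n <;> by_cases h2 : x / n = v <;> simp [h1, h2] <;> ring

theorem sum_range_mul {β : Type*} [AddCommMonoid β] (f : ℕ → β) (m M : ℕ) :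
    ∑ p ∈ Finset.range (m * M), f p =
      ∑ i ∈ Finset.range m, ∑ j ∈ Finset.range M, f (i * M + j) := by
  induction m with
  | zero => simp
  | succ m ih => rw [Nat.succ_mul, Finset.sum_range_add, ih, Finset.sum_range_succ]

/-- The memory stores the table `t` and the family `ω` of walks. -/
structure Stored (n R M : ℕ) (ε W₀ : ℝ) (t : Table) (ω : ℕ → List ℕ) (σ : State) : Prop where
  walking : Walking n R M (n * R * M) ε W₀ t.slot [] σ
  table : HasTable σ t
  walks : ∀ i < n * R, HasWalk n M ε W₀ t.slot i (ω i) σ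
  rest : ∀ i, n * R ≤ i → ω i = []

section stored

variable {w n R M : ℕ} {ε W₀ : ℝ} {t : Table} {ω : ℕ → List ℕ} {σ : State}

/-- Ties the lengths that the program reads to the random family, for use with `SlotTable.count_le`.
-/
theorem Stored.count_eq (h : Stored n R M ε W₀ t ω σ) (k : ℕ) :
    σ.words 9 k = ∑ i ∈ Finset.range (n * R), (ω i).count k := by
  rw [← h.walking.mem.index.card_eq k, Finset.card_filter, sum_range_mul]
  refine Finset.sum_congr rfl fun i hi => ?_
  have hw := h.walks i (Finset.mem_range.1 hi)
  rw [← hw.keys.sum_count k, hw.length]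

/-- Identifies the maintained output with the estimator analysed in `SlotTable.accurate`. -/
theorem Stored.output_eq (h : Stored n R M ε W₀ t ω σ) (v : ℕ) :
    σ.reals 1 v = W₀ * ∑ i ∈ Finset.range (n * R), visits n t.slot ε v n (ω i) := by
  rw [h.walking.mem.out, sum_range_mul, Finset.mul_sum]
  refine Finset.sum_congr rfl fun i hi => ?_
  have hw := h.walks i (Finset.mem_range.1 hi)
  rw [← hw.keys.sum_weights v hw.weights, hw.length]

theorem Stored.lists (h : Stored n R M ε W₀ t ω σ) : Lists n (n * R * M) (n * R * M) σ := by
  refine ⟨h.walking.params.N, fun k => ?_, fun k _ i hi => ?_⟩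
  · simpa using h.walking.mem.index.cnt_le k
  · exact Finset.mem_range.1 (h.walking.mem.index.list_mem k i hi)

/-- A bound for the time of an update. -/
def updateTime (n R M : ℕ) (S : List ℕ) (ω : ℕ → List ℕ) : ℕ :=
  3000 + (S.map fun k => ∑ i ∈ Finset.range (n * R), (ω i).count k).sum * (400 * M + 300)

theorem runs_solveIf_skip (h16 : σ.words 16 0 = 0) {Q : State → Prop} (hQ : Q σ) :
    RunsT w solveIf σ 20 Q := by
  refine RunsT.mono (RunsT.ite (B := 1) (fun h => ?_) fun _ =>
    Runs.timed trivial (Runs.skip hQ)) (by decide) fun _ _ h => h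
  simp [BExp.Holds, WExp.eval, h16] at h

/-- The heart of the implementation. The time is bounded in terms of the family before the update,
and the new family is sampled conditionally on it. Averaging over the old family is left to the
probabilistic analysis. -/
theorem Stored.samples_update (h : Stored n R M ε W₀ t ω σ) (h16 : σ.words 16 0 = 0) (hn : 0 < n)
    (hw : 8 * (n * n * (n * R * M + 1)) < 2 ^ w) {x : EdgeUpdate n} {t' : Table} {S : List ℕ}
    (hS : S.length ≤ 4) (hslot : ∀ k, k ∉ S → t.slot k = t'.slot k) (hle : ∀ k, t'.slot k ≤ n)
    (hrun : RunsT w changeGraph (announce σ x) (1500 + 100 * (S.map (σ.words 9)).sum) fun σ' =>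
      HasTable σ' t' ∧ Touched (n * R * M) σ' S) :
    Samples w updateProg (announce σ x) (updateTime n R M S ω)
      (prodLaw (fun i => resample n t'.slot S (ω i)) (n * R)) fun ω' σ' =>
        Stored n R M ε W₀ t' ω' σ' ∧ σ'.words 16 0 = 0 := by
  set N := n * R * M with hN
  have hcnt : (S.map (σ.words 9)).sum =
      (S.map fun k => ∑ i ∈ Finset.range (n * R), (ω i).count k).sum := by
    congr 1
    exact List.map_congr_left fun k _ => h.count_eq k
  set Q := (S.map (σ.words 9)).sum with hQ
  have hnn : 1 * (N + 1) ≤ n * n * (N + 1) := Nat.mul_le_mul_right _ (Nat.mul_pos hn hn)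
  have hQN : Q ≤ 4 * N := (sum_map_le S fun k _ => h.lists.le k).trans (Nat.mul_le_mul_right _ hS)
  have hannounce : AgreeOff [2] [] σ (announce σ x) := by
    refine ⟨fun a ha => ?_, fun a _ => rfl⟩
    have : a ≠ 2 := by simpa using ha
    simp [announce, State.setWord_words, this]
  -- the positions to be treated
  have key : ∀ σ₁, changeGraph.Agree (announce σ x) σ₁ → HasTable σ₁ t' ∧ Touched N σ₁ S →
      Samples w (refresh ;; clear ;; solveIf) σ₁ ((Q * (M * 400 + 200) + 100) + (4 * 100 + 100 + 20))
        (prodLaw (fun i => resample n t'.slot S (ω i)) (n * R)) fun ω' σ' =>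
          Stored n R M ε W₀ t' ω' σ' ∧ σ'.words 16 0 = 0 := by
    rintro σ₁ hA₁ ⟨ht₁, hT₁⟩
    have ew : ∀ a, a ∉ 2 :: changeGraph.wordTargets → σ₁.words a = σ.words a := by
      intro a ha
      rw [List.mem_cons, not_or] at ha
      exact (hA₁.1 a ha.2).trans (hannounce.1 a (by simpa using ha.1))
    have er : σ₁.reals = σ.reals := funext fun a =>
      (hA₁.2 a (by simp [show changeGraph.realTargets = [] from rfl])).trans (hannounce.2 a (by simp))
    have e6 := ew 6 (by decide)
    have e9 := ew 9 (by decide)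
    -- The indices of the walks to be redone, one for each touched position, so with repetitions.
    set l : List ℕ := (List.range' 0 Q).map fun q => σ₁.words 11 q / M with hl
    have hlen : l.length = Q := by simp [hl]
    have hcount := hT₁.count
    have hlt := hT₁.lt
    have hmem := hT₁.mem
    rw [e9, ← hQ] at hcount hlt
    have hllt : ∀ i ∈ l, i < n * R := by
      intro i hi
      obtain ⟨q, hq, rfl⟩ := List.mem_map.1 hi
      have := hlt q (by simpa using hq)
      exact Nat.div_lt_of_lt_mul (by rw [mul_comm]; exact this)
    -- If a walk contains a key of `S`, the position of that key is in the list of the key, hence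
    -- was copied, hence the walk is in `l`.
    have hclean : ∀ i < n * R, i ∉ l → ∀ k ∈ ω i, k ∉ S := by
      intro i hi hil k hk hkS
      have hwalk := h.walks i hi
      obtain ⟨j, hj, hjk⟩ := hwalk.keys.exists_of_mem hk
      rw [hwalk.length] at hj
      have hpN : i * M + j < N := key_lt hi hj
      have h1 := h.walking.mem.index.pos_lt _ (Finset.mem_range.2 hpN)
      have h2 := h.walking.mem.index.list_pos _ (Finset.mem_range.2 hpN)
      rw [hjk] at h1 h2
      obtain ⟨q, hq, hqt⟩ := hmem k hkS (σ.words 8 (i * M + j)) (by rwa [e9])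
      rw [ew 7 (by decide), h2] at hqt
      rw [e9, ← hQ] at hq
      apply hil
      refine List.mem_map.2 ⟨q, by simpa using hq, ?_⟩
      simp only [hqt, key_div hj]
    have hI₁ : Walking n R M N ε W₀ t'.slot S σ₁ := by
      refine ⟨h.walking.params.of_eq (ew _ (by decide)) (ew _ (by decide)) (ew _ (by decide))
        (ew _ (by decide)) (by rw [er]) (by rw [er]), ⟨?_, ?_, ?_⟩, ht₁.slot, hT₁.mark⟩
      · rw [e6, ew 7 (by decide), ew 8 (by decide), e9]
        exact h.walking.mem.index
      · rw [e6]
        exact h.walking.mem.key_lt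
      · rw [e6, er]
        exact h.walking.mem.out
    have hω₁ : Pending n R M ε W₀ t'.slot S l ω σ₁ := by
      intro i hi
      have hwalk := (h.walks i hi).of_eq (σ' := σ₁) e6 (by rw [er])
      by_cases hil : i ∈ l
      -- Listed walks keep the old table as their `τ₀`; for the others the contributions coincide
      -- for both tables.
      · exact ⟨t.slot, hslot, fun h => absurd hil h, hwalk⟩
      · refine ⟨t'.slot, fun _ _ => rfl, fun _ => rfl, hwalk.length, hwalk.keys, ?_⟩
        rw [← weights_congr (ω i) fun k hk => hslot k (hclean i hi hil k hk)]
        exact hwalk.weights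
    have hlaw : foldUpdate (resample n t'.slot S) l ω =
        prodLaw (fun i => resample n t'.slot S (ω i)) (n * R) :=
      foldUpdate_eq_prodLaw resample_idem hllt h.rest fun i hi hil =>
        resample_eq_pure (hclean i hi hil)
    rw [← hlaw]
    have hrefresh := samples_refresh (w := w) (by omega) hn hle hN l hllt (by rw [hlen]; omega) hI₁ hω₁
      (by rw [hcount, hlen]) (seg_map_range' _ 0 Q)
    rw [hlen] at hrefresh
    have hT21 := hT₁.num
    have hT12 := hT₁.keys
    have h16₁ : σ₁.words 16 0 = 0 := by rw [ew 16 (by decide), h16]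
    refine Samples.seq_right (Samples.mono hrefresh le_rfl (Q' := fun ω' σ' =>
      Walking n R M N ε W₀ t'.slot S σ' ∧ Pending n R M ε W₀ t'.slot S [] ω' σ' ∧
      (∀ i, n * R ≤ i → ω' i = []) ∧ σ'.words 21 0 = S.length ∧
      (∀ k ∈ S, ∃ i < S.length, σ'.words 12 i = k) ∧ HasTable σ' t' ∧ σ'.words 16 0 = 0) ?_) ?_
    · rintro ω' σ' hω' hA ⟨h1, h2⟩
      refine ⟨h1, h2, ?_, ?_, ?_, ?_, ?_⟩
      · rw [hlaw] at hω'
        exact eq_default_of_mem_support hω'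
      · rw [hA.1 21 (by decide), hT21]
      · rw [hA.1 12 (by decide)]
        exact hT12
      · exact ht₁.of_eq (hA.1 3 (by decide)) (hA.1 4 (by decide)) (hA.1 5 (by decide))
      · rw [hA.1 16 (by decide), h16₁]
    · rintro ω' σ₂ ⟨hI₂, hω₂, hrest, h21, h12, ht₂, h16₂⟩
      have hmark := hI₂.mark
      refine RunsT.seq (RunsT.mono (runs_clear (L := S.length) (by omega) h21 fun k hk => h12 k ?_)
        (by omega) ?_)
      · by_contra hkS
        rw [hmark k, if_neg hkS] at hk
        exact hk rfl
      · intro σ₃ hA₃ h10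
        refine runs_solveIf_skip (by rw [hA₃.1 16 (by decide), h16₂]) ⟨⟨⟨?_, ⟨?_, ?_, ?_⟩, ?_, ?_⟩,
          ?_, ?_, hrest⟩, by rw [hA₃.1 16 (by decide), h16₂]⟩
        · exact hI₂.params.of_eq (hA₃.1 _ (by decide)) (hA₃.1 _ (by decide)) (hA₃.1 _ (by decide))
            (hA₃.1 _ (by decide)) (hA₃.2 _ (by decide)) (hA₃.2 _ (by decide))
        · rw [hA₃.1 6 (by decide), hA₃.1 7 (by decide), hA₃.1 8 (by decide), hA₃.1 9 (by decide)]
          exact hI₂.mem.index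
        · rw [hA₃.1 6 (by decide)]
          exact hI₂.mem.key_lt
        · rw [hA₃.1 6 (by decide), hA₃.2 1 (by decide), hA₃.2 2 (by decide)]
          exact hI₂.mem.out
        · rw [hA₃.1 4 (by decide)]
          exact hI₂.table
        · simpa using h10
        · exact ht₂.of_eq (hA₃.1 3 (by decide)) (hA₃.1 4 (by decide)) (hA₃.1 5 (by decide))
        · intro i hi
          obtain ⟨τ₀, -, h2, h3⟩ := hω₂ i hi
          rw [h2 (by simp)] at h3
          exact h3.of_eq (hA₃.1 6 (by decide)) (hA₃.2 2 (by decide))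
  unfold updateProg
  refine Samples.mono (Samples.seq_left (RunsT.mono hrun le_rfl key)) ?_ fun _ _ _ _ h => h
  rw [updateTime, ← hcnt]
  have : Q * (400 * M + 300) = 100 * Q + Q * (M * 400 + 200) := by ring
  omega

end stored

/-! ## The exact regime -/

/-- The memory in the exact regime. -/
structure Exact (n : ℕ) (ε : ℝ) (t : Table) (σ : State) : Prop where
  solving : Solving n t ε σ
  mark : ∀ k, σ.words 10 k = 0
  lists : Lists n 0 0 σ
  flag : σ.words 16 0 = 1

theorem runs_solveIf_solve {w n : ℕ} {ε : ℝ} {t : Table} {σ : State} (hw : n * n + 1 < 2 ^ w)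
    (hn : 0 < n) (h0 : 0 < ε) (h1 : ε < 1) {E : UGraph n} (hE : E.NoIsolated) (ht : t.Describes E)
    (h : Exact n ε t σ) :
    RunsT w solveIf σ (2000 * n ^ 3 + 20) fun σ' => Exact n ε t σ' ∧
      ∀ v : Fin n, σ'.reals 1 v = pageRank ε E v := by
  refine RunsT.mono (RunsT.ite (B := 2000 * n ^ 3) (fun _ =>
    runs_solve hw hn h0 h1 hE ht h.solving) fun h' => ?_) ?_ ?_
  · exact absurd (by simp [BExp.Holds, WExp.eval, h.flag]) h'
  · have : (BExp.wlt (.lit 0) (V 16)).cost + 1 ≤ 20 := by decide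
    omega
  · intro σ' hA h2
    refine ⟨⟨h.solving.of_agree hA (by decide) (by decide), ?_, h.lists.of_eq (hA.1 7 (by decide))
      (hA.1 9 (by decide)) (hA.1 15 (by decide)), ?_⟩, h2⟩
    · rw [hA.1 10 (by decide)]
      exact h.mark
    · rw [hA.1 16 (by decide), h.flag]

/-- Here `N = 0`, so all lists of positions are empty and the refresh loop has no iterations. Only
the slot table is maintained, and PageRank is recomputed from it. -/
theorem Exact.runs_update {w n : ℕ} {ε : ℝ} {t t' : Table} {σ : State} (h : Exact n ε t σ)
    (hw : 8 * (n * n * (0 + 1)) < 2 ^ w) (hn : 0 < n) (h0 : 0 < ε) (h1 : ε < 1) {E : UGraph n}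
    (hE : E.NoIsolated) (ht : t'.Describes E) {x : EdgeUpdate n} {S : List ℕ}
    (hS : S.length ≤ 4)
    (hrun : RunsT w changeGraph (announce σ x) (1500 + 100 * (S.map (σ.words 9)).sum) fun σ' =>
      HasTable σ' t' ∧ Touched 0 σ' S) :
    RunsT w updateProg (announce σ x) (2000 * n ^ 3 + 3000) fun σ' => Exact n ε t' σ' ∧
      ∀ v : Fin n, σ'.reals 1 v = pageRank ε E v := by
  have hnn : 1 ≤ n * n := Nat.mul_pos hn hn
  have hQ : ∀ σ' : State, σ'.words 9 = σ.words 9 → (S.map (σ'.words 9)).sum = 0 := by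
    intro σ' h9
    rw [h9]
    have := sum_map_le S fun k _ => h.lists.le k
    omega
  have hannounce : AgreeOff [2] [] σ (announce σ x) := by
    refine ⟨fun a ha => ?_, fun a _ => rfl⟩
    have : a ≠ 2 := by simpa using ha
    simp [announce, State.setWord_words, this]
  have hB : (setV 28 (.lit 0)).staticCost + (0 * (0 + 5) + ((V 22).cost + 2)) ≤ 50 := by decide
  unfold updateProg
  refine RunsT.mono (B := 1500 + (50 + ((4 * 100 + 100) + (2000 * n ^ 3 + 20)))) (RunsT.seq
    (RunsT.mono hrun (by rw [hQ σ rfl]) ?_)) (by omega) fun _ _ h => h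
  rintro σ₁ hA₁ ⟨ht₁, hT₁⟩
  have ew : ∀ a, a ∉ 2 :: changeGraph.wordTargets → σ₁.words a = σ.words a := by
    intro a ha
    rw [List.mem_cons, not_or] at ha
    exact (hA₁.1 a ha.2).trans (hannounce.1 a (by simpa using ha.1))
  have er : σ₁.reals = σ.reals := funext fun a =>
    (hA₁.2 a (by simp [show changeGraph.realTargets = [] from rfl])).trans (hannounce.2 a (by simp))
  have h22 : σ₁.words 22 0 = 0 := by rw [hT₁.count, hQ σ₁ (ew 9 (by decide))]
  have hs₁ : Solving n t' ε σ₁ :=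
    ⟨by rw [ew 0 (by decide)]; exact h.solving.size, ht₁, by rw [er]; exact h.solving.eps⟩
  have hT21 := hT₁.num
  have hT12 := hT₁.keys
  have hmark := hT₁.mark
  have hl₁ : Lists n 0 0 σ₁ :=
    h.lists.of_eq (ew 7 (by decide)) (ew 9 (by decide)) (ew 15 (by decide))
  have h16 : σ₁.words 16 0 = 1 := by rw [ew 16 (by decide), h.flag]
  have hrefresh : RunsT w refresh σ₁ 50 fun σ₂ =>
      σ₂.words 7 = σ₁.words 7 ∧ σ₂.words 9 = σ₁.words 9 := by
    unfold refresh
    refine RunsT.mono (RunsT.seq (RunsT.mono (Q := fun _ => True) (Runs.timed (by simp [Prog.LoopFree])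
      (Runs.wset 0 0 (by simp [WExp.eval]) (by simp [WExp.eval]) trivial)) le_rfl ?_)) hB
      fun _ _ h => h
    intro σ₂ hA₂ _
    exact RunsT.rep (fun _ σ' => σ'.words 7 = σ₁.words 7 ∧ σ'.words 9 = σ₁.words 9) 0
      (by simp [WExp.eval, hA₂.1 22 (by decide), h22])
      ⟨hA₂.1 7 (by decide), hA₂.1 9 (by decide)⟩
      (fun j hj => absurd hj (by omega)) fun _ _ h => h
  refine RunsT.seq (RunsT.mono hrefresh le_rfl ?_)
  rintro σ₂ hA₂ ⟨h7, h9⟩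
  have hs₂ := hs₁.of_agree hA₂ (by decide) (by decide)
  refine RunsT.seq (RunsT.mono (runs_clear (L := S.length) (by omega)
    (by rw [hA₂.1 21 (by decide), hT21]) ?_) (by omega) ?_)
  · rw [hA₂.1 10 (by decide), hA₂.1 12 (by decide)]
    intro k hk
    refine hT12 k ?_
    by_contra hkS
    rw [hmark k, if_neg hkS] at hk
    exact hk rfl
  · intro σ₃ hA₃ h10
    have hs₃ := hs₂.of_agree hA₃ (by decide) (by decide)
    refine runs_solveIf_solve (by omega) hn h0 h1 hE ht ⟨hs₃, h10, ?_, ?_⟩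
    · exact hl₁.of_eq ((hA₃.1 7 (by decide)).trans h7)
        ((hA₃.1 9 (by decide)).trans h9)
        ((hA₃.1 15 (by decide)).trans (hA₂.1 15 (by decide)))
    · rw [hA₃.1 16 (by decide), hA₂.1 16 (by decide), h16]


/-! ## The state after the preprocessing -/

section init

variable {n : ℕ} {ε α : ℝ} {E : UGraph n}

theorem charge_charge (s t : ℕ) (m : PMF (State × ℕ)) :
    charge s (charge t m) = charge (t + s) m := by
  unfold charge
  rw [PMF.map_comp]
  congr 1
  funext r
  simp [add_assoc]

theorem inputState_words_of_two_le {a : ℕ} (ha : 2 ≤ a) : (inputState ε α E).words a = fun _ => 0 := by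
  funext k
  simp [inputState, show a ≠ 0 by omega, show a ≠ 1 by omega]

theorem inputState_reals_of_pos {a : ℕ} (ha : 1 ≤ a) : (inputState ε α E).reals a = fun _ => 0 := by
  funext k
  simp [inputState, show a ≠ 0 by omega]

theorem inputState_adj {a b : ℕ} (ha : a < n) (hb : b < n) :
    (inputState ε α E).words 1 (a * n + b) = if b ∈ nbr E a then 1 else 0 := by
  have : (∃ u v : Fin n, a * n + b = u * n + v ∧ s(u, v) ∈ E) ↔ b ∈ nbr E a := by
    rw [mem_nbr]
    constructor
    · rintro ⟨u, v, h, huv⟩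
      obtain ⟨rfl, rfl⟩ := (key_eq_iff hb v.2).1 h
      exact ⟨ha, hb, huv⟩
    · rintro ⟨ha, hb, h⟩
      exact ⟨⟨a, ha⟩, ⟨b, hb⟩, rfl, h⟩
  simp [inputState, this]

theorem nbrUpTo_zero : nbrUpTo E 0 = fun _ => ∅ := by
  funext a
  simp [nbrUpTo]

theorem nbrUpTo_sq : nbrUpTo E (n * n) = nbr E := by
  funext a
  refine Finset.filter_true_of_mem fun b hb => ?_
  obtain ⟨h1, h2⟩ := mem_nbr_lt hb
  exact key_lt h1 h2

theorem building_zero {N : ℕ} {σ : State} (h0 : σ.words 0 0 = n)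
    (h1 : σ.words 1 = (inputState ε α E).words 1) (h15 : σ.words 15 0 = N)
    (h : ∀ a ∈ [3, 4, 5, 9, 10, 21, 22], σ.words a = fun _ => 0) : Building N E 0 σ := by
  refine ⟨h0, fun a ha b hb => by rw [h1, inputState_adj ha hb], ?_, ?_, ?_⟩
  · refine ⟨⟨fun _ => 0, fun _ => 0, fun _ => 0⟩, ⟨h 3 (by simp), h 4 (by simp), h 5 (by simp)⟩, ?_,
      fun _ => Nat.zero_le _⟩
    rw [nbrUpTo_zero]
    constructor <;> simp
  · refine ⟨[], ?_, le_rfl⟩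
    constructor <;> simp [h]
  · refine ⟨h15, ?_, ?_⟩ <;> simp [h]

/-- The guarantee for the preprocessing and for the updates: in the exact regime PageRank is stored,
otherwise the family `ω` of walks. -/
def Invariant (n R M : ℕ) (ε : ℝ) (e : Bool) (t : Table) (E : UGraph n) (ω : ℕ → List ℕ)
    (σ : State) : Prop :=
  if e then Exact n ε t σ ∧ ∀ v : Fin n, σ.reals 1 v = pageRank ε E v
  else Stored n R M ε (ε / (n * R)) t ω σ ∧ σ.words 16 0 = 0

/-- The parameters and the table are chosen outside the coupling: they are determined by the input
alone, and only the walks are random. -/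
theorem exists_init {w c : ℕ} (hc : 10 ≤ c) (hn : 2 ≤ n) (hε : 0 < ε) (hε1 : ε < 1) (hα : 0 < α)
    (hα1 : α ≤ 1) (hE : E.NoIsolated) (hcap : c * n ^ 6 + 1 < 2 ^ w)
    (hw : ∀ R M e, Chosen c n R M ε α e → 8 * (n * n * (n * R * M + 1)) < 2 ^ w ∧ n * R < 2 ^ w) :
    ∃ R M e t, Chosen c n R M ε α e ∧ t.Describes E ∧
      Cpl (exec w (initProg c) (inputState ε α E)) (familyLaw n R M t.slot) fun ω r =>
        Invariant n R M ε e t E ω r.1 := by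
  have hn0 : 0 < n := by omega
  have hn6 : n + 1 < 2 ^ w := by
    have h1 : n ≤ n ^ 6 := Nat.le_self_pow (by norm_num) n
    have h2 : n ^ 6 ≤ c * n ^ 6 := Nat.le_mul_of_pos_left _ (by omega)
    omega
  set σ₀ := inputState ε α E with hσ₀
  have i0 : σ₀.words 0 0 = n := by simp [hσ₀, inputState]
  have iw : ∀ a, 2 ≤ a → σ₀.words a = fun _ => 0 := fun a ha => inputState_words_of_two_le ha
  have ir : ∀ a, 1 ≤ a → σ₀.reals a = fun _ => 0 := fun a ha => inputState_reals_of_pos ha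
  obtain ⟨σ₁, t₁, hA₁, h9, hx₁⟩ := (runs_harmonic (w := w) hn6 i0 (by rw [ir 9 (by norm_num)])).exec_seq
  have ew₁ : ∀ a ∈ [0, 1, 3, 4, 5, 6, 9, 10, 13, 14, 15, 16, 21, 22], σ₁.words a = σ₀.words a :=
    fun a ha => hA₁.1 a (by revert a; decide)
  have er₁ : ∀ a ∈ [0, 1, 2, 6], σ₁.reals a = σ₀.reals a := fun a ha => hA₁.2 a (by revert a; decide)
  obtain ⟨σ₂, t₂, hA₂, ⟨R, M, e, hch, hP, h16⟩, hx₂⟩ := (runs_regime (σ := σ₁) hc hn hε hε1 hα hα1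
    (fun R M h h' => by
      have h1 := (hw R M false (by simp [Chosen, h, h'])).1
      have : 1 * (n * R * M + 1) ≤ n * n * (n * R * M + 1) :=
        Nat.mul_le_mul_right _ (Nat.mul_pos hn0 hn0)
      omega) hcap (by rw [ew₁ 0 (by simp), i0])
      (by rw [er₁ 0 (by simp)]; simp [hσ₀, inputState])
      (by rw [er₁ 0 (by simp)]; simp [hσ₀, inputState]) h9
      (by rw [ew₁ _ (by simp), iw _ (by norm_num)]) (by rw [ew₁ _ (by simp), iw _ (by norm_num)])
      (by rw [ew₁ _ (by simp), iw _ (by norm_num)]) (by rw [ew₁ _ (by simp), iw _ (by norm_num)])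
      (by rw [er₁ _ (by simp), ir _ (by norm_num)])).exec_seq
  have hregw : (regimeProg c).wordTargets = [13, 14, 15, 16] := rfl
  have hregr : (regimeProg c).realTargets = [6] := rfl
  have ew₂ : ∀ a ∈ [1, 3, 4, 5, 6, 9, 10, 21, 22], σ₂.words a = σ₀.words a := fun a ha =>
    (hA₂.1 a (by rw [hregw]; revert a; decide)).trans (ew₁ a (by revert a; decide))
  have er₂ : ∀ a ∈ [1, 2], σ₂.reals a = σ₀.reals a := fun a ha =>
    (hA₂.2 a (by rw [hregr]; revert a; decide)).trans (er₁ a (by revert a; decide))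
  obtain ⟨hwN, hwR⟩ := hw R M e hch
  set N := n * R * M with hN
  have hNle : 1 * (N + 1) ≤ n * n * (N + 1) := Nat.mul_le_mul_right _ (Nat.mul_pos hn0 hn0)
  have hnnle : n * n ≤ n * n * (N + 1) := Nat.le_mul_of_pos_right _ (by omega)
  obtain ⟨σ₃, t₃, hA₃, hB₃, hx₃⟩ := (runs_build hwN hn0 (building_zero hP.n (ew₂ 1 (by simp)) hP.N
    fun a ha => (ew₂ a (by revert a; decide)).trans (iw a (by revert a; decide)))).exec_seq
  obtain ⟨tb, htb, hok, hle⟩ := hB₃.table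
  obtain ⟨S, hS, hSl⟩ := hB₃.touched
  rw [nbrUpTo_sq] at hok
  obtain ⟨σ₄, t₄, hA₄, h10, hx₄⟩ := (runs_clear (w := w) (L := S.length) (by omega) hS.num
    fun k hk => hS.keys k (by
      by_contra hkS
      rw [hS.mark k, if_neg hkS] at hk
      exact hk rfl)).runs.exec_seq
  have ew₄ : ∀ a ∈ [0, 6, 9, 13, 14, 15, 16], σ₄.words a = σ₂.words a := fun a ha =>
    (hA₄.1 a (by revert a; decide)).trans (hA₃.1 a (by revert a; decide))
  have er₄ : σ₄.reals = σ₂.reals := funext fun a =>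
    (hA₄.2 a (by simp [show clear.realTargets = [] from rfl])).trans
      (hA₃.2 a (by simp [show buildProg.realTargets = [] from rfl]))
  have ht₄ : HasTable σ₄ tb := htb.of_eq (hA₄.1 3 (by decide)) (hA₄.1 4 (by decide))
    (hA₄.1 5 (by decide))
  obtain ⟨σ₅, t₅, hA₅, hmem, hx₅⟩ := (runs_index (w := w) (n := n) (N := N) (by omega) hn0
    (by rw [ew₄ 15 (by simp), hP.N])
    (by rw [ew₄ 6 (by simp), ew₂ 6 (by simp), iw 6 (by norm_num)]; simp)
    (by rw [ew₄ 9 (by simp), ew₂ 9 (by simp), iw 9 (by norm_num)]; simp)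
    (by rw [er₄, er₂ 1 (by simp), ir 1 (by norm_num)]; simp)
    (by rw [er₄, er₂ 2 (by simp), ir 2 (by norm_num)]; simp)).exec_seq
  have ew₅ : ∀ a ∈ [0, 13, 14, 15, 16], σ₅.words a = σ₂.words a := fun a ha =>
    (hA₅.1 a (by revert a; decide)).trans (ew₄ a (by revert a; decide))
  have er₅ : σ₅.reals = σ₂.reals := funext fun a =>
    (hA₅.2 a (by simp [show indexProg.realTargets = [] from rfl])).trans (congrFun er₄ a)
  have hWalk : Walking n R M N ε (ε / (n * R)) tb.slot [] σ₅ := by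
    refine ⟨hP.of_eq (ew₅ _ (by simp)) (ew₅ _ (by simp)) (ew₅ _ (by simp)) (ew₅ _ (by simp))
      (by rw [er₅]) (by rw [er₅]), hmem, ?_, ?_⟩
    · rw [hA₅.1 4 (by decide)]
      exact ht₄.slot
    · rw [hA₅.1 10 (by decide)]
      simpa using h10
  have ht₅ : HasTable σ₅ tb := ht₄.of_eq (hA₅.1 3 (by decide)) (hA₅.1 4 (by decide))
    (hA₅.1 5 (by decide))
  have hdesc : tb.Describes E := ⟨hok, hle⟩
  obtain ⟨B, hstart⟩ := samples_start (w := w) (by omega) hn0 hle hN hwR hWalk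
  have h16₅ : σ₅.words 16 0 = if e then 1 else 0 := by rw [ew₅ 16 (by simp), h16]
  refine ⟨R, M, e, tb, hch, hdesc, ?_⟩
  unfold initProg
  rw [hx₁, hx₂, hx₃, hx₄, hx₅]
  simp only [charge_charge]
  have hfin : Samples w (startProg ;; solveIf) σ₅ (B + (2000 * n ^ 3 + 20)) (familyLaw n R M tb.slot)
      fun ω σ' => Invariant n R M ε e tb E ω σ' := by
    refine Samples.seq_right (Samples.mono hstart le_rfl (Q' := fun ω' σ' =>
      (Walking n R M N ε (ε / (n * R)) tb.slot [] σ' ∧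
        ∀ i < n * R, HasWalk n M ε (ε / (n * R)) tb.slot i (ω' i) σ') ∧ (∀ i, n * R ≤ i → ω' i = []) ∧
      HasTable σ' tb ∧ σ'.words 16 0 = if e then 1 else 0) ?_) ?_
    · intro ω' σ' hω' hA h
      exact ⟨h, eq_default_of_mem_support hω',
        ht₅.of_eq (hA.1 3 (by decide)) (hA.1 4 (by decide)) (hA.1 5 (by decide)),
        by rw [hA.1 16 (by decide), h16₅]⟩
    · rintro ω' σ' ⟨⟨hW, hωW⟩, hrest, ht, h16'⟩
      cases e with
      | false =>
        refine RunsT.mono (runs_solveIf_skip (Q := fun σ'' => σ'' = σ') (by simpa using h16') rfl)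
          (by omega) ?_
        rintro σ'' - rfl
        exact ⟨⟨hW, ht, hωW, hrest⟩, by simpa using h16'⟩
      | true =>
        -- In the exact regime there are no walks, so both regimes can share the same product law,
        -- trivial here.
        obtain ⟨-, rfl, rfl⟩ : _ ∧ R = 0 ∧ M = 0 := by simpa [Chosen] using hch
        refine runs_solveIf_solve (by omega) hn0 hε hε1 hE hdesc
          ⟨⟨hW.params.n, ht, hW.params.ε⟩, by simpa using hW.mark, ⟨hW.params.N, ?_, ?_⟩,
            by simpa using h16'⟩
        · intro k
          rw [← hW.mem.index.card_eq k]
          simp [hN]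
        · intro k _ s hs
          rw [← hW.mem.index.card_eq k] at hs
          simp [hN] at hs
  exact Cpl.mono (Smp.charge hfin _) fun _ _ _ _ h => h.2

end init


open scoped ENNReal

/-! ## The probability of a failure -/

theorem harm_eq_harmonic (n : ℕ) : harm n = (harmonic n : ℝ) := by
  simp [harm, harmonic]

theorem log_le_harm {n : ℕ} (hn : 0 < n) : Real.log n ≤ harm n := by
  rw [harm_eq_harmonic]
  refine le_trans (Real.log_le_log (by positivity) ?_) (log_add_one_le_harmonic n)
  push_cast
  linarith

theorem harm_le_log {n : ℕ} (hn : 2 ≤ n) : harm n ≤ 3 * Real.log n := by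
  have h1 := harmonic_le_one_add_log n
  have h2 := Real.log_two_gt_d9
  have h3 : Real.log 2 ≤ Real.log n := Real.log_le_log (by norm_num) (by exact_mod_cast hn)
  rw [harm_eq_harmonic]
  linarith

/-- Harmonic numbers stand in for logarithms: the machine can compute them exactly, and they are at
least `log n`. -/
theorem exp_neg_harm_le {n : ℕ} (hn : 0 < n) (k : ℕ) {x : ℝ} (hx : k * harm n ≤ x) :
    Real.exp (-x) ≤ 1 / (n : ℝ) ^ k := by
  have hn' : (0 : ℝ) < n := by exact_mod_cast hn
  have h : (k : ℝ) * Real.log n ≤ k * harm n :=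
    mul_le_mul_of_nonneg_left (log_le_harm hn) (Nat.cast_nonneg k)
  rw [← Real.exp_log (x := 1 / (n : ℝ) ^ k) (by positivity), Real.log_div one_ne_zero (by positivity),
    Real.log_one, Real.log_pow, Real.exp_le_exp]
  linarith

theorem Table.Describes.slotTable {n : ℕ} {t : Table} {E : UGraph n} (ht : t.Describes E)
    (hE : E.NoIsolated) : SlotTable n t.slot t.deg (adj E) where
  deg_pos u hu := by
    have := hE ⟨u, hu⟩
    rwa [← ht.deg_eq] at this
  deg_le u hu := ht.ok.deg_le hu
  filled u hu s hs := by
    obtain ⟨b, -, h, -⟩ := ht.ok.fill u hu s hs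
    omega
  lt u hu s hs := by
    obtain ⟨b, hb, h, -⟩ := ht.ok.fill u hu s hs
    have := ht.ok.sub u hu b hb
    omega
  empty := ht.ok.empty
  sum u hu f := by rw [ht.ok.sum hu f, sum_nbr]
  symm := adj_symm E

section adequate

variable {c n R M : ℕ} {ε α : ℝ}

/-- From `M * ε ≥ 10 * (harm n) ^ 2` the decay is at least `exp (-5 * harm n) ≤ 1 / n ^ 5`, that is,
the factor is at most `1 / n ^ 5`. It remains to see `4 ≤ ε * α * n ^ 4`, whose square is the regime
condition times `n ^ 5 ≥ 2 ^ 5`. -/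
theorem Adequate.tail (h : Adequate c n R M ε α) (hn : 2 ≤ n) (hε : 0 < ε) (hε1 : ε < 1)
    (hα : 0 < α) (hreg : 1 < ε * ε * (α * α) * (n * (n * n))) :
    n * (2 / ε) * (1 - ε / harm n / 2) ^ M ≤ α / 2 := by
  have hn' : (2 : ℝ) ≤ n := by exact_mod_cast hn
  have hH : 1 ≤ harm n := one_le_harm (by omega)
  have h1 : (1 - ε / harm n / 2) ^ M ≤ 1 / (n : ℝ) ^ 5 := by
    have hle : ε / harm n / 2 ≤ 1 := by
      rw [div_div, div_le_one (by positivity)]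
      linarith
    calc (1 - ε / harm n / 2) ^ M ≤ Real.exp (-(ε / harm n / 2)) ^ M :=
          pow_le_pow_left₀ (by linarith) (Real.one_sub_le_exp_neg _) M
      _ = Real.exp (-(M * (ε / harm n / 2))) := by rw [← Real.exp_nat_mul]; ring_nf
      _ ≤ 1 / (n : ℝ) ^ 5 := by
          refine exp_neg_harm_le (by omega) 5 ?_
          rw [show (M : ℝ) * (ε / harm n / 2) = M * ε / (2 * harm n) by field_simp,
            le_div_iff₀ (by positivity)]
          have := h.le_M
          push_cast
          linarith
  have h2 : 4 ≤ ε * α * (n : ℝ) ^ 4 := by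
    refine le_of_sq_le_sq ?_ (by positivity)
    have h3 : (2 : ℝ) ^ 5 ≤ (n : ℝ) ^ 5 := pow_le_pow_left₀ (by norm_num) hn' 5
    calc (4 : ℝ) ^ 2 ≤ 1 * (n : ℝ) ^ 5 := by linarith
      _ ≤ ε * ε * (α * α) * (n * (n * n)) * (n : ℝ) ^ 5 := by gcongr
      _ = (ε * α * (n : ℝ) ^ 4) ^ 2 := by ring
  calc n * (2 / ε) * (1 - ε / harm n / 2) ^ M ≤ n * (2 / ε) * (1 / (n : ℝ) ^ 5) := by gcongr
    _ = 2 / (ε * (n : ℝ) ^ 4) := by field_simp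
    _ ≤ α / 2 := by
        rw [div_le_div_iff₀ (by positivity) (by norm_num)]
        linarith

/-- Rounding up adds at most `α ^ 2 ≤ 1 ≤ c * harm n`. -/
theorem Adequate.R_le (h : Adequate c n R M ε α) (hc : 1 ≤ c) (hn : 0 < n) (hα : 0 < α)
    (hα1 : α ≤ 1) : R * (α * α) ≤ 2 * c * harm n := by
  have h1 := h.R_lt
  have hH : 1 ≤ harm n := one_le_harm hn
  have hc' : (1 : ℝ) ≤ c := by exact_mod_cast hc
  have hαα : α * α ≤ 1 := by nlinarith
  nlinarith

theorem Adequate.M_le (h : Adequate c n R M ε α) (hn : 0 < n) (hε1 : ε < 1) :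
    M * ε ≤ 11 * (harm n * harm n) := by
  have h1 := h.M_lt
  have hH : 1 ≤ harm n := one_le_harm hn
  nlinarith

theorem Adequate.R_pos (h : Adequate c n R M ε α) (hc : 1 ≤ c) (hn : 0 < n) : 0 < R := by
  refine Nat.pos_of_ne_zero fun h0 => ?_
  have h1 := h.le_R
  have hH : 1 ≤ harm n := one_le_harm hn
  have hc' : (1 : ℝ) ≤ c := by exact_mod_cast hc
  rw [h0] at h1
  simp only [Nat.cast_zero, zero_mul] at h1
  nlinarith

/-- Four keys with `3 * R * M` occurrences each give `12 * R * M` redone walks. Of the powers of the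
harmonic number, `R` contributes one and each of the two factors `M` contributes two. The constant
is `12 * 2 * 11 * 4700 = 1240800`, with `4700 = 400 * 11 + 300`. -/
theorem Adequate.update_le (h : Adequate c n R M ε α) (hc : 1 ≤ c) (hn : 0 < n) (hε : 0 < ε)
    (hε1 : ε < 1) (hα : 0 < α) (hα1 : α ≤ 1) :
    ((3000 + 12 * R * M * (400 * M + 300) : ℕ) : ℝ) * (ε ^ 2 * α ^ 2) ≤
      (1240800 * c + 5000) * harm n ^ 5 := by
  have hR := h.R_le hc hn hα hα1
  have hM := h.M_le hn hε1
  have hH : 1 ≤ harm n := one_le_harm hn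
  have h400 : (400 * M + 300) * ε ≤ 4700 * (harm n * harm n) := by nlinarith
  have hsmall : ε ^ 2 * α ^ 2 ≤ 1 :=
    mul_le_one₀ (pow_le_one₀ hε.le hε1.le) (by positivity) (pow_le_one₀ hα.le hα1)
  have hH5 : 1 ≤ harm n ^ 5 := one_le_pow₀ hH
  have hprod : (12 * (R * (α * α))) * (M * ε) * ((400 * M + 300) * ε) ≤
      (12 * (2 * c * harm n)) * (11 * (harm n * harm n)) * (4700 * (harm n * harm n)) := by
    gcongr
  push_cast
  calc (3000 + 12 * (R : ℝ) * M * (400 * M + 300)) * (ε ^ 2 * α ^ 2)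
      = 3000 * (ε ^ 2 * α ^ 2) +
        (12 * (R * (α * α))) * (M * ε) * ((400 * M + 300) * ε) := by ring
    _ ≤ 3000 * harm n ^ 5 +
        (12 * (2 * c * harm n)) * (11 * (harm n * harm n)) * (4700 * (harm n * harm n)) := by
        gcongr
        linarith
    _ = (1240800 * c + 3000) * harm n ^ 5 := by ring
    _ ≤ (1240800 * c + 5000) * harm n ^ 5 := by gcongr; norm_num

/-- The regime condition is designed for this: `n ^ 3 * ε ^ 2 * α ^ 2 ≤ 1`, so cubic time fits into
the bound. -/
theorem exact_update_le (hn : 0 < n) (hε : 0 < ε) (hε1 : ε < 1) (hα : 0 < α) (hα1 : α ≤ 1)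
    (hreg : ¬ 1 < ε * ε * (α * α) * (n * (n * n))) :
    ((2000 * n ^ 3 + 3000 : ℕ) : ℝ) * (ε ^ 2 * α ^ 2) ≤ (1240800 * c + 5000) * harm n ^ 5 := by
  have hH : 1 ≤ harm n := one_le_harm hn
  have hH5 : 1 ≤ harm n ^ 5 := one_le_pow₀ hH
  have hsmall : ε ^ 2 * α ^ 2 ≤ 1 :=
    mul_le_one₀ (pow_le_one₀ hε.le hε1.le) (by positivity) (pow_le_one₀ hα.le hα1)
  have hc : (0 : ℝ) ≤ c := Nat.cast_nonneg c
  rw [not_lt] at hreg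
  push_cast
  calc (2000 * (n : ℝ) ^ 3 + 3000) * (ε ^ 2 * α ^ 2)
      = 2000 * (ε * ε * (α * α) * (n * (n * n))) + 3000 * (ε ^ 2 * α ^ 2) := by ring
    _ ≤ 5000 * 1 := by linarith
    _ ≤ (1240800 * c + 5000) * harm n ^ 5 := by
        gcongr
        linarith

end adequate

section failure

variable {c n R M : ℕ} {ε α : ℝ} {E : UGraph n} {t : Table}

/-- Union bound over the vertices. The weight `ε / (n * R)` turns the mean `R * ∑ u, G u v` into
PageRank. -/
theorem prob_inaccurate_le (ht : t.Describes E) (hE : E.NoIsolated) (hR : 0 < R) (hn : 0 < n)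
    (hε : 0 < ε) (hε1 : ε < 1) (hα : 0 < α) (hα1 : α ≤ 1)
    (hM : n * (2 / ε) * (1 - ε / harm n / 2) ^ M ≤ α / 2) :
    (familyLaw n R M t.slot).toOuterMeasure {ω | ¬ UGraph.MulApprox α (pageRank ε E)
      fun v => ε / (n * R) * ∑ i ∈ Finset.range (n * R), visits n t.slot ε v n (ω i)} ≤
      n * (2 * ENNReal.ofReal (Real.exp (-(α ^ 2 * R / 16)))) := by
  have hT := ht.slotTable hE
  have hsub : {ω : ℕ → List ℕ | ¬ UGraph.MulApprox α (pageRank ε E)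
      fun v => ε / (n * R) * ∑ i ∈ Finset.range (n * R), visits n t.slot ε v n (ω i)} ⊆
      ⋃ v : Fin n, {ω | ¬ ((1 - α) * (R * ∑ u ∈ Finset.range n,
          if h : u < n then visitMatrix ε E ⟨u, h⟩ v else 0) ≤
          ∑ i ∈ Finset.range (n * R), visits n t.slot ε v n (ω i) ∧
        ∑ i ∈ Finset.range (n * R), visits n t.slot ε v n (ω i) ≤
          (1 + α) * (R * ∑ u ∈ Finset.range n,
            if h : u < n then visitMatrix ε E ⟨u, h⟩ v else 0))} := by
    intro ω hω
    simp only [UGraph.MulApprox, Set.mem_ofPred_eq, not_forall] at hω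
    obtain ⟨v, hv⟩ := hω
    refine Set.mem_iUnion.2 ⟨v, fun h => hv ?_⟩
    rw [Finset.sum_range] at h
    simp only [Fin.is_lt, dif_pos, Fin.eta] at h
    have hR' : (0 : ℝ) < R := by exact_mod_cast hR
    have hn' : (0 : ℝ) < n := by exact_mod_cast hn
    have hq : 0 ≤ ε / (n * R) := by positivity
    have e : pageRank ε E v = ε / (n * R) * (R * ∑ u, visitMatrix ε E u v) := by
      unfold pageRank
      field_simp
    have h1 := mul_le_mul_of_nonneg_left h.1 hq
    have h2 := mul_le_mul_of_nonneg_left h.2 hq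
    rw [e]
    constructor <;> linarith
  refine (MeasureTheory.measure_mono hsub).trans ((MeasureTheory.measure_iUnion_fintype_le _ _).trans ?_)
  refine (Finset.sum_le_sum fun v _ => hT.accurate (R := R) hε hε1 hα hα1 v.2
    (potential_visitMatrix hε hε1 hE ht.deg_eq v) hM).trans (le_of_eq ?_)
  simp

/-- Union bound over the touched keys. It is essential that `S` is fixed and does not depend on `ω`.
-/
theorem prob_slow_le (ht : t.Describes E) (hE : E.NoIsolated) (hn : 0 < n) {S : List ℕ}
    (hS : S.length ≤ 4) :
    (familyLaw n R M t.slot).toOuterMeasure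
      {ω | 3000 + 12 * R * M * (400 * M + 300) < updateTime n R M S ω} ≤
      4 * ENNReal.ofReal (Real.exp (-R)) := by
  have hT := ht.slotTable hE
  have hsub : {ω : ℕ → List ℕ | 3000 + 12 * R * M * (400 * M + 300) < updateTime n R M S ω} ⊆
      ⋃ k ∈ S.toFinset, {ω | 3 * R * M < ∑ i ∈ Finset.range (n * R), (ω i).count k} := by
    intro ω hω
    by_contra hcon
    simp only [Set.mem_iUnion, Set.mem_ofPred_eq, not_exists, not_lt, List.mem_toFinset] at hcon hω
    have h1 : (S.map fun k => ∑ i ∈ Finset.range (n * R), (ω i).count k).sum ≤ 12 * R * M := by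
      refine (sum_map_le S hcon).trans ?_
      calc S.length * (3 * R * M) ≤ 4 * (3 * R * M) := Nat.mul_le_mul_right _ hS
        _ = 12 * R * M := by ring
    have h2 := Nat.mul_le_mul_right (400 * M + 300) h1
    unfold updateTime at hω
    omega
  refine (MeasureTheory.measure_mono hsub).trans
    ((MeasureTheory.measure_biUnion_finset_le _ _).trans ?_)
  refine (Finset.sum_le_sum fun k _ => hT.count_le hn k).trans ?_
  rw [Finset.sum_const, nsmul_eq_mul]
  have h4 : S.toFinset.card ≤ 4 := (List.toFinset_card_le S).trans hS
  gcongr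
  exact_mod_cast h4

/-- The probability of a failure in one step. -/
theorem failure_le (hn : 2 ≤ n) (h : Adequate (16 * (c + 4)) n R M ε α) (hα : 0 < α) (hα1 : α ≤ 1) :
    n * (2 * ENNReal.ofReal (Real.exp (-(α ^ 2 * R / 16)))) +
      4 * ENNReal.ofReal (Real.exp (-R)) ≤ ENNReal.ofReal (1 / (n : ℝ) ^ c) := by
  have hn' : (2 : ℝ) ≤ n := by exact_mod_cast hn
  have hR := h.le_R
  push_cast at hR
  have hα2 : α * α ≤ 1 := by nlinarith
  have hR0 : (0 : ℝ) ≤ R := Nat.cast_nonneg R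
  have h1 : Real.exp (-(α ^ 2 * R / 16)) ≤ 1 / (n : ℝ) ^ (c + 4) := by
    refine exp_neg_harm_le (by omega) _ ?_
    push_cast
    nlinarith
  have h2 : Real.exp (-R) ≤ 1 / (n : ℝ) ^ (c + 4) := by
    refine le_trans (Real.exp_le_exp.2 ?_) h1
    nlinarith
  have hreal : n * (2 * Real.exp (-(α ^ 2 * R / 16))) + 4 * Real.exp (-R) ≤ 1 / (n : ℝ) ^ c := by
    have h4 : 2 * (n : ℝ) + 4 ≤ (n : ℝ) ^ 4 := by
      have : (2 : ℝ) ^ 3 * n ≤ (n : ℝ) ^ 3 * n := by gcongr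
      nlinarith
    calc n * (2 * Real.exp (-(α ^ 2 * R / 16))) + 4 * Real.exp (-R)
        ≤ n * (2 * (1 / (n : ℝ) ^ (c + 4))) + 4 * (1 / (n : ℝ) ^ (c + 4)) := by gcongr
      _ = (2 * n + 4) / (n : ℝ) ^ (c + 4) := by ring
      _ ≤ (n : ℝ) ^ 4 / (n : ℝ) ^ (c + 4) := by gcongr
      _ = 1 / (n : ℝ) ^ c := by rw [pow_add]; field_simp
  refine le_trans (le_of_eq ?_) (ENNReal.ofReal_le_ofReal hreal)
  rw [ENNReal.ofReal_add (by positivity) (by positivity), ENNReal.ofReal_mul (by positivity),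
    ENNReal.ofReal_mul (by positivity), ENNReal.ofReal_mul (by positivity), ENNReal.ofReal_natCast]
  norm_num

end failure

/-! ## Word sizes -/

/-- In the sampling regime `R ≤ 2 * c * n ^ 4` and `M ≤ 11 * n ^ 5`, so every address is below a
constant times `c * n ^ 12`. The constant is absorbed by `n ^ 8 ≥ 256` and the factor `c` by `n ^
c`. -/
theorem word_size {c n w : ℕ} {ε α : ℝ} (hc : 1 ≤ c) (hn : 2 ≤ n) (hε : 0 < ε) (hε1 : ε < 1)
    (hα : 0 < α) (hα1 : α ≤ 1) (hw : n ^ (c + 20) ≤ 2 ^ w) :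
    c * n ^ 6 + 1 < 2 ^ w ∧ ∀ R M e, Chosen c n R M ε α e →
      8 * (n * n * (n * R * M + 1)) < 2 ^ w ∧ n * R < 2 ^ w := by
  have hcn : c < n ^ c := (Nat.lt_two_pow_self).trans_le (Nat.pow_le_pow_left hn c)
  have h256 : 256 ≤ n ^ 8 := (by norm_num : 256 = 2 ^ 8).le.trans (Nat.pow_le_pow_left hn 8)
  have h12 : 0 < n ^ 12 := by positivity
  have hmain : 256 * c * n ^ 12 < 2 ^ w := by
    refine lt_of_lt_of_le ?_ hw
    calc 256 * c * n ^ 12 = c * (256 * n ^ 12) := by ring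
      _ < n ^ c * (256 * n ^ 12) := Nat.mul_lt_mul_of_pos_right hcn (by positivity)
      _ ≤ n ^ c * (n ^ 8 * n ^ 12) := by gcongr
      _ = n ^ (c + 20) := by ring
  have h6 : n ^ 6 ≤ n ^ 12 := Nat.pow_le_pow_right (by omega) (by norm_num)
  have hbound : ∀ R M, R ≤ 2 * c * n ^ 4 → M ≤ 11 * n ^ 5 →
      8 * (n * n * (n * R * M + 1)) < 2 ^ w ∧ n * R < 2 ^ w := by
    intro R M hR hM
    have h2 : n ^ 2 ≤ n ^ 12 := Nat.pow_le_pow_right (by omega) (by norm_num)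
    have h5 : n ^ 5 ≤ n ^ 12 := Nat.pow_le_pow_right (by omega) (by norm_num)
    constructor
    · calc 8 * (n * n * (n * R * M + 1))
          ≤ 8 * (n * n * (n * (2 * c * n ^ 4) * (11 * n ^ 5) + 1)) := by gcongr
        _ = 176 * c * n ^ 12 + 8 * n ^ 2 := by ring
        _ ≤ 176 * c * n ^ 12 + 8 * (c * n ^ 12) := by nlinarith
        _ ≤ 256 * c * n ^ 12 := by nlinarith
        _ < 2 ^ w := hmain
    · calc n * R ≤ n * (2 * c * n ^ 4) := by gcongr
        _ = 2 * c * n ^ 5 := by ring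
        _ ≤ 2 * c * n ^ 12 := by gcongr
        _ ≤ 256 * c * n ^ 12 := by nlinarith
        _ < 2 ^ w := hmain
  refine ⟨by nlinarith, fun R M e hch => ?_⟩
  cases e with
  | true =>
    obtain ⟨-, rfl, rfl⟩ : _ ∧ R = 0 ∧ M = 0 := by simpa [Chosen] using hch
    exact hbound 0 0 (Nat.zero_le _) (Nat.zero_le _)
  | false =>
    obtain ⟨hreg, h⟩ : 1 < ε * ε * (α * α) * (n * (n * n)) ∧ Adequate c n R M ε α := by
      simpa [Chosen] using hch
    have hn' : (2 : ℝ) ≤ n := by exact_mod_cast hn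
    have hn3 : (0 : ℝ) < n * (n * n) := by positivity
    have hεε : ε * ε ≤ ε := by nlinarith
    have hαα : α * α ≤ 1 := by nlinarith
    have ha3 : 1 ≤ α * α * (n * (n * n)) := by
      refine hreg.le.trans (mul_le_mul_of_nonneg_right ?_ hn3.le)
      nlinarith [mul_pos hα hα]
    have he3 : 1 ≤ ε * (n * (n * n)) := by
      refine hreg.le.trans (mul_le_mul_of_nonneg_right ?_ hn3.le)
      nlinarith [mul_pos hα hα, mul_pos hε hε]
    have hR := h.R_le hc (by omega) hα hα1
    have hM := h.M_le (by omega) hε1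
    have hH := harm_le n
    have hH1 : 1 ≤ harm n := one_le_harm (by omega)
    refine hbound R M ?_ ?_
    · have : (R : ℝ) ≤ 2 * c * n ^ 4 := by
        calc (R : ℝ) = R * 1 := (mul_one _).symm
          _ ≤ R * (α * α * (n * (n * n))) := by gcongr
          _ = R * (α * α) * (n * (n * n)) := by ring
          _ ≤ 2 * c * n * (n * (n * n)) :=
              mul_le_mul_of_nonneg_right (hR.trans (by gcongr)) hn3.le
          _ = 2 * c * n ^ 4 := by ring
      exact_mod_cast this
    · have : (M : ℝ) ≤ 11 * n ^ 5 := by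
        calc (M : ℝ) = M * 1 := (mul_one _).symm
          _ ≤ M * (ε * (n * (n * n))) := by gcongr
          _ = M * ε * (n * (n * n)) := by ring
          _ ≤ 11 * (n * n) * (n * (n * n)) :=
              mul_le_mul_of_nonneg_right (hM.trans (by gcongr)) hn3.le
          _ = 11 * n ^ 5 := by ring
      exact_mod_cast this


open scoped ENNReal

/-! ## The history of a run -/

theorem Cpl.of_forall {β γ : Type*} {m : PMF γ} {b : β} {Q : β → γ → Prop}
    (h : ∀ g ∈ m.support, Q b g) : Cpl m (PMF.pure b) Q := by
  have := Cpl.map_left (Q' := Q) (Function.const γ b)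
    (Cpl.mono (Cpl.self m) fun a g _ hg (h : a = g) => (⟨h, hg⟩ : a = g ∧ g ∈ m.support))
    fun a g hag => h g hag.2
  rwa [PMF.map_const] at this

theorem Samples.cpl {β : Type*} {w : ℕ} {P : Prog} {σ : State} {B : ℕ} {μ : PMF β}
    {Q : β → State → Prop} (h : Samples w P σ B μ Q) :
    Cpl (exec w P σ) μ fun b r => r.2 ≤ B ∧ Q b r.1 := h

/-- The history from a random state on. -/
noncomputable def historyFrom (A : DynAlg) (w : ℕ) {n : ℕ} (ν : PMF (State × ℕ))
    (xs : List (EdgeUpdate n)) : PMF (List (State × ℕ)) :=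
  ν.bind fun r => (processUpdates A w r.1 xs).map (r :: ·)

/-- The law of the state after one more update. -/
noncomputable def updateLaw (A : DynAlg) (w : ℕ) {n : ℕ} (ν : PMF (State × ℕ)) (x : EdgeUpdate n) :
    PMF (State × ℕ) :=
  ν.bind fun r => exec w A.update (announce r.1 x)

theorem noIsolated_of_validSeq {n : ℕ} {E : UGraph n} {xs : List (EdgeUpdate n)}
    (h : EdgeUpdate.ValidSeq E xs) : E.NoIsolated := by
  cases xs with
  | nil => exact h
  | cons x xs => exact h.1

section historyFrom

variable {A : DynAlg} {w n : ℕ} {ν : PMF (State × ℕ)} {x : EdgeUpdate n}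
  {xs : List (EdgeUpdate n)}

theorem cpl_historyFrom_zero :
    Cpl (historyFrom A w ν xs) ν fun r h => h[0]? = some r := by
  have := Cpl.bind (Cpl.self ν) (f := fun r => (processUpdates A w r.1 xs).map (r :: ·))
    (κ := PMF.pure) (Q' := fun r h => h[0]? = some r) (by
      rintro r _ rfl
      refine Cpl.of_forall fun h hh => ?_
      obtain ⟨h', -, rfl⟩ := (PMF.mem_support_map_iff _ _ _).1 hh
      rfl)
  rwa [PMF.bind_pure] at this

/-- Shifts the time by one update. After the shift only the law of the current memory matters, so
the induction can run over laws instead of over histories. -/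
theorem cpl_historyFrom_succ :
    Cpl (historyFrom A w ν (x :: xs)) (historyFrom A w (updateLaw A w ν x) xs) fun h' h =>
      ∀ i : ℕ, h[i + 1]? = h'[i]? := by
  have := Cpl.bind (Cpl.self ν) (f := fun r => (processUpdates A w r.1 (x :: xs)).map (r :: ·))
    (κ := fun r => processUpdates A w r.1 (x :: xs))
    (Q' := fun h' h => ∀ i : ℕ, h[i + 1]? = h'[i]?) (by
      rintro r _ rfl
      refine Cpl.map_right _ (Cpl.self _) ?_
      rintro h _ rfl i
      rfl)
  simpa only [historyFrom, updateLaw, PMF.bind_bind, processUpdates] using this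

/-- If one step preserves an invariant of the law of the state and fails with probability at most
`δ`, then the probability that an entry of the history is bad is at most `δ`. -/
theorem historyFrom_bad_le {Inv : PMF (State × ℕ) → UGraph n → Prop}
    {Acc : UGraph n → State × ℕ → Prop} {Fast : State × ℕ → Prop} {δ : ℝ≥0∞}
    (hstep : ∀ ν E x, Inv ν E → x.Legal E → (x.apply E).NoIsolated →
      Inv (updateLaw A w ν x) (x.apply E) ∧
        (updateLaw A w ν x).toOuterMeasure {r | ¬ (Acc (x.apply E) r ∧ Fast r)} ≤ δ)
    {E : UGraph n} (hxs : EdgeUpdate.ValidSeq E xs) (hν : Inv ν E) {G : State × ℕ → Prop}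
    (hG : ν.toOuterMeasure {r | ¬ G r} ≤ δ) {i : ℕ} (hi : i ≤ xs.length) :
    (historyFrom A w ν xs).toOuterMeasure {h | ¬ ∃ r, h[i]? = some r ∧ (i = 0 → G r) ∧
      (1 ≤ i → Acc (EdgeUpdate.applyAll E (xs.take i)) r ∧ Fast r)} ≤ δ := by
  induction xs generalizing ν E G i with
  | nil =>
    obtain rfl : i = 0 := by simpa using hi
    refine (cpl_historyFrom_zero.prob_le ?_).trans hG
    intro r h hr hbad hGr
    exact hbad ⟨r, hr, fun _ => hGr, fun h => absurd h (by norm_num)⟩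
  | cons x xs ih =>
    obtain ⟨-, hx, hxs⟩ := hxs
    rcases i with _ | i
    · refine (cpl_historyFrom_zero.prob_le ?_).trans hG
      intro r h hr hbad hGr
      exact hbad ⟨r, hr, fun _ => hGr, fun h => absurd h (by norm_num)⟩
    · obtain ⟨h1, h2⟩ := hstep ν E x hν hx (noIsolated_of_validSeq hxs)
      refine (cpl_historyFrom_succ.prob_le ?_).trans (ih hxs h1 h2 (i := i) (by simpa using hi))
      rintro h' h hh hbad ⟨r, hr, hr0, hr1⟩
      -- Entry `i + 1` of the history is entry `i` of the shifted one. If `i = 0`, its quality is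
      -- that of the initial law there, which is what the predicate `G` provides.
      refine hbad ⟨r, by rw [hh, hr], fun h => absurd h (by norm_num), fun _ => ?_⟩
      rcases i with _ | i
      · exact hr0 rfl
      · exact hr1 (by omega)

end historyFrom

/-- Union bound over the selected times; no independence between different times is required. -/
theorem one_sub_le_prob {β : Type*} (m : PMF β) {I : Finset ℕ} {S : ℕ → Set β} {δ : ℝ} (hδ : 0 ≤ δ)
    (h : ∀ i ∈ I, m.toOuterMeasure (S i)ᶜ ≤ ENNReal.ofReal δ) :
    1 - I.card * δ ≤ (m.toOuterMeasure {b | ∀ i ∈ I, b ∈ S i}).toReal := by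
  set T : Set β := {b | ∀ i ∈ I, b ∈ S i} with hT
  have h1 : m.toOuterMeasure Tᶜ ≤ ENNReal.ofReal (I.card * δ) := by
    have hsub : Tᶜ ⊆ ⋃ i ∈ I, (S i)ᶜ := by
      intro b hb
      simp only [hT, Set.mem_compl_iff, Set.mem_ofPred_eq, not_forall] at hb
      obtain ⟨i, hi, hb⟩ := hb
      exact Set.mem_biUnion hi hb
    refine (MeasureTheory.measure_mono hsub).trans
      ((MeasureTheory.measure_biUnion_finset_le _ _).trans ((Finset.sum_le_sum h).trans ?_))
    rw [Finset.sum_const, nsmul_eq_mul, ENNReal.ofReal_mul (Nat.cast_nonneg _), ENNReal.ofReal_natCast]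
  have h2 : 1 ≤ m.toOuterMeasure T + m.toOuterMeasure Tᶜ := by
    have h3 : m.toOuterMeasure Set.univ = 1 :=
      (PMF.toOuterMeasure_apply_eq_one_iff _ _).2 (Set.subset_univ _)
    rw [← h3, ← Set.union_compl_self T]
    exact MeasureTheory.measure_union_le _ _
  have h4 : m.toOuterMeasure T ≠ ⊤ := by
    refine ne_top_of_le_ne_top ENNReal.one_ne_top ?_
    have h3 : m.toOuterMeasure Set.univ = 1 :=
      (PMF.toOuterMeasure_apply_eq_one_iff _ _).2 (Set.subset_univ _)
    rw [← h3]
    exact MeasureTheory.measure_mono (Set.subset_univ _)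
  have h5 := ENNReal.toReal_mono (ENNReal.add_ne_top.2 ⟨h4, ENNReal.ofReal_ne_top⟩)
    (h2.trans (add_le_add_right h1 _))
  rw [ENNReal.toReal_one, ENNReal.toReal_add h4 ENNReal.ofReal_ne_top,
    ENNReal.toReal_ofReal (by positivity)] at h5
  linarith

/-! ## One update -/

section update

variable {w n R M : ℕ} {ε α : ℝ} {e : Bool} {E : UGraph n} {t : Table}

/-- A bound for the time of an update. -/
def stepTime (n R M : ℕ) (e : Bool) (S : List ℕ) (ω : ℕ → List ℕ) : ℕ :=
  if e then 2000 * n ^ 3 + 3000 else updateTime n R M S ω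

/-- The order of the quantifiers expresses obliviousness: the new table and the touched keys are
chosen before the random family and the memory. -/
theorem exists_update {c : ℕ} (hch : Chosen c n R M ε α e) (hn : 0 < n) (hε : 0 < ε) (hε1 : ε < 1)
    (hw : 8 * (n * n * (n * R * M + 1)) < 2 ^ w) (ht : t.Describes E) {x : EdgeUpdate n}
    (hx : x.Legal E) (hE : (x.apply E).NoIsolated) :
    ∃ (t' : Table) (S : List ℕ), t'.Describes (x.apply E) ∧ S.length ≤ 4 ∧
      (∀ k, k ∉ S → t.slot k = t'.slot k) ∧ ∀ ω σ, Invariant n R M ε e t E ω σ →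
        Samples w updateProg (announce σ x) (stepTime n R M e S ω)
          (prodLaw (fun i => resample n t'.slot S (ω i)) (n * R))
          fun ω' σ' => Invariant n R M ε e t' (x.apply E) ω' σ' := by
  obtain ⟨t', S, ht', hS, hslot, hrun⟩ := exists_change ht hx
  refine ⟨t', S, ht', hS, hslot, fun ω σ h => ?_⟩
  have hother : ∀ a, a ≠ 2 → (announce σ x).words a = σ.words a := fun a ha => by
    simp [announce, State.setWord_words, ha]
  have hann : ∀ N, 8 * (n * n * (N + 1)) < 2 ^ w → σ.words 0 0 = n → HasTable σ t →
      Lists n N N σ → (∀ k, σ.words 10 k = 0) →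
      RunsT w changeGraph (announce σ x) (1500 + 100 * (S.map (σ.words 9)).sum) fun σ' =>
        HasTable σ' t' ∧ Touched N σ' S := by
    intro N hwN h0 ht hl h10
    have := hrun w N (announce σ x) hwN (by simp [announce, State.setWord_words_apply])
      (by simp [announce, State.setWord_words_apply]) (by simp [announce, State.setWord_words_apply])
      (by rw [hother 0 (by norm_num), h0])
      (ht.of_eq (hother 3 (by norm_num)) (hother 4 (by norm_num)) (hother 5 (by norm_num)))
      (hl.of_eq (hother 7 (by norm_num)) (hother 9 (by norm_num)) (hother 15 (by norm_num)))
      (by rw [hother 10 (by norm_num)]; exact h10)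
    rwa [hother 9 (by norm_num)] at this
  cases e with
  | false =>
    obtain ⟨h1, h2⟩ : Stored n R M ε (ε / (n * R)) t ω σ ∧ σ.words 16 0 = 0 := h
    exact h1.samples_update h2 hn hw hS hslot ht'.slot_le
      (hann _ hw h1.walking.params.n h1.table h1.lists (by simpa using h1.walking.mark))
  | true =>
    obtain ⟨h1, -⟩ : Exact n ε t σ ∧ _ := h
    obtain ⟨-, rfl, rfl⟩ : _ ∧ R = 0 ∧ M = 0 := by simpa [Chosen] using hch
    have hw' : 8 * (n * n * (0 + 1)) < 2 ^ w := by simpa using hw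
    have := (h1.runs_update hw' hn hε hε1 hE ht' hS
      (hann 0 hw' h1.solving.size h1.solving.table h1.lists h1.mark)).samples (b := fun _ => [])
      (Q := fun ω' σ' => Invariant n 0 0 ε true t' (x.apply E) ω' σ')
    exact this

end update


open scoped ENNReal

/-! ## The analysis of the algorithm -/

section analysis

variable {c w n R M : ℕ} {ε α : ℝ} {e : Bool} {E : UGraph n} {ν : PMF (State × ℕ)}

/-- The memory stores a random family of walks, or PageRank. -/
def LawInvariant (n R M : ℕ) (ε : ℝ) (e : Bool) (ν : PMF (State × ℕ)) (E : UGraph n) : Prop :=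
  ∃ t : Table, t.Describes E ∧ Cpl ν (familyLaw n R M t.slot) fun ω r =>
    Invariant n R M ε e t E ω r.1

theorem LawInvariant.prob_inaccurate_le (h : LawInvariant n R M ε e ν E)
    (hch : Chosen (16 * (c + 4)) n R M ε α e) (hn : 2 ≤ n) (hε : 0 < ε) (hε1 : ε < 1) (hα : 0 < α)
    (hα1 : α ≤ 1) (hE : E.NoIsolated) :
    ν.toOuterMeasure {r | ¬ UGraph.MulApprox α (pageRank ε E) (output n r.1)} ≤
      if e then 0 else n * (2 * ENNReal.ofReal (Real.exp (-(α ^ 2 * R / 16)))) := by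
  obtain ⟨t, ht, hcpl⟩ := h
  cases e with
  | true =>
    refine (hcpl.prob_le (T := ∅) ?_).trans (by simp)
    rintro ω r ⟨-, hr⟩ hbad
    refine hbad fun v => ?_
    have hp := (isPageRank_pageRank (by omega) hε hε1 hE).nonneg v
    simp only [output, hr v]
    constructor <;> nlinarith
  | false =>
    obtain ⟨hreg, had⟩ : 1 < ε * ε * (α * α) * (n * (n * n)) ∧ Adequate (16 * (c + 4)) n R M ε α := by
      simpa [Chosen] using hch
    refine (hcpl.prob_le ?_).trans (RealRAM.prob_inaccurate_le ht hE (had.R_pos (by omega) (by omega))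
      (by omega) hε hε1 hα hα1 (had.tail hn hε hε1 hα hreg))
    rintro ω r ⟨hr, -⟩ hbad h
    refine hbad fun v => ?_
    rw [output, hr.output_eq]
    exact h v

theorem LawInvariant.prob_inaccurate_le' (h : LawInvariant n R M ε e ν E)
    (hch : Chosen (16 * (c + 4)) n R M ε α e) (hn : 2 ≤ n) (hε : 0 < ε) (hε1 : ε < 1) (hα : 0 < α)
    (hα1 : α ≤ 1) (hE : E.NoIsolated) :
    ν.toOuterMeasure {r | ¬ UGraph.MulApprox α (pageRank ε E) (output n r.1)} ≤
      ENNReal.ofReal (1 / (n : ℝ) ^ c) := by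
  refine (h.prob_inaccurate_le hch hn hε hε1 hα hα1 hE).trans ?_
  cases e with
  | true => exact zero_le
  | false =>
    have had : Adequate (16 * (c + 4)) n R M ε α := by
      simp only [Chosen, Bool.false_eq_true, if_false] at hch
      exact hch.2
    exact le_self_add.trans (failure_le hn had hα hα1)

/-- The constant in the time bound. -/
def timeConstant (c : ℕ) : ℝ := 243 * (1240800 * (16 * (c + 4) : ℕ) + 5000)

/-- The factor `243 = 3 ^ 5` in `timeConstant` comes from `harm n ≤ 3 * log n`. -/
theorem le_timeBound (hn : 2 ≤ n) (hε : 0 < ε) (hα : 0 < α) {T : ℕ}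
    (h : (T : ℝ) * (ε ^ 2 * α ^ 2) ≤ (1240800 * (16 * (c + 4) : ℕ) + 5000) * harm n ^ 5) :
    (T : ℝ) ≤ timeConstant c * Real.log n ^ 5 / (ε ^ 2 * α ^ 2) := by
  rw [le_div_iff₀ (by positivity)]
  have h1 : harm n ^ 5 ≤ (3 * Real.log n) ^ 5 :=
    pow_le_pow_left₀ (harm_nonneg n) (harm_le_log hn) 5
  calc (T : ℝ) * (ε ^ 2 * α ^ 2) ≤ (1240800 * (16 * (c + 4) : ℕ) + 5000) * harm n ^ 5 := h
    _ ≤ (1240800 * (16 * (c + 4) : ℕ) + 5000) * (3 * Real.log n) ^ 5 := by gcongr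
    _ = timeConstant c * Real.log n ^ 5 := by rw [timeConstant]; ring

/-- Two couplings of the same run are used: with the family after the update for the output, and
with the family before it for the time. Both families have the law of fresh walks, for their
respective tables. -/
theorem LawInvariant.update (h : LawInvariant n R M ε e ν E)
    (hch : Chosen (16 * (c + 4)) n R M ε α e) (hn : 2 ≤ n) (hε : 0 < ε) (hε1 : ε < 1) (hα : 0 < α)
    (hα1 : α ≤ 1) (hE : E.NoIsolated) (hw : 8 * (n * n * (n * R * M + 1)) < 2 ^ w)
    {A : DynAlg} (hA : A.update = updateProg) {x : EdgeUpdate n}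
    (hx : x.Legal E) (hxE : (x.apply E).NoIsolated) :
    LawInvariant n R M ε e (updateLaw A w ν x) (x.apply E) ∧
      (updateLaw A w ν x).toOuterMeasure {r | ¬ (UGraph.MulApprox α (pageRank ε (x.apply E))
        (output n r.1) ∧ (r.2 : ℝ) ≤ timeConstant c * Real.log n ^ 5 / (ε ^ 2 * α ^ 2))} ≤
        ENNReal.ofReal (1 / (n : ℝ) ^ c) := by
  obtain ⟨t, ht, hcpl⟩ := h
  obtain ⟨t', S, ht', hS, hslot, hupd⟩ := exists_update hch (by omega) hε hε1 hw ht hx hxE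
  have hstate : Cpl (updateLaw A w ν x) (familyLaw n R M t'.slot) fun ω' r =>
      Invariant n R M ε e t' (x.apply E) ω' r.1 := by
    have h1 := Cpl.bind hcpl (f := fun r => exec w A.update (announce r.1 x))
      (κ := fun ω => prodLaw (fun i => resample n t'.slot S (ω i)) (n * R))
      (Q' := fun ω' r => Invariant n R M ε e t' (x.apply E) ω' r.1) fun ω r hr => by
        rw [hA]
        exact Cpl.mono (hupd ω r.1 hr).cpl fun _ _ _ _ h => h.2
    -- Redrawing carries the product law for the old table exactly into the one for the new table,
    -- so errors do not accumulate over the updates.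
    have h2 : (familyLaw n R M t.slot).bind
        (fun ω => prodLaw (fun i => resample n t'.slot S (ω i)) (n * R)) =
        familyLaw n R M t'.slot := by
      unfold familyLaw
      rw [prodLaw_bind]
      exact prodLaw_congr fun i _ => walkLaw_bind_resample hslot M _
    rwa [h2] at h1
  have htime : Cpl (updateLaw A w ν x) (familyLaw n R M t.slot) fun ω r =>
      r.2 ≤ stepTime n R M e S ω := by
    have h1 := Cpl.bind hcpl (f := fun r => exec w A.update (announce r.1 x)) (κ := PMF.pure)
      (Q' := fun ω r => r.2 ≤ stepTime n R M e S ω) fun ω r hr => by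
        have h2 := Cpl.map_left (Q' := fun ω r => r.2 ≤ stepTime n R M e S ω)
          (Function.const _ ω) (hupd ω r.1 hr).cpl fun _ _ h => h.1
        rwa [PMF.map_const, ← hA] at h2
    rwa [PMF.bind_pure] at h1
  have hinv : LawInvariant n R M ε e (updateLaw A w ν x) (x.apply E) := ⟨t', ht', hstate⟩
  refine ⟨hinv, ?_⟩
  set B := timeConstant c * Real.log n ^ 5 / (ε ^ 2 * α ^ 2) with hB
  have hsub : {r : State × ℕ | ¬ (UGraph.MulApprox α (pageRank ε (x.apply E)) (output n r.1) ∧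
      (r.2 : ℝ) ≤ B)} ⊆
      {r | ¬ UGraph.MulApprox α (pageRank ε (x.apply E)) (output n r.1)} ∪
        {r | ¬ (r.2 : ℝ) ≤ B} := by
    intro r hr
    by_cases h : UGraph.MulApprox α (pageRank ε (x.apply E)) (output n r.1)
    · exact Or.inr fun h' => hr ⟨h, h'⟩
    · exact Or.inl h
  refine (MeasureTheory.measure_mono hsub).trans ((MeasureTheory.measure_union_le _ _).trans ?_)
  have hacc := hinv.prob_inaccurate_le hch hn hε hε1 hα hα1 hxE
  cases e with
  | true =>
    have hreg : ¬ 1 < ε * ε * (α * α) * (n * (n * n)) := by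
      simp only [Chosen, if_true] at hch
      exact hch.1
    have hslow : (updateLaw A w ν x).toOuterMeasure {r | ¬ (r.2 : ℝ) ≤ B} ≤ 0 := by
      refine (htime.prob_le (T := ∅) ?_).trans (by simp)
      intro ω r hr hbad
      refine hbad (le_trans (Nat.cast_le.2 hr) (le_timeBound hn hε hα ?_))
      exact exact_update_le (by omega) hε hε1 hα hα1 hreg
    exact (add_le_add hacc hslow).trans (by simp)
  | false =>
    have had : Adequate (16 * (c + 4)) n R M ε α := by
      simp only [Chosen, Bool.false_eq_true, if_false] at hch
      exact hch.2
    have hslow : (updateLaw A w ν x).toOuterMeasure {r | ¬ (r.2 : ℝ) ≤ B} ≤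
        4 * ENNReal.ofReal (Real.exp (-R)) := by
      refine (htime.prob_le ?_).trans (prob_slow_le ht hE (by omega) hS)
      intro ω r hr hbad
      by_contra hcon
      rw [Set.mem_ofPred_eq, not_lt] at hcon
      refine hbad (le_trans (Nat.cast_le.2 (hr.trans hcon)) (le_timeBound hn hε hα ?_))
      exact had.update_le (by omega) (by omega) hε hε1 hα hα1
    exact (add_le_add hacc hslow).trans (failure_le hn had hα hα1)

end analysis

end RealRAM

theorem mainTheorem4 (c : ℕ) :
    ∃ (A : RealRAM.DynAlg) (K : ℕ) (C : ℝ),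
      ∀ (n : ℕ), 2 ≤ n → ∀ (ε α : ℝ), 0 < ε → ε < 1 → 0 < α → α ≤ 1 →
      ∀ (w : ℕ), n ^ K ≤ 2 ^ w →
      ∀ (E : UGraph n) (xs : List (EdgeUpdate n)), EdgeUpdate.ValidSeq E xs →
      ∀ (I : Finset ℕ), I ⊆ Finset.range (xs.length + 1) →
        1 - (I.card : ℝ) / (n : ℝ) ^ c ≤
          ((RealRAM.history A w ε α E xs).toOuterMeasure
            {h | ∀ i ∈ I, RealRAM.GoodAt ε α
              (C * (Real.log n) ^ 5 / (ε ^ 2 * α ^ 2)) E xs i h}).toReal := by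
  -- The factor `16` cancels the one in the Chernoff exponent, and the surplus `4` in the power of
  -- `n` absorbs the `2 * n + 4` terms of the union bound in `failure_le`.
  refine ⟨⟨RealRAM.initProg (16 * (c + 4)), RealRAM.updateProg⟩, 16 * (c + 4) + 20,
    RealRAM.timeConstant c, ?_⟩
  intro n hn ε α hε hε1 hα hα1 w hw E xs hxs I hI
  have hn0 : 0 < n := by omega
  obtain ⟨hcap, hsize⟩ := RealRAM.word_size (by omega) hn hε hε1 hα hα1 hw
  have hE := RealRAM.noIsolated_of_validSeq hxs
  obtain ⟨R, M, e, t, hch, ht, hinit⟩ :=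
    RealRAM.exists_init (by omega) hn hε hε1 hα hα1 hE hcap hsize
  have hinv : RealRAM.LawInvariant n R M ε e (RealRAM.exec w (RealRAM.initProg (16 * (c + 4)))
    (RealRAM.inputState ε α E)) E := ⟨t, ht, hinit⟩
  rw [div_eq_mul_one_div]
  refine RealRAM.one_sub_le_prob _ (by positivity) fun i hi => ?_
  have hi' : i ≤ xs.length := by
    have := Finset.mem_range.1 (hI hi)
    omega
  set A : RealRAM.DynAlg := ⟨RealRAM.initProg (16 * (c + 4)), RealRAM.updateProg⟩ with hA
  have key := RealRAM.historyFrom_bad_le (A := A) (w := w) (xs := xs) (i := i)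
    -- The absence of isolated vertices is carried along in `Inv` and `Acc`, so that `pageRank` is
    -- known to be the PageRank of the graph at the time in question.
    (Inv := fun ν E => E.NoIsolated ∧ RealRAM.LawInvariant n R M ε e ν E)
    (Acc := fun E r => E.NoIsolated ∧ UGraph.MulApprox α (RealRAM.pageRank ε E) (RealRAM.output n r.1))
    (Fast := fun r =>
      (r.2 : ℝ) ≤ RealRAM.timeConstant c * Real.log n ^ 5 / (ε ^ 2 * α ^ 2))
    (δ := ENNReal.ofReal (1 / (n : ℝ) ^ c))
    (G := fun r => UGraph.MulApprox α (RealRAM.pageRank ε E) (RealRAM.output n r.1))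
    (by
      rintro ν E x ⟨hE, hν⟩ hx hxE
      obtain ⟨h1, h2⟩ := hν.update (A := A) hch hn hε hε1 hα hα1 hE (hsize R M e hch).1 rfl hx hxE
      exact ⟨⟨hxE, h1⟩, by simpa only [hxE, true_and] using h2⟩)
    hxs ⟨hE, hinv⟩ (hinv.prob_inaccurate_le' hch hn hε hε1 hα hα1 hE) hi'
  refine (MeasureTheory.measure_mono ?_).trans key
  rintro h hbad ⟨r, hr, hr0, hr1⟩
  refine hbad ⟨r, hr, ?_, fun hi => (hr1 hi).2⟩
  rcases Nat.eq_zero_or_pos i with rfl | hi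
  · exact ⟨_, RealRAM.isPageRank_pageRank hn0 hε hε1 hE, hr0 rfl⟩
  · exact ⟨_, RealRAM.isPageRank_pageRank hn0 hε hε1 (hr1 hi).1.1, (hr1 hi).1.2⟩
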